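/- **Setting.** Let $d\ge 2$, $n\ge 0$ be integers and let $\mathcal L\subset\mathbb Z^d$ have finite complement. $|\cdot|$ is the Euclidean norm (of lattice vectors and parameters). A matrix is a map $A:\mathcal L\times\mathcal L\to gl(2,\mathbb C)$, $(a,b)\mapsto A_a^b$; products are $(AB)_a^b=\sum_{e\in\mathcal L}A_a^eB_e^b$, $J=\begin{pmatrix}0&1\\-1&0\end{pmatrix}$ acts on each component, and $\pi$ is (componentwise) the orthogonal projection of $gl(2,\mathbb C)$ onto $\mathbb CI+\mathbb CJ$ for the scalar product $\mathrm{Tr}({}^t\bar AB)$. $A$ is symmetric if $A_a^b={}^tA_b^a$. $\|A\|$ is the operator norm on $\ell^2(\mathcal L,\mathbb C^2)$. *Blocks.* For real $\Delta\ge0$, $[a]_\Delta$ is the class of $a$ for the equivalence relation on $\mathcal L$ generated by: $|a|=|b|$ and $|a-b|\le\Delta$; $d_\Delta$ is the (finite) supremum of the diameters of the classes. $A$ is block diagonal over $\mathcal E_\Delta$ if $A_a^b=0$ whenever $[a]_\Delta\ne[b]_\Delta$; it is on normal form $\mathcal{NF}_\Delta$ if it is real, symmetric, block diagonal over $\mathcal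 E_\Delta$ and $\pi A=A$. *Töplitz matrices.* Put $A_a^b(\pm,c)=\lim_{t\to+\infty}A_{a+tc}^{b\pm tc}$ ($A(\pm,0)=A$). $A$ is $1$-Töplitz if all these limits exist, $m$-Töplitz if moreover all $A(\pm,c)$ are $(m-1)$-Töplitz, and Töplitz at $\infty$ if it is $(d-1)$-Töplitz. *Norms.* For a $2\times2$ matrix, $[A]$ is the matrix of absolute values of its entries. For $\gamma\ge0$, $$|A|_\gamma=\max\Big(\sup_{a,b}\|[(\pi A)_a^b]\|e^{\gamma|a-b|},\ \sup_{a,b}\|[((1-\pi)A)_a^b]\|e^{\gamma|a+b|}\Big).$$ For $c\in\mathbb Z^d\setminus0$, $D^+_\Lambda(c)$ is the set of $(a,b)$ with $|a|/|c|,|b|/|c|\ge2\Lambda^2$ for which there are $a',b'\in\mathbb Z^d$ and real $t\ge0$ with $a=a'+tc$, $b=b'+tc$, $|a|\ge\Lambda(|a'|+|c|)|c|$, $|b|\ge\Lambda(|b'|+|c|)|c|$; and $(a,b)\in D^-_\Lambda(c)$ iff $(a,-b)\in D^+_\Lambda(c)$. Let $$\mathrm{Lip}^\pm_{\Lambda,\gamma}A=\sup_{c\ne0}\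 \sup_{a,b\in\mathcal L,\ (a,b)\in D^\pm_\Lambda(c)}e^{\gamma|a\mp b|}\Big(\max\big(\tfrac{|a|}{|c|},\tfrac{|b|}{|c|}\big)+1\Big)\big\|[A_a^b-A_a^b(\pm,c)]\big\|,$$ ${}^1\langle A\rangle_{\Lambda,\gamma}=\max(\mathrm{Lip}^+_{\Lambda,\gamma}\pi A,\mathrm{Lip}^-_{\Lambda,\gamma}(1-\pi)A)+|A|_\gamma$, ${}^m\langle A\rangle_{\Lambda,\gamma}=\sup_{c\in\mathbb Z^d,\pm}{}^{m-1}\langle A(\pm,c)\rangle_{\Lambda,\gamma}$ and $\langle A\rangle_{\Lambda,\gamma}={}^{d-1}\langle A\rangle_{\Lambda,\gamma}\in[0,\infty]$. If $A(\omega)$ depends on $\omega\in X\subset\mathbb R^n$ and is entrywise $\mathcal C^1$ on $X$ in the sense of Whitney, with derivative $\partial_\omega A$ (part of the data), then $$\langle A\rangle_{\Lambda,\gamma,X}=\sup_{\omega\in X}\max\Big(\langle A(\omega)\rangle_{\Lambda,\gamma},\ \sup_{|v|\le1}\langle\partial_vA(\omega)\rangle_{\Lambda,\gamma}\Big);$$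 the index $\gamma$ is dropped if $\gamma=0$. **Proposition.** Let $C_1\ge1$, $C_3,C_4,C_5>0$ and $C_2,C_6\in\mathbb R$. There are an exponent $\exp$ depending only on $d,n$ and a constant $\mathrm{cte}>0$ depending only on $d,n,\mathcal L,C_1,\dots,C_6$ such that the following holds. Let $\Lambda\ge0$, $\Delta\ge2$, $\Delta'\ge1$ and $0<\kappa<\frac{C_5}2$ be real. Let $U\subset\{\omega\in\mathbb R^n:|\omega|\le C_1\}$ and let $B\supset U$ be convex. Let $\Omega_a(\omega)\in\mathbb R$ ($a\in\mathcal L$) and $H(\omega)$ be defined and $\mathcal C^1$ (Whitney, entrywise) on $B$, and let $\Omega(\omega)$ be the diagonal matrix with entries $\Omega_a(\omega)I$. Suppose that * $|\partial_\omega^\nu(\Omega_a(\omega)-|a|^2)|\le C_2e^{-C_3|a|}$ for $\nu=0,1$, $a\in\mathcal L$, $\omega\in U$; * for all $\omega\in B$, $k\in\mathbb Z^n\setminus0$, $a,b\in\mathcal L$, the scalar product with $\frac k{|k|}$ of $\partial_\omega(\langle k,\omega\rangle+\Omega_a)$, of $\partial_\omega(\langle k,\omega\rangle+\Omega_a+\Omega_b)$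 and, if $|a|\ne|b|$, of $\partial_\omega(\langle k,\omega\rangle+\Omega_a-\Omega_b)$ is $\ge C_4$; * $|\Omega_a|\ge C_5$, $|\Omega_a+\Omega_b|\ge C_5$ and, if $|a|\ne|b|$, $|\Omega_a-\Omega_b|\ge C_5$, for $a,b\in\mathcal L$, $\omega\in U$; * $H(\omega)$ and all $\partial_{\omega_l}H(\omega)$ are Töplitz at $\infty$ and $\mathcal{NF}_\Delta$, and $\|\partial_vH(\omega)\|\le\frac{C_4}4$ for $|v|\le1$, for all $\omega\in B$; * $\|H(\omega)\|\le\frac{C_5}4$ for $\omega\in U$, and $\langle H\rangle_{\Lambda,U}\le C_6$. Then there is a subset $U'\subset U$ with $$\mathrm{Leb}(U\setminus U')\le\mathrm{cte}\,\max(\Lambda,\Delta,\Delta')^{\exp}\,\kappa^{(\frac1{d+1})^d}$$ such that the following holds. Let $k\in\mathbb Z^n$, $|k|\le\Delta'$, and let $F$ be $\mathcal C^1$ on $U'$ in the sense of Whitney such that, for $\omega\in U'$, the matrices $G=F(\omega)$ and $G=\partial_{\omega_l}F(\omega)$ are Töplitz at $\infty$, symmetric and satisfy $(\pi G)_a^b=0$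 when $|a-b|>\Delta'$. Then there are $S,H'$, $\mathcal C^1$ on $U'$ in the sense of Whitney, such that for $\omega\in U'$ the matrices $S(\omega),H'(\omega)$ are symmetric, $S(\omega),H'(\omega),\partial_{\omega_l}S(\omega),\partial_{\omega_l}H'(\omega)$ are Töplitz at $\infty$, $$i\langle k,\omega\rangle S+(\Omega+H)JS-SJ(\Omega+H)=F-H',$$ and, for every $\Lambda'\ge\mathrm{cte}\max(\Lambda,d_\Delta^2,d_{\Delta'}^2)$: (i) for every $\gamma\ge0$, $$\langle S\rangle_{\Lambda'+d_\Delta+2,\gamma,U'}\le\mathrm{cte}\,\frac1{\kappa^3}\,\Delta'\,d_\Delta^{2d}\,e^{2\gamma d_\Delta}\,\langle F\rangle_{\Lambda',\gamma,U'};$$ (ii) if $k\ne0$, then $H'=0$ and $\partial_\omega H'=0$ on $U'$; if $k=0$, then $H'(\omega)$ and $\partial_{\omega_l}H'(\omega)$ are block diagonal over $\mathcal E_{\Delta'}$; in all cases $$\langle H'\rangle_{\Lambda'+d_\Delta+2,U'}\le\langle F\rangle_{\Lambda',U'}.$$ Moreover, if $k=0$ and $F,\partial_\omega F$ are real on $U'$,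 then $H'(\omega)$ and $\partial_{\omega_l}H'(\omega)$ are $\mathcal{NF}_{\Delta'}$ for $\omega\in U'$. -/

import Mathlib

open Filter Topology Asymptotics MeasureTheory
open scoped ENNReal

namespace ToplitzLipschitz

noncomputable section

/-- The lattice `ℤ^d`. -/
abbrev Lat (d : ℕ) := Fin d → ℤ

/-- The parameter space `ℝ^n` with its Euclidean norm. -/
abbrev Par (n : ℕ) := EuclideanSpace ℝ (Fin n)

/-- A lattice vector seen in Euclidean space. -/
def toE {m : ℕ} (a : Lat m) : Par m := WithLp.toLp 2 (fun i => (a i : ℝ))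

/-- The Euclidean norm `|a|` of a lattice vector. -/
def len {m : ℕ} (a : Lat m) : ℝ := ‖toE a‖

/-- `gl(2, ℂ)`. -/
abbrev Gl2 := Matrix (Fin 2) (Fin 2) ℂ

/-- `gl(2, ℂ)`-valued matrices. A matrix on a subset `L` of the lattice is represented by a function
on `ℤ^d × ℤ^d`, whose values outside `L × L` are irrelevant: wherever they could matter below, the
set `L` is an argument and only entries in `L × L` are looked at, except in limits along rays, which
do not see finitely many points. -/
abbrev LMat (d : ℕ) := Lat d → Lat d → Gl2

/-- The standard symplectic matrix `J`. -/
def J : Gl2 := !![0, 1; -1, 0]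

/-- The orthogonal projection `π` of `gl(2, ℂ)` onto `ℂ I + ℂ J`, for the scalar product
`Tr (ᵗĀ B)`; note that `I` and `J` are orthogonal and have squared norm `2`. -/
def piM (A : Gl2) : Gl2 :=
  ((A 0 0 + A 1 1) / 2) • (1 : Gl2) + ((A 0 1 - A 1 0) / 2) • J

/-- `π A` for the sign `+`, and `(1 - π) A` for the sign `-`. -/
def part {d : ℕ} (σ : ℤˣ) (A : LMat d) : LMat d := fun a b =>
  if σ = 1 then piM (A a b) else A a b - piM (A a b)

/-- The operator norm (on Euclidean `ℂ²`) of the matrix `[A]` of absolute values of the entries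
of `A`. -/
def absNorm (A : Gl2) : ℝ :=
  ‖Matrix.toEuclideanCLM (𝕜 := ℂ) (n := Fin 2) (Matrix.of fun i j => ((‖A i j‖ : ℝ) : ℂ))‖

/-! ### Töplitz limits -/

/-- The sequence `t ↦ A_{a + t c}^{b ± t c}`. -/
def ray {d : ℕ} (σ : ℤˣ) (c : Lat d) (A : LMat d) (a b : Lat d) (t : ℕ) : Gl2 :=
  A (a + (t : ℤ) • c) (b + ((σ : ℤ) * (t : ℤ)) • c)

/-- The Töplitz limit `A(±, c)`; it equals `A` if `c = 0`. -/
def tlim {d : ℕ} (σ : ℤˣ) (c : Lat d) (A : LMat d) : LMat d := fun a b =>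
  limUnder atTop (ray σ c A a b)

/-- `A` is `m`-Töplitz: all limits `A(±, c)` exist and are `(m - 1)`-Töplitz. -/
def IsTopl {d : ℕ} : ℕ → LMat d → Prop
  | 0, _ => True
  | m + 1, A =>
      (∀ (σ : ℤˣ) (c a b : Lat d), ∃ l : Gl2, Tendsto (ray σ c A a b) atTop (𝓝 l)) ∧
      ∀ (σ : ℤˣ) (c : Lat d), IsTopl m (tlim σ c A)

/-- `A` is Töplitz at infinity, i.e. `(d - 1)`-Töplitz (used for `d ≥ 2`). -/
def IsToplitz {d : ℕ} (A : LMat d) : Prop := IsTopl (d - 1) A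

/-! ### Norms. They take values in `[0, ∞]`. -/

/-- `sup ‖[A_a^b]‖ e^{γ |a ∓ b|}` over `a, b ∈ L`. -/
def decaySup {d : ℕ} (L : Set (Lat d)) (γ : ℝ) (σ : ℤˣ) (A : LMat d) : ℝ≥0∞ :=
  ⨆ a ∈ L, ⨆ b ∈ L, ENNReal.ofReal (Real.exp (γ * len (a - (σ : ℤ) • b)) * absNorm (A a b))

/-- `|A|_γ`. -/
def decayNorm {d : ℕ} (L : Set (Lat d)) (γ : ℝ) (A : LMat d) : ℝ≥0∞ :=
  max (decaySup L γ 1 (part 1 A)) (decaySup L γ (-1) (part (-1) A))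

/-- The Lipschitz domain `D_Λ^+(c)`. -/
def LipDomPos {d : ℕ} (Λ : ℝ) (c a b : Lat d) : Prop :=
  (∃ (a' b' : Lat d) (t : ℝ), 0 ≤ t ∧
    toE a = toE a' + t • toE c ∧ Λ * (len a' + len c) * len c ≤ len a ∧
    toE b = toE b' + t • toE c ∧ Λ * (len b' + len c) * len c ≤ len b) ∧
  2 * Λ ^ 2 ≤ len a / len c ∧ 2 * Λ ^ 2 ≤ len b / len c

/-- The Lipschitz domains `D_Λ^±(c)`: `(a, b) ∈ D_Λ^-(c)` iff `(a, -b) ∈ D_Λ^+(c)`. -/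
def LipDom {d : ℕ} (Λ : ℝ) (σ : ℤˣ) (c a b : Lat d) : Prop :=
  LipDomPos Λ c a ((σ : ℤ) • b)

/-- The Lipschitz constant `Lip_{Λ,γ}^± A`. -/
def lipConst {d : ℕ} (L : Set (Lat d)) (Λ γ : ℝ) (σ : ℤˣ) (A : LMat d) : ℝ≥0∞ :=
  ⨆ (c : Lat d) (_ : c ≠ 0), ⨆ a ∈ L, ⨆ b ∈ L, ⨆ (_ : LipDom Λ σ c a b),
    ENNReal.ofReal
      (Real.exp (γ * len (a - (σ : ℤ) • b)) * (max (len a / len c) (len b / len c) + 1) *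
        absNorm (A a b - tlim σ c A a b))

/-- The first Lipschitz norm `¹⟨A⟩_{Λ,γ}`. -/
def lipNorm {d : ℕ} (L : Set (Lat d)) (Λ γ : ℝ) (A : LMat d) : ℝ≥0∞ :=
  max (lipConst L Λ γ 1 (part 1 A)) (lipConst L Λ γ (-1) (part (-1) A)) + decayNorm L γ A

/-- `iterNorm m` is the norm `^{m+1}⟨A⟩_{Λ,γ}`: the supremum of `^m⟨A(±, c)⟩_{Λ,γ}` over all `c`,
`c = 0` included. -/
def iterNorm {d : ℕ} (L : Set (Lat d)) (Λ γ : ℝ) : ℕ → LMat d → ℝ≥0∞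
  | 0, A => lipNorm L Λ γ A
  | m + 1, A => ⨆ (c : Lat d) (σ : ℤˣ), iterNorm L Λ γ m (tlim σ c A)

/-- The Töplitz-Lipschitz norm `⟨A⟩_{Λ,γ} = ^{d-1}⟨A⟩_{Λ,γ}` (used for `d ≥ 2`). -/
def tlNorm {d : ℕ} (L : Set (Lat d)) (Λ γ : ℝ) (A : LMat d) : ℝ≥0∞ :=
  iterNorm L Λ γ (d - 2) A

/-- The directional derivative `∑ v_l ∂_l A`, given the partial derivatives `∂_l A`. -/
def dirDeriv {n d : ℕ} (v : Par n) (DA : Fin n → LMat d) : LMat d := fun a b =>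
  ∑ l, ((v l : ℝ) : ℂ) • DA l a b

/-- The norm over a parameter set `X`, i.e. the supremum over `ω ∈ X` of
`⟨A(ω)⟩_{Λ,γ}` and `⟨∂_ω A(ω)⟩_{Λ,γ}`; the norm of the derivative `∂_ω A(ω)` is the supremum over all
directional derivatives with `|v| ≤ 1`. -/
def tlNormOn {n d : ℕ} (L : Set (Lat d)) (Λ γ : ℝ) (X : Set (Par n))
    (A : Par n → LMat d) (DA : Fin n → Par n → LMat d) : ℝ≥0∞ :=
  ⨆ ω ∈ X, max (tlNorm L Λ γ (A ω))
    (⨆ (v : Par n) (_ : ‖v‖ ≤ 1), tlNorm L Λ γ (dirDeriv v fun l => DA l ω))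

/-- The operator norm of `A` on `ℓ²(L, ℂ²)`, as the supremum of the operator norms of its finite
sections. -/
def opNorm {d : ℕ} (L : Set (Lat d)) (A : LMat d) : ℝ≥0∞ :=
  ⨆ (s : Finset (Lat d)) (_ : (s : Set (Lat d)) ⊆ L),
    ‖Matrix.toEuclideanCLM (𝕜 := ℂ) (n := s × Fin 2)
      (Matrix.of fun p q => A (p.1 : Lat d) (q.1 : Lat d) p.2 q.2)‖ₑ

/-! ### Differentiability in the sense of Whitney -/

/-- `f` is of class `C¹` on the set `X` in the sense of Whitney, with partial derivatives `g l`. -/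
def WhitneyC1 {n : ℕ} {V : Type*} [NormedAddCommGroup V] [NormedSpace ℝ V]
    (X : Set (Par n)) (f : Par n → V) (g : Fin n → Par n → V) : Prop :=
  (∀ l, ContinuousOn (g l) X) ∧
  ∀ x ∈ X, (fun p : Par n × Par n => f p.2 - f p.1 - ∑ l, (p.2 l - p.1 l) • g l p.1)
    =o[𝓝[X ×ˢ X] (x, x)] fun p => p.2 - p.1

/-- The entries of `A` are of class `C¹` on `X` in the sense of Whitney, with partial derivatives
`DA l`. -/
def MatC1 {n d : ℕ} (L : Set (Lat d)) (X : Set (Par n)) (A : Par n → LMat d)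
    (DA : Fin n → Par n → LMat d) : Prop :=
  ∀ a ∈ L, ∀ b ∈ L, ∀ i j,
    WhitneyC1 X (fun ω => A ω a b i j) (fun l ω => DA l ω a b i j)

/-! ### Blocks and normal forms -/

/-- The equivalence relation on `L` whose classes are the blocks `[a]_Δ`. -/
def SameBlock {d : ℕ} (L : Set (Lat d)) (Δ : ℝ) : Lat d → Lat d → Prop :=
  Relation.EqvGen fun a b => a ∈ L ∧ b ∈ L ∧ len a = len b ∧ len (a - b) ≤ Δ

/-- `d_Δ`, the supremum of all block diameters (it is finite for every `Δ`). -/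
def blockDiam {d : ℕ} (L : Set (Lat d)) (Δ : ℝ) : ℝ :=
  sSup {r : ℝ | ∃ a ∈ L, ∃ b ∈ L, SameBlock L Δ a b ∧ r = len (a - b)}

def IsBlockDiag {d : ℕ} (L : Set (Lat d)) (Δ : ℝ) (A : LMat d) : Prop :=
  ∀ a ∈ L, ∀ b ∈ L, ¬ SameBlock L Δ a b → A a b = 0

def IsSymm {d : ℕ} (L : Set (Lat d)) (A : LMat d) : Prop :=
  ∀ a ∈ L, ∀ b ∈ L, A a b = (A b a).transpose

def IsReal {d : ℕ} (L : Set (Lat d)) (A : LMat d) : Prop :=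
  ∀ a ∈ L, ∀ b ∈ L, ∀ i j, (A a b i j).im = 0

/-- `A` is on normal form `NF_Δ`. -/
def IsNormalForm {d : ℕ} (L : Set (Lat d)) (Δ : ℝ) (A : LMat d) : Prop :=
  IsReal L A ∧ IsSymm L A ∧ (∀ a ∈ L, ∀ b ∈ L, piM (A a b) = A a b) ∧ IsBlockDiag L Δ A

/-- `(π A)_a^b = 0` when `|a - b| > Δ'`. -/
def IsTruncated {d : ℕ} (L : Set (Lat d)) (Δ' : ℝ) (A : LMat d) : Prop :=
  ∀ a ∈ L, ∀ b ∈ L, Δ' < len (a - b) → piM (A a b) = 0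

/-! ### The equation -/

/-- The product of matrices on `L`. -/
def lmul {d : ℕ} (L : Set (Lat d)) (A B : LMat d) : LMat d := fun a b =>
  ∑' e : L, A a e * B e b

/-- `J A`, where `J` acts on every component. -/
def jmul {d : ℕ} (A : LMat d) : LMat d := fun a b => J * A a b

/-- The diagonal matrix with diagonal elements `Ω_a I`. -/
def diagMat {d : ℕ} (Ω : Lat d → ℝ) : LMat d := fun a b =>
  if a = b then ((Ω a : ℝ) : ℂ) • (1 : Gl2) else 0

/-- `i⟨k, ω⟩ S + (Ω + H) J S - S J (Ω + H) = F - H'` on `L × L`, at the parameter `ω`. -/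
def HomologicalEq {n d : ℕ} (L : Set (Lat d)) (ω : Par n) (k : Lat n) (Ω : Lat d → ℝ)
    (H S F H' : LMat d) : Prop :=
  ∀ a ∈ L, ∀ b ∈ L,
    (Complex.I * ((inner ℝ (toE k) ω : ℝ) : ℂ)) • S a b
      + lmul L (diagMat Ω + H) (jmul S) a b
      - lmul L S (jmul (diagMat Ω + H)) a b = F a b - H' a b

/-! ### Conditions on the frequencies -/

/-- `Ω_a - |a|²` and its gradient are at most `C₂ e^{-C₃ |a|}`. -/
def FreqDecay {n d : ℕ} (L : Set (Lat d)) (X : Set (Par n)) (C₂ C₃ : ℝ)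
    (Ω : Par n → Lat d → ℝ) (DΩ : Par n → Lat d → Par n) : Prop :=
  ∀ ω ∈ X, ∀ a ∈ L,
    |Ω ω a - len a ^ 2| ≤ C₂ * Real.exp (-C₃ * len a) ∧
    ‖DΩ ω a‖ ≤ C₂ * Real.exp (-C₃ * len a)

/-- Lower bounds `C₄` for the derivatives in the direction `k / |k|` of `⟨k, ω⟩ + Ω_a`,
`⟨k, ω⟩ + Ω_a + Ω_b` and, for `|a| ≠ |b|`, `⟨k, ω⟩ + Ω_a - Ω_b`. -/
def FreqTransversal {n d : ℕ} (L : Set (Lat d)) (X : Set (Par n)) (C₄ : ℝ)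
    (DΩ : Par n → Lat d → Par n) : Prop :=
  ∀ ω ∈ X, ∀ k : Lat n, k ≠ 0 → ∀ a ∈ L, ∀ b ∈ L,
    C₄ ≤ inner ℝ (toE k + DΩ ω a) ((len k)⁻¹ • toE k) ∧
    C₄ ≤ inner ℝ (toE k + DΩ ω a + DΩ ω b) ((len k)⁻¹ • toE k) ∧
    (len a ≠ len b → C₄ ≤ inner ℝ (toE k + DΩ ω a - DΩ ω b) ((len k)⁻¹ • toE k))

/-- `|Ω_a|`, `|Ω_a + Ω_b|` and, for `|a| ≠ |b|`, `|Ω_a - Ω_b|` are at least `C₅`. -/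
def FreqNonresonant {n d : ℕ} (L : Set (Lat d)) (X : Set (Par n)) (C₅ : ℝ)
    (Ω : Par n → Lat d → ℝ) : Prop :=
  ∀ ω ∈ X, ∀ a ∈ L, ∀ b ∈ L,
    C₅ ≤ |Ω ω a| ∧ C₅ ≤ |Ω ω a + Ω ω b| ∧ (len a ≠ len b → C₅ ≤ |Ω ω a - Ω ω b|)

end

end ToplitzLipschitz

open ToplitzLipschitz

namespace ToplitzLipschitz

noncomputable section

/-! ### Lattice vectors -/

section Lattice

variable {d : ℕ}

@[simp] lemma toE_apply (a : Lat d) (i : Fin d) : toE a i = (a i : ℝ) := rfl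

lemma toE_add (a b : Lat d) : toE (a + b) = toE a + toE b := by ext i; simp

lemma toE_sub (a b : Lat d) : toE (a - b) = toE a - toE b := by ext i; simp

lemma toE_neg (a : Lat d) : toE (-a) = -toE a := by ext i; simp

lemma toE_smul (n : ℤ) (a : Lat d) : toE (n • a) = (n : ℝ) • toE a := by ext i; simp

lemma toE_zero : toE (0 : Lat d) = 0 := by ext i; simp

lemma toE_injective : Function.Injective (toE (m := d)) := by
  intro a b h
  ext i
  have := congrArg (fun x : Par d => x i) h
  simpa using this

lemma inner_toE (a b : Lat d) : inner ℝ (toE a) (toE b) = ((a ⬝ᵥ b : ℤ) : ℝ) := by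
  simp [toE, PiLp.inner_apply, dotProduct, mul_comm]

lemma len_sq (a : Lat d) : len a ^ 2 = ((a ⬝ᵥ a : ℤ) : ℝ) := by
  rw [← inner_toE, real_inner_self_eq_norm_sq]; rfl

lemma len_nonneg (a : Lat d) : 0 ≤ len a := norm_nonneg _

lemma len_add_le (a b : Lat d) : len (a + b) ≤ len a + len b := by
  unfold len; rw [toE_add]; exact norm_add_le _ _

lemma len_neg (a : Lat d) : len (-a) = len a := by
  unfold len; rw [toE_neg, norm_neg]

lemma len_sub_le (a b : Lat d) : len (a - b) ≤ len a + len b := by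
  unfold len; rw [toE_sub]; exact norm_sub_le _ _

lemma len_sub_comm (a b : Lat d) : len (a - b) = len (b - a) := by
  rw [← len_neg, neg_sub]

lemma len_smul (n : ℤ) (a : Lat d) : len (n • a) = |(n : ℝ)| * len a := by
  unfold len; rw [toE_smul, norm_smul, Real.norm_eq_abs]

@[simp] lemma len_zero : len (0 : Lat d) = 0 := by
  unfold len; rw [toE_zero, norm_zero]

lemma len_eq_zero {a : Lat d} : len a = 0 ↔ a = 0 := by
  unfold len
  rw [norm_eq_zero, ← toE_zero]
  exact toE_injective.eq_iff

lemma len_eq_iff {a b : Lat d} : len a = len b ↔ a ⬝ᵥ a = b ⬝ᵥ b := by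
  rw [← sq_eq_sq₀ (len_nonneg a) (len_nonneg b), len_sq, len_sq]
  exact Int.cast_inj

lemma one_le_len {a : Lat d} (h : a ≠ 0) : 1 ≤ len a := by
  have h0 : 0 < len a := (len_nonneg a).lt_of_ne fun h' => h (len_eq_zero.1 h'.symm)
  have h1 : (0 : ℝ) < ((a ⬝ᵥ a : ℤ) : ℝ) := by rw [← len_sq]; positivity
  have h2 : (1 : ℝ) ≤ ((a ⬝ᵥ a : ℤ) : ℝ) := by exact_mod_cast (Int.cast_pos.1 h1)
  rw [← len_sq] at h2
  nlinarith

lemma abs_coord_le_len (a : Lat d) (i : Fin d) : |(a i : ℝ)| ≤ len a := by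
  have := PiLp.norm_apply_le (toE a) i
  simpa [len] using this

lemma abs_dot_le (a b : Lat d) : |((a ⬝ᵥ b : ℤ) : ℝ)| ≤ len a * len b := by
  rw [← inner_toE]; exact abs_real_inner_le_norm _ _

/-- The box of lattice vectors with coordinates at most `r` in absolute value. -/
def box (d : ℕ) (r : ℝ) : Finset (Lat d) :=
  Finset.Icc (fun _ => -⌊r⌋) (fun _ => ⌊r⌋)

lemma mem_box {r : ℝ} {a : Lat d} (h : len a ≤ r) : a ∈ box d r := by
  rw [box, Finset.mem_Icc]
  have h1 : ∀ i, |a i| ≤ ⌊r⌋ := fun i => by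
    rw [Int.le_floor]
    push_cast
    exact (abs_coord_le_len a i).trans h
  exact ⟨fun i => (abs_le.1 (h1 i)).1, fun i => (abs_le.1 (h1 i)).2⟩

lemma card_box {r : ℝ} (hr : 0 ≤ r) : ((box d r).card : ℝ) ≤ (2 * r + 1) ^ d := by
  have h0 : (0 : ℤ) ≤ ⌊r⌋ := Int.floor_nonneg.2 hr
  have h1 : (box d r).card = (2 * ⌊r⌋ + 1).toNat ^ d := by
    rw [box, Pi.card_Icc]
    simp only [Int.card_Icc, Finset.prod_const, Finset.card_univ, Fintype.card_fin]
    congr 2; ring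
  rw [h1]
  push_cast
  have h2 : (((2 * ⌊r⌋ + 1).toNat : ℕ) : ℝ) = 2 * (⌊r⌋ : ℝ) + 1 := by
    have : (((2 * ⌊r⌋ + 1).toNat : ℕ) : ℤ) = 2 * ⌊r⌋ + 1 := Int.toNat_of_nonneg (by omega)
    exact_mod_cast congrArg (Int.cast : ℤ → ℝ) this
  rw [h2]
  have h3 : (0 : ℝ) ≤ ⌊r⌋ := by exact_mod_cast h0
  gcongr
  exact Int.floor_le r

lemma finite_len_le (r : ℝ) : {a : Lat d | len a ≤ r}.Finite :=
  (box d r).finite_toSet.subset fun _ h => mem_box h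

lemma finite_len_sub_le (x : Lat d) (r : ℝ) : {a : Lat d | len (x - a) ≤ r}.Finite := by
  refine ((finite_len_le r).image fun y => x - y).subset fun a ha => ⟨x - a, ha, by simp⟩

/-- Simultaneous Diophantine approximation. -/
lemma exists_simultaneous_approx (m : ℕ) : ∃ e : ℕ, ∀ (Q : ℕ) (_ : 1 ≤ Q) (x : Fin m → ℝ),
    ∃ (q : ℕ) (p : Fin m → ℤ), 1 ≤ q ∧ q ≤ Q ^ e ∧ ∀ i, |(q : ℝ) * x i - p i| ≤ 1 / (Q : ℝ) := by
  induction m with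
  | zero => exact ⟨0, fun Q hQ x => ⟨1, fun _ => 0, le_rfl, by simp, fun i => i.elim0⟩⟩
  | succ m ih =>
    obtain ⟨e, he⟩ := ih
    refine ⟨2 * e + 1, fun Q hQ x => ?_⟩
    have hQ0 : (0 : ℝ) < Q := by exact_mod_cast hQ
    obtain ⟨q, p, hq1, hq2, hp⟩ := he (Q ^ 2) (Nat.one_le_pow _ _ hQ) (fun i => x i.castSucc)
    obtain ⟨k, hk0, hkQ, hk⟩ := Real.exists_nat_abs_mul_sub_round_le (q * x (Fin.last m)) hQ
    refine ⟨k * q, Fin.snoc (fun i => k * p i) (round (k * (q * x (Fin.last m)))),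
      Nat.mul_pos hk0 hq1, ?_, ?_⟩
    · calc k * q ≤ Q * (Q ^ 2) ^ e := Nat.mul_le_mul hkQ hq2
        _ = Q ^ (2 * e + 1) := by rw [← pow_mul, pow_succ]; ring
    · intro i
      refine Fin.lastCases ?_ (fun i => ?_) i
      · simp only [Fin.snoc_last, Nat.cast_mul, mul_assoc]
        refine hk.trans ?_
        gcongr
        linarith
      · simp only [Fin.snoc_castSucc, Nat.cast_mul, Int.cast_mul, Int.cast_natCast]
        have h1 := hp i
        push_cast at h1
        have h2 : (k : ℝ) * q * x i.castSucc - k * p i = k * (q * x i.castSucc - p i) := by ring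
        rw [h2, abs_mul, Nat.abs_cast]
        calc (k : ℝ) * |q * x i.castSucc - p i| ≤ Q * (1 / (Q : ℝ) ^ 2) := by
              have : (k : ℝ) ≤ Q := by exact_mod_cast hkQ
              gcongr
          _ = 1 / Q := by field_simp

/-- Every long lattice vector is close to the ray in the direction of a short lattice vector. -/
lemma exists_near_ray (d : ℕ) : ∃ e : ℕ, ∀ (Y : ℕ) (_ : d + 8 ≤ Y) (a : Lat d),
    (Y : ℝ) ^ e ≤ len a → ∃ (c a' : Lat d) (t : ℕ), c ≠ 0 ∧ len c ≤ (Y : ℝ) ^ e ∧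
      a = a' + (t : ℤ) • c ∧ (Y : ℝ) * (len a' + len c + 1) ≤ t := by
  obtain ⟨e, he⟩ := exists_simultaneous_approx d
  refine ⟨6 * e + 3, fun Y hY a ha => ?_⟩
  have hY8 : (8 : ℝ) ≤ Y := by exact_mod_cast (by omega : 8 ≤ Y)
  have hYd : (d : ℝ) ≤ Y := by exact_mod_cast (by omega : d ≤ Y)
  have hl1 : (1 : ℝ) ≤ len a := (one_le_pow₀ (by linarith)).trans ha
  obtain ⟨q, c, hq1, hq2, hc⟩ := he (Y ^ 3) (Nat.one_le_pow _ _ (by omega))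
    (fun i => (a i : ℝ) / len a)
  have hq1' : (1 : ℝ) ≤ q := by exact_mod_cast hq1
  have hq2' : (q : ℝ) ≤ (Y : ℝ) ^ (3 * e) := by
    rw [pow_mul]; exact_mod_cast hq2
  push_cast at hc
  set u : Par d := (len a)⁻¹ • toE a with hu
  have hunorm : ‖u‖ = 1 := by
    rw [hu, norm_smul, Real.norm_eq_abs, abs_of_pos (by positivity)]
    exact inv_mul_cancel₀ (by linarith)
  have hau : toE a = len a • u := by
    rw [hu, smul_smul, mul_inv_cancel₀ (by linarith), one_smul]
  have hdiff : ‖(q : ℝ) • u - toE c‖ ≤ 1 / (Y : ℝ) ^ 2 := by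
    have h : (q : ℝ) • u - toE c = ∑ i, ((q : ℝ) * (a i / len a) - c i) •
        EuclideanSpace.single i (1 : ℝ) := by
      ext j; simp [Finset.sum_apply, Pi.single_apply, hu, div_eq_inv_mul]
    rw [h]
    refine (norm_sum_le _ _).trans ?_
    calc ∑ i, ‖((q : ℝ) * (a i / len a) - c i) • EuclideanSpace.single i (1 : ℝ)‖
        ≤ ∑ _i : Fin d, 1 / (Y : ℝ) ^ 3 := Finset.sum_le_sum fun i _ => by
          rw [norm_smul]; simpa using hc i
      _ = d * (1 / (Y : ℝ) ^ 3) := by simp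
      _ ≤ Y * (1 / (Y : ℝ) ^ 3) := by gcongr
      _ = 1 / (Y : ℝ) ^ 2 := by field_simp
  clear_value u
  have hY2 : 1 / (Y : ℝ) ^ 2 ≤ 1 / 64 := by
    apply one_div_le_one_div_of_le <;> nlinarith
  have hqu : ‖(q : ℝ) • u‖ = q := by rw [norm_smul, hunorm]; simp
  have hcq : len c ≤ q + 1 := by
    have : toE c = (q : ℝ) • u - ((q : ℝ) • u - toE c) := by abel
    unfold len
    rw [this]
    refine (norm_sub_le _ _).trans ?_
    rw [hqu]; linarith
  have hc0 : c ≠ 0 := by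
    rintro rfl
    rw [toE_zero, sub_zero, hqu] at hdiff
    linarith
  set t : ℕ := ⌊len a / q⌋₊ with ht
  have ht1 : (t : ℝ) ≤ len a / q := Nat.floor_le (by positivity)
  have ht2 : len a / q < t + 1 := Nat.lt_floor_add_one _
  have ht1' : (t : ℝ) * q ≤ len a := by rwa [le_div_iff₀ (by linarith)] at ht1
  have ht2' : len a < (t + 1) * q := by rwa [div_lt_iff₀ (by linarith)] at ht2
  refine ⟨c, a - (t : ℤ) • c, t, hc0, ?_, by abel, ?_⟩
  · calc len c ≤ q + 1 := hcq
      _ ≤ 2 * (Y : ℝ) ^ (3 * e) := by linarith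
      _ ≤ Y ^ 1 * (Y : ℝ) ^ (3 * e) := by gcongr; linarith
      _ = (Y : ℝ) ^ (1 + 3 * e) := by rw [pow_add]
      _ ≤ (Y : ℝ) ^ (6 * e + 3) := pow_le_pow_right₀ (by linarith) (by omega)
  · have ha' : len (a - (t : ℤ) • c) ≤ q + t * (1 / (Y : ℝ) ^ 2) := by
      have : toE (a - (t : ℤ) • c) = (len a - t * q) • u + (t : ℝ) • ((q : ℝ) • u - toE c) := by
        rw [toE_sub, toE_smul, hau]
        push_cast
        module
      unfold len
      rw [this]
      refine (norm_add_le _ _).trans ?_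
      rw [norm_smul, norm_smul, hunorm, Real.norm_eq_abs, Real.norm_eq_abs, Nat.abs_cast,
        abs_of_nonneg (by linarith)]
      have := mul_le_mul_of_nonneg_left hdiff (Nat.cast_nonneg t : (0 : ℝ) ≤ t)
      linarith
    have h3 : (Y : ℝ) * (t * (1 / (Y : ℝ) ^ 2)) ≤ t / 8 := by
      have : (Y : ℝ) * (t * (1 / (Y : ℝ) ^ 2)) = t / Y := by field_simp
      rw [this]; gcongr
    have h4 : (8 : ℝ) * Y * q ≤ t := by
      have h5 : (9 : ℝ) * Y * q * q ≤ len a := by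
        calc (9 : ℝ) * Y * q * q ≤ (Y * Y) * Y * (Y : ℝ) ^ (3 * e) * (Y : ℝ) ^ (3 * e) := by
              gcongr; nlinarith
          _ = (Y : ℝ) ^ (6 * e + 3) := by ring
          _ ≤ len a := ha
      have h6 : (9 : ℝ) * Y * q * q < (t + 1) * q := h5.trans_lt ht2'
      have h7 : (9 : ℝ) * Y * q < t + 1 := lt_of_mul_lt_mul_right h6 (by linarith)
      nlinarith
    nlinarith

end Lattice

/-! ### Diameters of blocks -/

section BlockDiam

variable {d : ℕ}

open scoped Nat in
/-- A vector in the span of independent lattice vectors is controlled by its scalar products with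
them, as the Gram determinant is a nonzero integer. -/
lemma norm_le_of_inner_le {ι : Type*} [Fintype ι] [DecidableEq ι] (v : ι → Lat d)
    (hv : LinearIndependent ℝ fun i => toE (v i)) (hι : Fintype.card ι ≤ d) {r K : ℝ} (hr : 1 ≤ r)
    (hK : 0 ≤ K) (hlen : ∀ i, len (v i) ≤ r) (x : Par d)
    (hx : x ∈ Submodule.span ℝ (Set.range fun i => toE (v i)))
    (hxv : ∀ i, |inner ℝ x (toE (v i))| ≤ K) :
    ‖x‖ ≤ d ^ 2 * d ! * r ^ (2 * d + 1) * K := by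
  obtain ⟨y, rfl⟩ := (Submodule.mem_span_range_iff_exists_fun ℝ).1 hx
  set G : Matrix ι ι ℝ := Matrix.gram ℝ fun i => toE (v i) with hG
  have hdet : 1 ≤ |G.det| := by
    have h0 : G.det ≠ 0 := Matrix.det_gram_ne_zero_iff_linearIndependent.2 hv
    have h1 : G = (Matrix.of fun i j => (v i ⬝ᵥ v j : ℤ)).map (Int.cast : ℤ → ℝ) := by
      ext i j
      rw [hG, Matrix.gram_apply, inner_toE]; rfl
    have h2 : G.det = (((Matrix.of fun i j => (v i ⬝ᵥ v j : ℤ)).det : ℤ) : ℝ) := by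
      rw [h1]
      exact ((Int.castRingHom ℝ).map_det _).symm
    rw [h2] at h0 ⊢
    exact_mod_cast Int.one_le_abs (by exact_mod_cast h0)
  have hGe : ∀ i j, |G i j| ≤ r ^ 2 := fun i j => by
    rw [hG, Matrix.gram_apply]
    refine (abs_real_inner_le_norm _ _).trans ?_
    rw [sq]
    exact mul_le_mul (hlen i) (hlen j) (norm_nonneg _) (by linarith)
  have hadj : ∀ i j, |G.adjugate i j| ≤ d ! * r ^ (2 * d) := fun i j => by
    rw [Matrix.adjugate_apply]
    have := Matrix.det_le (A := G.updateRow j (Pi.single i 1)) (abv := AbsoluteValue.abs)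
      (x := r ^ 2) (fun p q => by
        rw [AbsoluteValue.abs_apply, Matrix.updateRow_apply]
        split_ifs with h
        · rw [Pi.single_apply]
          split_ifs
          · rw [abs_one]; nlinarith
          · rw [abs_zero]; positivity
        · exact hGe p q)
    rw [AbsoluteValue.abs_apply, nsmul_eq_mul] at this
    refine this.trans ?_
    rw [← pow_mul]
    have h1 : ((Fintype.card ι)! : ℝ) ≤ d ! := by exact_mod_cast Nat.factorial_le hι
    have h2 : r ^ (2 * Fintype.card ι) ≤ r ^ (2 * d) := pow_le_pow_right₀ hr (by omega)
    gcongr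
  set b : ι → ℝ := G.mulVec y with hb
  have hbe : ∀ i, |b i| ≤ K := fun i => by
    have : b i = inner ℝ (∑ j, y j • toE (v j)) (toE (v i)) := by
      rw [hb, Matrix.mulVec, dotProduct, sum_inner]
      refine Finset.sum_congr rfl fun j _ => ?_
      rw [real_inner_smul_left, hG, Matrix.gram_apply, real_inner_comm, mul_comm]
    rw [this]; exact hxv i
  have hy : ∀ i, |y i| ≤ d * (d ! * r ^ (2 * d) * K) := fun i => by
    have h1 : G.det * y i = (G.adjugate.mulVec b) i := by
      rw [hb, Matrix.mulVec_mulVec, Matrix.adjugate_mul, Matrix.smul_mulVec, Matrix.one_mulVec]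
      rfl
    have h2 : |y i| ≤ |G.det * y i| := by
      rw [abs_mul]; nlinarith [abs_nonneg (y i)]
    refine h2.trans ?_
    rw [h1, Matrix.mulVec, dotProduct]
    refine (Finset.abs_sum_le_sum_abs _ _).trans ?_
    calc ∑ j, |G.adjugate i j * b j| ≤ ∑ _j : ι, (d ! * r ^ (2 * d) * K) :=
          Finset.sum_le_sum fun j _ => by
            rw [abs_mul]
            exact mul_le_mul (hadj i j) (hbe j) (abs_nonneg _) (by positivity)
      _ = Fintype.card ι * (d ! * r ^ (2 * d) * K) := by simp
      _ ≤ _ := by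
        have : (Fintype.card ι : ℝ) ≤ d := by exact_mod_cast hι
        gcongr
  refine (norm_sum_le _ _).trans ?_
  calc ∑ i, ‖y i • toE (v i)‖ ≤ ∑ _i : ι, (d * (d ! * r ^ (2 * d) * K)) * r :=
        Finset.sum_le_sum fun i _ => by
          rw [norm_smul]
          exact mul_le_mul (hy i) (hlen i) (norm_nonneg _) (by positivity)
    _ = Fintype.card ι * ((d * (d ! * r ^ (2 * d) * K)) * r) := by simp
    _ ≤ d * ((d * (d ! * r ^ (2 * d) * K)) * r) := by
        have : (Fintype.card ι : ℝ) ≤ d := by exact_mod_cast hι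
        gcongr
    _ = _ := by ring

/-- The span of the differences `e - a` of length at most `r`, for `e` in `X`. -/
def diffSpan (X : Set (Lat d)) (a : Lat d) (r : ℝ) : Submodule ℝ (Par d) :=
  Submodule.span ℝ {x | ∃ e ∈ X, len (e - a) ≤ r ∧ x = toE (e - a)}

lemma diffSpan_mono (X : Set (Lat d)) (a : Lat d) {r s : ℝ} (h : r ≤ s) :
    diffSpan X a r ≤ diffSpan X a s :=
  Submodule.span_mono fun _ ⟨e, he, hl, hx⟩ => ⟨e, he, hl.trans h, hx⟩

lemma mem_diffSpan {X : Set (Lat d)} {a e : Lat d} {r : ℝ} (he : e ∈ X) (h : len (e - a) ≤ r) :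
    toE (e - a) ∈ diffSpan X a r := Submodule.subset_span ⟨e, he, h, rfl⟩

open scoped Nat in
/-- On a sphere, the projection of a point to the span of the differences to nearby points is
bounded. -/
lemma norm_proj_diffSpan_le {X : Set (Lat d)} (hX : ∀ a ∈ X, ∀ b ∈ X, len a = len b) {a : Lat d}
    (ha : a ∈ X) {r : ℝ} (hr : 1 ≤ r) :
    ‖(diffSpan X a r).starProjection (toE a)‖ ≤ d ^ 2 * d ! * r ^ (2 * d + 3) := by
  set S : Set (Par d) := {x | ∃ e ∈ X, len (e - a) ≤ r ∧ x = toE (e - a)} with hS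
  obtain ⟨b, hbS, hspan, hli⟩ := exists_linearIndependent ℝ S
  have : Fintype b := hli.setFinite.fintype
  classical
  choose e he hl hx using hbS
  have hv : (fun i : b => toE (e i.2 - a)) = ((↑) : b → Par d) := by
    ext1 i; exact (hx i.2).symm
  have hcard : Fintype.card b ≤ d := by
    have := hli.fintype_card_le_finrank
    simpa using this
  have hW : diffSpan X a r = Submodule.span ℝ (Set.range fun i : b => toE (e i.2 - a)) := by
    rw [hv, Subtype.range_coe]; exact hspan.symm
  have key := norm_le_of_inner_le (fun i : b => e i.2 - a) (by rw [hv]; exact hli) hcard hr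
    (K := r ^ 2) (by positivity) (fun i => hl i.2) ((diffSpan X a r).starProjection (toE a))
    (by rw [← hW]; exact Submodule.starProjection_apply_mem _ _) (fun i => by
      have hm : toE (e i.2 - a) ∈ diffSpan X a r := mem_diffSpan (he i.2) (hl i.2)
      rw [Submodule.inner_starProjection_left_eq_right, Submodule.starProjection_eq_self_iff.2 hm,
        inner_toE]
      have h1 := len_sq (e i.2 - a)
      have h2 := len_eq_iff.1 (hX _ (he i.2) _ ha)
      have h3 : (2 : ℝ) * ((a ⬝ᵥ (e i.2 - a) : ℤ) : ℝ) = -(((e i.2 - a) ⬝ᵥ (e i.2 - a) : ℤ) : ℝ) := by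
        norm_cast
        simp only [dotProduct_sub, sub_dotProduct, h2, dotProduct_comm (e i.2) a]
        ring
      rw [← h1] at h3
      have h4 := hl i.2
      have h5 := len_nonneg (e i.2 - a)
      rw [abs_le]; constructor <;> nlinarith)
  calc _ ≤ _ := key
    _ = _ := by ring

open scoped Nat in
/-- Either a connected set on a sphere is small, or the differences at a given scale span a space
of dimension at least `k`. -/
lemma diam_le_or_finrank_ge (d k : ℕ) : ∃ (C : ℝ) (e : ℕ), 1 ≤ C ∧ ∀ (Δ : ℝ) (_ : 1 ≤ Δ)
    (X : Set (Lat d)) (_ : ∀ a ∈ X, ∀ b ∈ X, len a = len b)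
    (_ : ∀ a ∈ X, ∀ b ∈ X, Relation.ReflTransGen (fun x y => y ∈ X ∧ len (y - x) ≤ Δ) a b),
    (∀ a ∈ X, ∀ b ∈ X, len (a - b) ≤ C * Δ ^ e) ∨
      ∃ r, Δ ≤ r ∧ r ≤ C * Δ ^ e ∧ ∀ a ∈ X, k ≤ Module.finrank ℝ (diffSpan X a r) := by
  induction k with
  | zero =>
    exact ⟨1, 1, le_rfl, fun Δ hΔ X _ _ => Or.inr ⟨Δ, le_rfl, by simp, fun _ _ => Nat.zero_le _⟩⟩
  | succ k ih =>
    obtain ⟨C, e, hC, H⟩ := ih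
    set K : ℝ := d ^ 2 * d ! with hKdef
    have hK : 0 ≤ K := by positivity
    have hCm : 1 ≤ C ^ (2 * d + 3) := one_le_pow₀ hC
    refine ⟨(2 + 4 * K) * C ^ (2 * d + 3), e * (2 * d + 3), by nlinarith,
      fun Δ hΔ X hX hconn => ?_⟩
    have hexp : C ^ (2 * d + 3) * Δ ^ (e * (2 * d + 3)) = (C * Δ ^ e) ^ (2 * d + 3) := by
      rw [mul_pow, pow_mul]
    have hbase : 1 ≤ C * Δ ^ e := one_le_mul_of_one_le_of_one_le hC (one_le_pow₀ hΔ)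
    have hle : C * Δ ^ e ≤ (C * Δ ^ e) ^ (2 * d + 3) := le_self_pow₀ hbase (by omega)
    rcases H Δ hΔ X hX hconn with h | ⟨r, hΔr, hr, hdim⟩
    · refine Or.inl fun a ha b hb => (h a ha b hb).trans ?_
      rw [mul_assoc, hexp]
      nlinarith
    have hr1 : 1 ≤ r := hΔ.trans hΔr
    set f : ℝ := K * r ^ (2 * d + 3) with hf
    have hrm : r ^ (2 * d + 3) ≤ (C * Δ ^ e) ^ (2 * d + 3) := by gcongr
    have hf0 : 0 ≤ f := by positivity
    have hfle : f ≤ K * (C * Δ ^ e) ^ (2 * d + 3) := by rw [hf]; gcongr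
    set r' : ℝ := r + Δ + 2 * f with hr'
    by_cases hall : ∀ a ∈ X, k + 1 ≤ Module.finrank ℝ (diffSpan X a r')
    · refine Or.inr ⟨r', by linarith, ?_, hall⟩
      rw [mul_assoc, hexp]
      nlinarith
    · left
      push Not at hall
      obtain ⟨a, ha, hlt⟩ := hall
      have hWr : diffSpan X a r = diffSpan X a r' :=
        Submodule.eq_of_le_of_finrank_le (diffSpan_mono X a (by linarith))
          ((Nat.lt_succ_iff.1 hlt).trans (hdim a ha))
      set W := diffSpan X a r with hW
      have hnear : ∀ e ∈ X, diffSpan X e r = W → toE (e - a) ∈ W → len (e - a) ≤ 2 * f := by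
        intro e he hWe hea
        have h1 : toE (e - a) = W.starProjection (toE e) - W.starProjection (toE a) := by
          rw [← map_sub, ← toE_sub, Submodule.starProjection_eq_self_iff.2 hea]
        have h2 := norm_proj_diffSpan_le hX he hr1
        have h3 := norm_proj_diffSpan_le hX ha hr1
        rw [hWe] at h2
        unfold len
        rw [h1]
        refine (norm_sub_le _ _).trans ?_
        rw [← hW] at h3
        linarith
      have main : ∀ e ∈ X, diffSpan X e r = W ∧ toE (e - a) ∈ W := by
        intro e he
        suffices h : e ∈ X ∧ diffSpan X e r = W ∧ toE (e - a) ∈ W from h.2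
        induction hconn a ha e he with
        | refl => exact ⟨ha, rfl, by rw [sub_self, toE_zero]; exact W.zero_mem⟩
        | @tail x y _ hxy ihx =>
          obtain ⟨hxX, hxW, hxa⟩ := ihx (by
            rcases ‹Relation.ReflTransGen _ a x›.cases_tail with h | ⟨_, _, h⟩
            · exact h ▸ ha
            · exact h.1)
          obtain ⟨hyX, hyx⟩ := hxy
          have h1 : toE (y - x) ∈ W := by
            rw [← hxW]; exact mem_diffSpan hyX (hyx.trans hΔr)
          have h2 : toE (y - a) ∈ W := by
            have : y - a = (y - x) + (x - a) := by abel
            rw [this, toE_add]; exact W.add_mem h1 hxa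
          refine ⟨hyX, ?_, h2⟩
          have hle : diffSpan X y r ≤ W := by
            refine Submodule.span_le.2 ?_
            rintro _ ⟨z, hz, hzy, rfl⟩
            have h3 : len (z - a) ≤ r' := by
              have e1 : z - a = (z - y) + (y - x) + (x - a) := by abel
              rw [e1]
              have := hnear x hxX hxW hxa
              linarith [len_add_le ((z - y) + (y - x)) (x - a), len_add_le (z - y) (y - x)]
            have h4 : toE (z - a) ∈ W := by rw [hWr]; exact mem_diffSpan hz h3
            have : z - y = (z - a) - (y - a) := by abel
            rw [this, toE_sub]; exact W.sub_mem h4 h2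
          refine Submodule.eq_of_le_of_finrank_le hle ?_
          refine le_trans ?_ (hdim y hyX)
          rw [hWr]; omega
      intro x hx y hy
      have hx' := hnear x hx (main x hx).1 (main x hx).2
      have hy' := hnear y hy (main y hy).1 (main y hy).2
      have : x - y = (x - a) - (y - a) := by abel
      rw [this, mul_assoc, hexp]
      have := len_sub_le (x - a) (y - a)
      nlinarith

/-- The diameter of a `Δ`-connected set on a sphere is bounded by a power of `Δ`. -/
lemma diam_connected_sphere_le (d : ℕ) : ∃ (C : ℝ) (e : ℕ), 1 ≤ C ∧ ∀ (Δ : ℝ) (_ : 1 ≤ Δ)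
    (X : Set (Lat d)) (_ : ∀ a ∈ X, ∀ b ∈ X, len a = len b)
    (_ : ∀ a ∈ X, ∀ b ∈ X, Relation.ReflTransGen (fun x y => y ∈ X ∧ len (y - x) ≤ Δ) a b),
    ∀ a ∈ X, ∀ b ∈ X, len (a - b) ≤ C * Δ ^ e := by
  obtain ⟨C, e, hC, H⟩ := diam_le_or_finrank_ge d (d + 1)
  refine ⟨C, e, hC, fun Δ hΔ X hX hconn a ha b hb => ?_⟩
  rcases H Δ hΔ X hX hconn with h | ⟨r, _, _, h⟩
  · exact h a ha b hb
  · have h1 := h a ha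
    have h2 := Submodule.finrank_le (diffSpan X a r)
    rw [finrank_euclideanSpace_fin] at h2
    omega

end BlockDiam

/-! ### Levels: blocks along iterated limits -/

/-- The data of an iterated limit: the lattice points that are seen, the directions of the limits,
and the parameters of the problem. -/
structure Lev (d : ℕ) where
  /-- the lattice points -/
  L : Set (Lat d)
  /-- the directions of the limits -/
  C : List (Lat d)
  /-- the step of the blocks -/
  Δ : ℝ
  /-- the distance of interacting blocks -/
  Δ' : ℝ
  /-- a bound for the diameters of the blocks -/
  D : ℝ
  /-- all points outside the ball of radius `ρ` are seen -/
  ρ : ℝ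
  /-- whether pairs on the same sphere are excluded -/
  k0 : Prop

namespace Lev

variable {d : ℕ} (g : Lev d)

/-- The generator of the block relation. -/
def gen (a b : Lat d) : Prop :=
  a ∈ g.L ∧ b ∈ g.L ∧ len a = len b ∧ len (a - b) ≤ g.Δ ∧ ∀ c ∈ g.C, (a - b) ⬝ᵥ c = 0

/-- The block relation. -/
def Rel : Lat d → Lat d → Prop := Relation.ReflTransGen g.gen

/-- The level of the limits in the direction `c ≠ 0`. -/
def next (c : Lat d) : Lev d := { g with L := Set.univ, C := c :: g.C }

/-- The standing assumptions on a level. -/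
structure Good : Prop where
  hL : ∀ a, g.ρ ≤ len a → a ∈ g.L
  hdiam : ∀ a b, g.Rel a b → len (a - b) ≤ g.D
  hD : 1 ≤ g.D
  hΔ' : 1 ≤ g.Δ'

/-- Points on the same sphere at distance at most `D` from `a` differ from `a` by a vector
orthogonal to `c`. -/
def Rigid (c a : Lat d) : Prop := ∀ x, len (a + x) = len a → len x ≤ g.D → x ⬝ᵥ c = 0

open Classical in
/-- The block of `a`. -/
def blk (a : Lat d) : Finset (Lat d) :=
  if h : {e | g.Rel a e}.Finite then h.toFinset else ∅

/-- The pairs on which the equation is solved. -/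
def Act (a b : Lat d) : Prop :=
  a ∈ g.L ∧ b ∈ g.L ∧ (∀ c ∈ g.C, (a - b) ⬝ᵥ c = 0) ∧ (g.k0 → len a ≠ len b) ∧
    ∃ a' b', g.Rel a a' ∧ g.Rel b b' ∧ len (a' - b') ≤ g.Δ'

variable {g}

lemma gen_symm {a b : Lat d} (h : g.gen a b) : g.gen b a :=
  ⟨h.2.1, h.1, h.2.2.1.symm, len_sub_comm a b ▸ h.2.2.2.1, fun c hc => by
    rw [← neg_sub, neg_dotProduct, h.2.2.2.2 c hc, neg_zero]⟩

lemma Rel.symm {a b : Lat d} (h : g.Rel a b) : g.Rel b a := by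
  unfold Rel at h
  induction h with
  | refl => exact Relation.ReflTransGen.refl
  | tail _ h2 ih => exact Relation.ReflTransGen.head (gen_symm h2) ih

lemma Rel.trans {a b c : Lat d} (h : g.Rel a b) (h' : g.Rel b c) : g.Rel a c :=
  Relation.ReflTransGen.trans h h'

lemma Rel.refl (a : Lat d) : g.Rel a a := Relation.ReflTransGen.refl

lemma Rel.len_eq {a b : Lat d} (h : g.Rel a b) : len a = len b := by
  induction h with
  | refl => rfl
  | tail _ h2 ih => exact ih.trans h2.2.2.1

lemma Rel.orth {a b : Lat d} (h : g.Rel a b) {c : Lat d} (hc : c ∈ g.C) : (a - b) ⬝ᵥ c = 0 := by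
  induction h with
  | refl => simp
  | @tail x y _ h2 ih =>
    have := h2.2.2.2.2 c hc
    rw [sub_dotProduct] at *
    omega

lemma Rel.mem {a b : Lat d} (h : g.Rel a b) (ha : a ∈ g.L) : b ∈ g.L := by
  induction h with
  | refl => exact ha
  | tail _ h2 _ => exact h2.2.1

lemma Rel.eq_or_mem {a b : Lat d} (h : g.Rel a b) : a = b ∨ (a ∈ g.L ∧ b ∈ g.L) := by
  induction h with
  | refl => exact Or.inl rfl
  | tail _ h2 ih =>
    rcases ih with rfl | ih
    · exact Or.inr ⟨h2.1, h2.2.1⟩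
    · exact Or.inr ⟨ih.1, h2.2.1⟩

lemma sq_add (a z : Lat d) :
    (a + z) ⬝ᵥ (a + z) = a ⬝ᵥ a + 2 * (a ⬝ᵥ z) + z ⬝ᵥ z := by
  simp only [dotProduct_add, add_dotProduct, dotProduct_comm z a]; ring

lemma sq_sub_shift (a b z : Lat d) : (a + z) ⬝ᵥ (a + z) - (b + z) ⬝ᵥ (b + z)
    = a ⬝ᵥ a - b ⬝ᵥ b + 2 * ((a - b) ⬝ᵥ z) := by
  rw [sq_add, sq_add, sub_dotProduct]; ring

lemma len_shift_iff {a b z : Lat d} (h : (a - b) ⬝ᵥ z = 0) :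
    len (a + z) = len (b + z) ↔ len a = len b := by
  have := sq_sub_shift a b z
  rw [len_eq_iff, len_eq_iff]
  omega

lemma Rel.shift (hL : g.L = Set.univ) {z : Lat d}
    (hz : ∀ x : Lat d, (∀ c ∈ g.C, x ⬝ᵥ c = 0) → x ⬝ᵥ z = 0) {a b : Lat d} (h : g.Rel a b) :
    g.Rel (a + z) (b + z) := by
  unfold Rel at h
  induction h with
  | refl => exact .refl _
  | tail _ hxy ih =>
  obtain ⟨_, _, h1, h2, h3⟩ := hxy
  refine ih.tail ⟨by rw [hL]; trivial, by rw [hL]; trivial, (len_shift_iff (hz _ h3)).2 h1, ?_, ?_⟩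
  · rwa [add_sub_add_right_eq_sub]
  · simpa only [add_sub_add_right_eq_sub] using h3

lemma Rel.shift_iff (hL : g.L = Set.univ) {z : Lat d}
    (hz : ∀ x : Lat d, (∀ c ∈ g.C, x ⬝ᵥ c = 0) → x ⬝ᵥ z = 0) {a b : Lat d} :
    g.Rel (a + z) (b + z) ↔ g.Rel a b := by
  refine ⟨fun h => ?_, fun h => h.shift hL hz⟩
  have := h.shift (z := -z) hL fun x hx => by rw [dotProduct_neg, hz x hx, neg_zero]
  simpa using this

lemma next_orth {c : Lat d} (t : ℤ) (x : Lat d) (hx : ∀ e ∈ (g.next c).C, x ⬝ᵥ e = 0) :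
    x ⬝ᵥ (t • c) = 0 := by
  rw [dotProduct_smul, hx c (by simp [next]), smul_zero]

lemma next_shift_iff {c a b : Lat d} (t : ℤ) :
    (g.next c).Rel (a + t • c) (b + t • c) ↔ (g.next c).Rel a b :=
  Rel.shift_iff rfl (next_orth t)

lemma Good.rel_next (hg : g.Good) {c a e : Lat d} (hr : g.Rigid c a) (h : g.Rel a e) :
    (g.next c).Rel a e := by
  have key : ∀ x, g.Rel a x → (x - a) ⬝ᵥ c = 0 := fun x hx =>
    hr (x - a) (by rw [add_sub_cancel]; exact hx.len_eq.symm)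
      (by rw [len_sub_comm]; exact hg.hdiam _ _ hx)
  unfold Rel at h
  induction h with
  | refl => exact .refl a
  | @tail x y h1 h2 ih =>
    refine ih.tail ⟨trivial, trivial, h2.2.2.1, h2.2.2.2.1, fun c' hc' => ?_⟩
    rcases List.mem_cons.1 hc' with rfl | hc'
    · have e1 := key x h1
      have e2 := key y (Relation.ReflTransGen.tail h1 h2)
      rw [sub_dotProduct] at *
      omega
    · exact h2.2.2.2.2 c' hc'

lemma Good.rel_of_next (hg : g.Good) {c a e : Lat d} (ha : g.ρ ≤ len a)
    (h : (g.next c).Rel a e) : g.Rel a e := by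
  unfold Rel at h
  induction h with
  | refl => exact .refl a
  | @tail x y h1 h2 ih =>
    have hx : len a = len x := Rel.len_eq h1
    refine ih.tail ⟨hg.hL _ (hx ▸ ha), hg.hL _ (h2.2.2.1 ▸ hx ▸ ha), h2.2.2.1, h2.2.2.2.1,
      fun c' hc' => h2.2.2.2.2 c' (List.mem_cons_of_mem _ hc')⟩

lemma Good.rel_next_iff (hg : g.Good) {c a e : Lat d} (hr : g.Rigid c a) (ha : g.ρ ≤ len a) :
    (g.next c).Rel a e ↔ g.Rel a e := ⟨hg.rel_of_next ha, hg.rel_next hr⟩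

lemma Good.mem_blk (hg : g.Good) {a e : Lat d} : e ∈ g.blk a ↔ g.Rel a e := by
  have h : {e | g.Rel a e}.Finite :=
    (finite_len_sub_le a g.D).subset fun e he => hg.hdiam a e he
  rw [blk, dif_pos h, Set.Finite.mem_toFinset]; rfl

lemma Good.self_mem_blk (hg : g.Good) (a : Lat d) : a ∈ g.blk a := hg.mem_blk.2 (.refl a)

lemma Good.blk_eq (hg : g.Good) {a e : Lat d} (h : g.Rel a e) : g.blk e = g.blk a := by
  ext x
  rw [hg.mem_blk, hg.mem_blk]
  exact ⟨h.trans, h.symm.trans⟩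

lemma Good.card_blk (hg : g.Good) (a : Lat d) : ((g.blk a).card : ℝ) ≤ (3 * g.D) ^ d := by
  have h1 : (g.blk a).card ≤ (box d g.D).card := by
    refine Finset.card_le_card_of_injOn (fun e => a - e) (fun e he => mem_box ?_) ?_
    · exact hg.hdiam _ _ (hg.mem_blk.1 he)
    · intro x _ y _ h; simpa using h
  have hD := hg.hD
  calc ((g.blk a).card : ℝ) ≤ (box d g.D).card := by exact_mod_cast h1
    _ ≤ (2 * g.D + 1) ^ d := card_box (by linarith)
    _ ≤ (3 * g.D) ^ d := by gcongr; linarith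

/-- If `a = a' + t c` with `t` large, then short vectors `x` for which `|a + x|² - |a|²` is small
are orthogonal to `c`. -/
lemma orth_of_large {a a' c x : Lat d} {t δ h : ℝ} (ha : toE a = toE a' + t • toE c)
    (hx : len x ≤ δ) (hh : |(((a + x) ⬝ᵥ (a + x) - a ⬝ᵥ a : ℤ) : ℝ)| ≤ h)
    (ht : len a' * δ + δ ^ 2 + h < t) : x ⬝ᵥ c = 0 := by
  by_contra hne
  have h1 : (1 : ℝ) ≤ |((x ⬝ᵥ c : ℤ) : ℝ)| := by exact_mod_cast Int.one_le_abs hne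
  have h2 : ((a ⬝ᵥ x : ℤ) : ℝ) = ((a' ⬝ᵥ x : ℤ) : ℝ) + t * ((x ⬝ᵥ c : ℤ) : ℝ) := by
    rw [← inner_toE, ha, inner_add_left, real_inner_smul_left, inner_toE, inner_toE,
      dotProduct_comm c x]
  have h3 : (((a + x) ⬝ᵥ (a + x) - a ⬝ᵥ a : ℤ) : ℝ)
      = 2 * ((a' ⬝ᵥ x : ℤ) : ℝ) + 2 * (t * ((x ⬝ᵥ c : ℤ) : ℝ)) + len x ^ 2 := by
    rw [sq_add, len_sq]; push_cast; rw [h2]; ring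
  have h4 := abs_dot_le a' x
  have h5 := len_nonneg x
  have h6 := len_nonneg a'
  have h0 : 0 ≤ h := (abs_nonneg _).trans hh
  have ht0 : 0 < t := by nlinarith
  have h7 : t ≤ |t * ((x ⬝ᵥ c : ℤ) : ℝ)| := by
    rw [abs_mul, abs_of_pos ht0]; nlinarith
  rw [h3] at hh
  have h8 : len a' * len x ≤ len a' * δ := by gcongr
  have h9 : len x ^ 2 ≤ δ ^ 2 := by gcongr
  rw [abs_le] at hh h4
  rcases le_abs.1 h7 with h | h <;> nlinarith

lemma toE_shift (a c : Lat d) (t : ℤ) : toE (a + t • c) = toE a + (t : ℝ) • toE c := by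
  rw [toE_add, toE_smul]

lemma rigid_of_large {a a' c : Lat d} {t : ℝ} (ha : toE a = toE a' + t • toE c)
    (ht : len a' * g.D + g.D ^ 2 < t) : g.Rigid c a := fun x hx hl =>
  orth_of_large ha hl (h := 0) (by rw [len_eq_iff.1 hx]; simp) (by linarith)

lemma len_shift_ge (a c : Lat d) (hc : c ≠ 0) (t : ℕ) : (t : ℝ) - len a ≤ len (a + (t : ℤ) • c) := by
  have h1 : len ((t : ℤ) • c) ≤ len (a + (t : ℤ) • c) + len a := by
    have : (t : ℤ) • c = (a + (t : ℤ) • c) - a := by abel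
    conv_lhs => rw [this]
    exact len_sub_le _ _
  rw [len_smul] at h1
  have h2 := one_le_len hc
  have h3 : (0 : ℝ) ≤ t := Nat.cast_nonneg t
  rw [Int.cast_natCast, Nat.abs_cast] at h1
  nlinarith

lemma tendsto_len_shift (a : Lat d) {c : Lat d} (hc : c ≠ 0) :
    Tendsto (fun t : ℕ => len (a + (t : ℤ) • c)) atTop atTop :=
  tendsto_atTop_mono (len_shift_ge a c hc)
    (tendsto_atTop_add_const_right _ _ tendsto_natCast_atTop_atTop)

lemma eventually_rigid (g : Lev d) {c : Lat d} (hc : c ≠ 0) (a : Lat d) :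
    ∀ᶠ t : ℕ in atTop, g.Rigid c (a + (t : ℤ) • c) ∧ g.ρ ≤ len (a + (t : ℤ) • c) := by
  filter_upwards [(tendsto_len_shift a hc).eventually_ge_atTop g.ρ,
    (tendsto_natCast_atTop_atTop (R := ℝ)).eventually_gt_atTop (len a * g.D + g.D ^ 2)]
    with t h1 h2
  exact ⟨rigid_of_large (a' := a) (t := t) (by rw [toE_shift]; simp) h2, h1⟩

lemma Good.next (hg : g.Good) {c : Lat d} (hc : c ≠ 0) : (g.next c).Good := by
  refine ⟨fun _ _ => trivial, fun a b hab => ?_, hg.hD, hg.hΔ'⟩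
  obtain ⟨t, ht⟩ := (g.eventually_rigid hc a).exists
  have h1 := hg.rel_of_next ht.2 ((next_shift_iff (t : ℤ)).2 hab)
  have h2 := hg.hdiam _ _ h1
  rwa [add_sub_add_right_eq_sub] at h2

lemma Good.blk_next (hg : g.Good) {c a : Lat d} (hc : c ≠ 0) (hr : g.Rigid c a)
    (ha : g.ρ ≤ len a) : (g.next c).blk a = g.blk a := by
  ext e
  rw [hg.mem_blk, (hg.next hc).mem_blk, hg.rel_next_iff hr ha]

lemma Good.blk_shift (hg : g.Good) (hL : g.L = Set.univ) {z : Lat d}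
    (hz : ∀ x : Lat d, (∀ c ∈ g.C, x ⬝ᵥ c = 0) → x ⬝ᵥ z = 0) (a : Lat d) :
    g.blk (a + z) = (g.blk a).map (addRightEmbedding z) := by
  ext e
  rw [hg.mem_blk, Finset.mem_map]
  constructor
  · intro h
    refine ⟨e - z, hg.mem_blk.2 ?_, by simp⟩
    rw [← Rel.shift_iff hL hz]; simpa using h
  · rintro ⟨x, hx, rfl⟩
    exact (hg.mem_blk.1 hx).shift hL hz

lemma Good.blk_ray (hg : g.Good) {c a : Lat d} (hc : c ≠ 0) {t : ℕ}
    (ht : g.Rigid c (a + (t : ℤ) • c) ∧ g.ρ ≤ len (a + (t : ℤ) • c)) :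
    g.blk (a + (t : ℤ) • c) = ((g.next c).blk a).map (addRightEmbedding ((t : ℤ) • c)) := by
  rw [← hg.blk_next hc ht.1 ht.2, (hg.next hc).blk_shift rfl (next_orth (t : ℤ))]

lemma Act.congr {a b a' b' : Lat d} (h : g.Act a b) (ha : g.Rel a a') (hb : g.Rel b b') :
    g.Act a' b' := by
  obtain ⟨h1, h2, h3, h4, x, y, hx, hy, hxy⟩ := h
  refine ⟨ha.mem h1, hb.mem h2, fun c hc => ?_, fun hk => ?_, x, y, ha.symm.trans hx,
    hb.symm.trans hy, hxy⟩
  · have e1 := h3 c hc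
    have e2 := ha.orth hc
    have e3 := hb.orth hc
    rw [sub_dotProduct] at *
    omega
  · rw [← ha.len_eq, ← hb.len_eq]; exact h4 hk

lemma Good.act_len (hg : g.Good) {a b : Lat d} (h : g.Act a b) :
    len (a - b) ≤ g.Δ' + 2 * g.D := by
  obtain ⟨_, _, _, _, x, y, hx, hy, hxy⟩ := h
  have e1 := hg.hdiam _ _ hx
  have e2 := hg.hdiam _ _ hy
  have : a - b = (a - x) + (x - y) + (y - b) := by abel
  rw [this]
  rw [len_sub_comm] at e2
  linarith [len_add_le ((a - x) + (x - y)) (y - b), len_add_le (a - x) (x - y)]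

lemma Good.act_next_iff (hg : g.Good) {c a b : Lat d} (hra : g.Rigid c a) (ha : g.ρ ≤ len a)
    (hrb : g.Rigid c b) (hb : g.ρ ≤ len b) :
    (g.next c).Act a b ↔ g.Act a b ∧ (a - b) ⬝ᵥ c = 0 := by
  constructor
  · rintro ⟨-, -, h3, h4, x, y, hx, hy, hxy⟩
    exact ⟨⟨hg.hL a ha, hg.hL b hb, fun e he => h3 e (List.mem_cons_of_mem _ he), h4, x, y,
      hg.rel_of_next ha hx, hg.rel_of_next hb hy, hxy⟩, h3 c (by simp [Lev.next])⟩
  · rintro ⟨⟨-, -, h3, h4, x, y, hx, hy, hxy⟩, h5⟩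
    refine ⟨trivial, trivial, fun e he => ?_, h4, x, y, hg.rel_next hra hx, hg.rel_next hrb hy, hxy⟩
    rcases List.mem_cons.1 he with rfl | he
    · exact h5
    · exact h3 e he

lemma Act.shift (hL : g.L = Set.univ) {z : Lat d}
    (hz : ∀ x : Lat d, (∀ c ∈ g.C, x ⬝ᵥ c = 0) → x ⬝ᵥ z = 0) {a b : Lat d} (h : g.Act a b) :
    g.Act (a + z) (b + z) := by
  obtain ⟨_, _, h3, h4, x, y, hx, hy, hxy⟩ := h
  refine ⟨by rw [hL]; trivial, by rw [hL]; trivial, ?_, ?_, x + z, y + z, hx.shift hL hz,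
    hy.shift hL hz, ?_⟩
  · simpa only [add_sub_add_right_eq_sub] using h3
  · rwa [Ne, len_shift_iff (hz _ h3)]
  · rwa [add_sub_add_right_eq_sub]

lemma Act.shift_iff (hL : g.L = Set.univ) {z : Lat d}
    (hz : ∀ x : Lat d, (∀ c ∈ g.C, x ⬝ᵥ c = 0) → x ⬝ᵥ z = 0) {a b : Lat d} :
    g.Act (a + z) (b + z) ↔ g.Act a b := by
  refine ⟨fun h => ?_, fun h => h.shift hL hz⟩
  have := h.shift (z := -z) hL fun x hx => by rw [dotProduct_neg, hz x hx, neg_zero]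
  simpa using this

end Lev

/-! ### Sylvester operators on finite blocks -/

/-- Scalar kernels on the lattice. -/
abbrev Ker (d : ℕ) := Lat d → Lat d → ℂ

section Sylvester

variable {d : ℕ} {A B : Finset (Lat d)} {κ K : ℝ} {M z N X Y : Ker d} {ι : Type*} {a b : Lat d}

/-- The Hilbert–Schmidt norm of the restriction of `X` to `A × B`. -/
def hs (A B : Finset (Lat d)) (X : Ker d) : ℝ := √(∑ a ∈ A, ∑ b ∈ B, ‖X a b‖ ^ 2)

/-- The restriction of a kernel to `A × B`. -/
def restr (A B : Finset (Lat d)) (X : Ker d) : EuclideanSpace ℂ (A × B) :=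
  WithLp.toLp 2 fun p => X p.1 p.2

lemma norm_restr (A B : Finset (Lat d)) (X : Ker d) : ‖restr A B X‖ = hs A B X := by
  rw [EuclideanSpace.norm_eq, hs, ← Finset.sum_coe_sort A, Fintype.sum_prod_type]
  congr 1
  refine Finset.sum_congr rfl fun a _ => ?_
  rw [← Finset.sum_coe_sort B]
  rfl

lemma hs_nonneg (A B : Finset (Lat d)) (X : Ker d) : 0 ≤ hs A B X := Real.sqrt_nonneg _

lemma hs_sq (A B : Finset (Lat d)) (X : Ker d) : hs A B X ^ 2 = ∑ a ∈ A, ∑ b ∈ B, ‖X a b‖ ^ 2 :=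
  Real.sq_sqrt (by positivity)

lemma hs_congr (h : ∀ a ∈ A, ∀ b ∈ B, X a b = Y a b) :
    hs A B X = hs A B Y := by
  unfold hs
  congr 1
  exact Finset.sum_congr rfl fun a ha => Finset.sum_congr rfl fun b hb => by rw [h a ha b hb]

lemma hs_add_le (A B : Finset (Lat d)) (X Y : Ker d) : hs A B (X + Y) ≤ hs A B X + hs A B Y := by
  simp only [← norm_restr]
  exact norm_add_le (restr A B X) (restr A B Y)

lemma hs_sub_le (A B : Finset (Lat d)) (X Y : Ker d) : hs A B (X - Y) ≤ hs A B X + hs A B Y := by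
  simp only [← norm_restr]
  exact norm_sub_le (restr A B X) (restr A B Y)

lemma hs_smul (A B : Finset (Lat d)) (c : ℂ) (X : Ker d) : hs A B (c • X) = ‖c‖ * hs A B X := by
  simp only [← norm_restr]
  exact norm_smul c (restr A B X)

lemma hs_zero (A B : Finset (Lat d)) : hs A B 0 = 0 := by simp [hs]

lemma hs_mono (h : ∀ a ∈ A, ∀ b ∈ B, ‖X a b‖ ≤ ‖Y a b‖) :
    hs A B X ≤ hs A B Y := by
  unfold hs
  refine Real.sqrt_le_sqrt (Finset.sum_le_sum fun a ha => Finset.sum_le_sum fun b hb => ?_)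
  have := h a ha b hb
  gcongr

lemma norm_le_hs (X : Ker d) (ha : a ∈ A) (hb : b ∈ B) :
    ‖X a b‖ ≤ hs A B X := by
  have := PiLp.norm_apply_le (restr A B X) (⟨a, ha⟩, ⟨b, hb⟩)
  rwa [norm_restr] at this

lemma hs_le_card {m N : ℝ} (hA : (A.card : ℝ) ≤ N)
    (hB : (B.card : ℝ) ≤ N) (hm : 0 ≤ m) (h : ∀ a ∈ A, ∀ b ∈ B, ‖X a b‖ ≤ m) :
    hs A B X ≤ N * m := by
  have hN : 0 ≤ N := (Nat.cast_nonneg _).trans hA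
  refine Real.sqrt_le_iff.2 ⟨by positivity, ?_⟩
  calc ∑ a ∈ A, ∑ b ∈ B, ‖X a b‖ ^ 2 ≤ ∑ _a ∈ A, ∑ _b ∈ B, m ^ 2 :=
        Finset.sum_le_sum fun a ha => Finset.sum_le_sum fun b hb => by
          have := h a ha b hb
          gcongr
    _ = A.card * (B.card * m ^ 2) := by simp
    _ ≤ N * (N * m ^ 2) := by gcongr
    _ = (N * m) ^ 2 := by ring

lemma hs_map (A B : Finset (Lat d)) (z w : Lat d) (X : Ker d) :
    hs (A.map (addRightEmbedding z)) (B.map (addRightEmbedding w)) X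
      = hs A B fun a b => X (a + z) (b + w) := by
  simp [hs, Finset.sum_map]

lemma eq_zero_of_hs (h : hs A B X ≤ 0)
    (ha : a ∈ A) (hb : b ∈ B) : X a b = 0 :=
  norm_le_zero_iff.1 ((norm_le_hs X ha hb).trans h)

lemma tendsto_hs {l : Filter ι} {X : ι → Ker d}
    (h : ∀ a ∈ A, ∀ b ∈ B, Tendsto (fun t => X t a b) l (𝓝 (Y a b))) :
    Tendsto (fun t => hs A B (X t)) l (𝓝 (hs A B Y)) := by
  unfold hs
  refine (Real.continuous_sqrt.tendsto _).comp ?_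
  exact tendsto_finsetSum _ fun a ha => tendsto_finsetSum _ fun b hb => ((h a ha b hb).norm).pow 2

/-- The product `M X`, summed over `A`. -/
def lprod (A : Finset (Lat d)) (M X : Ker d) : Ker d := fun a b => ∑ e ∈ A, M a e * X e b

/-- The product `X N`, summed over `B`. -/
def rprod (B : Finset (Lat d)) (X N : Ker d) : Ker d := fun a b => ∑ e ∈ B, X a e * N e b

/-- The Sylvester operator `X ↦ z X + M X + X N` on `A × B`. -/
def sylv (A B : Finset (Lat d)) (z M N X : Ker d) : Ker d := fun a b =>
  z a b * X a b + lprod A M X a b + rprod B X N a b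

/-- The section of `M` over `A` has operator norm at most `K`. -/
def OpOn (A : Finset (Lat d)) (M : Ker d) (K : ℝ) : Prop :=
  0 ≤ K ∧ ∀ ξ : Lat d → ℂ, ∑ a ∈ A, ‖∑ e ∈ A, M a e * ξ e‖ ^ 2 ≤ K ^ 2 * ∑ e ∈ A, ‖ξ e‖ ^ 2

/-- The transposed kernel. -/
def tr (M : Ker d) : Ker d := fun a b => M b a

lemma OpOn.mono {K K' : ℝ} (h : OpOn A M K) (hK : K ≤ K') :
    OpOn A M K' := by
  refine ⟨h.1.trans hK, fun ξ => (h.2 ξ).trans ?_⟩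
  have := h.1
  gcongr

lemma hs_lprod_le (B : Finset (Lat d)) (h : OpOn A M K)
    (X : Ker d) : hs A B (lprod A M X) ≤ K * hs A B X := by
  refine Real.sqrt_le_iff.2 ⟨mul_nonneg h.1 (hs_nonneg _ _ _), ?_⟩
  rw [mul_pow, hs_sq, Finset.sum_comm, Finset.sum_comm (s := A) (t := B), Finset.mul_sum]
  exact Finset.sum_le_sum fun b _ => h.2 fun e => X e b

lemma hs_rprod_le (A : Finset (Lat d))
    (h : OpOn B (tr N) K) (X : Ker d) : hs A B (rprod B X N) ≤ K * hs A B X := by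
  refine Real.sqrt_le_iff.2 ⟨mul_nonneg h.1 (hs_nonneg _ _ _), ?_⟩
  rw [mul_pow, hs_sq, Finset.mul_sum]
  refine Finset.sum_le_sum fun a _ => ?_
  have := h.2 fun e => X a e
  simpa only [rprod, tr, mul_comm] using this

lemma opOn_of_entries {m N : ℝ} (hA : (A.card : ℝ) ≤ N)
    (hm : 0 ≤ m) (h : ∀ a ∈ A, ∀ e ∈ A, ‖M a e‖ ≤ m) : OpOn A M (N * m) := by
  have hN : 0 ≤ N := (Nat.cast_nonneg _).trans hA
  refine ⟨by positivity, fun ξ => ?_⟩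
  have h1 : ∀ a ∈ A, ‖∑ e ∈ A, M a e * ξ e‖ ^ 2 ≤ N * m ^ 2 * ∑ e ∈ A, ‖ξ e‖ ^ 2 := by
    intro a ha
    have h2 : ‖∑ e ∈ A, M a e * ξ e‖ ≤ m * ∑ e ∈ A, ‖ξ e‖ := by
      rw [Finset.mul_sum]
      refine (norm_sum_le _ _).trans (Finset.sum_le_sum fun e he => ?_)
      rw [norm_mul]
      exact mul_le_mul_of_nonneg_right (h a ha e he) (norm_nonneg _)
    have h3 : (∑ e ∈ A, ‖ξ e‖) ^ 2 ≤ A.card * ∑ e ∈ A, ‖ξ e‖ ^ 2 := sq_sum_le_card_mul_sum_sq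
    calc ‖∑ e ∈ A, M a e * ξ e‖ ^ 2 ≤ (m * ∑ e ∈ A, ‖ξ e‖) ^ 2 := by gcongr
      _ = m ^ 2 * (∑ e ∈ A, ‖ξ e‖) ^ 2 := by ring
      _ ≤ m ^ 2 * (N * ∑ e ∈ A, ‖ξ e‖ ^ 2) := by
        gcongr
        exact h3.trans (by gcongr)
      _ = _ := by ring
  calc ∑ a ∈ A, ‖∑ e ∈ A, M a e * ξ e‖ ^ 2 ≤ ∑ _a ∈ A, N * m ^ 2 * ∑ e ∈ A, ‖ξ e‖ ^ 2 :=
        Finset.sum_le_sum h1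
    _ = A.card * (N * m ^ 2 * ∑ e ∈ A, ‖ξ e‖ ^ 2) := by simp
    _ ≤ N * (N * m ^ 2 * ∑ e ∈ A, ‖ξ e‖ ^ 2) := by gcongr
    _ = (N * m) ^ 2 * ∑ e ∈ A, ‖ξ e‖ ^ 2 := by ring

lemma opOn_tr_of_entries {m N : ℝ} (hA : (A.card : ℝ) ≤ N)
    (hm : 0 ≤ m) (h : ∀ a ∈ A, ∀ e ∈ A, ‖M a e‖ ≤ m) : OpOn A (tr M) (N * m) :=
  opOn_of_entries hA hm fun a ha e he => h e he a ha

lemma OpOn.neg (h : OpOn A M K) : OpOn A (-M) K := by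
  refine ⟨h.1, fun ξ => ?_⟩
  have := h.2 ξ
  simpa [neg_mul, Finset.sum_neg_distrib, norm_neg] using this

lemma tr_neg (M : Ker d) : tr (-M) = -tr M := rfl

/-- The operator `sylv A B z M N` is bounded below by `κ`. -/
def LB (A B : Finset (Lat d)) (z M N : Ker d) (κ : ℝ) : Prop :=
  ∀ X : Ker d, κ * hs A B X ≤ hs A B (sylv A B z M N X)

lemma LB.mono {κ κ' : ℝ} (h : LB A B z M N κ)
    (hκ : κ' ≤ κ) : LB A B z M N κ' := fun X =>
  (mul_le_mul_of_nonneg_right hκ (hs_nonneg _ _ _)).trans (h X)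

lemma lprod_sub (A : Finset (Lat d)) (M X Y : Ker d) :
    lprod A M (X - Y) = lprod A M X - lprod A M Y := by
  ext a b; simp [lprod, mul_sub]

lemma rprod_sub (B : Finset (Lat d)) (N X Y : Ker d) :
    rprod B (X - Y) N = rprod B X N - rprod B Y N := by
  ext a b; simp [rprod, sub_mul]

lemma sylv_sub (A B : Finset (Lat d)) (z M N X Y : Ker d) :
    sylv A B z M N (X - Y) = sylv A B z M N X - sylv A B z M N Y := by
  ext a b
  simp only [sylv, lprod_sub, rprod_sub, Pi.sub_apply]; ring

lemma sylv_add (A B : Finset (Lat d)) (z M N X Y : Ker d) :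
    sylv A B z M N (X + Y) = sylv A B z M N X + sylv A B z M N Y := by
  ext a b
  simp only [sylv, lprod, rprod, Pi.add_apply, mul_add, add_mul, Finset.sum_add_distrib]; ring

lemma sylv_smul (A B : Finset (Lat d)) (z M N X : Ker d) (c : ℂ) :
    sylv A B z M N (c • X) = c • sylv A B z M N X := by
  ext a b
  simp only [sylv, lprod, rprod, Pi.smul_apply, smul_eq_mul, mul_add, Finset.mul_sum]
  congr 1
  · congr 1
    · ring
    · exact Finset.sum_congr rfl fun e _ => by ring
  · exact Finset.sum_congr rfl fun e _ => by ring

lemma sylv_congr {z z' M M' N N' X X' : Ker d} (ha : a ∈ A)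
    (hb : b ∈ B) (hz : ∀ a ∈ A, ∀ b ∈ B, z a b = z' a b) (hM : ∀ a ∈ A, ∀ e ∈ A, M a e = M' a e)
    (hN : ∀ a ∈ B, ∀ e ∈ B, N a e = N' a e) (hX : ∀ a ∈ A, ∀ b ∈ B, X a b = X' a b) :
    sylv A B z M N X a b = sylv A B z' M' N' X' a b := by
  unfold sylv lprod rprod
  rw [hz a ha b hb, hX a ha b hb]
  congr 1
  · congr 1
    exact Finset.sum_congr rfl fun e he => by rw [hM a ha e he, hX e he b hb]
  · exact Finset.sum_congr rfl fun e he => by rw [hN e he b hb, hX a ha e he]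

lemma LB.congr {z z' M M' N N' : Ker d} (h : LB A B z M N κ)
    (hz : ∀ a ∈ A, ∀ b ∈ B, z a b = z' a b) (hM : ∀ a ∈ A, ∀ e ∈ A, M a e = M' a e)
    (hN : ∀ a ∈ B, ∀ e ∈ B, N a e = N' a e) : LB A B z' M' N' κ := fun X =>
  (h X).trans_eq (hs_congr fun _ ha _ hb => sylv_congr ha hb hz hM hN fun _ _ _ _ => rfl)

lemma LB.perturb {z M N M' N' : Ker d} {κ ε₁ ε₂ : ℝ}
    (h : LB A B z M N κ) (h₁ : OpOn A (M - M') ε₁) (h₂ : OpOn B (tr (N - N')) ε₂) :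
    LB A B z M' N' (κ - ε₁ - ε₂) := by
  intro X
  have e : sylv A B z M N X = sylv A B z M' N' X + lprod A (M - M') X + rprod B X (N - N') := by
    ext a b
    simp only [sylv, lprod, rprod, Pi.add_apply, Pi.sub_apply, sub_mul, mul_sub,
      Finset.sum_sub_distrib]
    ring
  have h3 := h X
  rw [e] at h3
  have h4 := hs_add_le A B (sylv A B z M' N' X + lprod A (M - M') X) (rprod B X (N - N'))
  have h5 := hs_add_le A B (sylv A B z M' N' X) (lprod A (M - M') X)
  have h6 := hs_lprod_le B h₁ X
  have h7 := hs_rprod_le A h₂ X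
  linarith

lemma LB_diag {μ : ℝ} (hμ : 0 ≤ μ)
    (h : ∀ a ∈ A, ∀ b ∈ B, μ ≤ ‖z a b‖) : LB A B z 0 0 μ := by
  intro X
  have : μ * hs A B X = hs A B ((μ : ℂ) • X) := by
    rw [hs_smul, Complex.norm_real, Real.norm_of_nonneg hμ]
  rw [this]
  refine hs_mono fun a ha b hb => ?_
  simp only [sylv, lprod, rprod, Pi.smul_apply, Pi.zero_apply, zero_mul, mul_zero,
    Finset.sum_const_zero, add_zero, smul_eq_mul, norm_mul, Complex.norm_real,
    Real.norm_of_nonneg hμ]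
  exact mul_le_mul_of_nonneg_right (h a ha b hb) (norm_nonneg _)

lemma LB_of_diag {μ m₁ m₂ : ℝ} (hμ : 0 ≤ μ)
    (h : ∀ a ∈ A, ∀ b ∈ B, μ ≤ ‖z a b‖) (h₁ : OpOn A M m₁) (h₂ : OpOn B (tr N) m₂) :
    LB A B z M N (μ - m₁ - m₂) :=
  (LB_diag hμ h).perturb (by rw [zero_sub]; exact h₁.neg)
    (by rw [zero_sub, tr_neg]; exact h₂.neg)

lemma sylv_map (A B : Finset (Lat d)) (z M N X : Ker d) (u w a b : Lat d) :
    sylv (A.map (addRightEmbedding u)) (B.map (addRightEmbedding w)) z M N X (a + u) (b + w)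
      = sylv A B (fun a b => z (a + u) (b + w)) (fun a b => M (a + u) (b + u))
        (fun a b => N (a + w) (b + w)) (fun a b => X (a + u) (b + w)) a b := by
  simp [sylv, lprod, rprod, Finset.sum_map]

lemma LB_map {u w : Lat d} :
    LB (A.map (addRightEmbedding u)) (B.map (addRightEmbedding w)) z M N κ ↔
      LB A B (fun a b => z (a + u) (b + w)) (fun a b => M (a + u) (b + u))
        (fun a b => N (a + w) (b + w)) κ := by
  constructor
  · intro h X
    have := h fun a b => X (a - u) (b - w)
    rw [hs_map, hs_map] at this
    simpa only [sylv_map, add_sub_cancel_right] using this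
  · intro h X
    have := h fun a b => X (a + u) (b + w)
    rw [hs_map, hs_map]
    simpa only [sylv_map] using this

lemma tendsto_sylv {l : Filter ι} {z M N X : ι → Ker d}
    {z' M' N' X' : Ker d}
    (hz : ∀ a ∈ A, ∀ b ∈ B, Tendsto (fun t => z t a b) l (𝓝 (z' a b)))
    (hM : ∀ a ∈ A, ∀ b ∈ A, Tendsto (fun t => M t a b) l (𝓝 (M' a b)))
    (hN : ∀ a ∈ B, ∀ b ∈ B, Tendsto (fun t => N t a b) l (𝓝 (N' a b)))
    (hX : ∀ a ∈ A, ∀ b ∈ B, Tendsto (fun t => X t a b) l (𝓝 (X' a b))) :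
    ∀ a ∈ A, ∀ b ∈ B, Tendsto (fun t => sylv A B (z t) (M t) (N t) (X t) a b) l
      (𝓝 (sylv A B z' M' N' X' a b)) := by
  intro a ha b hb
  refine (((hz a ha b hb).mul (hX a ha b hb)).add ?_).add ?_
  · exact tendsto_finsetSum _ fun e he => (hM a ha e he).mul (hX e he b hb)
  · exact tendsto_finsetSum _ fun e he => (hX a ha e he).mul (hN e he b hb)

lemma LB_of_tendsto {l : Filter ι} [l.NeBot]
    {z M N : ι → Ker d} {z' M' N' : Ker d}
    (hz : ∀ a ∈ A, ∀ b ∈ B, Tendsto (fun t => z t a b) l (𝓝 (z' a b)))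
    (hM : ∀ a ∈ A, ∀ b ∈ A, Tendsto (fun t => M t a b) l (𝓝 (M' a b)))
    (hN : ∀ a ∈ B, ∀ b ∈ B, Tendsto (fun t => N t a b) l (𝓝 (N' a b)))
    (h : ∀ᶠ t in l, LB A B (z t) (M t) (N t) κ) : LB A B z' M' N' κ := fun X =>
  le_of_tendsto_of_tendsto tendsto_const_nhds
    (tendsto_hs (tendsto_sylv hz hM hN fun _ _ _ _ => tendsto_const_nhds))
    (h.mono fun _ ht => ht X)

lemma LB.exists_sol (h : LB A B z M N κ)
    (hκ : 0 < κ) (f : Ker d) : ∃ X : Ker d, ∀ a ∈ A, ∀ b ∈ B, sylv A B z M N X a b = f a b := by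
  classical
  let ext : (A × B → ℂ) → Ker d := fun x a b =>
    if h : a ∈ A ∧ b ∈ B then x (⟨a, h.1⟩, ⟨b, h.2⟩) else 0
  have ext_val : ∀ x (p : A × B), ext x p.1 p.2 = x p := fun x p => by simp [ext]
  let T : (A × B → ℂ) →ₗ[ℂ] (A × B → ℂ) :=
    { toFun := fun x p => sylv A B z M N (ext x) p.1 p.2
      map_add' := fun x y => by
        have : ext (x + y) = ext x + ext y := by
          funext a b; simp only [ext, Pi.add_apply]; split_ifs <;> simp
        funext p; rw [this, sylv_add]; rfl
      map_smul' := fun c x => by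
        have : ext (c • x) = c • ext x := by
          funext a b; simp only [ext, Pi.smul_apply]; split_ifs <;> simp
        funext p; rw [this, sylv_smul]; rfl }
  have hinj : Function.Injective T := by
    refine (injective_iff_map_eq_zero T).2 fun x hx => ?_
    have h1 : hs A B (sylv A B z M N (ext x)) = 0 := by
      rw [← hs_zero A B]
      exact hs_congr fun a ha b hb => congrFun hx (⟨a, ha⟩, ⟨b, hb⟩)
    have h2 := h (ext x)
    rw [h1] at h2
    have h3 : hs A B (ext x) ≤ 0 := by
      by_contra hc
      push Not at hc
      have := mul_pos hκ hc
      linarith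
    funext p
    rw [← ext_val x p]
    exact eq_zero_of_hs h3 p.1.2 p.2.2
  obtain ⟨x, hx⟩ := LinearMap.injective_iff_surjective.1 hinj fun p => f p.1 p.2
  exact ⟨ext x, fun a ha b hb => congrFun hx (⟨a, ha⟩, ⟨b, hb⟩)⟩

lemma LB.hs_le (h : LB A B z M N κ)
    (hκ : 0 < κ) (X : Ker d) : hs A B X ≤ κ⁻¹ * hs A B (sylv A B z M N X) := by
  rw [inv_mul_eq_div, le_div_iff₀ hκ, mul_comm]; exact h X

lemma tendsto_sol {l : Filter ι} {z M N f s : ι → Ker d}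
    {z' M' N' f' s' : Ker d} (hκ : 0 < κ)
    (hz : ∀ a ∈ A, ∀ b ∈ B, Tendsto (fun t => z t a b) l (𝓝 (z' a b)))
    (hM : ∀ a ∈ A, ∀ b ∈ A, Tendsto (fun t => M t a b) l (𝓝 (M' a b)))
    (hN : ∀ a ∈ B, ∀ b ∈ B, Tendsto (fun t => N t a b) l (𝓝 (N' a b)))
    (hf : ∀ a ∈ A, ∀ b ∈ B, Tendsto (fun t => f t a b) l (𝓝 (f' a b)))
    (h : ∀ᶠ t in l, LB A B (z t) (M t) (N t) κ)
    (hs : ∀ᶠ t in l, ∀ a ∈ A, ∀ b ∈ B, sylv A B (z t) (M t) (N t) (s t) a b = f t a b)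
    (hs' : ∀ a ∈ A, ∀ b ∈ B, sylv A B z' M' N' s' a b = f' a b) :
    ∀ a ∈ A, ∀ b ∈ B, Tendsto (fun t => s t a b) l (𝓝 (s' a b)) := by
  have h1 : Tendsto (fun t => κ⁻¹ * ToplitzLipschitz.hs A B
      (fun a b => f t a b - sylv A B (z t) (M t) (N t) s' a b)) l (𝓝 (κ⁻¹ * 0)) := by
    refine Tendsto.const_mul _ ?_
    rw [← hs_zero A B]
    refine tendsto_hs fun a ha b hb => ?_
    have := (hf a ha b hb).sub (tendsto_sylv hz hM hN (X := fun _ => s') (X' := s')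
      (fun _ _ _ _ => tendsto_const_nhds) a ha b hb)
    rw [hs' a ha b hb, sub_self] at this
    exact this
  rw [mul_zero] at h1
  intro a ha b hb
  rw [tendsto_iff_norm_sub_tendsto_zero]
  refine squeeze_zero' (Eventually.of_forall fun t => norm_nonneg _) ?_ h1
  filter_upwards [h, hs] with t ht hst
  have h2 := ht.hs_le hκ (s t - s')
  rw [sylv_sub] at h2
  have h3 := norm_le_hs (s t - s') ha hb
  refine h3.trans (h2.trans_eq ?_)
  congr 1
  exact hs_congr fun a ha b hb => by rw [Pi.sub_apply, Pi.sub_apply, hst a ha b hb]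

end Sylvester

/-! ### The commutator equation on blocks -/

section Commutator

variable {d : ℕ} {c a b : Lat d} {θ κ : ℝ} {Q f s Q' f' s' : Ker d} {t : ℕ}

/-- The kernel `A'` is the limit of `A` along `c`. -/
def HasLim (c : Lat d) (A A' : Ker d) : Prop :=
  ∀ a b, Tendsto (fun t : ℕ => A (a + (t : ℤ) • c) (b + (t : ℤ) • c)) atTop (𝓝 (A' a b))

/-- The energy `θ + |a|² - |b|²`. -/
def energy (θ : ℝ) : Ker d := fun a b => (θ : ℂ) + ((a ⬝ᵥ a - b ⬝ᵥ b : ℤ) : ℂ)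

lemma energy_shift {a b z : Lat d} (h : (a - b) ⬝ᵥ z = 0) :
    energy θ (a + z) (b + z) = energy θ a b := by
  unfold energy; rw [Lev.sq_sub_shift, h]; simp

lemma norm_energy_ge (θ : ℝ) (a b : Lat d) :
    |((a ⬝ᵥ a - b ⬝ᵥ b : ℤ) : ℝ)| - |θ| ≤ ‖energy θ a b‖ := by
  have h := norm_sub_le (energy θ a b) (θ : ℂ)
  have e : energy θ a b - (θ : ℂ) = (((a ⬝ᵥ a - b ⬝ᵥ b : ℤ) : ℝ) : ℂ) := by
    unfold energy; push_cast; ring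
  rw [e, Complex.norm_real, Complex.norm_real, Real.norm_eq_abs, Real.norm_eq_abs] at h
  linarith

namespace Lev

variable (g : Lev d)

/-- The commutator equation is solvable with bound `κ⁻¹` on all active pairs of blocks. -/
def LBall (θ : ℝ) (Q : Ker d) (κ : ℝ) : Prop :=
  ∀ a b, g.Act a b → LB (g.blk a) (g.blk b) (energy θ) Q (-Q) κ

/-- `s` solves `(θ + |a|² - |b|²) s + Q s - s Q = f` on the active pairs and vanishes elsewhere. -/
structure IsSol (θ : ℝ) (Q f s : Ker d) : Prop where
  eq : ∀ a b, g.Act a b → sylv (g.blk a) (g.blk b) (energy θ) Q (-Q) s a b = f a b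
  zero : ∀ a b, ¬ g.Act a b → s a b = 0

/-- The commutator of `P` and `s`, with sums restricted to blocks. -/
def comm (P s : Ker d) : Ker d := fun a b =>
  lprod (g.blk a) P s a b - rprod (g.blk b) s P a b

/-- The right-hand side of the equation for the derivative of the solution. -/
def dRhs (η : ℝ) (P f s : Ker d) : Ker d := f - (η : ℂ) • s - g.comm P s

/-- The operator norms of `Q` on the blocks are at most `K`. -/
def OpBlk (Q : Ker d) (K : ℝ) : Prop :=
  ∀ a ∈ g.L, OpOn (g.blk a) Q K ∧ OpOn (g.blk a) (tr Q) K

variable {g}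

lemma IsSol.eq_on (hg : g.Good) (h : g.IsSol θ Q f s)
    (hab : g.Act a b) : ∀ x ∈ g.blk a, ∀ y ∈ g.blk b,
      sylv (g.blk a) (g.blk b) (energy θ) Q (-Q) s x y = f x y := by
  intro x hx y hy
  rw [hg.mem_blk] at hx hy
  have := h.eq x y (hab.congr hx hy)
  rwa [hg.blk_eq hx, hg.blk_eq hy] at this

lemma exists_isSol (hg : g.Good) (hκ : 0 < κ) (h : g.LBall θ Q κ) (f : Ker d) :
    ∃ s, g.IsSol θ Q f s := by
  classical
  have h1 : ∀ A B : Finset (Lat d), ∃ X : Ker d, LB A B (energy θ) Q (-Q) κ →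
      ∀ a ∈ A, ∀ b ∈ B, sylv A B (energy θ) Q (-Q) X a b = f a b := by
    intro A B
    by_cases hAB : LB A B (energy θ) Q (-Q) κ
    · obtain ⟨X, hX⟩ := hAB.exists_sol hκ f
      exact ⟨X, fun _ => hX⟩
    · exact ⟨0, fun h => absurd h hAB⟩
  choose X hX using h1
  refine ⟨fun a b => if g.Act a b then X (g.blk a) (g.blk b) a b else 0, fun a b hab => ?_,
    fun a b hab => if_neg hab⟩
  rw [← hX _ _ (h a b hab) a (hg.self_mem_blk a) b (hg.self_mem_blk b)]
  refine sylv_congr (hg.self_mem_blk a) (hg.self_mem_blk b) (fun _ _ _ _ => rfl)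
    (fun _ _ _ _ => rfl) (fun _ _ _ _ => rfl) fun x hx y hy => ?_
  rw [hg.mem_blk] at hx hy
  rw [if_pos (hab.congr hx hy), hg.blk_eq hx, hg.blk_eq hy]

lemma IsSol.hs_le (hg : g.Good) (hκ : 0 < κ) (hLB : g.LBall θ Q κ)
    (h : g.IsSol θ Q f s) (hab : g.Act a b) :
    hs (g.blk a) (g.blk b) s ≤ κ⁻¹ * hs (g.blk a) (g.blk b) f := by
  refine ((hLB a b hab).hs_le hκ s).trans_eq ?_
  rw [hs_congr (h.eq_on hg hab)]

lemma LB_energy (hg : g.Good) {θ K : ℝ} (hQ : g.OpBlk Q K)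
    (hab : g.Act a b) (hθ : |θ| ≤ |((a ⬝ᵥ a - b ⬝ᵥ b : ℤ) : ℝ)|) :
    LB (g.blk a) (g.blk b) (energy θ) Q (-Q)
      (|((a ⬝ᵥ a - b ⬝ᵥ b : ℤ) : ℝ)| - |θ| - 2 * K) := by
  refine (LB_of_diag (μ := |((a ⬝ᵥ a - b ⬝ᵥ b : ℤ) : ℝ)| - |θ|) (by linarith) ?_
    (hQ a hab.1).1 (by rw [tr_neg]; exact (hQ b hab.2.1).2.neg)).mono (by linarith)
  intro x hx y hy
  rw [hg.mem_blk] at hx hy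
  rw [len_eq_iff.1 hx.len_eq, len_eq_iff.1 hy.len_eq]
  exact norm_energy_ge θ x y

lemma hs_ray (hg : g.Good) (hc : c ≠ 0)
    (ha : g.Rigid c (a + (t : ℤ) • c) ∧ g.ρ ≤ len (a + (t : ℤ) • c))
    (hb : g.Rigid c (b + (t : ℤ) • c) ∧ g.ρ ≤ len (b + (t : ℤ) • c)) (X : Ker d) :
    hs (g.blk (a + (t : ℤ) • c)) (g.blk (b + (t : ℤ) • c)) X
      = hs ((g.next c).blk a) ((g.next c).blk b)
        fun x y => X (x + (t : ℤ) • c) (y + (t : ℤ) • c) := by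
  rw [hg.blk_ray hc ha, hg.blk_ray hc hb, hs_map]

lemma act_ray_iff (hg : g.Good)
    (ha : g.Rigid c (a + (t : ℤ) • c) ∧ g.ρ ≤ len (a + (t : ℤ) • c))
    (hb : g.Rigid c (b + (t : ℤ) • c) ∧ g.ρ ≤ len (b + (t : ℤ) • c)) :
    (g.next c).Act a b ↔ g.Act (a + (t : ℤ) • c) (b + (t : ℤ) • c) ∧ (a - b) ⬝ᵥ c = 0 := by
  rw [← Act.shift_iff (g := g.next c) rfl (next_orth (t : ℤ)),
    hg.act_next_iff ha.1 ha.2 hb.1 hb.2, add_sub_add_right_eq_sub]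

lemma act_orth (h : (g.next c).Act a b) {x y : Lat d} (hx : (g.next c).Rel a x)
    (hy : (g.next c).Rel b y) : (x - y) ⬝ᵥ c = 0 :=
  (h.congr hx hy).2.2.1 c (by simp [next])

lemma LBall.next (hg : g.Good) (hc : c ≠ 0)
    (hQ : HasLim c Q Q') (h : g.LBall θ Q κ) : (g.next c).LBall θ Q' κ := by
  intro a b hab
  have hev : ∀ᶠ t : ℕ in atTop, LB ((g.next c).blk a) ((g.next c).blk b)
      (fun x y => energy θ (x + (t : ℤ) • c) (y + (t : ℤ) • c))
      (fun x y => Q (x + (t : ℤ) • c) (y + (t : ℤ) • c))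
      (fun x y => (-Q) (x + (t : ℤ) • c) (y + (t : ℤ) • c)) κ := by
    filter_upwards [g.eventually_rigid hc a, g.eventually_rigid hc b] with t ha hb
    have h1 := h _ _ ((act_ray_iff hg ha hb).1 hab).1
    rw [hg.blk_ray hc ha, hg.blk_ray hc hb] at h1
    exact LB_map.1 h1
  refine LB_of_tendsto ?_ (fun x _ y _ => hQ x y) (fun x _ y _ => (hQ x y).neg) hev
  intro x hx y hy
  rw [(hg.next hc).mem_blk] at hx hy
  refine tendsto_const_nhds.congr fun t => (energy_shift ?_).symm
  rw [dotProduct_smul, act_orth hab hx hy, smul_zero]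

lemma IsSol.hasLim (hg : g.Good) (hc : c ≠ 0) {θ κ K : ℝ}
    (hκ : 0 < κ) (hLB : g.LBall θ Q κ) (hK : g.OpBlk Q K) (hQ : HasLim c Q Q') (hf : HasLim c f f')
    (h : g.IsSol θ Q f s) (h' : (g.next c).IsSol θ Q' f' s') : HasLim c s s' := by
  intro a b
  have hra := g.eventually_rigid hc a
  have hrb := g.eventually_rigid hc b
  by_cases hab : (g.next c).Act a b
  · refine tendsto_sol (A := (g.next c).blk a) (B := (g.next c).blk b)
      (z := fun (t : ℕ) x y => energy θ (x + (t : ℤ) • c) (y + (t : ℤ) • c))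
      (M := fun (t : ℕ) x y => Q (x + (t : ℤ) • c) (y + (t : ℤ) • c))
      (N := fun (t : ℕ) x y => (-Q) (x + (t : ℤ) • c) (y + (t : ℤ) • c))
      (f := fun (t : ℕ) x y => f (x + (t : ℤ) • c) (y + (t : ℤ) • c))
      (s := fun (t : ℕ) x y => s (x + (t : ℤ) • c) (y + (t : ℤ) • c))
      (s' := s') hκ ?_ (fun x _ y _ => hQ x y)
      (fun x _ y _ => (hQ x y).neg) (fun x _ y _ => hf x y) ?_ ?_ (h'.eq_on (hg.next hc) hab)
      a ((hg.next hc).self_mem_blk a) b ((hg.next hc).self_mem_blk b)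
    · intro x hx y hy
      rw [(hg.next hc).mem_blk] at hx hy
      refine tendsto_const_nhds.congr fun t => (energy_shift ?_).symm
      rw [dotProduct_smul, act_orth hab hx hy, smul_zero]
    · filter_upwards [hra, hrb] with t ha hb
      have h1 := hLB _ _ ((act_ray_iff hg ha hb).1 hab).1
      rw [hg.blk_ray hc ha, hg.blk_ray hc hb] at h1
      exact LB_map.1 h1
    · filter_upwards [hra, hrb] with t ha hb x hx y hy
      have h1 := h.eq_on hg ((act_ray_iff hg ha hb).1 hab).1 (x + (t : ℤ) • c)
        (by rw [hg.blk_ray hc ha]; exact Finset.mem_map_of_mem _ hx) (y + (t : ℤ) • c)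
        (by rw [hg.blk_ray hc hb]; exact Finset.mem_map_of_mem _ hy)
      rw [hg.blk_ray hc ha, hg.blk_ray hc hb, sylv_map] at h1
      exact h1
  · rw [h'.zero a b hab]
    by_cases horth : (a - b) ⬝ᵥ c = 0
    · refine tendsto_const_nhds.congr' ?_
      filter_upwards [hra, hrb] with t ha hb
      exact (h.zero _ _ fun hact => hab ((act_ray_iff hg ha hb).2 ⟨hact, horth⟩)).symm
    · set ε : ℕ → ℝ := fun t => |((a ⬝ᵥ a - b ⬝ᵥ b + 2 * ((a - b) ⬝ᵥ ((t : ℤ) • c)) : ℤ) : ℝ)|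
        with hε
      have hεt : Tendsto ε atTop atTop := by
        refine tendsto_atTop_mono (fun t : ℕ => ?_) (tendsto_atTop_add_const_right _
          (-|((a ⬝ᵥ a - b ⬝ᵥ b : ℤ) : ℝ)|) (tendsto_natCast_atTop_atTop (R := ℝ)))
        have h1 : (1 : ℝ) ≤ |(((a - b) ⬝ᵥ c : ℤ) : ℝ)| := by exact_mod_cast Int.one_le_abs horth
        have h2 : ((a ⬝ᵥ a - b ⬝ᵥ b + 2 * ((a - b) ⬝ᵥ ((t : ℤ) • c)) : ℤ) : ℝ)
            = ((a ⬝ᵥ a - b ⬝ᵥ b : ℤ) : ℝ) + 2 * (t * (((a - b) ⬝ᵥ c : ℤ) : ℝ)) := by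
          rw [dotProduct_smul]; push_cast; simp
        have h3 : (t : ℝ) ≤ |(t : ℝ) * (((a - b) ⬝ᵥ c : ℤ) : ℝ)| := by
          rw [abs_mul, Nat.abs_cast]
          exact le_mul_of_one_le_right (Nat.cast_nonneg t) h1
        have h4 : |2 * ((t : ℝ) * (((a - b) ⬝ᵥ c : ℤ) : ℝ))| ≤ ε t +
            |((a ⬝ᵥ a - b ⬝ᵥ b : ℤ) : ℝ)| := by
          have e : 2 * ((t : ℝ) * (((a - b) ⬝ᵥ c : ℤ) : ℝ)) = ((a ⬝ᵥ a - b ⬝ᵥ b +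
            2 * ((a - b) ⬝ᵥ ((t : ℤ) • c)) : ℤ) : ℝ) - ((a ⬝ᵥ a - b ⬝ᵥ b : ℤ) : ℝ) := by
            rw [h2]; ring
          rw [e]; exact abs_sub _ _
        rw [abs_mul, abs_two] at h4
        have h5 : (0 : ℝ) ≤ t := Nat.cast_nonneg t
        linarith
      have hlim : Tendsto (fun t : ℕ => hs ((g.next c).blk a) ((g.next c).blk b)
          (fun x y => f (x + (t : ℤ) • c) (y + (t : ℤ) • c)) / (ε t - (|θ| + 2 * K)))
          atTop (𝓝 0) :=
        (tendsto_hs fun x _ y _ => hf x y).div_atTop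
          (tendsto_atTop_add_const_right _ _ hεt)
      rw [tendsto_zero_iff_norm_tendsto_zero]
      refine squeeze_zero' (Eventually.of_forall fun t => norm_nonneg _) ?_ hlim
      filter_upwards [hra, hrb, hεt.eventually_gt_atTop (|θ| + 2 * |K|)] with t ha hb ht
      have hKa := le_abs_self K
      have hK0 := abs_nonneg K
      by_cases hact : g.Act (a + (t : ℤ) • c) (b + (t : ℤ) • c)
      · have e : |(((a + (t : ℤ) • c) ⬝ᵥ (a + (t : ℤ) • c) - (b + (t : ℤ) • c) ⬝ᵥ (b + (t : ℤ) • c)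
            : ℤ) : ℝ)| = ε t := by rw [hε, sq_sub_shift]
        have h1 := LB_energy hg (θ := θ) hK hact (by rw [e]; linarith)
        rw [e] at h1
        have h2 := h1.hs_le (by linarith) s
        rw [hs_congr (h.eq_on hg hact), hs_ray hg hc ha hb f] at h2
        refine (norm_le_hs s (hg.self_mem_blk _) (hg.self_mem_blk _)).trans (h2.trans_eq ?_)
        rw [inv_mul_eq_div, sub_sub]
      · rw [h.zero _ _ hact, norm_zero]
        exact div_nonneg (hs_nonneg _ _ _) (by linarith)

lemma hasLim_comm (hg : g.Good) (hc : c ≠ 0) {P P' s s' : Ker d} (hP : HasLim c P P')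
    (hs : HasLim c s s') : HasLim c (g.comm P s) ((g.next c).comm P' s') := by
  intro a b
  have h1 : Tendsto (fun t : ℕ =>
      lprod ((g.next c).blk a) (fun x y => P (x + (t : ℤ) • c) (y + (t : ℤ) • c))
        (fun x y => s (x + (t : ℤ) • c) (y + (t : ℤ) • c)) a b -
      rprod ((g.next c).blk b) (fun x y => s (x + (t : ℤ) • c) (y + (t : ℤ) • c))
        (fun x y => P (x + (t : ℤ) • c) (y + (t : ℤ) • c)) a b) atTop
      (𝓝 ((g.next c).comm P' s' a b)) :=
    (tendsto_finsetSum _ fun e _ => (hP a e).mul (hs e b)).sub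
      (tendsto_finsetSum _ fun e _ => (hs a e).mul (hP e b))
  refine h1.congr' ?_
  filter_upwards [g.eventually_rigid hc a, g.eventually_rigid hc b] with t ha hb
  simp only [comm, lprod, rprod]
  rw [hg.blk_ray hc ha, hg.blk_ray hc hb, Finset.sum_map, Finset.sum_map]
  rfl

lemma hasLim_dRhs (hg : g.Good) (hc : c ≠ 0) {η : ℝ} {P P' f f' s s' : Ker d}
    (hP : HasLim c P P') (hf : HasLim c f f') (hs : HasLim c s s') :
    HasLim c (g.dRhs η P f s) ((g.next c).dRhs η P' f' s') := fun a b =>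
  ((hf a b).sub ((hs a b).const_mul (η : ℂ))).sub (hasLim_comm hg hc hP hs a b)

lemma OpBlk.next (hg : g.Good) (hc : c ≠ 0) {K : ℝ}
    (hQ : HasLim c Q Q') (h : g.OpBlk Q K) : (g.next c).OpBlk Q' K := by
  have key : ∀ (A : Finset (Lat d)) (Q Q' : Ker d) (_ : HasLim c Q Q'),
      (∀ᶠ t : ℕ in atTop, OpOn (A.map (addRightEmbedding ((t : ℤ) • c))) Q K) → OpOn A Q' K := by
    intro A Q Q' hQ hev
    refine ⟨hev.exists.choose_spec.1, fun ξ => ?_⟩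
    refine le_of_tendsto (tendsto_finsetSum A fun a _ => ((tendsto_finsetSum A fun e _ =>
      (hQ a e).mul_const (ξ e)).norm).pow 2) (hev.mono fun t ht => ?_)
    have := ht.2 fun e => ξ (e - (t : ℤ) • c)
    simpa [Finset.sum_map] using this
  intro a _
  constructor
  · refine key _ Q Q' hQ ?_
    filter_upwards [g.eventually_rigid hc a] with t ht
    rw [← hg.blk_ray hc ht]
    exact (h _ (hg.hL _ ht.2)).1
  · refine key _ (tr Q) (tr Q') (fun a b => hQ b a) ?_
    filter_upwards [g.eventually_rigid hc a] with t ht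
    rw [← hg.blk_ray hc ht]
    exact (h _ (hg.hL _ ht.2)).2

lemma IsSol.hs_sub_le (hg : g.Good) (hc : c ≠ 0) {θ κ ε : ℝ}
    (hκ : 0 < κ) (hLB : g.LBall θ Q κ)
    (h : g.IsSol θ Q f s) (h' : (g.next c).IsSol θ Q' f' s') (hab : g.Act a b)
    (horth : (a - b) ⬝ᵥ c = 0) (ha : g.Rigid c a ∧ g.ρ ≤ len a) (hb : g.Rigid c b ∧ g.ρ ≤ len b)
    (h₁ : OpOn (g.blk a) (Q - Q') ε) (h₂ : OpOn (g.blk b) (tr (Q - Q')) ε) :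
    hs (g.blk a) (g.blk b) (s - s') ≤
      κ⁻¹ * (hs (g.blk a) (g.blk b) (f - f') + 2 * ε * hs (g.blk a) (g.blk b) s') := by
  have hab' : (g.next c).Act a b := (hg.act_next_iff ha.1 ha.2 hb.1 hb.2).2 ⟨hab, horth⟩
  have e1 := h.eq_on hg hab
  have e2 := h'.eq_on (hg.next hc) hab'
  rw [hg.blk_next hc ha.1 ha.2, hg.blk_next hc hb.1 hb.2] at e2
  refine ((hLB a b hab).hs_le hκ (s - s')).trans ?_
  have e3 : hs (g.blk a) (g.blk b) (sylv (g.blk a) (g.blk b) (energy θ) Q (-Q) (s - s'))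
      = hs (g.blk a) (g.blk b) (f - f' - lprod (g.blk a) (Q - Q') s' +
        rprod (g.blk b) s' (Q - Q')) := by
    refine hs_congr fun x hx y hy => ?_
    rw [sylv_sub, Pi.sub_apply, Pi.sub_apply, e1 x hx y hy, Pi.add_apply, Pi.add_apply,
      Pi.sub_apply, Pi.sub_apply, Pi.sub_apply, Pi.sub_apply, ← e2 x hx y hy]
    simp only [sylv, lprod, rprod, Pi.sub_apply, Pi.neg_apply, sub_mul, mul_sub,
      Finset.sum_sub_distrib, mul_neg, Finset.sum_neg_distrib]
    ring
  rw [e3]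
  gcongr
  have h3 := hs_lprod_le (g.blk b) h₁ s'
  have h4 := hs_rprod_le (g.blk a) h₂ s'
  have h5 := hs_add_le (g.blk a) (g.blk b) (f - f' - lprod (g.blk a) (Q - Q') s')
    (rprod (g.blk b) s' (Q - Q'))
  have h6 := ToplitzLipschitz.hs_sub_le (g.blk a) (g.blk b) (f - f') (lprod (g.blk a) (Q - Q') s')
  linarith

end Lev

end Commutator

/-! ### Lipschitz estimates for the commutator equation -/

section Lipschitz

variable {d : ℕ} {S t : ℝ} {c a b a' : Lat d} {Q Q' f f' s s' : Ker d}

/-- The weight `max (|a| / |c|, |b| / |c|) + 1` of the Lipschitz norms. -/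
def wt (c a b : Lat d) : ℝ := max (len a / len c) (len b / len c) + 1

lemma one_le_wt (c a b : Lat d) : 1 ≤ wt c a b := by
  have : 0 ≤ max (len a / len c) (len b / len c) :=
    le_max_of_le_left (div_nonneg (len_nonneg _) (len_nonneg _))
  unfold wt; linarith

lemma wt_pos (c a b : Lat d) : 0 < wt c a b := one_pos.trans_le (one_le_wt c a b)

namespace Lev

variable {g : Lev d}

/-- The decomposition of one point of the Lipschitz domain. -/
structure OnRay (S : ℝ) (c a a' : Lat d) (t : ℝ) : Prop where
  pos : 0 ≤ t
  eq : toE a = toE a' + t • toE c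
  le : S * (len a' + len c) * len c ≤ len a
  large : 2 * S ^ 2 ≤ len a / len c

lemma OnRay.t_ge (h : OnRay S c a a' t) (hc : c ≠ 0) (hS : 2 ≤ S) :
    len a / len c / 2 ≤ t ∧ S / 2 * (len a' + len c) ≤ t := by
  have hc1 := one_le_len hc
  have h0 := len_nonneg a'
  have h1 := h.le
  have h3 : len a ≤ len a' + t * len c := by
    have : len a = ‖toE a' + t • toE c‖ := by rw [← h.eq]; rfl
    rw [this]
    refine (norm_add_le _ _).trans ?_
    rw [norm_smul, Real.norm_of_nonneg h.pos]; exact le_rfl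
  have h4 : 2 * (len a' + len c) ≤ S * (len a' + len c) * len c := by
    have : 2 * (len a' + len c) ≤ S * (len a' + len c) := by gcongr
    nlinarith [mul_nonneg (by linarith : (0 : ℝ) ≤ S) (by linarith : 0 ≤ len a' + len c)]
  have h5 : len a ≤ t * 2 * len c := by nlinarith
  constructor
  · rw [div_div, div_le_iff₀ (by linarith)]; linarith
  · have h6 : S / 2 * (len a' + len c) * len c ≤ t * len c := by linarith
    exact le_of_mul_le_mul_right h6 (by linarith)

lemma OnRay.rigid (h : OnRay S c a a' t) (hc : c ≠ 0)
    (hg : g.Good) (hS : 32 * (g.Δ' + 2 * g.D + 1) ^ 2 ≤ S) (hρ : g.ρ ≤ S) :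
    g.Rigid c a ∧ g.ρ ≤ len a := by
  have hc1 := one_le_len hc
  have h0 := len_nonneg a'
  have hD := hg.hD
  have hΔ := hg.hΔ'
  have hS2 : 2 ≤ S := by nlinarith
  constructor
  · refine rigid_of_large h.eq ?_
    have h1 := (h.t_ge hc hS2).2
    have h2 : 16 * (g.Δ' + 2 * g.D + 1) ^ 2 * (len a' + 1) ≤ S / 2 * (len a' + len c) := by
      gcongr
      linarith
    have h3 : g.D ^ 2 + g.D ≤ (g.Δ' + 2 * g.D + 1) ^ 2 := by nlinarith
    nlinarith
  · have h1 := h.large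
    have h2 : len a / len c ≤ len a := div_le_self (len_nonneg a) hc1
    nlinarith

lemma OnRay.near {S t D : ℝ} {c a a' x : Lat d} (h : OnRay (S + D + 2) c a a' t) (hc : c ≠ 0)
    (hS : 0 ≤ S) (hD : 0 ≤ D) (hx : len x = len a) (hxa : len (a - x) ≤ D) :
    OnRay S c x (a' + (x - a)) t := by
  have hc1 := one_le_len hc
  refine ⟨h.pos, ?_, ?_, ?_⟩
  · rw [toE_add, toE_sub, h.eq]; abel
  · have h1 : len (a' + (x - a)) ≤ len a' + D := by
      rw [len_sub_comm] at hxa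
      linarith [len_add_le a' (x - a)]
    have h2 := h.le
    have h3 := h.large
    rw [le_div_iff₀ (by linarith)] at h3
    have h4 := len_nonneg a'
    rw [hx]
    have h5 : S * (len (a' + (x - a)) + len c) * len c ≤ S * (len a' + D + len c) * len c := by
      gcongr
    refine h5.trans ?_
    have h6 : (S + D + 2) * (S * (len a' + D + len c) * len c) ≤ (S + D + 2) * len a := by
      have e1 : (S + D + 2) * (S * (len a' + D + len c) * len c)
        = S * ((S + D + 2) * (len a' + len c) * len c) + (S + D + 2) * S * D * len c := by ring
      have e2 : S * ((S + D + 2) * (len a' + len c) * len c) ≤ S * len a := by gcongr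
      have e3 : (D + 2) * (2 * (S + D + 2) ^ 2 * len c) ≤ (D + 2) * len a := by gcongr
      have e4 : (S + D + 2) * S * D * len c ≤ (D + 2) * (2 * (S + D + 2) ^ 2 * len c) := by
        have : (S + D + 2) * S * D ≤ (D + 2) * (2 * (S + D + 2) ^ 2) := by
          have q1 : S * D ≤ (S + D + 2) * (D + 2) := by nlinarith [mul_nonneg hS hD]
          have q2 : 0 ≤ S + D + 2 := by linarith
          nlinarith [mul_le_mul_of_nonneg_left q1 q2, mul_nonneg (mul_nonneg q2 q2) (by linarith : 0 ≤ D + 2)]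
        nlinarith
      linarith
    exact le_of_mul_le_mul_left h6 (by linarith)
  · rw [hx]
    refine le_trans ?_ h.large
    gcongr
    linarith

lemma lipDomPos_iff :
    LipDomPos S c a b ↔ ∃ a' b' t, OnRay S c a a' t ∧ OnRay S c b b' t :=
  ⟨fun ⟨⟨a', b', t, h1, h2, h3, h4, h5⟩, h6, h7⟩ => ⟨a', b', t, ⟨h1, h2, h3, h6⟩, h1, h4, h5, h7⟩,
    fun ⟨a', b', t, h, h'⟩ => ⟨⟨a', b', t, h.pos, h.eq, h.le, h'.eq, h'.le⟩, h.large, h'.large⟩⟩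

lemma wt_congr {c a b x y : Lat d} (hx : len x = len a) (hy : len y = len b) :
    wt c x y = wt c a b := by unfold wt; rw [hx, hy]

lemma energy_large (hg : g.Good) (h : LipDomPos S c a b) (hc : c ≠ 0)
    (hS : 32 * (g.Δ' + 2 * g.D + 1) ^ 2 ≤ S) (hab : len (a - b) ≤ g.Δ' + 2 * g.D)
    (horth : (a - b) ⬝ᵥ c ≠ 0) :
    wt c a b / 8 ≤ |((a ⬝ᵥ a - b ⬝ᵥ b : ℤ) : ℝ)| ∧ S ^ 2 / 2 ≤ |((a ⬝ᵥ a - b ⬝ᵥ b : ℤ) : ℝ)| := by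
  obtain ⟨a', b', t, ha, hb⟩ := lipDomPos_iff.1 h
  have hD := hg.hD
  have hΔ := hg.hΔ'
  have hc1 := one_le_len hc
  have hS2 : 2 ≤ S := by nlinarith
  have key : ∀ {a a' b : Lat d} (_ : OnRay S c a a' t), len (a - b) ≤ g.Δ' + 2 * g.D →
      (a - b) ⬝ᵥ c ≠ 0 → len a / len c / 4 ≤ |((a ⬝ᵥ a - b ⬝ᵥ b : ℤ) : ℝ)| := by
    intro a a' b ha hab horth
    have h1 := ha.t_ge hc hS2
    have h0 := len_nonneg a'
    by_contra hlt
    push Not at hlt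
    refine horth ?_
    rw [← neg_sub, neg_dotProduct, neg_eq_zero]
    rw [len_sub_comm] at hab
    refine orth_of_large ha.eq hab (h := len a / len c / 4) ?_ ?_
    · rw [add_sub_cancel]
      have : ((b ⬝ᵥ b - a ⬝ᵥ a : ℤ) : ℝ) = -((a ⬝ᵥ a - b ⬝ᵥ b : ℤ) : ℝ) := by push_cast; ring
      rw [this, abs_neg]; exact hlt.le
    · have h2 : 16 * (g.Δ' + 2 * g.D + 1) ^ 2 * (len a' + 1) ≤ S / 2 * (len a' + len c) := by
        gcongr
        linarith
      have h3 : (g.Δ' + 2 * g.D) ^ 2 + (g.Δ' + 2 * g.D) ≤ (g.Δ' + 2 * g.D + 1) ^ 2 := by nlinarith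
      have h4 : len a' * (g.Δ' + 2 * g.D) ≤ len a' * (g.Δ' + 2 * g.D + 1) ^ 2 := by
        gcongr; nlinarith
      nlinarith
  have k1 := key ha hab horth
  have k2 := key (a := b) (b := a) hb (by rwa [len_sub_comm]) (by
    rw [← neg_sub, neg_dotProduct, Ne, neg_eq_zero]; exact horth)
  have e : |((b ⬝ᵥ b - a ⬝ᵥ a : ℤ) : ℝ)| = |((a ⬝ᵥ a - b ⬝ᵥ b : ℤ) : ℝ)| := by
    rw [← abs_neg]; congr 1; push_cast; ring
  rw [e] at k2
  have k3 := ha.large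
  constructor
  · have : max (len a / len c) (len b / len c) ≤ 4 * |((a ⬝ᵥ a - b ⬝ᵥ b : ℤ) : ℝ)| :=
      max_le (by linarith) (by linarith)
    unfold wt
    nlinarith
  · linarith

variable (g)

/-- Decay of the Hilbert–Schmidt norms of the blocks of `f`. -/
def Bd (γ M : ℝ) (f : Ker d) : Prop :=
  ∀ a b, g.Act a b → hs (g.blk a) (g.blk b) f ≤ M * Real.exp (-γ * len (a - b))

/-- Lipschitz bounds for the blocks of `f`, with limit `f'` in the direction `c`. -/
def LipBd (γ S M : ℝ) (c : Lat d) (f f' : Ker d) : Prop :=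
  ∀ a b, g.Act a b → LipDomPos S c a b → (a - b) ⬝ᵥ c = 0 →
    wt c a b * hs (g.blk a) (g.blk b) (f - f') ≤ M * Real.exp (-γ * len (a - b))

/-- Lipschitz bounds for the operator norms of the diagonal blocks of `Q`. -/
def LipOp (S E : ℝ) (c : Lat d) (Q Q' : Ker d) : Prop :=
  ∀ a b, g.Act a b → LipDomPos S c a b →
    OpOn (g.blk a) (Q - Q') (E / wt c a b) ∧ OpOn (g.blk b) (tr (Q - Q')) (E / wt c a b)

variable {g}

lemma Bd.sol (hg : g.Good) {θ κ γ M : ℝ} (hκ : 0 < κ) (hLB : g.LBall θ Q κ)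
    (h : g.IsSol θ Q f s) (hf : g.Bd γ M f) : g.Bd γ (κ⁻¹ * M) s := by
  intro a b hab
  refine (h.hs_le hg hκ hLB hab).trans ?_
  rw [mul_assoc]
  have := hf a b hab
  gcongr

lemma hs_comm_eq (hg : g.Good) (P s : Ker d) (a b : Lat d) :
    hs (g.blk a) (g.blk b) (g.comm P s)
      = hs (g.blk a) (g.blk b) (lprod (g.blk a) P s - rprod (g.blk b) s P) := by
  refine hs_congr fun x hx y hy => ?_
  rw [hg.mem_blk] at hx hy
  rw [comm, hg.blk_eq hx, hg.blk_eq hy]; rfl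

lemma Bd.comm (hg : g.Good) {K γ M : ℝ} {P s : Ker d} (hP : g.OpBlk P K) (hs : g.Bd γ M s) :
    g.Bd γ (2 * K * M) (g.comm P s) := by
  intro a b hab
  rw [hs_comm_eq hg]
  have h1 := hs_lprod_le (g.blk b) (hP a hab.1).1 s
  have h2 := hs_rprod_le (g.blk a) (hP b hab.2.1).2 s
  have h3 := hs_sub_le (g.blk a) (g.blk b) (lprod (g.blk a) P s) (rprod (g.blk b) s P)
  have h4 := mul_le_mul_of_nonneg_left (hs a b hab) (hP a hab.1).1.1
  linarith

lemma Bd.dRhs (hg : g.Good) {K γ M Ms η N : ℝ} {P f s : Ker d} (hP : g.OpBlk P K)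
    (hf : g.Bd γ M f) (hsb : g.Bd γ Ms s) (hη : |η| ≤ N) :
    g.Bd γ (M + (N + 2 * K) * Ms) (g.dRhs η P f s) := by
  intro a b hab
  have h1 := hf a b hab
  have h2 := hsb a b hab
  have h3 := hsb.comm hg hP a b hab
  have h4 := hs_sub_le (g.blk a) (g.blk b) (f - (η : ℂ) • s) (g.comm P s)
  have h5 := hs_sub_le (g.blk a) (g.blk b) f ((η : ℂ) • s)
  rw [hs_smul, Complex.norm_real, Real.norm_eq_abs] at h5
  have h6 : |η| * hs (g.blk a) (g.blk b) s ≤ N * (Ms * Real.exp (-γ * len (a - b))) :=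
    mul_le_mul hη h2 (hs_nonneg _ _ _) ((abs_nonneg _).trans hη)
  unfold Lev.dRhs
  linarith

/-- The standing assumptions on the Lipschitz radius `S`. -/
structure Radius (g : Lev d) (S : ℝ) : Prop where
  big : 32 * (g.Δ' + 2 * g.D + 1) ^ 2 ≤ S
  rho : g.ρ ≤ S

lemma Radius.next (hS : g.Radius S) (c : Lat d) : (g.next c).Radius S := ⟨hS.big, hS.rho⟩

lemma Radius.rigid (hg : g.Good) (hS : g.Radius S) (hc : c ≠ 0)
    (h : LipDomPos S c a b) : (g.Rigid c a ∧ g.ρ ≤ len a) ∧ (g.Rigid c b ∧ g.ρ ≤ len b) := by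
  obtain ⟨a', b', t, ha, hb⟩ := lipDomPos_iff.1 h
  exact ⟨ha.rigid hc hg hS.big hS.rho, hb.rigid hc hg hS.big hS.rho⟩

lemma LipBd.sol (hg : g.Good) (hc : c ≠ 0) {θ κ γ S E M M' : ℝ}
    (hκ : 0 < κ) (hS : g.Radius S)
    (hLB : g.LBall θ Q κ) (h : g.IsSol θ Q f s) (h' : (g.next c).IsSol θ Q' f' s')
    (hQ : g.LipOp S E c Q Q') (hf : g.LipBd γ S M c f f') (hs' : (g.next c).Bd γ M' s') (hE : 0 ≤ E) :
    g.LipBd γ S (κ⁻¹ * (M + 2 * E * M')) c s s' := by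
  intro a b hab hdom horth
  obtain ⟨ha, hb⟩ := hS.rigid hg hc hdom
  have hab' : (g.next c).Act a b := (hg.act_next_iff ha.1 ha.2 hb.1 hb.2).2 ⟨hab, horth⟩
  obtain ⟨q1, q2⟩ := hQ a b hab hdom
  have h1 := h.hs_sub_le hg hc hκ hLB h' hab horth ha hb q1 q2
  have h2 := hf a b hab hdom horth
  have h3 := hs' a b hab'
  rw [hg.blk_next hc ha.1 ha.2, hg.blk_next hc hb.1 hb.2] at h3
  have hw : 0 < wt c a b := wt_pos c a b
  have hκ' : 0 < κ⁻¹ := inv_pos.2 hκ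
  calc wt c a b * hs (g.blk a) (g.blk b) (s - s')
      ≤ wt c a b * (κ⁻¹ * (hs (g.blk a) (g.blk b) (f - f') +
          2 * (E / wt c a b) * hs (g.blk a) (g.blk b) s')) := by gcongr
    _ = κ⁻¹ * (wt c a b * hs (g.blk a) (g.blk b) (f - f') +
          2 * E * hs (g.blk a) (g.blk b) s') := by field_simp
    _ ≤ κ⁻¹ * (M * Real.exp (-γ * len (a - b)) + 2 * E * (M' * Real.exp (-γ * len (a - b)))) := by
        gcongr
    _ = _ := by ring

lemma LipBd.comm (hg : g.Good) (hc : c ≠ 0) {γ S E K M M' : ℝ} {P P' s s' : Ker d}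
    (hS : g.Radius S) (hP : g.OpBlk P K) (hPE : g.LipOp S E c P P')
    (hs : g.LipBd γ S M c s s') (hs' : (g.next c).Bd γ M' s') (hE : 0 ≤ E) :
    g.LipBd γ S (2 * K * M + 2 * E * M') c (g.comm P s) ((g.next c).comm P' s') := by
  intro a b hab hdom horth
  obtain ⟨ha, hb⟩ := hS.rigid hg hc hdom
  have hab' : (g.next c).Act a b := (hg.act_next_iff ha.1 ha.2 hb.1 hb.2).2 ⟨hab, horth⟩
  obtain ⟨q1, q2⟩ := hPE a b hab hdom
  have h2 := hs a b hab hdom horth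
  have h3 := hs' a b hab'
  rw [hg.blk_next hc ha.1 ha.2, hg.blk_next hc hb.1 hb.2] at h3
  have hw : 0 < wt c a b := wt_pos c a b
  set A := g.blk a
  set B := g.blk b
  have e : ToplitzLipschitz.hs A B (g.comm P s - (g.next c).comm P' s')
      = ToplitzLipschitz.hs A B ((lprod A P (s - s') - rprod B (s - s') P) +
        (lprod A (P - P') s' - rprod B s' (P - P'))) := by
    refine hs_congr fun x hx y hy => ?_
    have hx' := (hg.mem_blk).1 hx
    have hy' := (hg.mem_blk).1 hy
    have hxn := hg.rel_next ha.1 hx'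
    have hyn := hg.rel_next hb.1 hy'
    simp only [Lev.comm, Pi.sub_apply, Pi.add_apply]
    rw [hg.blk_eq hx', hg.blk_eq hy', (hg.next hc).blk_eq hxn, (hg.next hc).blk_eq hyn,
      hg.blk_next hc ha.1 ha.2, hg.blk_next hc hb.1 hb.2]
    simp only [lprod, rprod, Pi.sub_apply, sub_mul, mul_sub, Finset.sum_sub_distrib]
    ring
  rw [e]
  have k0 := hs_add_le A B (lprod A P (s - s') - rprod B (s - s') P)
    (lprod A (P - P') s' - rprod B s' (P - P'))
  have k1 := hs_sub_le A B (lprod A P (s - s')) (rprod B (s - s') P)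
  have k2 := hs_sub_le A B (lprod A (P - P') s') (rprod B s' (P - P'))
  have k3 := hs_lprod_le B (hP a hab.1).1 (s - s')
  have k4 := hs_rprod_le A (hP b hab.2.1).2 (s - s')
  have k5 := hs_lprod_le B q1 s'
  have k6 := hs_rprod_le A q2 s'
  have hK := (hP a hab.1).1.1
  calc wt c a b * _ ≤ wt c a b * (2 * K * ToplitzLipschitz.hs A B (s - s') +
          2 * (E / wt c a b) * ToplitzLipschitz.hs A B s') := by
        refine mul_le_mul_of_nonneg_left ?_ hw.le
        linarith
    _ = 2 * K * (wt c a b * ToplitzLipschitz.hs A B (s - s')) +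
          2 * E * ToplitzLipschitz.hs A B s' := by field_simp
    _ ≤ 2 * K * (M * Real.exp (-γ * len (a - b))) +
          2 * E * (M' * Real.exp (-γ * len (a - b))) := by gcongr
    _ = _ := by ring

lemma LipBd.dRhs (hg : g.Good) (hc : c ≠ 0) {γ S E K M Ms M' η N : ℝ}
    {P P' f f' s s' : Ker d} (hS : g.Radius S) (hP : g.OpBlk P K) (hPE : g.LipOp S E c P P')
    (hf : g.LipBd γ S M c f f') (hs : g.LipBd γ S Ms c s s') (hs' : (g.next c).Bd γ M' s')
    (hE : 0 ≤ E) (hη : |η| ≤ N) :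
    g.LipBd γ S (M + (N + 2 * K) * Ms + 2 * E * M') c (g.dRhs η P f s)
      ((g.next c).dRhs η P' f' s') := by
  intro a b hab hdom horth
  have h1 := hf a b hab hdom horth
  have h2 := hs a b hab hdom horth
  have h3 := hs.comm hg hc hS hP hPE hs' hE a b hab hdom horth
  have hw : 0 < wt c a b := wt_pos c a b
  have e : g.dRhs η P f s - (g.next c).dRhs η P' f' s'
      = (f - f') - (η : ℂ) • (s - s') - (g.comm P s - (g.next c).comm P' s') := by
    unfold Lev.dRhs; rw [smul_sub]; abel
  rw [e]
  have h4 := hs_sub_le (g.blk a) (g.blk b) ((f - f') - (η : ℂ) • (s - s'))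
    (g.comm P s - (g.next c).comm P' s')
  have h5 := hs_sub_le (g.blk a) (g.blk b) (f - f') ((η : ℂ) • (s - s'))
  rw [hs_smul, Complex.norm_real, Real.norm_eq_abs] at h5
  have h6 : |η| * (wt c a b * ToplitzLipschitz.hs (g.blk a) (g.blk b) (s - s'))
      ≤ N * (Ms * Real.exp (-γ * len (a - b))) :=
    mul_le_mul hη h2 (mul_nonneg hw.le (hs_nonneg _ _ _)) ((abs_nonneg _).trans hη)
  have h7 := mul_le_mul_of_nonneg_left h4 hw.le
  have h8 := mul_le_mul_of_nonneg_left h5 hw.le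
  linarith

lemma IsSol.lip (hg : g.Good) (hc : c ≠ 0) {θ K γ S M Mf : ℝ}
    (hS : g.Radius S) (hK : g.OpBlk Q K) (hθ : |θ| + 2 * K ≤ S) (h : g.IsSol θ Q f s)
    (h' : (g.next c).IsSol θ Q' f' s') (hf : g.Bd γ Mf f) (hs : g.LipBd γ S M c s s')
    (hM : 16 * Mf ≤ M) (hM0 : 0 ≤ M) (a b : Lat d) (hdom : LipDomPos S c a b) :
    wt c a b * ‖s a b - s' a b‖ ≤ M * Real.exp (-γ * len (a - b)) := by
  obtain ⟨ha, hb⟩ := hS.rigid hg hc hdom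
  have hw : 0 < wt c a b := wt_pos c a b
  have hM1 : 0 ≤ M * Real.exp (-γ * len (a - b)) := by positivity
  by_cases hab : g.Act a b
  · by_cases horth : (a - b) ⬝ᵥ c = 0
    · refine le_trans ?_ (hs a b hab hdom horth)
      exact mul_le_mul_of_nonneg_left (norm_le_hs (s - s') (hg.self_mem_blk a) (hg.self_mem_blk b))
        hw.le
    · have h1 : s' a b = 0 := h'.zero a b fun hact =>
        horth ((hg.act_next_iff ha.1 ha.2 hb.1 hb.2).1 hact).2
      obtain ⟨e1, e2⟩ := energy_large hg hdom hc hS.big (hg.act_len hab) horth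
      have hK0 := (hK a hab.1).1.1
      have hS32 : 32 ≤ S := by
        have h1 := hg.hD
        have h2 := hg.hΔ'
        have h3 := hS.big
        nlinarith
      have h2 := (LB_energy (θ := θ) hg hK hab (by nlinarith)).mono
        (κ' := wt c a b / 16) (by nlinarith)
      have h3 := h2.hs_le (by positivity) s
      rw [hs_congr (h.eq_on hg hab)] at h3
      rw [h1, sub_zero]
      have h4 := norm_le_hs s (hg.self_mem_blk a) (hg.self_mem_blk b)
      calc wt c a b * ‖s a b‖ ≤ wt c a b * ((wt c a b / 16)⁻¹ *
            ToplitzLipschitz.hs (g.blk a) (g.blk b) f) := by gcongr; exact h4.trans h3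
        _ = 16 * ToplitzLipschitz.hs (g.blk a) (g.blk b) f := by field_simp
        _ ≤ 16 * (Mf * Real.exp (-γ * len (a - b))) := by
          have := hf a b hab
          gcongr
        _ = 16 * Mf * Real.exp (-γ * len (a - b)) := by ring
        _ ≤ _ := by gcongr
  · rw [h.zero a b hab, h'.zero a b fun hact =>
      hab ((hg.act_next_iff ha.1 ha.2 hb.1 hb.2).1 hact).1, sub_zero, norm_zero, mul_zero]
    exact hM1

end Lev
end Lipschitz

/-! ### Measure of the set of resonant parameters -/

section Slab

variable {n : ℕ}

/-- The volume of a ball of radius `3 C₁`. -/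
abbrev ballVol (n : ℕ) (C₁ : ℝ) : ℝ≥0∞ := volume (Metric.closedBall (0 : Par n) (3 * C₁))

/-- A bounded set whose extent in the direction `v` is at most `2 τ / μ` has small volume: many of
its translates are disjoint. -/
lemma volume_slab_le {E : Set (Par n)} {C₁ τ μ K : ℝ} {v : Par n} (hC₁ : 1 ≤ C₁)
    (hE : E ⊆ Metric.closedBall 0 C₁) (hv : ‖v‖ = 1) (hτ : 0 < τ) (hμ : 0 < μ)
    (h : ∀ x ∈ E, ∀ y ∈ E, ∀ (s : ℝ) (w : Par n), 0 ≤ s → y - x = s • v + w →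
      μ * s ≤ 2 * τ + K * ‖w‖) :
    volume E ≤ ballVol n C₁ * ENNReal.ofReal (4 * τ / μ) := by
  set F := closure E with hF
  have hFE : E ⊆ F := subset_closure
  have hFb : F ⊆ Metric.closedBall 0 C₁ := closure_minimal hE Metric.isClosed_closedBall
  set δ : ℝ := 4 * τ / μ with hδ
  have hδ0 : 0 < δ := by positivity
  have hmono : volume E ≤ volume F := measure_mono hFE
  have hball : Metric.closedBall (0 : Par n) C₁ ⊆ Metric.closedBall 0 (3 * C₁) :=
    Metric.closedBall_subset_closedBall (by linarith)
  rcases le_or_gt 1 δ with h1 | h1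
  · calc volume E ≤ ballVol n C₁ * 1 := by
          rw [mul_one]; exact measure_mono (hE.trans hball)
      _ ≤ _ := by gcongr; exact ENNReal.one_le_ofReal.2 h1
  have hlim : ∀ x ∈ F, ∀ y ∈ F, ∀ s : ℝ, 0 ≤ s → y - x = s • v → μ * s ≤ 2 * τ := by
    intro x hx y hy s hs hxy
    obtain ⟨xs, hxs, hxl⟩ := mem_closure_iff_seq_limit.1 hx
    obtain ⟨ys, hys, hyl⟩ := mem_closure_iff_seq_limit.1 hy
    have hw : Tendsto (fun j => 2 * τ + K * ‖ys j - xs j - s • v‖) atTop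
        (𝓝 (2 * τ + K * ‖y - x - s • v‖)) :=
      tendsto_const_nhds.add (((hyl.sub hxl).sub_const _).norm.const_mul K)
    rw [hxy, sub_self, norm_zero, mul_zero, add_zero] at hw
    exact ge_of_tendsto' hw fun j => h _ (hxs j) _ (hys j) s _ hs (by abel)
  set m : ℕ := ⌈1 / δ⌉₊ with hm
  have hm1 : 1 / δ ≤ m := Nat.le_ceil _
  have hm2 : (m : ℝ) < 1 / δ + 1 := Nat.ceil_lt_add_one (by positivity)
  set G : ℕ → Set (Par n) := fun i => (fun z => z + (-(i * δ : ℝ)) • v) ⁻¹' F with hG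
  have hGvol : ∀ i, volume (G i) = volume F := fun i => measure_preimage_add_right _ _ _
  have hGmeas : ∀ i, MeasurableSet (G i) := fun i =>
    (isClosed_closure.preimage (by fun_prop)).measurableSet
  have hdisj : ∀ i j : ℕ, i < j → Disjoint (G i) (G j) := by
    intro i j hij
    rw [Set.disjoint_left]
    intro z hi hj
    have hij' : (i : ℝ) + 1 ≤ j := by exact_mod_cast hij
    have := hlim _ hj _ hi (((j : ℝ) - i) * δ) (by nlinarith) (by module)
    have e : μ * δ = 4 * τ := by rw [hδ]; field_simp
    nlinarith
  have hsub : (⋃ i ∈ Finset.range m, G i) ⊆ Metric.closedBall 0 (3 * C₁) := by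
    refine Set.iUnion₂_subset fun i hi z hz => ?_
    have h2 := hFb hz
    rw [mem_closedBall_zero_iff] at h2 ⊢
    have hi' : (i : ℝ) + 1 ≤ m := by exact_mod_cast Finset.mem_range.1 hi
    have h3 : ‖z‖ ≤ ‖z + (-(i * δ : ℝ)) • v‖ + ‖((i * δ : ℝ)) • v‖ := by
      have : z = (z + (-(i * δ : ℝ)) • v) + ((i * δ : ℝ)) • v := by module
      conv_lhs => rw [this]
      exact norm_add_le _ _
    rw [norm_smul, hv, mul_one, Real.norm_of_nonneg (by positivity)] at h3
    have h4 : (i : ℝ) * δ ≤ 1 := by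
      have : (i : ℝ) * δ ≤ (1 / δ) * δ := by gcongr; linarith
      rwa [one_div, inv_mul_cancel₀ hδ0.ne'] at this
    linarith
  have hsum : (m : ℝ≥0∞) * volume F ≤ ballVol n C₁ := by
    have h2 := measure_biUnion_finset (μ := (volume : Measure (Par n))) (s := Finset.range m) (f := G)
      (fun i _ j _ hij => by
        rcases lt_or_gt_of_ne hij with h | h
        · exact hdisj i j h
        · exact (hdisj j i h).symm) (fun i _ => hGmeas i)
    simp only [hGvol, Finset.sum_const, Finset.card_range, nsmul_eq_mul] at h2
    rw [← h2]
    exact measure_mono hsub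
  have hδm : 1 ≤ ENNReal.ofReal δ * m := by
    rw [← ENNReal.ofReal_natCast, ← ENNReal.ofReal_mul hδ0.le, ENNReal.one_le_ofReal]
    rwa [div_le_iff₀' hδ0] at hm1
  calc volume E ≤ 1 * volume F := by rw [one_mul]; exact hmono
    _ ≤ (ENNReal.ofReal δ * m) * volume F := by gcongr
    _ = (m * volume F) * ENNReal.ofReal δ := by ring
    _ ≤ _ := by gcongr

open Module in
/-- An eigenvalue close to zero of a symmetric operator that is not bounded below. -/
lemma exists_small_eigenvalue {V : Type*} [NormedAddCommGroup V] [InnerProductSpace ℂ V]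
    [FiniteDimensional ℂ V] {T : V →ₗ[ℂ] V} (hT : T.IsSymmetric) {τ : ℝ} (hτ : 0 < τ)
    (h : ¬ ∀ ξ, τ * ‖ξ‖ ≤ ‖T ξ‖) :
    ∃ (lam : ℝ) (u : V), u ≠ 0 ∧ |lam| < τ ∧ T u = (lam : ℂ) • u := by
  by_contra hne
  push Not at hne
  refine h fun ξ => ?_
  set b := hT.eigenvectorBasis rfl with hb
  have hlam : ∀ i, τ ≤ |hT.eigenvalues rfl i| := fun i => by
    by_contra hlt
    push Not at hlt
    refine hne _ (b i) (b.orthonormal.ne_zero i) hlt ?_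
    rw [hb]
    exact hT.apply_eigenvectorBasis rfl i
  have h1 : ∀ i, b.repr (T ξ) i = hT.eigenvalues rfl i * b.repr ξ i := fun i =>
    hT.eigenvectorBasis_apply_self_apply rfl ξ i
  have h2 : (τ * ‖ξ‖) ^ 2 ≤ ‖T ξ‖ ^ 2 := by
    rw [mul_pow, ← b.repr.norm_map ξ, ← b.repr.norm_map (T ξ), EuclideanSpace.norm_sq_eq,
      EuclideanSpace.norm_sq_eq, Finset.mul_sum]
    refine Finset.sum_le_sum fun i _ => ?_
    rw [h1, norm_mul, mul_pow, Complex.norm_real, Real.norm_eq_abs]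
    have := hlam i
    gcongr
  exact (sq_le_sq₀ (by positivity) (norm_nonneg _)).1 h2

open Module in
/-- The set of parameters where a monotone family of symmetric operators is not bounded below has
small volume. -/
lemma volume_bad_le {V : Type*} [NormedAddCommGroup V] [InnerProductSpace ℂ V]
    [FiniteDimensional ℂ V] {U : Set (Par n)} {C₁ τ μ K : ℝ} {v : Par n} (hC₁ : 1 ≤ C₁)
    (hU : U ⊆ Metric.closedBall 0 C₁) (hv : ‖v‖ = 1) (hτ : 0 < τ) (hμ : 0 < μ)
    (T : Par n → V →ₗ[ℂ] V) (hT : ∀ ω ∈ U, (T ω).IsSymmetric)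
    (hmono : ∀ x ∈ U, ∀ y ∈ U, ∀ (s : ℝ) (w : Par n), 0 ≤ s → y - x = s • v + w → ∀ ξ : V,
      (μ * s - K * ‖w‖) * ‖ξ‖ ^ 2 ≤ (inner ℂ ξ (T y ξ)).re - (inner ℂ ξ (T x ξ)).re) :
    volume {ω ∈ U | ¬ ∀ ξ, τ * ‖ξ‖ ≤ ‖T ω ξ‖} ≤ (finrank ℂ V + 1 : ℕ) *
      (ballVol n C₁ * ENNReal.ofReal (4 * τ / μ)) := by
  classical
  set N := finrank ℂ V
  let P : Par n → ℕ → Prop := fun ω k => ∃ W : Submodule ℂ V, finrank ℂ W = k ∧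
    ∀ ξ ∈ W, ξ ≠ 0 → (inner ℂ ξ (T ω ξ)).re < τ * ‖ξ‖ ^ 2
  have hP0 : ∀ ω, P ω 0 := fun ω => ⟨⊥, finrank_bot ℂ V, fun ξ hξ h0 =>
    absurd ((Submodule.mem_bot ℂ).1 hξ) h0⟩
  let p : Par n → ℕ := fun ω => Nat.findGreatest (P ω) N
  have hp : ∀ ω, P ω (p ω) := fun ω => Nat.findGreatest_spec (Nat.zero_le N) (hP0 ω)
  set Bad := {ω ∈ U | ¬ ∀ ξ, τ * ‖ξ‖ ≤ ‖T ω ξ‖} with hBad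
  have hcover : Bad ⊆ ⋃ i ∈ Finset.range (N + 1), {ω ∈ Bad | p ω = i} := by
    intro ω hω
    simp only [Set.mem_iUnion, Finset.mem_range]
    exact ⟨p ω, Nat.lt_succ_of_le (Nat.findGreatest_le N), hω, rfl⟩
  have hpiece : ∀ i, volume {ω ∈ Bad | p ω = i} ≤
      ballVol n C₁ * ENNReal.ofReal (4 * τ / μ) := by
    intro i
    refine volume_slab_le (K := K) hC₁ (fun ω hω => hU hω.1.1) hv hτ hμ ?_
    rintro x ⟨⟨hxU, hxbad⟩, hxp⟩ y ⟨⟨hyU, -⟩, hyp⟩ s w hs hxy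
    by_contra hlt
    push Not at hlt
    obtain ⟨lam, u, hu0, hlam, hu⟩ := exists_small_eigenvalue (hT x hxU) hτ hxbad
    rw [abs_lt] at hlam
    obtain ⟨W, hWdim, hW⟩ := hp y
    rw [hyp] at hWdim
    have hinu : (inner ℂ u (T x u)).re = lam * ‖u‖ ^ 2 := by
      rw [hu, inner_smul_right, Complex.re_ofReal_mul]
      exact congrArg (lam * ·) (inner_self_eq_norm_sq (𝕜 := ℂ) u)
    have hWx : ∀ ξ ∈ W, (inner ℂ ξ (T x ξ)).re ≤ -τ * ‖ξ‖ ^ 2 := by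
      intro ξ hξ
      rcases eq_or_ne ξ 0 with rfl | h0
      · simp
      have h1 := hW ξ hξ h0
      have h2 := hmono x hxU y hyU s w hs hxy ξ
      have h3 : 0 < ‖ξ‖ ^ 2 := by positivity
      nlinarith
    have huW : u ∉ W := fun hmem => by
      have h1 := hWx u hmem
      have h3 : 0 < ‖u‖ ^ 2 := by positivity
      rw [hinu] at h1
      nlinarith
    have hdim : finrank ℂ (W ⊔ Submodule.span ℂ {u} : Submodule ℂ V) = i + 1 := by
      have hd : Disjoint W (Submodule.span ℂ {u}) :=
        (Submodule.disjoint_span_singleton' hu0).2 huW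
      have h1 := Submodule.finrank_sup_add_finrank_inf_eq W (Submodule.span ℂ {u})
      rw [hd.eq_bot, finrank_bot, finrank_span_singleton hu0, hWdim] at h1
      simpa using h1
    have hPx : P x (i + 1) := by
      refine ⟨W ⊔ Submodule.span ℂ {u}, hdim, fun ξ hξ h0 => ?_⟩
      obtain ⟨w₀, hw₀, z, hz, rfl⟩ := Submodule.mem_sup.1 hξ
      obtain ⟨c, rfl⟩ := Submodule.mem_span_singleton.1 hz
      have hsym : inner ℂ u (T x w₀) = (lam : ℂ) * inner ℂ u w₀ := by
        rw [← (hT x hxU) u w₀, hu, inner_smul_left, Complex.conj_ofReal]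
      have e1 : inner ℂ (w₀ + c • u) (T x (w₀ + c • u)) - (lam : ℂ) * inner ℂ (w₀ + c • u) (w₀ + c • u)
          = inner ℂ w₀ (T x w₀) - (lam : ℂ) * inner ℂ w₀ w₀ := by
        rw [map_add, map_smul, hu]
        simp only [inner_add_left, inner_add_right, inner_smul_left, inner_smul_right, hsym]
        ring
      have e2 := congrArg Complex.re e1
      have nrm : ∀ ζ : V, ((lam : ℂ) * inner ℂ ζ ζ).re = lam * ‖ζ‖ ^ 2 := fun ζ => by
        rw [Complex.re_ofReal_mul]
        exact congrArg (lam * ·) (inner_self_eq_norm_sq (𝕜 := ℂ) ζ)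
      rw [Complex.sub_re, Complex.sub_re, nrm, nrm] at e2
      have h1 := hWx w₀ hw₀
      have h3 : 0 < ‖w₀ + c • u‖ ^ 2 := by positivity
      have h4 : 0 ≤ ‖w₀‖ ^ 2 := by positivity
      nlinarith
    have hle : i + 1 ≤ N := hdim ▸ Submodule.finrank_le _
    have := Nat.le_findGreatest hle hPx
    change i + 1 ≤ p x at this
    omega
  calc volume Bad ≤ volume (⋃ i ∈ Finset.range (N + 1), {ω ∈ Bad | p ω = i}) := measure_mono hcover
    _ ≤ ∑ i ∈ Finset.range (N + 1), volume {ω ∈ Bad | p ω = i} := measure_biUnion_finset_le _ _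
    _ ≤ ∑ _i ∈ Finset.range (N + 1), _ := Finset.sum_le_sum fun i _ => hpiece i
    _ = _ := by rw [Finset.sum_const, Finset.card_range, nsmul_eq_mul]

end Slab

/-! ### Resonant parameters of Sylvester operators -/

section SylvesterMeasure

variable {d n : ℕ} {A B : Finset (Lat d)} {z M N : Ker d} {c : ℝ}

/-- The extension by zero of a matrix on `A × B`. -/
def extK (A B : Finset (Lat d)) (x : EuclideanSpace ℂ (A × B)) : Ker d := fun a b =>
  open Classical in if h : a ∈ A ∧ b ∈ B then x (⟨a, h.1⟩, ⟨b, h.2⟩) else 0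

lemma extK_restr (X : Ker d) {a b : Lat d} (ha : a ∈ A) (hb : b ∈ B) :
    extK A B (restr A B X) a b = X a b := by simp [extK, restr, ha, hb]

lemma restr_extK (A B : Finset (Lat d)) (x : EuclideanSpace ℂ (A × B)) :
    restr A B (extK A B x) = x := by
  ext p
  simp [extK, restr]

/-- The Sylvester operator on matrices on `A × B`. -/
def sylvOp (A B : Finset (Lat d)) (z M N : Ker d) :
    EuclideanSpace ℂ (A × B) →ₗ[ℂ] EuclideanSpace ℂ (A × B) where
  toFun x := restr A B (sylv A B z M N (extK A B x))
  map_add' x y := by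
    have : extK A B (x + y) = extK A B x + extK A B y := by
      funext a b; simp only [extK, Pi.add_apply, PiLp.add_apply]; split_ifs <;> simp
    rw [this, sylv_add]; rfl
  map_smul' c x := by
    have : extK A B (c • x) = c • extK A B x := by
      funext a b; simp only [extK, Pi.smul_apply, PiLp.smul_apply]; split_ifs <;> simp
    rw [this, sylv_smul]; rfl

lemma sylvOp_restr (A B : Finset (Lat d)) (z M N X : Ker d) :
    sylvOp A B z M N (restr A B X) = restr A B (sylv A B z M N X) := by
  ext p
  exact sylv_congr p.1.2 p.2.2 (fun _ _ _ _ => rfl) (fun _ _ _ _ => rfl) (fun _ _ _ _ => rfl)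
    fun a ha b hb => extK_restr X ha hb

lemma LB_iff_sylvOp {κ : ℝ} :
    LB A B z M N κ ↔ ∀ ξ, κ * ‖ξ‖ ≤ ‖sylvOp A B z M N ξ‖ := by
  constructor
  · intro h ξ
    have := h (extK A B ξ)
    rwa [← norm_restr, ← norm_restr, ← sylvOp_restr, restr_extK] at this
  · intro h X
    rw [← norm_restr, ← norm_restr, ← sylvOp_restr]
    exact h _

lemma inner_restr (A B : Finset (Lat d)) (X Y : Ker d) :
    inner ℂ (restr A B X) (restr A B Y) = ∑ a ∈ A, ∑ b ∈ B, starRingEnd ℂ (X a b) * Y a b := by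
  rw [PiLp.inner_apply, ← Finset.sum_coe_sort A, Fintype.sum_prod_type]
  refine Finset.sum_congr rfl fun a _ => ?_
  rw [← Finset.sum_coe_sort B]
  refine Finset.sum_congr rfl fun b _ => ?_
  simp [restr, mul_comm]

/-- The quadratic form of the section of `M` over `A`. -/
def qf (A : Finset (Lat d)) (M : Ker d) (ξ : Lat d → ℂ) : ℂ :=
  ∑ a ∈ A, ∑ e ∈ A, starRingEnd ℂ (ξ a) * (M a e * ξ e)

/-- The quadratic form of the section of `M` over `A` is bounded by `c`. -/
def FormLe (A : Finset (Lat d)) (M : Ker d) (c : ℝ) : Prop :=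
  ∀ ξ : Lat d → ℂ, |(qf A M ξ).re| ≤ c * ∑ a ∈ A, ‖ξ a‖ ^ 2

lemma FormLe.neg (h : FormLe A M c) : FormLe A (-M) c := by
  intro ξ
  have e : qf A (-M) ξ = -qf A M ξ := by simp [qf, Finset.sum_neg_distrib]
  rw [e, Complex.neg_re, abs_neg]; exact h ξ

lemma FormLe.tr (h : FormLe A M c) :
    FormLe A (tr M) c := by
  intro ξ
  have e : qf A (ToplitzLipschitz.tr M) ξ = qf A M fun a => starRingEnd ℂ (ξ a) := by
    unfold qf ToplitzLipschitz.tr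
    rw [Finset.sum_comm]
    refine Finset.sum_congr rfl fun a _ => Finset.sum_congr rfl fun e _ => ?_
    rw [Complex.conj_conj]; ring
  rw [e]
  simpa using h fun a => starRingEnd ℂ (ξ a)

/-- `M` is Hermitian on `A`. -/
def HermOn (A : Finset (Lat d)) (M : Ker d) : Prop :=
  ∀ a ∈ A, ∀ e ∈ A, starRingEnd ℂ (M a e) = M e a

lemma inner_sylvOp (A B : Finset (Lat d)) (z M N X : Ker d) :
    inner ℂ (restr A B X) (sylvOp A B z M N (restr A B X))
      = ∑ a ∈ A, ∑ b ∈ B, z a b * (‖X a b‖ ^ 2 : ℝ) + ∑ b ∈ B, qf A M (fun a => X a b)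
        + ∑ a ∈ A, qf B (tr N) (fun b => X a b) := by
  rw [sylvOp_restr, inner_restr]
  simp only [sylv, mul_add, Finset.sum_add_distrib]
  congr 1
  · congr 1
    · refine Finset.sum_congr rfl fun a _ => Finset.sum_congr rfl fun b _ => ?_
      rw [Complex.ofReal_pow, ← Complex.conj_mul' (X a b)]; ring
    · rw [Finset.sum_comm]
      simp only [qf, lprod, Finset.mul_sum]
  · simp only [qf, rprod, Finset.mul_sum, tr]
    exact Finset.sum_congr rfl fun a _ => Finset.sum_congr rfl fun b _ =>
      Finset.sum_congr rfl fun e _ => by ring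

lemma sylvOp_isSymmetric
    (hz : ∀ a ∈ A, ∀ b ∈ B, starRingEnd ℂ (z a b) = z a b) (hM : HermOn A M) (hN : HermOn B N) :
    (sylvOp A B z M N).IsSymmetric := by
  intro x y
  rw [← restr_extK A B x, ← restr_extK A B y]
  set X := extK A B x
  set Y := extK A B y
  rw [sylvOp_restr, sylvOp_restr, inner_restr, inner_restr]
  simp only [sylv, map_add, map_mul, add_mul, mul_add, Finset.sum_add_distrib]
  congr 1
  · congr 1
    · refine Finset.sum_congr rfl fun a ha => Finset.sum_congr rfl fun b hb => ?_
      rw [hz a ha b hb]; ring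
    · simp only [lprod, map_sum, map_mul, Finset.sum_mul, Finset.mul_sum]
      rw [Finset.sum_comm]
      conv_rhs => rw [Finset.sum_comm]
      refine Finset.sum_congr rfl fun b _ => ?_
      rw [Finset.sum_comm]
      refine Finset.sum_congr rfl fun a ha => Finset.sum_congr rfl fun e he => ?_
      rw [hM e he a ha]; ring
  · simp only [rprod, map_sum, map_mul, Finset.sum_mul, Finset.mul_sum]
    refine Finset.sum_congr rfl fun a _ => ?_
    rw [Finset.sum_comm]
    refine Finset.sum_congr rfl fun b hb => Finset.sum_congr rfl fun e he => ?_
    rw [hN b hb e he]; ring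

/-- Volume of the parameters for which a Sylvester operator on a pair of blocks is resonant. -/
lemma volume_not_LB_le {U : Set (Par n)} {C₁ τ α β K : ℝ} {v : Par n} (hC₁ : 1 ≤ C₁)
    (hU : U ⊆ Metric.closedBall 0 C₁) (hv : ‖v‖ = 1) (hτ : 0 < τ) (hαβ : 2 * α < β)
    (A B : Finset (Lat d)) (z : Par n → Lat d → Lat d → ℝ) (M N : Par n → Ker d)
    (hM : ∀ ω ∈ U, HermOn A (M ω)) (hN : ∀ ω ∈ U, HermOn B (N ω))
    (hmono : ∀ x ∈ U, ∀ y ∈ U, ∀ (s : ℝ) (w : Par n), 0 ≤ s → y - x = s • v + w →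
      (∀ a b, β * s - K * ‖w‖ ≤ z y a b - z x a b) ∧
      FormLe A (M y - M x) (α * s + K * ‖w‖) ∧ FormLe B (tr (N y - N x)) (α * s + K * ‖w‖)) :
    volume {ω ∈ U | ¬ LB A B (fun a b => (z ω a b : ℂ)) (M ω) (N ω) τ} ≤
      (A.card * B.card + 1 : ℕ) *
      (ballVol n C₁ * ENNReal.ofReal (4 * τ / (β - 2 * α))) := by
  have key := volume_bad_le (K := 3 * K) hC₁ hU hv hτ (μ := β - 2 * α) (by linarith)
    (fun ω => sylvOp A B (fun a b => (z ω a b : ℂ)) (M ω) (N ω))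
    (fun ω hω => sylvOp_isSymmetric (fun _ _ _ _ => Complex.conj_ofReal _) (hM ω hω) (hN ω hω)) ?_
  · have e : Module.finrank ℂ (EuclideanSpace ℂ (A × B)) = A.card * B.card := by
      rw [finrank_euclideanSpace]; simp
    rw [e] at key
    simpa only [LB_iff_sylvOp] using key
  · intro x hx y hy s w hs hxy ξ
    rw [← restr_extK A B ξ]
    set X := extK A B ξ
    obtain ⟨h1, h2, h3⟩ := hmono x hx y hy s w hs hxy
    rw [norm_restr, hs_sq, inner_sylvOp, inner_sylvOp]
    have f1 : ∀ b, |(qf A (M y) (fun a => X a b)).re - (qf A (M x) (fun a => X a b)).re|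
        ≤ (α * s + K * ‖w‖) * ∑ a ∈ A, ‖X a b‖ ^ 2 := fun b => by
      have := h2 fun a => X a b
      have e : qf A (M y - M x) (fun a => X a b)
          = qf A (M y) (fun a => X a b) - qf A (M x) (fun a => X a b) := by
        simp [qf, sub_mul, mul_sub, Finset.sum_sub_distrib]
      rwa [e, Complex.sub_re] at this
    have f2 : ∀ a, |(qf B (tr (N y)) (fun b => X a b)).re - (qf B (tr (N x)) (fun b => X a b)).re|
        ≤ (α * s + K * ‖w‖) * ∑ b ∈ B, ‖X a b‖ ^ 2 := fun a => by
      have := h3 fun b => X a b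
      have e : qf B (tr (N y - N x)) (fun b => X a b)
          = qf B (tr (N y)) (fun b => X a b) - qf B (tr (N x)) (fun b => X a b) := by
        simp [qf, tr, sub_mul, mul_sub, Finset.sum_sub_distrib]
      rwa [e, Complex.sub_re] at this
    set T := ∑ a ∈ A, ∑ b ∈ B, ‖X a b‖ ^ 2 with hT
    have hT' : T = ∑ b ∈ B, ∑ a ∈ A, ‖X a b‖ ^ 2 := Finset.sum_comm
    have g1 : -((α * s + K * ‖w‖) * T) ≤ ∑ b ∈ B, (qf A (M y) (fun a => X a b)).re
        - ∑ b ∈ B, (qf A (M x) (fun a => X a b)).re := by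
      rw [← Finset.sum_sub_distrib, hT', Finset.mul_sum, ← Finset.sum_neg_distrib]
      exact Finset.sum_le_sum fun b _ => (abs_le.1 (f1 b)).1
    have g2 : -((α * s + K * ‖w‖) * T) ≤ ∑ a ∈ A, (qf B (tr (N y)) (fun b => X a b)).re
        - ∑ a ∈ A, (qf B (tr (N x)) (fun b => X a b)).re := by
      rw [← Finset.sum_sub_distrib, hT, Finset.mul_sum, ← Finset.sum_neg_distrib]
      exact Finset.sum_le_sum fun a _ => (abs_le.1 (f2 a)).1
    have g3 : (β * s - K * ‖w‖) * T ≤ ∑ a ∈ A, ∑ b ∈ B, z y a b * ‖X a b‖ ^ 2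
        - ∑ a ∈ A, ∑ b ∈ B, z x a b * ‖X a b‖ ^ 2 := by
      rw [← Finset.sum_sub_distrib, hT, Finset.mul_sum]
      refine Finset.sum_le_sum fun a _ => ?_
      rw [← Finset.sum_sub_distrib, Finset.mul_sum]
      refine Finset.sum_le_sum fun b _ => ?_
      rw [← sub_mul]
      exact mul_le_mul_of_nonneg_right (h1 a b) (by positivity)
    have re : ∀ ω, (∑ a ∈ A, ∑ b ∈ B, (z ω a b : ℂ) * (‖X a b‖ ^ 2 : ℝ)).re
        = ∑ a ∈ A, ∑ b ∈ B, z ω a b * ‖X a b‖ ^ 2 := fun ω => by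
      simp only [← Complex.ofReal_mul, ← Complex.ofReal_sum, Complex.ofReal_re]
    simp only [Complex.add_re, re, Complex.re_sum] at *
    linarith

end SylvesterMeasure

/-! ### Propagation of lower bounds from the next level -/

section Regular

variable {d : ℕ} {z : Lat d} {C : List (Lat d)} {Q : Ker d} {Y t : ℕ}

/-- The kernel `A` has `m` iterated limits, with Lipschitz bounds `K` on the domains of radius `S`
outside the ball of radius `ρ`. -/
def SReg (ρ S K : ℝ) : ℕ → Ker d → Prop
  | 0, _ => True
  | m + 1, A => ∀ c : Lat d, c ≠ 0 → ∃ A', HasLim c A A' ∧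
      (∀ a b, ρ ≤ len a → ρ ≤ len b → LipDomPos S c a b → wt c a b * ‖A a b - A' a b‖ ≤ K) ∧
      SReg ρ S K m A'

lemma HasLim.invariant {c : Lat d} {A A' : Ker d} (h : HasLim c A A') (a b : Lat d) :
    A' (a + c) (b + c) = A' a b := by
  refine tendsto_nhds_unique (h (a + c) (b + c)) ?_
  have h1 := (h a b).comp (tendsto_add_atTop_nat 1)
  refine h1.congr fun t => ?_
  simp only [Function.comp, Nat.cast_add, Nat.cast_one, add_smul, one_smul]
  rw [add_right_comm, add_right_comm b, ← add_assoc, ← add_assoc, add_right_comm, add_right_comm b]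

namespace Lev

variable {g : Lev d}

/-- The real span of the directions of a level. -/
def span (g : Lev d) : Submodule ℝ (Par d) := Submodule.span ℝ {x | ∃ c ∈ g.C, x = toE c}

lemma exists_closure_near (C : List (Lat d)) (x : Par d)
    (hx : x ∈ Submodule.span ℝ {x | ∃ c ∈ C, x = toE c}) :
    ∃ z ∈ AddSubgroup.closure {c | c ∈ C}, ‖x - toE z‖ ≤ (C.map len).sum := by
  induction C generalizing x with
  | nil =>
    refine ⟨0, AddSubgroup.zero_mem _, ?_⟩
    simp only [List.not_mem_nil, false_and, exists_false, Set.ofPred_false, Submodule.span_empty,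
      Submodule.mem_bot] at hx
    simp [hx, toE_zero]
  | cons c C ih =>
    have e : {x | ∃ c' ∈ c :: C, x = toE c'} = insert (toE c) {x | ∃ c ∈ C, x = toE c} := by
      ext y; simp
    rw [e, Submodule.mem_span_insert] at hx
    obtain ⟨y, x', hx', rfl⟩ := hx
    obtain ⟨z, hz, hle⟩ := ih x' hx'
    refine ⟨⌊y⌋ • c + z, AddSubgroup.add_mem _ (AddSubgroup.zsmul_mem _
      (AddSubgroup.subset_closure (by simp)) _) (AddSubgroup.closure_mono (fun _ h => by
        simp only [Set.mem_ofPred_eq, List.mem_cons] at *; exact Or.inr h) hz), ?_⟩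
    have e2 : y • toE c + x' - toE (⌊y⌋ • c + z) = Int.fract y • toE c + (x' - toE z) := by
      rw [toE_add, toE_smul, Int.fract]; module
    rw [e2, List.map_cons, List.sum_cons]
    refine (norm_add_le _ _).trans (add_le_add ?_ hle)
    rw [norm_smul, Real.norm_of_nonneg (Int.fract_nonneg y)]
    exact mul_le_of_le_one_left (norm_nonneg _) (Int.fract_lt_one y).le

lemma orth_closure (hz : z ∈ AddSubgroup.closure {c | c ∈ C})
    (x : Lat d) (hx : ∀ c ∈ C, x ⬝ᵥ c = 0) : x ⬝ᵥ z = 0 := by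
  induction hz using AddSubgroup.closure_induction with
  | mem c hc => exact hx c hc
  | zero => simp
  | add a b _ _ ha hb => rw [dotProduct_add, ha, hb, add_zero]
  | neg a _ ha => rw [dotProduct_neg, ha, neg_zero]

lemma invariant_closure
    (hz : z ∈ AddSubgroup.closure {c | c ∈ C})
    (hQ : ∀ c ∈ C, ∀ a b, Q (a + c) (b + c) = Q a b) (a b : Lat d) :
    Q (a + z) (b + z) = Q a b := by
  induction hz using AddSubgroup.closure_induction generalizing a b with
  | mem c hc => exact hQ c hc a b
  | zero => simp
  | add x y _ _ hx hy => rw [← add_assoc, ← add_assoc, hy, hx]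
  | neg x _ hx => rw [← hx]; simp

lemma mem_span_closure (hz : z ∈ AddSubgroup.closure {c | c ∈ g.C}) :
    toE z ∈ g.span := by
  induction hz using AddSubgroup.closure_induction with
  | mem c hc => exact Submodule.subset_span ⟨c, hc, rfl⟩
  | zero => rw [toE_zero]; exact Submodule.zero_mem _
  | add x y _ _ hx hy => rw [toE_add]; exact Submodule.add_mem _ hx hy
  | neg x _ hx => rw [toE_neg]; exact Submodule.neg_mem _ hx

lemma LB_shift (hg : g.Good) (hL : g.C ≠ [] → g.L = Set.univ) {θ τ : ℝ}
    (hQ : ∀ c ∈ g.C, ∀ a b, Q (a + c) (b + c) = Q a b) {z a b : Lat d}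
    (hz : z ∈ AddSubgroup.closure {c | c ∈ g.C}) (hab : g.Act a b)
    (h : LB (g.blk (a - z)) (g.blk (b - z)) (energy θ) Q (-Q) τ) :
    LB (g.blk a) (g.blk b) (energy θ) Q (-Q) τ := by
  by_cases hC : g.C = []
  · have : z = 0 := by simpa [hC] using hz
    simpa [this] using h
  have hz' := fun x => orth_closure hz x
  have ea : g.blk a = (g.blk (a - z)).map (addRightEmbedding z) := by
    rw [← hg.blk_shift (hL hC) hz', sub_add_cancel]
  have eb : g.blk b = (g.blk (b - z)).map (addRightEmbedding z) := by
    rw [← hg.blk_shift (hL hC) hz', sub_add_cancel]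
  have hab' : g.Act (a - z) (b - z) := by
    rw [← Act.shift_iff (hL hC) hz', sub_add_cancel, sub_add_cancel]; exact hab
  rw [ea, eb, LB_map]
  refine h.congr (fun x hx y hy => ?_) (fun x _ y _ => (invariant_closure hz hQ x y).symm)
    (fun x _ y _ => ?_)
  · rw [hg.mem_blk] at hx hy
    exact (energy_shift (hz' _ (hab'.congr hx hy).2.2.1)).symm
  · simp only [Pi.neg_apply]
    rw [invariant_closure hz hQ x y]

/-- Constants that dominate the parameters of a level. -/
structure Dom (g : Lev d) (S K T : ℝ) (Y : ℕ) : Prop where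
  hY : d + 8 ≤ Y
  h1 : (S + 1) * (g.Δ' + 3 * g.D + 1) ≤ Y
  h2 : 2 * S ^ 2 + g.Δ' + 3 * g.D + 1 ≤ Y
  h3 : (g.Δ' + 2 * g.D + 1) ^ 2 + T + 1 ≤ Y
  h4 : (3 * g.D) ^ d ≤ Y
  h5 : K ≤ Y

lemma onRay_of_near {S R : ℝ} (hS : 0 ≤ S) (hR : 0 ≤ R) (h1 : (S + 1) * (R + 1) ≤ Y)
    (h2 : 2 * S ^ 2 + R + 1 ≤ Y) {c a' x x' : Lat d} (hc : c ≠ 0)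
    (hx : x = x' + (t : ℤ) • c) (hx' : len x' ≤ len a' + R)
    (ht : (Y : ℝ) * (len a' + len c + 1) ≤ t) : OnRay S c x x' t := by
  have hc1 := one_le_len hc
  have h0 := len_nonneg a'
  set p := len a' + len c + 1 with hp
  have hlen : (t : ℝ) * len c - len x' ≤ len x := by
    have : len ((t : ℤ) • c) ≤ len x + len x' := by
      have e : (t : ℤ) • c = x - x' := by rw [hx]; abel
      rw [e]; exact len_sub_le _ _
    rw [len_smul, Int.cast_natCast, Nat.abs_cast] at this
    linarith
  have hlow : ((Y : ℝ) - R - 1) * p * len c ≤ len x := by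
    have e1 : len a' + R ≤ (R + 1) * p * len c := by
      have : len a' + R ≤ (R + 1) * p := by nlinarith
      have h' : 0 ≤ (R + 1) * p := by positivity
      nlinarith
    have e2 : (Y : ℝ) * p * len c ≤ t * len c := by gcongr
    nlinarith
  refine ⟨Nat.cast_nonneg t, by rw [hx, toE_shift]; simp, ?_, ?_⟩
  · refine le_trans ?_ hlow
    have e1 : len x' + len c ≤ (R + 1) * p := by nlinarith
    have e2 : S * (len x' + len c) ≤ (Y - R - 1) * p := by
      calc S * (len x' + len c) ≤ S * ((R + 1) * p) := by gcongr
        _ = S * (R + 1) * p := by ring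
        _ ≤ (Y - R - 1) * p := mul_le_mul_of_nonneg_right (by linarith) (by linarith)
    exact mul_le_mul_of_nonneg_right e2 (by linarith)
  · rw [le_div_iff₀ (by linarith)]
    refine le_trans ?_ hlow
    have e1 : 2 * S ^ 2 ≤ Y - R - 1 := by linarith
    have e2 : 2 * S ^ 2 ≤ (Y - R - 1) * p :=
      e1.trans (le_mul_of_one_le_right (by nlinarith [sq_nonneg S]) (by linarith))
    exact mul_le_mul_of_nonneg_right e2 (by linarith)

lemma far_facts (hg : g.Good) {S K T : ℝ} (hS : g.Radius S) (hD : g.Dom S K T Y)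
    (hT : 0 ≤ T) {c a a' b : Lat d} (hc : c ≠ 0)
    (ha : a = a' + (t : ℤ) • c) (ht : (Y : ℝ) * (len a' + len c + 1) ≤ t) (hab : g.Act a b)
    (hε : |((a ⬝ᵥ a - b ⬝ᵥ b : ℤ) : ℝ)| ≤ T) :
    (g.Rigid c a ∧ g.ρ ≤ len a) ∧ (g.Rigid c b ∧ g.ρ ≤ len b) ∧ (a - b) ⬝ᵥ c = 0 ∧
    (∀ x ∈ g.blk a, ∀ y ∈ g.blk a, LipDomPos S c x y) ∧
    (∀ x ∈ g.blk b, ∀ y ∈ g.blk b, LipDomPos S c x y) := by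
  have hD1 := hg.hD
  have hΔ1 := hg.hΔ'
  have hS0 : 0 ≤ S := by have := hS.big; nlinarith
  have hab' := hg.act_len hab
  have h0 := len_nonneg a'
  have hc1 := one_le_len hc
  set R := g.Δ' + 3 * g.D with hR
  have key : ∀ x : Lat d, len (x - a) ≤ R → OnRay S c x (a' + (x - a)) t := fun x hx =>
    onRay_of_near hS0 (by linarith) hD.h1 (by have := hD.h2; linarith) hc
      (by rw [ha]; abel) (by linarith [len_add_le a' (x - a)]) ht
  have hxa : ∀ x ∈ g.blk a, OnRay S c x (a' + (x - a)) t := fun x hx => key x <| by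
    have := hg.hdiam _ _ (hg.mem_blk.1 hx)
    rw [len_sub_comm]; linarith
  have hxb : ∀ x ∈ g.blk b, OnRay S c x (a' + (x - a)) t := fun x hx => key x <| by
    have h1 := hg.hdiam _ _ (hg.mem_blk.1 hx)
    have e : x - a = (x - b) - (a - b) := by abel
    rw [e]
    have h2 := len_sub_le (x - b) (a - b)
    rw [len_sub_comm x b] at h2
    linarith
  refine ⟨(hxa a (hg.self_mem_blk a)).rigid hc hg hS.big hS.rho,
    (hxb b (hg.self_mem_blk b)).rigid hc hg hS.big hS.rho, ?_,
    fun x hx y hy => lipDomPos_iff.2 ⟨_, _, t, hxa x hx, hxa y hy⟩,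
    fun x hx y hy => lipDomPos_iff.2 ⟨_, _, t, hxb x hx, hxb y hy⟩⟩
  rw [← neg_sub, neg_dotProduct, neg_eq_zero]
  refine orth_of_large (a := a) (a' := a') (t := t) (δ := g.Δ' + 2 * g.D) (h := T)
    (by rw [ha, toE_shift]; simp) (by rwa [len_sub_comm] at hab') ?_ ?_
  · rw [add_sub_cancel, ← abs_neg]
    refine le_trans (le_of_eq ?_) hε
    congr 1; push_cast; ring
  · have h3 := hD.h3
    set δ := g.Δ' + 2 * g.D with hδ
    have e1 : len a' * δ + δ ^ 2 + T < ((δ + 1) ^ 2 + T + 1) * (len a' + len c + 1) := by nlinarith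
    have e2 : ((δ + 1) ^ 2 + T + 1) * (len a' + len c + 1) ≤ Y * (len a' + len c + 1) := by gcongr
    linarith

end Lev
end Regular

/-! ### The measure of the resonant set -/

section Fam

variable {d n : ℕ} {r e t : ℕ} {Q : Par n → Ker d} {c a a' b : Lat d} {τ : ℝ}

lemma qf_map (A : Finset (Lat d)) (z : Lat d) (M : Ker d) (ξ : Lat d → ℂ) :
    qf (A.map (addRightEmbedding z)) M ξ
      = qf A (fun a b => M (a + z) (b + z)) fun a => ξ (a + z) := by
  simp [qf, Finset.sum_map]

lemma FormLe.of_tendsto {A : Finset (Lat d)} {M : ℕ → Ker d} {M' : Ker d} {c : ℝ}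
    (h : ∀ a ∈ A, ∀ b ∈ A, Tendsto (fun t => M t a b) atTop (𝓝 (M' a b)))
    (hM : ∀ᶠ t in atTop, FormLe A (M t) c) : FormLe A M' c := fun ξ => by
  have h1 : Tendsto (fun t => qf A (M t) ξ) atTop (𝓝 (qf A M' ξ)) :=
    tendsto_finsetSum _ fun a ha => tendsto_finsetSum _ fun b hb =>
      tendsto_const_nhds.mul ((h a ha b hb).mul tendsto_const_nhds)
  exact le_of_tendsto ((Complex.continuous_re.tendsto _).comp h1).abs (hM.mono fun t ht => ht ξ)

/-- A family of Hermitian kernels at a level, monotone at most at rate `α` in the direction `v`. -/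
structure Fam (g : Lev d) (U : Set (Par n)) (v : Par n) (S K Kop α KL : ℝ) (r : ℕ)
    (Q : Par n → Ker d) : Prop where
  herm : ∀ ω ∈ U, ∀ a ∈ g.L, ∀ b ∈ g.L, starRingEnd ℂ (Q ω a b) = Q ω b a
  op : ∀ ω ∈ U, g.OpBlk (Q ω) Kop
  reg : ∀ ω ∈ U, SReg g.ρ S K r (Q ω)
  mono : ∀ x ∈ U, ∀ y ∈ U, ∀ (s : ℝ) (w : Par n), 0 ≤ s → y - x = s • v + w →
    ∀ A : Finset (Lat d), (∀ a ∈ A, a ∈ g.L) → FormLe A (Q y - Q x) (α * s + KL * ‖w‖)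
  inv : ∀ ω ∈ U, ∀ c ∈ g.C, ∀ a b, Q ω (a + c) (b + c) = Q ω a b
  univ : g.C ≠ [] → g.L = Set.univ

variable {g : Lev d} {U : Set (Par n)} {v : Par n} {S K Kop α KL : ℝ}

lemma Fam.next (hg : g.Good)
    (h : Fam g U v S K Kop α KL (r + 1) Q) (hc : c ≠ 0) :
    ∃ Q' : Par n → Ker d, Fam (g.next c) U v S K Kop α KL r Q' ∧
      ∀ ω ∈ U, ∀ a b, g.ρ ≤ len a → g.ρ ≤ len b → LipDomPos S c a b →
        wt c a b * ‖Q ω a b - Q' ω a b‖ ≤ K := by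
  have h0 : ∀ ω, ∃ A', ω ∈ U → HasLim c (Q ω) A' ∧
      (∀ a b, g.ρ ≤ len a → g.ρ ≤ len b → LipDomPos S c a b →
        wt c a b * ‖Q ω a b - A' a b‖ ≤ K) ∧ SReg g.ρ S K r A' := fun ω => by
    by_cases hω : ω ∈ U
    · obtain ⟨A', hA'⟩ := h.reg ω hω c hc
      exact ⟨A', fun _ => hA'⟩
    · exact ⟨0, fun h => absurd h hω⟩
  choose Q' hQ' using h0
  refine ⟨Q', ⟨?_, fun ω hω => (h.op ω hω).next hg hc (hQ' ω hω).1, fun ω hω => (hQ' ω hω).2.2,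
    ?_, ?_, fun _ => rfl⟩, fun ω hω => (hQ' ω hω).2.1⟩
  · intro ω hω a _ b _
    refine tendsto_nhds_unique ((Complex.continuous_conj.tendsto _).comp ((hQ' ω hω).1 a b))
      (((hQ' ω hω).1 b a).congr' ?_)
    filter_upwards [g.eventually_rigid hc a, g.eventually_rigid hc b] with t h1 h2
    exact (h.herm ω hω _ (hg.hL _ h1.2) _ (hg.hL _ h2.2)).symm
  · intro x hx y hy s w hs e A _
    refine FormLe.of_tendsto (M := fun t a b => (Q y - Q x) (a + (t : ℤ) • c) (b + (t : ℤ) • c))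
      (fun a _ b _ => ((hQ' y hy).1 a b).sub ((hQ' x hx).1 a b)) ?_
    have h1 : ∀ᶠ t : ℕ in atTop, ∀ a ∈ A, a + (t : ℤ) • c ∈ g.L := by
      rw [Filter.eventually_all_finset]
      exact fun a _ => (g.eventually_rigid hc a).mono fun t ht => hg.hL _ ht.2
    filter_upwards [h1] with t ht ξ
    have := h.mono x hx y hy s w hs e (A.map (addRightEmbedding ((t : ℤ) • c))) (by simpa using ht)
      fun a => ξ (a - (t : ℤ) • c)
    rw [qf_map] at this
    simpa using this
  · intro ω hω c' hc' a b
    rcases List.mem_cons.1 hc' with rfl | hc'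
    · exact (hQ' ω hω).1.invariant a b
    · refine tendsto_nhds_unique ((hQ' ω hω).1 (a + c') (b + c')) (((hQ' ω hω).1 a b).congr fun t => ?_)
      rw [add_right_comm, add_right_comm b, h.inv ω hω c' hc']

/-- A scalar frequency, monotone at least at rate `β` in the direction `v`. -/
structure Freq (U : Set (Par n)) (v : Par n) (C₁ Kop α β KL T : ℝ) (Y : ℕ) (θ : Par n → ℝ) :
    Prop where
  hC : 1 ≤ C₁
  hU : U ⊆ Metric.closedBall 0 C₁
  hv : ‖v‖ = 1
  hα : 0 ≤ α
  hβ : 1 ≤ (β - 2 * α) * Y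
  mono : ∀ x ∈ U, ∀ y ∈ U, ∀ (s : ℝ) (w : Par n), 0 ≤ s → y - x = s • v + w →
    β * s - KL * ‖w‖ ≤ θ y - θ x
  le : ∀ ω ∈ U, |θ ω| + 2 * Kop + 1 ≤ T

variable {C₁ β T : ℝ} {Y : ℕ} {θ : Par n → ℝ}

lemma Freq.pos (hθ : Freq U v C₁ Kop α β KL T Y θ) : 0 < β - 2 * α ∧ 4 / (β - 2 * α) ≤ 4 * Y := by
  have h := hθ.hβ
  have h1 : (0 : ℝ) ≤ Y := Nat.cast_nonneg Y
  have h2 : 0 < β - 2 * α := by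
    by_contra hn
    nlinarith
  refine ⟨h2, ?_⟩
  rw [div_le_iff₀ h2]; linarith

lemma Fam.volume_pair_le (hg : g.Good) (hD : g.Dom S K T Y)
    (h : Fam g U v S K Kop α KL r Q) (hθ : Freq U v C₁ Kop α β KL T Y θ) (hτ : 0 < τ)
    (ha : a ∈ g.L) (hb : b ∈ g.L) :
    volume {ω ∈ U | ¬ LB (g.blk a) (g.blk b) (energy (θ ω)) (Q ω) (-Q ω) τ} ≤
      (Y : ℝ≥0∞) ^ 4 * (ballVol n C₁ * ENNReal.ofReal τ) := by
  have hsub : ∀ a ∈ g.L, ∀ x ∈ g.blk a, x ∈ g.L := fun a ha x hx => (hg.mem_blk.1 hx).mem ha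
  have h1 := volume_not_LB_le (α := α) (β := β) (K := KL) hθ.hC hθ.hU hθ.hv hτ
    (by linarith [hθ.pos.1]) (g.blk a)
    (g.blk b) (fun ω x y => θ ω + ((x ⬝ᵥ x - y ⬝ᵥ y : ℤ) : ℝ)) Q (fun ω => -Q ω)
    (fun ω hω x hx y hy => h.herm ω hω x (hsub a ha x hx) y (hsub a ha y hy))
    (fun ω hω x hx y hy => by
      simp only [Pi.neg_apply, map_neg]
      rw [h.herm ω hω x (hsub b hb x hx) y (hsub b hb y hy)])
    (fun x hx y hy s w hs e => ⟨fun p q => by linarith [hθ.mono x hx y hy s w hs e],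
      h.mono x hx y hy s w hs e _ (hsub a ha), by
        have := (h.mono x hx y hy s w hs e _ (hsub b hb)).neg.tr
        rwa [neg_sub, ← neg_sub_neg] at this⟩)
  have e1 : ∀ ω, (fun x y => ((θ ω + ((x ⬝ᵥ x - y ⬝ᵥ y : ℤ) : ℝ) : ℝ) : ℂ))
      = energy (d := d) (θ ω) := fun ω => by
    funext x y; simp [energy]
  simp only [e1] at h1
  refine h1.trans ?_
  have hcard : ∀ a, (g.blk a).card ≤ Y := fun a => by
    exact_mod_cast (hg.card_blk a).trans hD.h4
  have hY : 8 ≤ Y := by have := hD.hY; omega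
  have e2 : (g.blk a).card * (g.blk b).card + 1 ≤ Y ^ 2 + 1 := by
    rw [pow_two]; exact Nat.add_le_add_right (Nat.mul_le_mul (hcard a) (hcard b)) 1
  have e3 : ENNReal.ofReal (4 * τ / (β - 2 * α)) ≤ ((4 * Y : ℕ) : ℝ≥0∞) * ENNReal.ofReal τ := by
    rw [← ENNReal.ofReal_natCast, ← ENNReal.ofReal_mul (by positivity)]
    refine ENNReal.ofReal_le_ofReal ?_
    rw [mul_div_right_comm]
    push_cast
    exact mul_le_mul_of_nonneg_right hθ.pos.2 hτ.le
  calc _ ≤ ((Y ^ 2 + 1 : ℕ) : ℝ≥0∞) * (ballVol n C₁ *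
        (((4 * Y : ℕ) : ℝ≥0∞) * ENNReal.ofReal τ)) := by gcongr
    _ = (((Y ^ 2 + 1) * (4 * Y) : ℕ) : ℝ≥0∞) *
        (ballVol n C₁ * ENNReal.ofReal τ) := by
      push_cast; ring
    _ ≤ _ := by
      gcongr
      have : (Y ^ 2 + 1) * (4 * Y) ≤ Y ^ 4 := by nlinarith [Nat.mul_le_mul hY hY, pow_pos (by omega : 0 < Y) 3]
      exact_mod_cast this

lemma Freq.volume_le (hθ : Freq U v C₁ Kop α β KL T Y θ) (hY : 8 ≤ Y)
    (hτ : 0 < τ) : volume {ω ∈ U | |θ ω| < τ} ≤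
      (Y : ℝ≥0∞) ^ 4 * (ballVol n C₁ * ENNReal.ofReal τ) := by
  have hp := hθ.pos
  have h1 := volume_slab_le (K := KL) (τ := τ) (μ := β - 2 * α) (E := {ω ∈ U | |θ ω| < τ}) hθ.hC
    (fun ω hω => hθ.hU hω.1) hθ.hv hτ hp.1 (fun x hx y hy s w hs e => by
      have e1 := hθ.mono x hx.1 y hy.1 s w hs e
      have e2 := abs_lt.1 hx.2
      have e3 := abs_lt.1 hy.2
      have := hθ.hα
      nlinarith)
  refine h1.trans ?_
  have e3 : ENNReal.ofReal (4 * τ / (β - 2 * α)) ≤ ((4 * Y : ℕ) : ℝ≥0∞) * ENNReal.ofReal τ := by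
    rw [← ENNReal.ofReal_natCast, ← ENNReal.ofReal_mul (by positivity)]
    refine ENNReal.ofReal_le_ofReal ?_
    rw [mul_div_right_comm]
    push_cast
    exact mul_le_mul_of_nonneg_right hp.2 hτ.le
  calc _ ≤ ballVol n C₁ *
        (((4 * Y : ℕ) : ℝ≥0∞) * ENNReal.ofReal τ) := by gcongr
    _ = ((4 * Y : ℕ) : ℝ≥0∞) *
        (ballVol n C₁ * ENNReal.ofReal τ) := by ring
    _ ≤ _ := by
      gcongr
      have : 4 * Y ≤ Y ^ 4 := by nlinarith [Nat.mul_le_mul hY hY, pow_pos (by omega : 0 < Y) 3]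
      exact_mod_cast this

namespace Lev

lemma sum_len_le {C : List (Lat d)} {M : ℝ} (h : ∀ c ∈ C, len c ≤ M) :
    (C.map len).sum ≤ C.length * M := by
  induction C with
  | nil => simp
  | cons c C ih =>
    simp only [List.map_cons, List.sum_cons, List.length_cons]
    push_cast
    have h1 := h c (by simp)
    have h2 := ih fun c' hc' => h c' (by simp [hc'])
    linarith

/-- The conclusion of Dirichlet's theorem on simultaneous approximation: far lattice points are
close to a ray with a short direction. -/
def NearRay (d e Y : ℕ) : Prop := ∀ a : Lat d, (Y : ℝ) ^ e ≤ len a →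
  ∃ (c a' : Lat d) (t : ℕ), c ≠ 0 ∧ len c ≤ (Y : ℝ) ^ e ∧ a = a' + (t : ℤ) • c ∧
    (Y : ℝ) * (len a' + len c + 1) ≤ t

/-- Lower bounds hold everywhere if they hold for the pairs in a large ball, and for pairs that are
far out in a direction outside the span of the directions of the level. -/
lemma LBall_of_near_far (hg : g.Good) (hD : g.Dom S K T Y) (he : NearRay d e Y)
    (hC : ∀ c ∈ g.C, len c ≤ (Y : ℝ) ^ e) (hlen : g.C.length ≤ d) (huniv : g.C ≠ [] → g.L = Set.univ)
    {θ τ N : ℝ} {Q : Ker d} (hinv : ∀ c ∈ g.C, ∀ a b, Q (a + c) (b + c) = Q a b)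
    (hop : g.OpBlk Q Kop) (hT : |θ| + 2 * Kop + 1 ≤ T) (hKop : 0 ≤ Kop) (hτ : τ ≤ 1)
    (hN : (Y : ℝ) ^ (2 * e + 3) ≤ N)
    (near : ∀ a b, len a ≤ N → g.Act a b → LB (g.blk a) (g.blk b) (energy θ) Q (-Q) τ)
    (far : ∀ (c a a' b : Lat d) (t : ℕ), c ≠ 0 → len c ≤ (Y : ℝ) ^ e → toE c ∉ g.span →
      N < len a → a = a' + (t : ℤ) • c → (Y : ℝ) * (len a' + len c + 1) ≤ t → g.Act a b →
      |((a ⬝ᵥ a - b ⬝ᵥ b : ℤ) : ℝ)| ≤ T → LB (g.blk a) (g.blk b) (energy θ) Q (-Q) τ) :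
    g.LBall θ Q τ := by
  have hY8 : (8 : ℝ) ≤ Y := by have := hD.hY; exact_mod_cast (by omega : 8 ≤ Y)
  have hYd : (d : ℝ) ≤ Y := by have := hD.hY; exact_mod_cast (by omega : d ≤ Y)
  have hYe : (1 : ℝ) ≤ (Y : ℝ) ^ e := one_le_pow₀ (by linarith)
  have main : ∀ a b, g.Act a b → ‖g.span.starProjection (toE a)‖ ≤ (Y : ℝ) ^ (e + 1) →
      LB (g.blk a) (g.blk b) (energy θ) Q (-Q) τ := by
    intro a b hab hP
    rcases le_or_gt (len a) N with hle | hlt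
    · exact near a b hle hab
    rcases le_or_gt |((a ⬝ᵥ a - b ⬝ᵥ b : ℤ) : ℝ)| T with hε | hε
    · have hNe : (Y : ℝ) ^ e ≤ N := le_trans (pow_le_pow_right₀ (by linarith) (by omega)) hN
      obtain ⟨c, a', t, hc, hce, ha, ht⟩ := he a (hNe.trans hlt.le)
      refine far c a a' b t hc hce (fun hmem => ?_) hlt ha ht hab hε
      have hc1 := one_le_len hc
      have h0 := len_nonneg a'
      have ht0 : (0 : ℝ) ≤ t := Nat.cast_nonneg t
      have e1 : (t : ℝ) ≤ (Y : ℝ) ^ (e + 1) + len a' := by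
        have h1 : g.span.starProjection (toE a)
            = g.span.starProjection (toE a') + (t : ℝ) • toE c := by
          rw [ha, toE_shift, map_add, map_smul, Submodule.starProjection_eq_self_iff.2 hmem]; simp
        have h2 : ‖(t : ℝ) • toE c‖ ≤ ‖g.span.starProjection (toE a)‖
            + ‖g.span.starProjection (toE a')‖ := by
          rw [h1]
          calc ‖(t : ℝ) • toE c‖ = ‖(g.span.starProjection (toE a') + (t : ℝ) • toE c)
              - g.span.starProjection (toE a')‖ := by rw [add_sub_cancel_left]
            _ ≤ _ := norm_sub_le _ _
        have h3 := g.span.norm_starProjection_apply_le (toE a')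
        rw [norm_smul, Real.norm_of_nonneg ht0] at h2
        change (t : ℝ) * len c ≤ _ at h2
        change _ ≤ len a' at h3
        nlinarith
      have e2 : len a' ≤ t / 2 := by nlinarith
      have e3 : len a ≤ len a' + t * len c := by
        rw [ha]
        refine (len_add_le _ _).trans ?_
        rw [len_smul]; simp
      have e4 : (t : ℝ) ≤ 2 * (Y : ℝ) ^ (e + 1) := by linarith
      have e5 : len a ≤ 4 * ((Y : ℝ) ^ (e + 1) * (Y : ℝ) ^ e) := by
        have : t * len c ≤ 2 * (Y : ℝ) ^ (e + 1) * (Y : ℝ) ^ e := by gcongr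
        have : (Y : ℝ) ^ (e + 1) ≤ (Y : ℝ) ^ (e + 1) * (Y : ℝ) ^ e :=
          le_mul_of_one_le_right (by positivity) hYe
        linarith
      have e6 : (Y : ℝ) ^ (2 * e + 3) = (Y : ℝ) ^ 2 * ((Y : ℝ) ^ (e + 1) * (Y : ℝ) ^ e) := by ring
      have e7 : (0 : ℝ) < (Y : ℝ) ^ (e + 1) * (Y : ℝ) ^ e := by positivity
      have e8 : 64 * ((Y : ℝ) ^ (e + 1) * (Y : ℝ) ^ e)
          ≤ (Y : ℝ) ^ 2 * ((Y : ℝ) ^ (e + 1) * (Y : ℝ) ^ e) :=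
        mul_le_mul_of_nonneg_right (by nlinarith) e7.le
      linarith
    · refine (LB_energy hg hop hab ?_).mono ?_ <;> linarith
  intro a b hab
  obtain ⟨z, hz, hle⟩ := exists_closure_near g.C (g.span.starProjection (toE a))
    (g.span.starProjection_apply_mem _)
  refine LB_shift hg huniv hinv hz hab (main _ _ ?_ ?_)
  · by_cases hC0 : g.C = []
    · have : z = 0 := by simpa [hC0] using hz
      simpa [this] using hab
    · rw [← Act.shift_iff (huniv hC0) (orth_closure hz), sub_add_cancel, sub_add_cancel]
      exact hab
  · rw [toE_sub, map_sub, Submodule.starProjection_eq_self_iff.2 (mem_span_closure hz)]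
    refine hle.trans ((sum_len_le hC).trans ?_)
    rw [pow_succ']
    exact mul_le_mul_of_nonneg_right ((Nat.cast_le (α := ℝ).2 hlen).trans hYd) (by linarith)

lemma Dom.next (hD : g.Dom S K T Y) (c : Lat d) : (g.next c).Dom S K T Y :=
  ⟨hD.hY, hD.h1, hD.h2, hD.h3, hD.h4, hD.h5⟩

lemma LB_far_next (hg : g.Good) (hS : g.Radius S) (hD : g.Dom S K T Y) (hT : 0 ≤ T)
    {θ τ τ' N : ℝ} {Q Q' : Ker d} (hτ : 0 < τ') (hτ1 : τ' ≤ 1) (hττ : τ ≤ τ' / 2)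
    (hN : (Y : ℝ) ^ (e + 3) / τ' ≤ N)
    (hc : c ≠ 0) (hce : len c ≤ (Y : ℝ) ^ e) (haN : N < len a) (ha : a = a' + (t : ℤ) • c)
    (ht : (Y : ℝ) * (len a' + len c + 1) ≤ t) (hab : g.Act a b)
    (hε : |((a ⬝ᵥ a - b ⬝ᵥ b : ℤ) : ℝ)| ≤ T)
    (hQ : ∀ a b, g.ρ ≤ len a → g.ρ ≤ len b → LipDomPos S c a b →
        wt c a b * ‖Q a b - Q' a b‖ ≤ K)
    (hLB : (g.next c).LBall θ Q' τ') : LB (g.blk a) (g.blk b) (energy θ) Q (-Q) τ := by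
  obtain ⟨hra, hrb, horth, hda, hdb⟩ := far_facts hg hS hD hT hc ha ht hab hε
  have hY8 : (8 : ℝ) ≤ Y := by have := hD.hY; exact_mod_cast (by omega : 8 ≤ Y)
  have hc1 := one_le_len hc
  have h1 := hLB a b ((hg.act_next_iff hra.1 hra.2 hrb.1 hrb.2).2 ⟨hab, horth⟩)
  rw [hg.blk_next hc hra.1 hra.2, hg.blk_next hc hrb.1 hrb.2] at h1
  have hNpos : 0 < N := lt_of_lt_of_le (by positivity) hN
  have hlen : ∀ x : Lat d, |len x - len a| ≤ g.Δ' + 2 * g.D → N / 2 ≤ len x := by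
    intro x hx
    have h3 : g.Δ' + 2 * g.D ≤ Y := by
      have := hD.h3
      have := hg.hD
      have := hg.hΔ'
      nlinarith
    have h4 : (Y : ℝ) ^ 3 ≤ N := by
      refine le_trans ?_ hN
      rw [le_div_iff₀ hτ]
      calc (Y : ℝ) ^ 3 * τ' ≤ (Y : ℝ) ^ 3 := mul_le_of_le_one_right (by positivity) hτ1
        _ ≤ _ := pow_le_pow_right₀ (by linarith) (by omega)
    have h5 : 2 * (Y : ℝ) ≤ (Y : ℝ) ^ 3 := by
      nlinarith [mul_le_mul hY8 hY8 (by norm_num) (by linarith)]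
    have := (abs_le.1 hx).1
    linarith
  have ent : ∀ x y, g.ρ ≤ len x → g.ρ ≤ len y → LipDomPos S c x y → N / 2 ≤ len x →
      ‖Q' x y - Q x y‖ ≤ τ' / (4 * Y) := by
    intro x y hx hy hd hxN
    have e1 := hQ x y hx hy hd
    rw [norm_sub_rev] at e1
    have e2 : N / 2 / (Y : ℝ) ^ e ≤ wt c x y := by
      have : N / 2 / (Y : ℝ) ^ e ≤ len x / len c :=
        div_le_div₀ (len_nonneg x) hxN (by linarith) hce
      have := le_max_left (len x / len c) (len y / len c)
      unfold wt; linarith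
    have e3 : 4 * (Y : ℝ) * K ≤ τ' * (N / 2 / (Y : ℝ) ^ e) := by
      rw [div_le_iff₀ hτ] at hN
      have h5 := hD.h5
      have : (Y : ℝ) ^ 3 / 2 ≤ τ' * (N / 2 / (Y : ℝ) ^ e) := by
        have e4 : τ' * (N / 2 / (Y : ℝ) ^ e) = N * τ' / 2 / (Y : ℝ) ^ e := by ring
        rw [e4, le_div_iff₀ (by positivity)]
        calc (Y : ℝ) ^ 3 / 2 * (Y : ℝ) ^ e = (Y : ℝ) ^ (e + 3) / 2 := by ring
          _ ≤ _ := by linarith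
      have e5 : 4 * (Y : ℝ) * K ≤ 4 * Y * Y := by gcongr
      have e6 : 4 * (Y : ℝ) * Y ≤ (Y : ℝ) ^ 3 / 2 := by nlinarith [sq_nonneg (Y : ℝ)]
      linarith
    rw [le_div_iff₀ (by positivity)]
    have h6 : 0 ≤ ‖Q' x y - Q x y‖ := norm_nonneg _
    have hw : 0 < wt c x y := wt_pos c x y
    have : ‖Q' x y - Q x y‖ * (4 * Y) * wt c x y ≤ τ' * wt c x y := by
      calc ‖Q' x y - Q x y‖ * (4 * Y) * wt c x y = 4 * Y * (wt c x y * ‖Q' x y - Q x y‖) := by ring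
        _ ≤ 4 * Y * K := by gcongr
        _ ≤ τ' * (N / 2 / (Y : ℝ) ^ e) := e3
        _ ≤ _ := by gcongr
    exact le_of_mul_le_mul_right this hw
  have hcard : ∀ a, ((g.blk a).card : ℝ) ≤ Y := fun a => (hg.card_blk a).trans hD.h4
  have hl := hg.act_len hab
  have len1 : ∀ x ∈ g.blk a, len x = len a := fun x hx => ((hg.mem_blk.1 hx).len_eq).symm
  have len2 : ∀ x ∈ g.blk b, len x = len b := fun x hx => ((hg.mem_blk.1 hx).len_eq).symm
  have hba : |len b - len a| ≤ g.Δ' + 2 * g.D := by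
    refine le_trans (abs_norm_sub_norm_le _ _) ?_
    rw [← toE_sub]; rw [len_sub_comm] at hl; exact hl
  have haa : |len a - len a| ≤ g.Δ' + 2 * g.D := by
    rw [sub_self, abs_zero]; exact (len_nonneg _).trans hl
  have o1 : OpOn (g.blk a) (Q' - Q) (Y * (τ' / (4 * Y))) :=
    opOn_of_entries (hcard a) (by positivity) fun x hx y hy =>
      ent x y (by rw [len1 x hx]; exact hra.2) (by rw [len1 y hy]; exact hra.2) (hda x hx y hy)
        (by rw [len1 x hx]; exact hlen a haa)
  have o2 : OpOn (g.blk b) (tr (-Q' - -Q)) (Y * (τ' / (4 * Y))) :=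
    opOn_tr_of_entries (hcard b) (by positivity) fun x hx y hy => by
      have := ent x y (by rw [len2 x hx]; exact hrb.2) (by rw [len2 y hy]; exact hrb.2)
        (hdb x hx y hy) (by rw [len2 x hx]; exact hlen b hba)
      rw [← norm_neg, neg_sub] at this
      rwa [Pi.sub_apply, Pi.sub_apply, Pi.neg_apply, Pi.neg_apply, Pi.neg_apply, Pi.neg_apply,
        neg_sub_neg]
  refine (h1.perturb o1 o2).mono ?_
  have : (Y : ℝ) * (τ' / (4 * Y)) = τ' / 4 := by field_simp
  rw [this]; linarith

lemma span_next (c : Lat d) : (g.next c).span = g.span ⊔ Submodule.span ℝ {toE c} := by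
  rw [span, span, ← Submodule.span_union]
  congr 1
  ext y
  simp [next, eq_comm]

lemma finrank_span_next (hc : toE c ∉ g.span) :
    Module.finrank ℝ g.span + 1 ≤ Module.finrank ℝ (g.next c).span := by
  refine Submodule.finrank_lt_finrank_of_lt (lt_of_le_of_ne (span_next c ▸ le_sup_left) fun h => hc ?_)
  rw [h, span_next]
  exact Submodule.mem_sup_right (Submodule.mem_span_singleton_self _)

lemma eq_zero_of_orth (h : d ≤ Module.finrank ℝ g.span) {x : Lat d}
    (hx : ∀ c ∈ g.C, x ⬝ᵥ c = 0) : x = 0 := by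
  have htop : g.span = ⊤ := Submodule.eq_top_of_finrank_eq
    (le_antisymm (Submodule.finrank_le _) (by rw [finrank_euclideanSpace_fin]; exact h))
  have h1 : ∀ y ∈ g.span, inner ℝ (toE x) y = (0 : ℝ) := by
    intro y hy
    induction hy using Submodule.span_induction with
    | mem y hy =>
      obtain ⟨c, hc, rfl⟩ := hy
      rw [inner_toE, hx c hc, Int.cast_zero]
    | zero => exact inner_zero_right _
    | add y z _ _ hy hz => rw [inner_add_right, hy, hz, add_zero]
    | smul r y _ hy => rw [inner_smul_right, hy, mul_zero]
  have h2 := h1 (toE x) (htop ▸ Submodule.mem_top)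
  rw [inner_self_eq_zero] at h2
  exact toE_injective (by rw [h2, toE_zero])

lemma LB_far_last (hg : g.Good) (hS : g.Radius S) (hD : g.Dom S K T Y) (hT : 0 ≤ T)
    {θ τ : ℝ} {Q : Ker d}
    (hc : c ≠ 0) (hspan : d ≤ Module.finrank ℝ (g.next c).span) (ha : a = a' + (t : ℤ) • c)
    (ht : (Y : ℝ) * (len a' + len c + 1) ≤ t) (hab : g.Act a b)
    (hε : |((a ⬝ᵥ a - b ⬝ᵥ b : ℤ) : ℝ)| ≤ T) (hθ : τ ≤ |θ|) :
    LB (g.blk a) (g.blk b) (energy θ) Q (-Q) τ := by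
  obtain ⟨hra, hrb, horth, -, -⟩ := far_facts hg hS hD hT hc ha ht hab hε
  obtain rfl : a = b := sub_eq_zero.1 <| eq_zero_of_orth hspan fun e he => by
    rcases List.mem_cons.1 he with rfl | he
    · exact horth
    · exact hab.2.2.1 e he
  have hblk : g.blk a = {a} := by
    ext x
    rw [← hg.blk_next hc hra.1 hra.2, (hg.next hc).mem_blk, Finset.mem_singleton]
    refine ⟨fun h => ?_, fun h => h ▸ Rel.refl _⟩
    exact (sub_eq_zero.1 (eq_zero_of_orth hspan fun e he => h.orth he)).symm
  intro X
  rw [hblk]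
  have e : hs {a} {a} (sylv {a} {a} (energy θ) Q (-Q) X) = |θ| * hs {a} {a} X := by
    rw [← Real.norm_eq_abs, ← Complex.norm_real, ← hs_smul]
    refine hs_congr fun x hx y hy => ?_
    rw [Finset.mem_singleton] at hx hy
    subst hx; subst hy
    simp [sylv, lprod, rprod, energy, mul_comm]
  rw [e]
  exact mul_le_mul_of_nonneg_right hθ (hs_nonneg _ _ _)

end Lev

lemma Fam.volume_step (hg : g.Good) (hD : g.Dom S K T Y) (he : Lev.NearRay d e Y)
    (hC : ∀ c ∈ g.C, len c ≤ (Y : ℝ) ^ e) (hlen : g.C.length ≤ d)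
    (h : Fam g U v S K Kop α KL r Q) (hKop : 0 ≤ Kop) (hT : 0 ≤ T)
    (hθ : Freq U v C₁ Kop α β KL T Y θ) {τ' : ℝ} (hτ : 0 < τ') (hτ1 : τ' ≤ 1) (W : Set (Par n))
    (far : ∀ ω ∈ U, ω ∉ W → ∀ (c a a' b : Lat d) (t : ℕ), c ≠ 0 → len c ≤ (Y : ℝ) ^ e →
      toE c ∉ g.span → (Y : ℝ) ^ (2 * e + 3) / τ' < len a → a = a' + (t : ℤ) • c →
      (Y : ℝ) * (len a' + len c + 1) ≤ t → g.Act a b → |((a ⬝ᵥ a - b ⬝ᵥ b : ℤ) : ℝ)| ≤ T →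
      LB (g.blk a) (g.blk b) (energy (θ ω)) (Q ω) (-Q ω) (τ' ^ (d + 1))) :
    volume {ω ∈ U | ¬ g.LBall (θ ω) (Q ω) (τ' ^ (d + 1))} ≤ volume W +
      (Y : ℝ≥0∞) ^ ((2 * e + 5) * d + 4) *
        (ballVol n C₁ * ENNReal.ofReal τ') := by
  have hY8 : (8 : ℝ) ≤ Y := by have := hD.hY; exact_mod_cast (by omega : 8 ≤ Y)
  set N : ℝ := (Y : ℝ) ^ (2 * e + 3) / τ' with hN
  have hNY : (Y : ℝ) ^ (2 * e + 3) ≤ N := by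
    rw [hN, le_div_iff₀ hτ]; exact mul_le_of_le_one_right (by positivity) hτ1
  have hN1 : 1 ≤ N := (one_le_pow₀ (by linarith)).trans hNY
  set R := g.Δ' + 2 * g.D with hR
  have hR0 : 0 ≤ R := by have := hg.hD; have := hg.hΔ'; linarith
  set V := ballVol n C₁ with hV
  set bad : Lat d → Lat d → Set (Par n) := fun a u => {ω ∈ U | g.Act a (a + u) ∧
    ¬ LB (g.blk a) (g.blk (a + u)) (energy (θ ω)) (Q ω) (-Q ω) (τ' ^ (d + 1))} with hbad
  have hsub : {ω ∈ U | ¬ g.LBall (θ ω) (Q ω) (τ' ^ (d + 1))} ⊆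
      W ∪ ⋃ a ∈ box d N, ⋃ u ∈ box d R, bad a u := by
    rintro ω ⟨hω, hn⟩
    by_contra hcon
    rw [Set.mem_union, not_or] at hcon
    obtain ⟨hW, hb⟩ := hcon
    refine hn (Lev.LBall_of_near_far hg hD he hC hlen h.univ (h.inv ω hω) (h.op ω hω)
      (hθ.le ω hω) hKop (pow_le_one₀ hτ.le hτ1) hNY (fun a b ha hab => ?_) (far ω hω hW))
    by_contra hL
    refine hb (Set.mem_biUnion (mem_box ha) (Set.mem_biUnion (mem_box (a := b - a) ?_) ⟨hω, ?_⟩))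
    · rw [len_sub_comm]; exact hg.act_len hab
    · rw [add_sub_cancel]; exact ⟨hab, hL⟩
  have hpair : ∀ a u, volume (bad a u) ≤
      (Y : ℝ≥0∞) ^ 4 * (V * ENNReal.ofReal (τ' ^ (d + 1))) := by
    intro a u
    by_cases hab : g.Act a (a + u)
    · refine (measure_mono ?_).trans (h.volume_pair_le hg hD hθ (pow_pos hτ _) hab.1 hab.2.1)
      exact fun ω hω => ⟨hω.1, hω.2.2⟩
    · have : bad a u = ∅ := by
        ext ω; simp [hbad, hab]
      rw [this, measure_empty]; exact bot_le
  have hcR : ((box d R).card : ℝ≥0∞) ≤ (Y : ℝ≥0∞) ^ d := by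
    have h1 : ((box d R).card : ℝ) ≤ (Y : ℝ) ^ d := by
      refine (card_box hR0).trans ?_
      gcongr
      have := hD.h3
      have := hg.hD
      have := hg.hΔ'
      nlinarith
    exact_mod_cast h1
  have hcN : ((box d N).card : ℝ≥0∞) * ENNReal.ofReal (τ' ^ (d + 1)) ≤
      (Y : ℝ≥0∞) ^ ((2 * e + 4) * d) * ENNReal.ofReal τ' := by
    rw [← ENNReal.ofReal_natCast, ← ENNReal.ofReal_natCast, ← ENNReal.ofReal_pow (by positivity),
      ← ENNReal.ofReal_mul (by positivity), ← ENNReal.ofReal_mul (by positivity)]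
    refine ENNReal.ofReal_le_ofReal ?_
    calc ((box d N).card : ℝ) * τ' ^ (d + 1) ≤ (3 * N) ^ d * τ' ^ (d + 1) := by
          gcongr
          refine (card_box (by linarith)).trans ?_
          gcongr; linarith
      _ = (3 * (Y : ℝ) ^ (2 * e + 3)) ^ d * τ' := by
          rw [pow_succ, ← mul_assoc, ← mul_pow, hN]
          congr 2
          field_simp
      _ ≤ ((Y : ℝ) ^ (2 * e + 4)) ^ d * τ' := by
          gcongr
          rw [pow_succ (Y : ℝ) (2 * e + 3), mul_comm]
          gcongr; linarith
      _ = _ := by rw [pow_mul]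
  refine (measure_mono hsub).trans ((measure_union_le _ _).trans (add_le_add le_rfl ?_))
  calc volume (⋃ a ∈ box d N, ⋃ u ∈ box d R, bad a u)
      ≤ ∑ a ∈ box d N, ∑ u ∈ box d R, volume (bad a u) :=
        (measure_biUnion_finset_le _ _).trans
          (Finset.sum_le_sum fun a _ => measure_biUnion_finset_le _ _)
    _ ≤ ∑ a ∈ box d N, ∑ u ∈ box d R, (Y : ℝ≥0∞) ^ 4 * (V * ENNReal.ofReal (τ' ^ (d + 1))) :=
        Finset.sum_le_sum fun a _ => Finset.sum_le_sum fun u _ => hpair a u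
    _ = ((box d R).card : ℝ≥0∞) * (Y : ℝ≥0∞) ^ 4 * V *
        (((box d N).card : ℝ≥0∞) * ENNReal.ofReal (τ' ^ (d + 1))) := by
        simp only [Finset.sum_const, nsmul_eq_mul]; ring
    _ ≤ (Y : ℝ≥0∞) ^ d * (Y : ℝ≥0∞) ^ 4 * V *
        ((Y : ℝ≥0∞) ^ ((2 * e + 4) * d) * ENNReal.ofReal τ') := by gcongr
    _ = _ := by ring

/-- A bound for the volume of the resonant sets at the levels with `d - r - 1` directions. -/
def VolBd (d e r E n : ℕ) : Prop := ∀ {g : Lev d} {U : Set (Par n)}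
    {v : Par n} {S K Kop α KL C₁ β T : ℝ} {Y : ℕ} {θ : Par n → ℝ} {Q : Par n → Ker d} {x : ℝ},
    g.Good → g.Radius S → g.Dom S K T Y → Lev.NearRay d e Y → 0 ≤ K → 0 ≤ Kop → 0 ≤ T →
    (∀ c ∈ g.C, len c ≤ (Y : ℝ) ^ e) → g.C.length + r + 1 = d →
    g.C.length ≤ Module.finrank ℝ g.span →
    Fam g U v S K Kop α KL r Q → Freq U v C₁ Kop α β KL T Y θ → 0 < x → x ≤ 1 / 2 →
    volume {ω ∈ U | ¬ g.LBall (θ ω) (Q ω) (x ^ ((d + 1) ^ (r + 1)))} ≤ (Y : ℝ≥0∞) ^ E *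
      (ballVol n C₁ * ENNReal.ofReal x)

theorem exists_volBd (d e r : ℕ) : ∃ E : ℕ, ∀ n, VolBd d e r E n := by
  induction r with
  | zero =>
    refine ⟨(2 * e + 5) * d + 5, ?_⟩
    intro n g U v S K Kop α KL C₁ β T Y θ Q x hg hS hD he hK hKop hT hC hlen hfin hQ hθ hx0 hx
    have hY8 : 8 ≤ Y := by have := hD.hY; omega
    have h1 := hQ.volume_step hg hD he hC (by omega) hKop hT hθ hx0 (by linarith)
      {ω ∈ U | |θ ω| < x} (fun ω hω hW c a a' b t hc _ hcs _ ha ht hab hε => by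
        refine Lev.LB_far_last hg hS hD hT hc ?_ ha ht hab hε ?_
        · have := Lev.finrank_span_next hcs
          omega
        · have : ¬ |θ ω| < x := fun h => hW ⟨hω, h⟩
          refine le_trans ?_ (not_lt.1 this)
          exact pow_le_of_le_one hx0.le (by linarith) (by omega))
    rw [zero_add, pow_one]
    refine h1.trans ((add_le_add (hθ.volume_le hY8 hx0) le_rfl).trans ?_)
    rw [← add_mul]
    gcongr
    have : Y ^ 4 + Y ^ ((2 * e + 5) * d + 4) ≤ Y ^ ((2 * e + 5) * d + 5) := by
      have h2 : Y ^ 4 ≤ Y ^ ((2 * e + 5) * d + 4) := Nat.pow_le_pow_right (by omega) (by omega)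
      have h3 := Nat.mul_le_mul_left (Y ^ ((2 * e + 5) * d + 4)) hY8
      rw [pow_succ Y (_ + 4)]
      omega
    exact_mod_cast this
  | succ r ih =>
    obtain ⟨E, ih⟩ := ih
    refine ⟨(2 * e + 5) * d + 5 + (e + 1) * d + E, ?_⟩
    intro n g U v S K Kop α KL C₁ β T Y θ Q x hg hS hD he hK hKop hT hC hlen hfin hQ hθ hx0 hx
    have hY8 : 8 ≤ Y := by have := hD.hY; omega
    have hY8' : (8 : ℝ) ≤ Y := by exact_mod_cast hY8
    set τ' := x ^ ((d + 1) ^ (r + 1)) with hτ'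
    have hτ0 : 0 < τ' := pow_pos hx0 _
    have hτx : τ' ≤ x := pow_le_of_le_one hx0.le (by linarith) (by positivity)
    have hττ : τ' ^ (d + 1) ≤ τ' / 2 := by
      have hd : 1 ≤ d := by omega
      have : τ' ^ d ≤ τ' := pow_le_of_le_one hτ0.le (by linarith) (by omega)
      rw [pow_succ]
      nlinarith
    have hn : ∀ c : Lat d, ∃ Q' : Par n → Ker d, c ≠ 0 →
        Fam (g.next c) U v S K Kop α KL r Q' ∧
        ∀ ω ∈ U, ∀ a b, g.ρ ≤ len a → g.ρ ≤ len b → LipDomPos S c a b →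
          wt c a b * ‖Q ω a b - Q' ω a b‖ ≤ K := fun c => by
      by_cases hc : c = 0
      · exact ⟨0, fun h => absurd hc h⟩
      · obtain ⟨Q', h⟩ := hQ.next hg hc
        exact ⟨Q', fun _ => h⟩
    choose Q' hQ' using hn
    set V := ballVol n C₁ with hV
    set bad : Lat d → Set (Par n) := fun c => {ω ∈ U | (c ≠ 0 ∧ len c ≤ (Y : ℝ) ^ e ∧
      toE c ∉ g.span) ∧ ¬ (g.next c).LBall (θ ω) (Q' c ω) τ'} with hbad
    have h1 := hQ.volume_step hg hD he hC (by omega) hKop hT hθ hτ0 (by linarith)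
      (⋃ c ∈ box d ((Y : ℝ) ^ e), bad c) (fun ω hω hW c a a' b t hc hce hcs haN ha ht hab hε => by
        refine Lev.LB_far_next (T := T) hg hS hD hT hτ0 (by linarith) hττ ?_ hc hce haN ha ht
          hab hε ((hQ' c hc).2 ω hω) ?_
        · exact div_le_div_of_nonneg_right (pow_le_pow_right₀ (by linarith) (by omega)) hτ0.le
        · by_contra hcon
          exact hW (Set.mem_biUnion (mem_box hce) ⟨hω, ⟨hc, hce, hcs⟩, hcon⟩))
    have e1 : x ^ ((d + 1) ^ (r + 1 + 1)) = τ' ^ (d + 1) := by rw [hτ', ← pow_mul, ← pow_succ]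
    rw [e1]
    have h2 : ∀ c, volume (bad c) ≤ (Y : ℝ≥0∞) ^ E * (V * ENNReal.ofReal x) := by
      intro c
      by_cases hc : c ≠ 0 ∧ len c ≤ (Y : ℝ) ^ e ∧ toE c ∉ g.span
      · have hs : bad c ⊆ {ω ∈ U | ¬ (g.next c).LBall (θ ω) (Q' c ω) τ'} :=
          fun ω hω => ⟨hω.1, hω.2.2⟩
        refine (measure_mono hs).trans
          (ih n (hg.next hc.1) (hS.next c) (hD.next c) he hK hKop hT
            ?_ ?_ ?_ (hQ' c hc.1).1 hθ hx0 hx)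
        · intro c' hc'
          rcases List.mem_cons.1 hc' with rfl | hc'
          · exact hc.2.1
          · exact hC c' hc'
        · simp only [Lev.next, List.length_cons]; omega
        · have := Lev.finrank_span_next hc.2.2
          simp only [Lev.next, List.length_cons] at this ⊢; omega
      · have : bad c = ∅ := by
          ext ω; simp only [hbad, Set.mem_ofPred_eq, Set.mem_empty_iff_false, iff_false]; tauto
        rw [this, measure_empty]; exact bot_le
    have hcard : ((box d ((Y : ℝ) ^ e)).card : ℝ≥0∞) ≤ (Y : ℝ≥0∞) ^ ((e + 1) * d) := by
      have h3 : ((box d ((Y : ℝ) ^ e)).card : ℝ) ≤ (Y : ℝ) ^ ((e + 1) * d) := by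
        refine (card_box (by positivity)).trans ?_
        rw [pow_mul]
        gcongr
        have : (1 : ℝ) ≤ (Y : ℝ) ^ e := one_le_pow₀ (by linarith)
        rw [pow_succ]; nlinarith
      exact_mod_cast h3
    have h4 : volume (⋃ c ∈ box d ((Y : ℝ) ^ e), bad c) ≤
        (Y : ℝ≥0∞) ^ ((e + 1) * d) * ((Y : ℝ≥0∞) ^ E * (V * ENNReal.ofReal x)) := by
      refine (measure_biUnion_finset_le _ _).trans ((Finset.sum_le_sum fun c _ => h2 c).trans ?_)
      rw [Finset.sum_const, nsmul_eq_mul]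
      gcongr
    refine h1.trans ((add_le_add h4 (mul_le_mul_right
      (mul_le_mul_right (ENNReal.ofReal_le_ofReal hτx) _) _)).trans ?_)
    rw [← mul_assoc, ← pow_add, ← add_mul]
    gcongr
    have : Y ^ ((e + 1) * d + E) + Y ^ ((2 * e + 5) * d + 4)
        ≤ Y ^ ((2 * e + 5) * d + 5 + (e + 1) * d + E) := by
      have h5 : Y ^ ((e + 1) * d + E) ≤ Y ^ ((2 * e + 5) * d + 4 + (e + 1) * d + E) :=
        Nat.pow_le_pow_right (by omega) (by omega)
      have h6 : Y ^ ((2 * e + 5) * d + 4) ≤ Y ^ ((2 * e + 5) * d + 4 + (e + 1) * d + E) :=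
        Nat.pow_le_pow_right (by omega) (by omega)
      have h7 : (2 * e + 5) * d + 5 + (e + 1) * d + E = (2 * e + 5) * d + 4 + (e + 1) * d + E + 1 := by
        ring
      have h8 := Nat.mul_le_mul_left (Y ^ ((2 * e + 5) * d + 4 + (e + 1) * d + E)) hY8
      rw [h7, pow_succ Y ((2 * e + 5) * d + 4 + (e + 1) * d + E)]
      omega
    exact_mod_cast this

end Fam

/-! ### Iterated Lipschitz bounds for the solutions -/

section Iterated

variable {d : ℕ} {p : Prop} {c : Lat d} {f Q s : Ker d}

namespace Lev

/-- Iterated limits of a kernel, with block bounds at all levels if `p` holds. -/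
def BlkReg (p : Prop) (γ S Mb Ml : ℝ) : ℕ → Lev d → Ker d → Prop
  | 0, g, f => p → g.Bd γ Mb f
  | m + 1, g, f => (p → g.Bd γ Mb f) ∧ ∀ c : Lat d, c ≠ 0 → ∃ f', HasLim c f f' ∧
      (p → g.LipBd γ S Ml c f f') ∧ BlkReg p γ S Mb Ml m (g.next c) f'

lemma BlkReg.bd {γ S Mb Ml : ℝ} {m : ℕ} {g : Lev d}
    (h : BlkReg p γ S Mb Ml m g f) : p → g.Bd γ Mb f := by
  cases m with
  | zero => exact h
  | succ m => exact h.1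

end Lev

/-- Iterated limits of a kernel that is concentrated near the diagonal, with pointwise bounds at
all levels if `p` holds. -/
def PtReg (p : Prop) (γ S M : ℝ) : ℕ → Set (Lat d) → Ker d → Prop
  | 0, L, s => p → ∀ a ∈ L, ∀ b ∈ L, ‖s a b‖ ≤ M * Real.exp (-γ * len (a - b))
  | m + 1, L, s => (p → ∀ a ∈ L, ∀ b ∈ L, ‖s a b‖ ≤ M * Real.exp (-γ * len (a - b))) ∧
      (∀ c : Lat d, c ≠ 0 → ∀ a b,
        Tendsto (fun t : ℕ => s (a + (t : ℤ) • c) (b - (t : ℤ) • c)) atTop (𝓝 0)) ∧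
      ∀ c : Lat d, c ≠ 0 → ∃ s', HasLim c s s' ∧
        (p → ∀ a ∈ L, ∀ b ∈ L, LipDomPos S c a b →
          wt c a b * ‖s a b - s' a b‖ ≤ M * Real.exp (-γ * len (a - b))) ∧
        PtReg p γ S M m Set.univ s'

namespace Lev

variable {g : Lev d}

lemma lipOp_of_entries (hg : g.Good) {S₀ K : ℝ} (hS : g.Radius S₀) (hc : c ≠ 0)
    (hK : 0 ≤ K) {Q Q' : Ker d}
    (h : ∀ a b, g.ρ ≤ len a → g.ρ ≤ len b → LipDomPos S₀ c a b →
      wt c a b * ‖Q a b - Q' a b‖ ≤ K) :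
    g.LipOp (S₀ + g.D + 2) (2 * (3 * g.D) ^ d * K) c Q Q' := by
  intro a b hab hdom
  have hD := hg.hD
  have hΔ := hg.hΔ'
  have hS0 : 0 ≤ S₀ := by have := hS.big; nlinarith
  have hc1 := one_le_len hc
  have hS' : g.Radius (S₀ + g.D + 2) := ⟨by linarith [hS.big], by linarith [hS.rho]⟩
  obtain ⟨hra, hrb⟩ := hS'.rigid hg hc hdom
  obtain ⟨a', b', t, ha, hb⟩ := lipDomPos_iff.1 hdom
  have hl := hg.act_len hab
  have key : ∀ u v u' : Lat d, OnRay (S₀ + g.D + 2) c u u' t → g.ρ ≤ len u →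
      len v ≤ len u + (g.Δ' + 2 * g.D) → wt c a b = max (len u / len c) (len v / len c) + 1 →
      ∀ x ∈ g.blk u, ∀ y ∈ g.blk u, ‖(Q - Q') x y‖ ≤ 2 * K / wt c a b := by
    intro u v u' hu hρ hv hw x hx y hy
    have hx' := hg.mem_blk.1 hx
    have hy' := hg.mem_blk.1 hy
    have e1 := h x y (hx'.len_eq ▸ hρ) (hy'.len_eq ▸ hρ) (lipDomPos_iff.2 ⟨_, _, t,
      hu.near hc hS0 (by linarith) hx'.len_eq.symm (hg.hdiam _ _ hx'),
      hu.near hc hS0 (by linarith) hy'.len_eq.symm (hg.hdiam _ _ hy')⟩)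
    rw [wt_congr hx'.len_eq.symm hy'.len_eq.symm, wt, max_self] at e1
    have hpos : 0 < wt c a b := wt_pos c a b
    have hL : g.Δ' + 2 * g.D ≤ len u := by
      have h1 := hu.large
      rw [le_div_iff₀ (by linarith)] at h1
      have := hS.big
      nlinarith
    have e2 : wt c a b ≤ 2 * (len u / len c + 1) := by
      rw [hw]
      have : len v / len c ≤ 2 * (len u / len c) := by
        rw [← mul_div_assoc]
        gcongr; linarith
      have h0 : 0 ≤ len u / len c := div_nonneg (len_nonneg _) (len_nonneg _)
      have := max_le (by linarith : len u / len c ≤ 2 * (len u / len c)) this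
      linarith
    rw [le_div_iff₀ hpos]
    calc ‖(Q - Q') x y‖ * wt c a b ≤ ‖(Q - Q') x y‖ * (2 * (len u / len c + 1)) := by gcongr
      _ = 2 * ((len u / len c + 1) * ‖Q x y - Q' x y‖) := by
        rw [Pi.sub_apply, Pi.sub_apply]; ring
      _ ≤ 2 * K := by gcongr
  have h0 : 0 ≤ 2 * K / wt c a b :=
    div_nonneg (by linarith) (wt_pos c a b |>.le)
  have e : 2 * (3 * g.D) ^ d * K / wt c a b = (3 * g.D) ^ d * (2 * K / wt c a b) := by ring
  have hlen : len b ≤ len a + (g.Δ' + 2 * g.D) := by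
    have := len_sub_le a (a - b)
    rw [sub_sub_cancel] at this; linarith
  have hlen' : len a ≤ len b + (g.Δ' + 2 * g.D) := by
    have := len_add_le b (a - b)
    rw [add_sub_cancel] at this; linarith
  rw [e]
  refine ⟨opOn_of_entries (hg.card_blk a) h0 (key a b a' ha hra.2 hlen rfl),
    opOn_tr_of_entries (hg.card_blk b) h0 (key b a b' hb hrb.2 hlen' ?_)⟩
  rw [wt, max_comm]

lemma LipBd.mono {γ S M M' : ℝ} {f f' : Ker d} (h : g.LipBd γ S M c f f')
    (hM : M ≤ M') : g.LipBd γ S M' c f f' := fun a b hab hd ho =>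
  (h a b hab hd ho).trans (mul_le_mul_of_nonneg_right hM (Real.exp_pos _).le)

lemma IsSol.zero_of_far (hg : g.Good) {θ : ℝ} (h : g.IsSol θ Q f s)
    (hc : c ≠ 0) (a b : Lat d) :
    Tendsto (fun t : ℕ => s (a + (t : ℤ) • c) (b - (t : ℤ) • c)) atTop (𝓝 0) := by
  refine tendsto_const_nhds.congr' ?_
  filter_upwards [(tendsto_len_shift (a - b) (c := (2 : ℤ) • c) (smul_ne_zero two_ne_zero hc)).eventually_gt_atTop
    (g.Δ' + 2 * g.D)] with t ht
  refine (h.zero _ _ fun hab => ?_).symm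
  have := hg.act_len hab
  have e : a + (t : ℤ) • c - (b - (t : ℤ) • c) = a - b + (t : ℤ) • ((2 : ℤ) • c) := by
    rw [smul_comm, two_smul]; abel
  rw [e] at this
  linarith

/-- The solution of the equation has iterated limits and inherits the bounds of the right hand
side. -/
lemma IsSol.reg {θ κ γ S₀ S K E Kop Mb Ml M : ℝ} (hκ : 0 < κ) (hK : 0 ≤ K)
    (hMb : 0 ≤ Mb) (m : ℕ) (hM1 : κ⁻¹ * (Ml + 2 * E * (κ⁻¹ * Mb)) ≤ M) (hM2 : 16 * Mb ≤ M)
    (hM3 : κ⁻¹ * Mb ≤ M) (hg : g.Good) (hS : g.Radius S₀)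
    (hSS : S = S₀ + g.D + 2) (hE : E = 2 * (3 * g.D) ^ d * K) (hθ : |θ| + 2 * Kop ≤ S)
    (hLB : g.LBall θ Q κ) (hop : g.OpBlk Q Kop) (hQ : SReg g.ρ S₀ K m Q)
    (hf : BlkReg p γ S Mb Ml m g f) (h : g.IsSol θ Q f s) :
    BlkReg p γ S (κ⁻¹ * Mb) (κ⁻¹ * (Ml + 2 * E * (κ⁻¹ * Mb))) m g s ∧ PtReg p γ S M m g.L s := by
  have hM0 : 0 ≤ M := by linarith
  have pt : ∀ {g : Lev d} {Q f s : Ker d}, g.Good → g.LBall θ Q κ → g.IsSol θ Q f s →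
      g.Bd γ Mb f → ∀ a ∈ g.L, ∀ b ∈ g.L, ‖s a b‖ ≤ M * Real.exp (-γ * len (a - b)) := by
    intro g Q f s hg hLB h hf a _ b _
    by_cases hab : g.Act a b
    · refine (norm_le_hs s (hg.self_mem_blk a) (hg.self_mem_blk b)).trans
        ((Bd.sol hg hκ hLB h hf a b hab).trans ?_)
      exact mul_le_mul_of_nonneg_right hM3 (Real.exp_pos _).le
    · rw [h.zero a b hab, norm_zero]; positivity
  induction m generalizing g Q f s with
  | zero => exact ⟨fun hp => Bd.sol hg hκ hLB h (hf hp), fun hp => pt hg hLB h (hf hp)⟩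
  | succ m ih =>
    have hstep : ∀ c : Lat d, c ≠ 0 → ∃ s', HasLim c s s' ∧
        (p → g.LipBd γ S (κ⁻¹ * (Ml + 2 * E * (κ⁻¹ * Mb))) c s s') ∧
        (p → ∀ a b, LipDomPos S c a b →
          wt c a b * ‖s a b - s' a b‖ ≤ M * Real.exp (-γ * len (a - b))) ∧
        BlkReg p γ S (κ⁻¹ * Mb) (κ⁻¹ * (Ml + 2 * E * (κ⁻¹ * Mb))) m (g.next c) s' ∧
        PtReg p γ S M m Set.univ s' := by
      intro c hc
      obtain ⟨f', hff', hlip, hf'⟩ := hf.2 c hc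
      obtain ⟨Q', hQQ', hQlip, hQ'⟩ := hQ c hc
      have hLB' := hLB.next hg hc hQQ'
      obtain ⟨s', hs'⟩ := exists_isSol (hg.next hc) hκ hLB' f'
      have hS' : g.Radius S := ⟨by rw [hSS]; linarith [hS.big, hg.hD],
        by rw [hSS]; linarith [hS.rho, hg.hD]⟩
      have hlipQ : g.LipOp S E c Q Q' := by
        rw [hSS, hE]; exact lipOp_of_entries hg hS hc hK hQlip
      have hE0 : 0 ≤ E := by have := hg.hD; rw [hE]; positivity
      have hsl : p → g.LipBd γ S (κ⁻¹ * (Ml + 2 * E * (κ⁻¹ * Mb))) c s s' := fun hp =>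
        LipBd.sol hg hc hκ hS' hLB h hs' hlipQ (hlip hp)
          (Bd.sol (hg.next hc) hκ hLB' hs' (hf'.bd hp)) hE0
      refine ⟨s', h.hasLim hg hc hκ hLB hop hQQ' hff' hs', hsl, fun hp a b hdom => ?_, ?_⟩
      · exact IsSol.lip hg hc hS' hop hθ h hs' (hf.1 hp) ((hsl hp).mono hM1) hM2 hM0 a b hdom
      · exact ih (hg.next hc) (hS.next c) hSS hE hLB' (hop.next hg hc hQQ') hQ' hf' hs'
    refine ⟨⟨fun hp => Bd.sol hg hκ hLB h (hf.1 hp), fun c hc => ?_⟩,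
      fun hp => pt hg hLB h (hf.1 hp), fun c hc => h.zero_of_far hg hc, fun c hc => ?_⟩
    · obtain ⟨s', h1, h2, -, h4, -⟩ := hstep c hc
      exact ⟨s', h1, h2, h4⟩
    · obtain ⟨s', h1, -, h3, -, h5⟩ := hstep c hc
      exact ⟨s', h1, fun hp a _ b _ => h3 hp a b, h5⟩

lemma BlkReg.dRhs {γ S₀ S K E Kop N η Mb Ml Sb Sl : ℝ} (hK : 0 ≤ K) (hη : |η| ≤ N)
    (m : ℕ) {P f s : Ker d} (hg : g.Good) (hS : g.Radius S₀)
    (hSS : S = S₀ + g.D + 2) (hE : E = 2 * (3 * g.D) ^ d * K)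
    (hop : g.OpBlk P Kop) (hP : SReg g.ρ S₀ K m P)
    (hf : BlkReg p γ S Mb Ml m g f) (hs : BlkReg p γ S Sb Sl m g s) :
    BlkReg p γ S (Mb + (N + 2 * Kop) * Sb) (Ml + (N + 2 * Kop) * Sl + 2 * E * Sb) m g
      (g.dRhs η P f s) := by
  induction m generalizing g P f s with
  | zero => exact fun hp => Bd.dRhs hg hop (hf hp) (hs hp) hη
  | succ m ih =>
    refine ⟨fun hp => Bd.dRhs hg hop (hf.1 hp) (hs.1 hp) hη, fun c hc => ?_⟩
    obtain ⟨f', hff', hfl, hf'⟩ := hf.2 c hc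
    obtain ⟨s', hss', hsl, hs'⟩ := hs.2 c hc
    obtain ⟨P', hPP', hPl, hP'⟩ := hP c hc
    have hS' : g.Radius S := ⟨by rw [hSS]; linarith [hS.big, hg.hD],
      by rw [hSS]; linarith [hS.rho, hg.hD]⟩
    have hlipP : g.LipOp S E c P P' := by
      rw [hSS, hE]; exact lipOp_of_entries hg hS hc hK hPl
    have hE0 : 0 ≤ E := by have := hg.hD; rw [hE]; positivity
    exact ⟨_, hasLim_dRhs hg hc hPP' hff' hss',
      fun hp => LipBd.dRhs hg hc hS' hop hlipP (hfl hp) (hsl hp) (hs'.bd hp) hE0 hη,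
      ih (hg.next hc) (hS.next c) hSS hE (hop.next hg hc hPP') hP' hf' hs'⟩

lemma blkReg_of_entries {γ S₀ S M : ℝ} (hγ : 0 ≤ γ) (hM : 0 ≤ M) (m : ℕ)
    (hg : g.Good) (hS0 : 0 ≤ S₀) (hSS : S = S₀ + g.D + 2)
    (hf : PtReg p γ S₀ M m g.L f) :
    BlkReg p γ S ((3 * g.D) ^ d * (Real.exp (2 * γ * g.D) * M))
      ((3 * g.D) ^ d * (Real.exp (2 * γ * g.D) * M)) m g f := by
  have hexp : ∀ {g : Lev d}, g.Good → ∀ {a b x y : Lat d}, x ∈ g.blk a → y ∈ g.blk b →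
      M * Real.exp (-γ * len (x - y))
        ≤ Real.exp (2 * γ * g.D) * M * Real.exp (-γ * len (a - b)) := by
    intro g hg a b x y hx hy
    have e1 := hg.hdiam _ _ (hg.mem_blk.1 hx)
    have e2 := hg.hdiam _ _ (hg.mem_blk.1 hy)
    rw [mul_comm (Real.exp _) M, mul_assoc, ← Real.exp_add]
    gcongr
    have : len (a - b) ≤ len (x - y) + 2 * g.D := by
      have e : a - b = (a - x) + (x - y) - (b - y) := by abel
      rw [e]
      linarith [len_sub_le ((a - x) + (x - y)) (b - y), len_add_le (a - x) (x - y)]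
    nlinarith
  have bd : ∀ {g : Lev d} {f : Ker d}, g.Good →
      (∀ a ∈ g.L, ∀ b ∈ g.L, ‖f a b‖ ≤ M * Real.exp (-γ * len (a - b))) →
      g.Bd γ ((3 * g.D) ^ d * (Real.exp (2 * γ * g.D) * M)) f := by
    intro g f hg h a b hab
    rw [mul_assoc]
    refine hs_le_card (hg.card_blk a) (hg.card_blk b) (by positivity) fun x hx y hy => ?_
    exact (h x ((hg.mem_blk.1 hx).mem hab.1) y ((hg.mem_blk.1 hy).mem hab.2.1)).trans (hexp hg hx hy)
  induction m generalizing g f with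
  | zero => exact fun hp => bd hg (hf hp)
  | succ m ih =>
    refine ⟨fun hp => bd hg (hf.1 hp), fun c hc => ?_⟩
    obtain ⟨f', hff', hlip, hf'⟩ := hf.2.2 c hc
    refine ⟨f', hff', fun hp a b hab hdom _ => ?_, ih (hg.next hc) hSS hf'⟩
    have hw : 0 < wt c a b := wt_pos c a b
    rw [← le_div_iff₀' hw, mul_assoc, mul_div_assoc]
    refine hs_le_card (hg.card_blk a) (hg.card_blk b) (by positivity) fun x hx y hy => ?_
    have hx' := hg.mem_blk.1 hx
    have hy' := hg.mem_blk.1 hy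
    rw [le_div_iff₀' hw, ← wt_congr hx'.len_eq.symm hy'.len_eq.symm]
    obtain ⟨a', b', t, ha, hb⟩ := lipDomPos_iff.1 hdom
    rw [hSS] at ha hb
    have hD := hg.hD
    refine (hlip hp x (hx'.mem hab.1) y (hy'.mem hab.2.1) (lipDomPos_iff.2 ⟨_, _, t,
      ha.near hc hS0 (by linarith) hx'.len_eq.symm (hg.hdiam _ _ hx'),
      hb.near hc hS0 (by linarith) hy'.len_eq.symm (hg.hdiam _ _ hy')⟩)).trans (hexp hg hx hy)

end Lev
end Iterated

/-! ### The equation with the sum of the energies -/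

section Plus

variable {d n : ℕ} {s P : Ker d} {a b x : Lat d} {θ κ K : ℝ}

/-- The sum `θ + |a|² + |b|²`. -/
def energyP (θ : ℝ) : Ker d := fun a b => (θ : ℂ) + ((a ⬝ᵥ a + b ⬝ᵥ b : ℤ) : ℂ)

lemma tr_sylv (A B : Finset (Lat d)) (θ : ℝ) (M N X : Ker d) :
    tr (sylv A B (energyP θ) M N X) = sylv B A (energyP θ) (tr N) (tr M) (tr X) := by
  funext a b
  simp only [tr, sylv, lprod, rprod, energyP, add_comm (a ⬝ᵥ a)]
  simp only [mul_comm (X _ _)]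
  ring

/-- Iterated limits of a kernel that is concentrated near the antidiagonal: all of them vanish. -/
structure AntiReg (p : Prop) (γ S M : ℝ) (L : Set (Lat d)) (s : Ker d) : Prop where
  bd : p → ∀ a ∈ L, ∀ b ∈ L, ‖s a b‖ ≤ M * Real.exp (-γ * len (a + b))
  lip : p → ∀ c : Lat d, c ≠ 0 → ∀ a ∈ L, ∀ b ∈ L, LipDomPos S c a (-b) →
    wt c a b * ‖s a b‖ ≤ M * Real.exp (-γ * len (a + b))
  lim : ∀ (ε : ℤˣ) (c : Lat d), c ≠ 0 → ∀ a b,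
    Tendsto (fun t : ℕ => s (a + (t : ℤ) • c) (b + ((ε : ℤ) * (t : ℤ)) • c)) atTop (𝓝 0)

lemma AntiReg.zero (p : Prop) (γ S M : ℝ) (hM : 0 ≤ M) (L : Set (Lat d)) :
    AntiReg p γ S M L (0 : Ker d) := by
  refine ⟨fun _ a _ b _ => ?_, fun _ c _ a _ b _ _ => ?_, fun _ _ _ _ _ => tendsto_const_nhds⟩
  · simp only [Pi.zero_apply, norm_zero]; positivity
  · simp only [Pi.zero_apply, norm_zero, mul_zero]; positivity

namespace Lev

variable (g : Lev d)

/-- Uniform lower bounds on all pairs of blocks. -/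
def LBallP (θ : ℝ) (Q : Ker d) (κ : ℝ) : Prop :=
  ∀ a ∈ g.L, ∀ b ∈ g.L, LB (g.blk a) (g.blk b) (energyP θ) Q (tr Q) κ

/-- Solutions of the equation with the sum of the energies. -/
structure IsSolP (θ : ℝ) (Q f s : Ker d) : Prop where
  eq : ∀ a ∈ g.L, ∀ b ∈ g.L, sylv (g.blk a) (g.blk b) (energyP θ) Q (tr Q) s a b = f a b
  zero : ∀ a b, ¬ (a ∈ g.L ∧ b ∈ g.L) → s a b = 0

/-- The anticommutator with `P`. -/
def acomm (P s : Ker d) : Ker d := fun a b =>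
  lprod (g.blk a) P s a b + rprod (g.blk b) s (tr P) a b

/-- The right hand side of the differentiated equation. -/
def dRhsP (η : ℝ) (P f s : Ker d) : Ker d := f - (η : ℂ) • s - g.acomm P s

/-- Block bounds with decay in `|a + b|`. -/
def BdP (γ M : ℝ) (f : Ker d) : Prop :=
  ∀ a ∈ g.L, ∀ b ∈ g.L, hs (g.blk a) (g.blk b) f ≤ M * Real.exp (-γ * len (a + b))

variable {g}

lemma mem_of_blk (hg : g.Good) (ha : a ∈ g.L) (hx : x ∈ g.blk a) : x ∈ g.L :=
  (hg.mem_blk.1 hx).mem ha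

lemma blk_of_mem (hg : g.Good) (hx : x ∈ g.blk a) : g.blk x = g.blk a :=
  hg.blk_eq (hg.mem_blk.1 hx)

lemma IsSolP.eq_on (hg : g.Good) {Q f s : Ker d} (h : g.IsSolP θ Q f s)
    (ha : a ∈ g.L) (hb : b ∈ g.L) : ∀ x ∈ g.blk a, ∀ y ∈ g.blk b,
      sylv (g.blk a) (g.blk b) (energyP θ) Q (tr Q) s x y = f x y := fun x hx y hy => by
  rw [← h.eq x (mem_of_blk hg ha hx) y (mem_of_blk hg hb hy), blk_of_mem hg hx, blk_of_mem hg hy]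

lemma exists_isSolP (hg : g.Good) {Q : Ker d} (hκ : 0 < κ) (h : g.LBallP θ Q κ)
    (f : Ker d) : ∃ s, g.IsSolP θ Q f s := by
  classical
  have h0 : ∀ A B : Finset (Lat d), ∃ X : Ker d, LB A B (energyP θ) Q (tr Q) κ →
      ∀ x ∈ A, ∀ y ∈ B, sylv A B (energyP θ) Q (tr Q) X x y = f x y := fun A B => by
    by_cases hL : LB A B (energyP θ) Q (tr Q) κ
    · obtain ⟨X, hX⟩ := hL.exists_sol hκ f
      exact ⟨X, fun _ => hX⟩
    · exact ⟨0, fun h => absurd h hL⟩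
  choose X hX using h0
  refine ⟨fun a b => if a ∈ g.L ∧ b ∈ g.L then X (g.blk a) (g.blk b) a b else 0, ?_, ?_⟩
  · intro a ha b hb
    rw [← hX _ _ (h a ha b hb) a (hg.self_mem_blk a) b (hg.self_mem_blk b)]
    refine sylv_congr (hg.self_mem_blk a) (hg.self_mem_blk b) (fun _ _ _ _ => rfl)
      (fun _ _ _ _ => rfl) (fun _ _ _ _ => rfl) fun x hx y hy => ?_
    rw [if_pos ⟨mem_of_blk hg ha hx, mem_of_blk hg hb hy⟩, blk_of_mem hg hx, blk_of_mem hg hy]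
  · intro a b hab
    rw [if_neg hab]

lemma IsSolP.hs_le (hg : g.Good) {Q f s : Ker d} (h : g.IsSolP θ Q f s) (hκ : 0 < κ)
    (ha : a ∈ g.L) (hb : b ∈ g.L)
    (hLB : LB (g.blk a) (g.blk b) (energyP θ) Q (tr Q) κ) :
    hs (g.blk a) (g.blk b) s ≤ κ⁻¹ * hs (g.blk a) (g.blk b) f :=
  (hLB.hs_le hκ s).trans_eq (by rw [hs_congr (h.eq_on hg ha hb)])

lemma IsSolP.symm (hg : g.Good) {Q f s : Ker d} (h : g.IsSolP θ Q f s) (hκ : 0 < κ)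
    (hLB : g.LBallP θ Q κ) (hf : ∀ a ∈ g.L, ∀ b ∈ g.L, f a b = f b a) (a b : Lat d) :
    s a b = s b a := by
  by_cases hab : a ∈ g.L ∧ b ∈ g.L
  · obtain ⟨ha, hb⟩ := hab
    have h1 := (hLB a ha b hb).hs_le hκ (s - tr s)
    have h2 : hs (g.blk a) (g.blk b) (sylv (g.blk a) (g.blk b) (energyP θ) Q (tr Q) (s - tr s))
        = 0 := by
      rw [← hs_zero (g.blk a) (g.blk b)]
      refine hs_congr fun x hx y hy => ?_
      have e := congrFun (congrFun (tr_sylv (g.blk b) (g.blk a) θ Q (tr Q) s) x) y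
      change sylv (g.blk b) (g.blk a) (energyP θ) Q (tr Q) s y x
        = sylv (g.blk a) (g.blk b) (energyP θ) Q (tr Q) (tr s) x y at e
      rw [sylv_sub, Pi.sub_apply, Pi.sub_apply, ← e, h.eq_on hg ha hb x hx y hy,
        h.eq_on hg hb ha y hy x hx, hf x (mem_of_blk hg ha hx) y (mem_of_blk hg hb hy), sub_self]
      rfl
    rw [h2, mul_zero] at h1
    exact sub_eq_zero.1 (eq_zero_of_hs h1 (hg.self_mem_blk a) (hg.self_mem_blk b))
  · rw [h.zero a b hab, h.zero b a fun h => hab h.symm]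

lemma LBP_of_large (hg : g.Good) {Q : Ker d} (hQ : g.OpBlk Q K)
    (ha : a ∈ g.L) (hb : b ∈ g.L) (hθ : 2 * (|θ| + 2 * K) ≤ len a ^ 2 + len b ^ 2) :
    LB (g.blk a) (g.blk b) (energyP θ) Q (tr Q) ((len a ^ 2 + len b ^ 2) / 2) := by
  have hK : 0 ≤ K := (hQ a ha).1.1
  have h := LB_of_diag (A := g.blk a) (B := g.blk b) (z := energyP θ) (M := Q) (N := tr Q)
    (μ := len a ^ 2 + len b ^ 2 - |θ|) (by linarith [abs_nonneg θ]) (fun x hx y hy => ?_)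
    (hQ a ha).1 (hQ b hb).1
  · exact h.mono (by linarith)
  · have e1 := (hg.mem_blk.1 hx).len_eq
    have e2 := (hg.mem_blk.1 hy).len_eq
    rw [e1, e2, len_sq, len_sq, energyP]
    have h1 := norm_sub_norm_le ((x ⬝ᵥ x + y ⬝ᵥ y : ℤ) : ℂ) (-(θ : ℂ))
    rw [sub_neg_eq_add, norm_neg, Complex.norm_real, Real.norm_eq_abs, add_comm _ (θ : ℂ)] at h1
    refine le_trans ?_ h1
    rw [Complex.norm_intCast]
    have := le_abs_self ((x ⬝ᵥ x + y ⬝ᵥ y : ℤ) : ℝ)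
    push_cast at this ⊢
    linarith

lemma hs_acomm_eq (hg : g.Good) (P s : Ker d) (a b : Lat d) :
    hs (g.blk a) (g.blk b) (g.acomm P s)
      = hs (g.blk a) (g.blk b) (lprod (g.blk a) P s + rprod (g.blk b) s (tr P)) :=
  hs_congr fun x hx y hy => by
    simp only [acomm, Pi.add_apply]
    rw [blk_of_mem hg hx, blk_of_mem hg hy]

lemma hs_dRhsP_le (hg : g.Good) {K N η : ℝ} {P f s : Ker d} (hP : g.OpBlk P K) (hη : |η| ≤ N)
    (ha : a ∈ g.L) (hb : b ∈ g.L) :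
    hs (g.blk a) (g.blk b) (g.dRhsP η P f s)
      ≤ hs (g.blk a) (g.blk b) f + (N + 2 * K) * hs (g.blk a) (g.blk b) s := by
  have h1 : hs (g.blk a) (g.blk b) (g.acomm P s) ≤ 2 * K * hs (g.blk a) (g.blk b) s := by
    rw [hs_acomm_eq hg]
    refine (hs_add_le _ _ _ _).trans ?_
    have e1 := hs_lprod_le (g.blk b) (hP a ha).1 s
    have e2 := hs_rprod_le (g.blk a) (N := tr P) (hP b hb).1 s
    linarith
  have h2 : hs (g.blk a) (g.blk b) ((η : ℂ) • s) ≤ N * hs (g.blk a) (g.blk b) s := by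
    rw [hs_smul, Complex.norm_real, Real.norm_eq_abs]
    exact mul_le_mul_of_nonneg_right hη (hs_nonneg _ _ _)
  have h3 := hs_sub_le (g.blk a) (g.blk b) (f - (η : ℂ) • s) (g.acomm P s)
  have h4 := hs_sub_le (g.blk a) (g.blk b) f ((η : ℂ) • s)
  unfold dRhsP
  linarith

lemma BdP.sol (hg : g.Good) {θ κ γ M : ℝ} {Q f s : Ker d} (hκ : 0 < κ) (hLB : g.LBallP θ Q κ)
    (h : g.IsSolP θ Q f s) (hf : g.BdP γ M f) : g.BdP γ (κ⁻¹ * M) s := fun a ha b hb => by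
  refine (h.hs_le hg hκ ha hb (hLB a ha b hb)).trans ?_
  rw [mul_assoc]
  exact mul_le_mul_of_nonneg_left (hf a ha b hb) (inv_pos.2 hκ).le

lemma BdP.dRhs (hg : g.Good) {K N η γ M Ms : ℝ} {P f s : Ker d} (hP : g.OpBlk P K) (hη : |η| ≤ N)
    (hf : g.BdP γ M f) (hsb : g.BdP γ Ms s) :
    g.BdP γ (M + (N + 2 * K) * Ms) (g.dRhsP η P f s) := fun a ha b hb => by
  have hK : 0 ≤ K := (hP a ha).1.1
  have hN : 0 ≤ N := (abs_nonneg η).trans hη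
  refine (hs_dRhsP_le hg hP hη ha hb).trans ?_
  rw [add_mul M, mul_assoc]
  exact add_le_add (hf a ha b hb) (mul_le_mul_of_nonneg_left (hsb a ha b hb) (by positivity))

/-- A kernel is bounded on the blocks along the rays in the directions `c` and `±c`. -/
def RayBdd (g : Lev d) (f : Ker d) : Prop := ∀ (ε : ℤˣ) (c : Lat d), c ≠ 0 → ∀ a b, ∃ M : ℝ,
  ∀ᶠ t : ℕ in atTop, hs (g.blk (a + (t : ℤ) • c)) (g.blk (b + ((ε : ℤ) * (t : ℤ)) • c)) f ≤ M

lemma ray_neg (b c : Lat d) (ε : ℤˣ) (t : ℕ) :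
    b + ((ε : ℤ) * (t : ℤ)) • c = b + (t : ℤ) • ((ε : ℤ) • c) := by
  rw [smul_smul, mul_comm]

lemma unit_smul_ne_zero (ε : ℤˣ) {c : Lat d} (hc : c ≠ 0) : (ε : ℤ) • c ≠ 0 :=
  smul_ne_zero ε.ne_zero hc

lemma rayBdd_of_lim (hg : g.Good) {f : Ker d} (h : ∀ (ε : ℤˣ) (c : Lat d), c ≠ 0 → ∀ a b, ∃ l : ℂ,
    Tendsto (fun t : ℕ => f (a + (t : ℤ) • c) (b + ((ε : ℤ) * (t : ℤ)) • c)) atTop (𝓝 l)) :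
    g.RayBdd f := by
  intro ε c hc a b
  have hc' := unit_smul_ne_zero ε hc
  choose l hl using h ε c hc
  have h1 := tendsto_hs (A := (g.next c).blk a) (B := (g.next ((ε : ℤ) • c)).blk b)
    (X := fun t : ℕ => fun x y => f (x + (t : ℤ) • c) (y + (t : ℤ) • ((ε : ℤ) • c))) (Y := l)
    (fun x _ y _ => (hl x y).congr fun t => by rw [ray_neg])
  refine ⟨hs ((g.next c).blk a) ((g.next ((ε : ℤ) • c)).blk b) l + 1, ?_⟩
  filter_upwards [g.eventually_rigid hc a, g.eventually_rigid hc' b,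
    h1.eventually (eventually_le_nhds (lt_add_one _))] with t ha hb ht
  rw [ray_neg, hg.blk_ray hc ha, hg.blk_ray hc' hb, hs_map]
  exact ht

lemma IsSolP.ray_lim (hg : g.Good) {Q f s : Ker d} (hQ : g.OpBlk Q K)
    (h : g.IsSolP θ Q f s) (hf : g.RayBdd f) (ε : ℤˣ) (c : Lat d) (hc : c ≠ 0) (a b : Lat d) :
    Tendsto (fun t : ℕ => hs (g.blk (a + (t : ℤ) • c)) (g.blk (b + ((ε : ℤ) * (t : ℤ)) • c)) s)
      atTop (𝓝 0) := by
  obtain ⟨M, hM⟩ := hf ε c hc a b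
  have hlen := tendsto_len_shift a hc
  have h1 : Tendsto (fun t : ℕ => (len (a + (t : ℤ) • c) ^ 2 / 2)⁻¹ * M) atTop (𝓝 0) := by
    have h2 : Tendsto (fun t : ℕ => len (a + (t : ℤ) • c) ^ 2 / 2) atTop atTop :=
      ((tendsto_pow_atTop two_ne_zero).comp hlen).atTop_div_const two_pos
    simpa using h2.inv_tendsto_atTop.mul_const M
  refine squeeze_zero' (Eventually.of_forall fun _ => hs_nonneg _ _ _) ?_ h1
  filter_upwards [hM, g.eventually_rigid hc a, g.eventually_rigid (unit_smul_ne_zero ε hc) b,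
    hlen.eventually_ge_atTop (max 1 (2 * (|θ| + 2 * K)))] with t ht ha hb hl
  rw [← ray_neg] at hb
  have hl1 := (le_max_left _ _).trans hl
  have hl2 := (le_max_right _ _).trans hl
  have ha' := hg.hL _ ha.2
  have hb' := hg.hL _ hb.2
  have h3 := LBP_of_large (θ := θ) hg hQ ha' hb' (by
    nlinarith [sq_nonneg (len (b + ((ε : ℤ) * (t : ℤ)) • c))])
  refine (h.hs_le hg (κ := len (a + (t : ℤ) • c) ^ 2 / 2) (by positivity) ha' hb'
    (h3.mono (by linarith [sq_nonneg (len (b + ((ε : ℤ) * (t : ℤ)) • c))]))).trans ?_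
  exact mul_le_mul_of_nonneg_left ht (by positivity)

lemma RayBdd.dRhsP (hg : g.Good) {θ Kq K η : ℝ} {Q P f f' s : Ker d} (hQ : g.OpBlk Q Kq)
    (hP : g.OpBlk P K) (h : g.IsSolP θ Q f s) (hf : g.RayBdd f) (hf' : g.RayBdd f') :
    g.RayBdd (g.dRhsP η P f' s) := by
  intro ε c hc a b
  obtain ⟨M, hM⟩ := hf' ε c hc a b
  refine ⟨M + (|η| + 2 * K), ?_⟩
  filter_upwards [hM, (h.ray_lim hg hQ hf ε c hc a b).eventually (eventually_le_nhds one_pos),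
    g.eventually_rigid hc a, g.eventually_rigid (unit_smul_ne_zero ε hc) b] with t h1 h2 ha hb
  rw [← ray_neg] at hb
  have ha' := hg.hL _ ha.2
  have hK : 0 ≤ K := (hP _ ha').1.1
  refine (hs_dRhsP_le hg hP le_rfl ha' (hg.hL _ hb.2)).trans (add_le_add h1 ?_)
  exact mul_le_of_le_one_right (by positivity) h2

lemma IsSolP.antiReg (hg : g.Good) {p : Prop} {θ κ γ S K Mb M : ℝ} {Q f s : Ker d} (hκ : 0 < κ)
    (hLB : g.LBallP θ Q κ) (hQ : g.OpBlk Q K) (h : g.IsSolP θ Q f s) (hf : g.RayBdd f)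
    (hM1 : κ⁻¹ * Mb ≤ M) (hM2 : 2 * Mb ≤ M) (hS : 2 ≤ S) (hθ : |θ| + 2 * K ≤ S)
    (hb : p → g.BdP γ Mb f) : AntiReg p γ S M g.L s := by
  refine ⟨fun hp a ha b hb' => ?_, fun hp c hc a ha b hb' hdom => ?_, fun ε c hc a b => ?_⟩
  · refine (norm_le_hs s (hg.self_mem_blk a) (hg.self_mem_blk b)).trans
      ((BdP.sol hg hκ hLB h (hb hp) a ha b hb').trans ?_)
    exact mul_le_mul_of_nonneg_right hM1 (Real.exp_pos _).le
  · obtain ⟨a', b', t, hra, hrb⟩ := lipDomPos_iff.1 hdom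
    have hc1 := one_le_len hc
    have e1 : 2 * S ^ 2 ≤ len a := by
      have := hra.large
      rw [le_div_iff₀ (by linarith)] at this
      nlinarith [sq_nonneg S]
    have e2 : 2 * S ^ 2 ≤ len b := by
      have := hrb.large
      rw [le_div_iff₀ (by linarith), len_neg] at this
      nlinarith [sq_nonneg S]
    have h8 : 8 ≤ 2 * S ^ 2 := by nlinarith
    have h3 := LBP_of_large (θ := θ) hg hQ ha hb' (by nlinarith)
    have hpos : 0 < (len a ^ 2 + len b ^ 2) / 2 := by nlinarith
    have h4 := h.hs_le hg hpos ha hb' h3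
    have h5 := norm_le_hs s (hg.self_mem_blk a) (hg.self_mem_blk b)
    have h6 := hb hp a ha b hb'
    have hw : wt c a b ≤ len a ^ 2 + len b ^ 2 := by
      have e3 : len a / len c ≤ len a := div_le_self (len_nonneg _) hc1
      have e4 : len b / len c ≤ len b := div_le_self (len_nonneg _) hc1
      have : max (len a / len c) (len b / len c) ≤ len a + len b :=
        max_le (by linarith [len_nonneg b]) (by linarith [len_nonneg a])
      unfold wt
      nlinarith
    have hE := Real.exp_pos (-γ * len (a + b))
    have h7 : ‖s a b‖ ≤ ((len a ^ 2 + len b ^ 2) / 2)⁻¹ * (Mb * Real.exp (-γ * len (a + b))) :=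
      h5.trans (h4.trans (mul_le_mul_of_nonneg_left h6 (inv_pos.2 hpos).le))
    calc wt c a b * ‖s a b‖ ≤ (len a ^ 2 + len b ^ 2) *
          (((len a ^ 2 + len b ^ 2) / 2)⁻¹ * (Mb * Real.exp (-γ * len (a + b)))) := by
          gcongr
      _ = 2 * Mb * Real.exp (-γ * len (a + b)) := by
          have hne : len a ^ 2 + len b ^ 2 ≠ 0 := by linarith
          field_simp
      _ ≤ _ := by gcongr
  · refine squeeze_zero_norm' (Eventually.of_forall fun t => ?_) (h.ray_lim hg hQ hf ε c hc a b)
    exact norm_le_hs s (hg.self_mem_blk _) (hg.self_mem_blk _)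

lemma bdP_of_entries (hg : g.Good) {γ M : ℝ} (hγ : 0 ≤ γ) (hM : 0 ≤ M) {f : Ker d}
    (h : ∀ a ∈ g.L, ∀ b ∈ g.L, ‖f a b‖ ≤ M * Real.exp (-γ * len (a + b))) :
    g.BdP γ ((3 * g.D) ^ d * (Real.exp (2 * γ * g.D) * M)) f := by
  intro a ha b hb
  rw [mul_assoc]
  refine hs_le_card (hg.card_blk a) (hg.card_blk b) (by positivity) fun x hx y hy => ?_
  refine (h x (mem_of_blk hg ha hx) y (mem_of_blk hg hb hy)).trans ?_
  have e1 := hg.hdiam _ _ (hg.mem_blk.1 hx)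
  have e2 := hg.hdiam _ _ (hg.mem_blk.1 hy)
  rw [mul_comm (Real.exp _) M, mul_assoc, ← Real.exp_add]
  gcongr
  have : len (a + b) ≤ len (x + y) + 2 * g.D := by
    have e : a + b = (a - x) + (x + y) + (b - y) := by abel
    rw [e]
    linarith [len_add_le ((a - x) + (x + y)) (b - y), len_add_le (a - x) (x + y)]
  nlinarith

end Lev
end Plus

/-! ### Scalar components of `gl(2, ℂ)` -/

section Components

/-- The two characters of the algebra `ℂ I + ℂ J`, extended by zero. -/
def phi (ε : ℤˣ) (X : Gl2) : ℂ :=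
  (X 0 0 + X 1 1) / 2 + ((ε : ℤ) : ℂ) * Complex.I * ((X 0 1 - X 1 0) / 2)

/-- The components of `(1 - π) X`. -/
def psi (ε : ℤˣ) (X : Gl2) : ℂ :=
  (X 0 1 + X 1 0) / 2 + ((ε : ℤ) : ℂ) * Complex.I * ((X 0 0 - X 1 1) / 2)

/-- The matrix with given scalar components. -/
def ofComp (p q u w : ℂ) : Gl2 :=
  !![(p + q) / 2 - Complex.I * ((u - w) / 2), -Complex.I * ((p - q) / 2) + (u + w) / 2;
    Complex.I * ((p - q) / 2) + (u + w) / 2, (p + q) / 2 + Complex.I * ((u - w) / 2)]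

lemma ofComp_comp (X : Gl2) : ofComp (phi 1 X) (phi (-1) X) (psi 1 X) (psi (-1) X) = X := by
  have hI := Complex.I_mul_I
  ext i j
  fin_cases i <;> fin_cases j <;> simp [ofComp, phi, psi] <;> ring_nf <;>
    simp only [Complex.I_sq] <;> ring

lemma phi_ofComp (p q u w : ℂ) : phi 1 (ofComp p q u w) = p ∧ phi (-1) (ofComp p q u w) = q := by
  constructor <;> simp [ofComp, phi] <;> ring_nf <;> simp only [Complex.I_sq] <;> ring_nf

lemma psi_ofComp (p q u w : ℂ) : psi 1 (ofComp p q u w) = u ∧ psi (-1) (ofComp p q u w) = w := by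
  constructor <;> simp [ofComp, psi] <;> ring_nf <;> simp only [Complex.I_sq] <;> ring_nf

lemma eq_of_comp {X Y : Gl2} (h : ∀ ε, phi ε X = phi ε Y) (h' : ∀ ε, psi ε X = psi ε Y) : X = Y := by
  rw [← ofComp_comp X, ← ofComp_comp Y, h, h, h', h']

lemma phi_piM (ε : ℤˣ) (X : Gl2) : phi ε (piM X) = phi ε X := by
  simp [phi, piM, J]

lemma psi_piM (ε : ℤˣ) (X : Gl2) : psi ε (piM X) = 0 := by
  simp [psi, piM, J]

lemma phi_add (ε : ℤˣ) (X Y : Gl2) : phi ε (X + Y) = phi ε X + phi ε Y := by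
  simp [phi]; ring

lemma psi_add (ε : ℤˣ) (X Y : Gl2) : psi ε (X + Y) = psi ε X + psi ε Y := by
  simp [psi]; ring

lemma phi_smul (ε : ℤˣ) (z : ℂ) (X : Gl2) : phi ε (z • X) = z * phi ε X := by
  simp [phi]; ring

lemma psi_smul (ε : ℤˣ) (z : ℂ) (X : Gl2) : psi ε (z • X) = z * psi ε X := by
  simp [psi]; ring

lemma phi_sub (ε : ℤˣ) (X Y : Gl2) : phi ε (X - Y) = phi ε X - phi ε Y := by
  simp [phi]; ring

lemma psi_sub (ε : ℤˣ) (X Y : Gl2) : psi ε (X - Y) = psi ε X - psi ε Y := by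
  simp [psi]; ring

lemma phi_zero (ε : ℤˣ) : phi ε 0 = 0 := by simp [phi]

lemma psi_zero (ε : ℤˣ) : psi ε 0 = 0 := by simp [psi]

lemma phi_sum {ι : Type*} (s : Finset ι) (ε : ℤˣ) (X : ι → Gl2) :
    phi ε (∑ i ∈ s, X i) = ∑ i ∈ s, phi ε (X i) := by
  classical
  induction s using Finset.induction_on with
  | empty => simp [phi_zero]
  | insert i s hi ih => rw [Finset.sum_insert hi, Finset.sum_insert hi, phi_add, ih]

lemma psi_sum {ι : Type*} (s : Finset ι) (ε : ℤˣ) (X : ι → Gl2) :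
    psi ε (∑ i ∈ s, X i) = ∑ i ∈ s, psi ε (X i) := by
  classical
  induction s using Finset.induction_on with
  | empty => simp [psi_zero]
  | insert i s hi ih => rw [Finset.sum_insert hi, Finset.sum_insert hi, psi_add, ih]

lemma phi_transpose (ε : ℤˣ) (X : Gl2) : phi ε X.transpose = phi (-ε) X := by
  simp [phi]; ring

lemma psi_transpose (ε : ℤˣ) (X : Gl2) : psi ε X.transpose = psi ε X := by
  simp [psi]; ring

lemma piM_apply (X : Gl2) : piM X = !![(X 0 0 + X 1 1) / 2, (X 0 1 - X 1 0) / 2;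
    -((X 0 1 - X 1 0) / 2), (X 0 0 + X 1 1) / 2] := by
  ext i j; fin_cases i <;> fin_cases j <;> simp [piM, J]

lemma J_mul (X : Gl2) : J * X = !![X 1 0, X 1 1; -X 0 0, -X 0 1] := by
  ext i j; fin_cases i <;> fin_cases j <;> simp [J, Matrix.mul_apply, Fin.sum_univ_two]

lemma phi_mul_J_mul (ε : ℤˣ) {h : Gl2} (hh : piM h = h) (X : Gl2) :
    phi ε (h * (J * X)) = ((ε : ℤ) : ℂ) * Complex.I * (phi ε h * phi ε X) := by
  rw [← hh, piM_apply, J_mul]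
  rcases Int.units_eq_one_or ε with rfl | rfl <;>
  simp [phi, Matrix.mul_apply, Fin.sum_univ_two] <;> ring_nf <;>
    simp only [Complex.I_sq, Complex.I_pow_three] <;>
    ring

lemma phi_mul_J_mul' (ε : ℤˣ) {h : Gl2} (hh : piM h = h) (X : Gl2) :
    phi ε (X * (J * h)) = ((ε : ℤ) : ℂ) * Complex.I * (phi ε X * phi ε h) := by
  rw [← hh, piM_apply, J_mul]
  rcases Int.units_eq_one_or ε with rfl | rfl <;>
  simp [phi, Matrix.mul_apply, Fin.sum_univ_two] <;> ring_nf <;>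
    simp only [Complex.I_sq, Complex.I_pow_three] <;>
    ring

lemma psi_mul_J_mul (ε : ℤˣ) {h : Gl2} (hh : piM h = h) (X : Gl2) :
    psi ε (h * (J * X)) = ((ε : ℤ) : ℂ) * Complex.I * (phi ε h * psi ε X) := by
  rw [← hh, piM_apply, J_mul]
  rcases Int.units_eq_one_or ε with rfl | rfl <;>
  simp [phi, psi, Matrix.mul_apply, Fin.sum_univ_two] <;> ring_nf <;>
    simp only [Complex.I_sq, Complex.I_pow_three] <;>
    ring

lemma psi_mul_J_mul' (ε : ℤˣ) {h : Gl2} (hh : piM h = h) (X : Gl2) :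
    psi ε (X * (J * h)) = -(((ε : ℤ) : ℂ) * Complex.I * (psi ε X * phi (-ε) h)) := by
  rw [← hh, piM_apply, J_mul]
  rcases Int.units_eq_one_or ε with rfl | rfl <;>
  simp [phi, psi, Matrix.mul_apply, Fin.sum_univ_two] <;> ring_nf <;>
    simp only [Complex.I_sq, Complex.I_pow_three] <;>
    ring

lemma absNorm_of_pattern {X : Gl2} {p q : ℝ} (h00 : ‖X 0 0‖ = p) (h11 : ‖X 1 1‖ = p)
    (h01 : ‖X 0 1‖ = q) (h10 : ‖X 1 0‖ = q) : absNorm X = p + q := by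
  have hp : 0 ≤ p := h00 ▸ norm_nonneg _
  have hq : 0 ≤ q := h01 ▸ norm_nonneg _
  set M : Gl2 := Matrix.of fun i j => ((‖X i j‖ : ℝ) : ℂ) with hM
  have hMv : ∀ v : EuclideanSpace ℂ (Fin 2), Matrix.toEuclideanCLM (𝕜 := ℂ) (n := Fin 2) M v
      = (p : ℂ) • v + (q : ℂ) • (!₂[v 1, v 0] : EuclideanSpace ℂ (Fin 2)) := by
    intro v
    ext i
    fin_cases i <;>
      simp [hM, Matrix.ofLp_toEuclideanCLM, Matrix.mulVec, dotProduct, Fin.sum_univ_two, h00, h01, h10, h11]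
    ring
  refine le_antisymm (ContinuousLinearMap.opNorm_le_bound _ (by positivity) fun v => ?_) ?_
  · rw [hMv]
    refine (norm_add_le _ _).trans ?_
    have e : ‖(!₂[v 1, v 0] : EuclideanSpace ℂ (Fin 2))‖ = ‖v‖ := by
      rw [EuclideanSpace.norm_eq, EuclideanSpace.norm_eq]
      simp [Fin.sum_univ_two, add_comm]
    rw [norm_smul, norm_smul, e, Complex.norm_real, Complex.norm_real, Real.norm_of_nonneg hp,
      Real.norm_of_nonneg hq, add_mul]
  · have h1 := (Matrix.toEuclideanCLM (𝕜 := ℂ) (n := Fin 2) M).le_opNorm !₂[1, 1]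
    rw [hMv] at h1
    have e : (p : ℂ) • (!₂[1, 1] : EuclideanSpace ℂ (Fin 2)) + (q : ℂ) • !₂[1, 1]
        = ((p + q : ℝ) : ℂ) • !₂[1, 1] := by
      rw [← add_smul]; push_cast; rfl
    have e' : (!₂[(!₂[1, 1] : EuclideanSpace ℂ (Fin 2)) 1, (!₂[1, 1] : EuclideanSpace ℂ (Fin 2)) 0]
        : EuclideanSpace ℂ (Fin 2)) = !₂[1, 1] := by
      ext i; fin_cases i <;> simp
    rw [e', e, norm_smul, Complex.norm_real, Real.norm_of_nonneg (by positivity)] at h1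
    refine le_of_mul_le_mul_right h1 ?_
    rw [norm_pos_iff]
    intro h
    have := congrFun (congrArg (fun z : EuclideanSpace ℂ (Fin 2) => (z : Fin 2 → ℂ)) h) 0
    simp at this

lemma norm_eps (ε : ℤˣ) : ‖((ε : ℤ) : ℂ)‖ = 1 := by
  rcases Int.units_eq_one_or ε with rfl | rfl <;> simp

lemma absNorm_piM (X : Gl2) :
    absNorm (piM X) = ‖(X 0 0 + X 1 1) / 2‖ + ‖(X 0 1 - X 1 0) / 2‖ := by
  rw [piM_apply]
  refine absNorm_of_pattern ?_ ?_ ?_ ?_ <;> simp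

lemma absNorm_sub_piM (X : Gl2) :
    absNorm (X - piM X) = ‖(X 0 0 - X 1 1) / 2‖ + ‖(X 0 1 + X 1 0) / 2‖ := by
  have e1 : X 0 0 - (X 0 0 + X 1 1) / 2 = (X 0 0 - X 1 1) / 2 := by ring
  have e2 : X 1 1 - (X 0 0 + X 1 1) / 2 = -((X 0 0 - X 1 1) / 2) := by ring
  have e3 : X 0 1 - (X 0 1 - X 1 0) / 2 = (X 0 1 + X 1 0) / 2 := by ring
  have e4 : X 1 0 - -((X 0 1 - X 1 0) / 2) = (X 0 1 + X 1 0) / 2 := by ring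
  rw [piM_apply]
  refine absNorm_of_pattern ?_ ?_ ?_ ?_
  · simp only [Matrix.sub_apply, Matrix.of_apply, Matrix.cons_val_zero, Matrix.cons_val', e1]
  · simp [e2]
  · simp [e3]
  · simp only [Matrix.sub_apply, Matrix.of_apply, Matrix.cons_val_zero, Matrix.cons_val_one,
      Matrix.cons_val', e4]

lemma norm_phi_le (ε : ℤˣ) (X : Gl2) : ‖phi ε X‖ ≤ absNorm (piM X) := by
  rw [absNorm_piM, phi]
  refine (norm_add_le _ _).trans_eq ?_
  rw [norm_mul, norm_mul, norm_eps, Complex.norm_I, one_mul, one_mul]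

lemma norm_psi_le (ε : ℤˣ) (X : Gl2) : ‖psi ε X‖ ≤ absNorm (X - piM X) := by
  rw [absNorm_sub_piM, psi, add_comm ‖_‖]
  refine (norm_add_le _ _).trans_eq ?_
  rw [norm_mul, norm_mul, norm_eps, Complex.norm_I, one_mul, one_mul]

lemma absNorm_piM_le (X : Gl2) : absNorm (piM X) ≤ ‖phi 1 X‖ + ‖phi (-1) X‖ := by
  rw [absNorm_piM]
  have e1 : (X 0 0 + X 1 1) / 2 = (phi 1 X + phi (-1) X) / 2 := by simp [phi]; ring
  have e2 : (X 0 1 - X 1 0) / 2 = -Complex.I * ((phi 1 X - phi (-1) X) / 2) := by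
    simp [phi]; ring_nf; simp only [Complex.I_sq]; ring
  rw [e1, e2, norm_mul, norm_neg, Complex.norm_I, one_mul, norm_div, norm_div, Complex.norm_two]
  linarith [norm_add_le (phi 1 X) (phi (-1) X), norm_sub_le (phi 1 X) (phi (-1) X)]

lemma absNorm_sub_piM_le (X : Gl2) : absNorm (X - piM X) ≤ ‖psi 1 X‖ + ‖psi (-1) X‖ := by
  rw [absNorm_sub_piM]
  have e1 : (X 0 1 + X 1 0) / 2 = (psi 1 X + psi (-1) X) / 2 := by simp [psi]; ring
  have e2 : (X 0 0 - X 1 1) / 2 = -Complex.I * ((psi 1 X - psi (-1) X) / 2) := by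
    simp [psi]; ring_nf; simp only [Complex.I_sq]; ring
  rw [e1, e2, norm_mul, norm_neg, Complex.norm_I, one_mul, norm_div, norm_div, Complex.norm_two]
  linarith [norm_add_le (psi 1 X) (psi (-1) X), norm_sub_le (psi 1 X) (psi (-1) X)]

lemma continuous_phi (ε : ℤˣ) : Continuous (phi ε) := by
  unfold phi; fun_prop

lemma continuous_psi (ε : ℤˣ) : Continuous (psi ε) := by
  unfold psi; fun_prop

lemma continuous_piM : Continuous piM := by
  unfold piM; fun_prop

lemma tendsto_ofComp {ι : Type*} {l : Filter ι} {p q u w : ι → ℂ} {p' q' u' w' : ℂ}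
    (hp : Tendsto p l (𝓝 p')) (hq : Tendsto q l (𝓝 q')) (hu : Tendsto u l (𝓝 u'))
    (hw : Tendsto w l (𝓝 w')) :
    Tendsto (fun t => ofComp (p t) (q t) (u t) (w t)) l (𝓝 (ofComp p' q' u' w')) := by
  refine tendsto_pi_nhds.2 fun i => tendsto_pi_nhds.2 fun j => ?_
  have h1 := ((hp.add hq).div_const 2).sub (((hu.sub hw).div_const 2).const_mul Complex.I)
  have h2 := (((hp.sub hq).div_const 2).const_mul (-Complex.I)).add ((hu.add hw).div_const 2)
  have h3 := (((hp.sub hq).div_const 2).const_mul Complex.I).add ((hu.add hw).div_const 2)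
  have h4 := ((hp.add hq).div_const 2).add (((hu.sub hw).div_const 2).const_mul Complex.I)
  fin_cases i <;> fin_cases j
  · exact h1
  · exact h2
  · exact h3
  · exact h4

end Components

/-! ### Norms and Töplitz limits in terms of the scalar components -/

section Norms

variable {d : ℕ} {L L' : Set (Lat d)} {c a b : Lat d} {p : Prop} {γ S M : ℝ} {m : ℕ} {A A' : LMat d}
  {σ : ℤˣ} {s u w : Ker d}

/-- The matrix with the components `s`, `ᵗs`, `u`, `w`. -/
def ofKer (s u w : Ker d) : LMat d := fun a b => ofComp (s a b) (s b a) (u a b) (w a b)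

lemma ofKer_zero : ofKer (0 : Ker d) 0 0 = 0 := by
  funext a b
  ext i j
  fin_cases i <;> fin_cases j <;> simp [ofKer, ofComp]

lemma part_one_apply (A : LMat d) (a b : Lat d) : part 1 A a b = piM (A a b) := by simp [part]

lemma part_neg_apply (A : LMat d) (a b : Lat d) : part (-1) A a b = A a b - piM (A a b) := by
  simp [part, show ¬ ((-1 : ℤˣ) = 1) by decide]

lemma piM_ofComp (p q u w : ℂ) : piM (ofComp p q u w) = ofComp p q 0 0 := by
  refine eq_of_comp (fun ε => ?_) fun ε => ?_
  · rw [phi_piM]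
    rcases Int.units_eq_one_or ε with rfl | rfl <;> simp [phi_ofComp]
  · rw [psi_piM]
    rcases Int.units_eq_one_or ε with rfl | rfl <;> simp [psi_ofComp]

lemma sub_piM_ofComp (p q u w : ℂ) : ofComp p q u w - piM (ofComp p q u w) = ofComp 0 0 u w := by
  rw [piM_ofComp]
  refine eq_of_comp (fun ε => ?_) fun ε => ?_ <;>
    rcases Int.units_eq_one_or ε with rfl | rfl <;>
    simp [phi_sub, psi_sub, phi_ofComp, psi_ofComp]

lemma part_one_ofKer (s u w : Ker d) : part 1 (ofKer s u w) = ofKer s 0 0 := by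
  funext a b; rw [part_one_apply]; exact piM_ofComp _ _ _ _

lemma part_neg_ofKer (s u w : Ker d) : part (-1) (ofKer s u w) = ofKer 0 u w := by
  funext a b; rw [part_neg_apply]; exact sub_piM_ofComp _ _ _ _

lemma absNorm_ofKer_sub_le (s s' : Ker d) (a b : Lat d) :
    absNorm (ofKer s 0 0 a b - ofKer s' 0 0 a b) ≤ ‖s a b - s' a b‖ + ‖s b a - s' b a‖ := by
  have e : ofKer s 0 0 a b - ofKer s' 0 0 a b = piM (ofKer s 0 0 a b - ofKer s' 0 0 a b) := by
    refine eq_of_comp (fun ε => (phi_piM ε _).symm) fun ε => ?_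
    rw [psi_piM, psi_sub]
    rcases Int.units_eq_one_or ε with rfl | rfl <;> simp [ofKer, psi_ofComp]
  rw [e]
  refine (absNorm_piM_le _).trans_eq ?_
  simp [phi_sub, ofKer, phi_ofComp]

lemma absNorm_ofKer_le (u w : Ker d) (a b : Lat d) :
    absNorm (ofKer 0 u w a b) ≤ ‖u a b‖ + ‖w a b‖ := by
  have e : ofKer 0 u w a b = ofKer 0 u w a b - piM (ofKer 0 u w a b) := by
    rw [ofKer, sub_piM_ofComp]; simp
  rw [e]
  refine (absNorm_sub_piM_le _).trans_eq ?_
  simp [ofKer, psi_ofComp]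

lemma absNorm_nonneg (X : Gl2) : 0 ≤ absNorm X := norm_nonneg _

lemma tlim_eq
    (h : ∀ a b, Tendsto (ray σ c A a b) atTop (𝓝 (A' a b))) : tlim σ c A = A' := by
  funext a b; exact (h a b).limUnder_eq

lemma tendsto_ray_zero (σ : ℤˣ) (A : LMat d) (a b : Lat d) :
    Tendsto (ray σ 0 A a b) atTop (𝓝 (A a b)) := by
  refine tendsto_const_nhds.congr fun t => ?_
  simp [ray]

lemma tlim_zero_dir (σ : ℤˣ) (A : LMat d) : tlim σ 0 A = A := tlim_eq (tendsto_ray_zero σ A)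

lemma tendsto_ray_pos {s s' u w : Ker d} (hs : HasLim c s s')
    (hu : HasLim c u 0) (hw : HasLim c w 0) (a b : Lat d) :
    Tendsto (ray 1 c (ofKer s u w) a b) atTop (𝓝 (ofKer s' 0 0 a b)) := by
  have := tendsto_ofComp (hs a b) (hs b a) (hu a b) (hw a b)
  refine this.congr fun t => ?_
  simp [ray, ofKer]

lemma tendsto_ray_neg
    (hs : ∀ (ε : ℤˣ) a b, Tendsto (fun t : ℕ => s (a + (t : ℤ) • ((ε : ℤ) • c))
      (b - (t : ℤ) • ((ε : ℤ) • c))) atTop (𝓝 0))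
    (hu : ∀ a b, Tendsto (fun t : ℕ => u (a + (t : ℤ) • c) (b + (((-1 : ℤˣ) : ℤ) * (t : ℤ)) • c))
      atTop (𝓝 0))
    (hw : ∀ a b, Tendsto (fun t : ℕ => w (a + (t : ℤ) • c) (b + (((-1 : ℤˣ) : ℤ) * (t : ℤ)) • c))
      atTop (𝓝 0)) (a b : Lat d) :
    Tendsto (ray (-1) c (ofKer s u w) a b) atTop (𝓝 ((0 : LMat d) a b)) := by
  have := tendsto_ofComp (hs 1 a b) (hs (-1) b a) (hu a b) (hw a b)
  have e : ofComp 0 0 0 0 = (0 : LMat d) a b := by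
    rw [← ofKer_zero]; rfl
  rw [e] at this
  refine this.congr fun t => ?_
  simp [ray, ofKer, sub_eq_add_neg]

lemma LipDomPos.symm (h : LipDomPos S c a b) : LipDomPos S c b a := by
  obtain ⟨⟨a', b', t, h0, h1, h2, h3, h4⟩, h5, h6⟩ := h
  exact ⟨⟨b', a', t, h0, h3, h4, h1, h2⟩, h6, h5⟩

lemma wt_comm (c a b : Lat d) : wt c a b = wt c b a := by rw [wt, wt, max_comm]

lemma PtReg.zero (p : Prop) (γ S M : ℝ) (hM : 0 ≤ M) (m : ℕ) (L : Set (Lat d)) :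
    PtReg p γ S M m L (0 : Ker d) := by
  have h : ∀ (L : Set (Lat d)), ∀ a ∈ L, ∀ b ∈ L,
      ‖(0 : Ker d) a b‖ ≤ M * Real.exp (-γ * len (a - b)) := fun L a _ b _ => by
    simp only [Pi.zero_apply, norm_zero]; positivity
  induction m generalizing L with
  | zero => exact fun _ => h L
  | succ m ih =>
    refine ⟨fun _ => h L, fun c _ a b => tendsto_const_nhds, fun c _ => ⟨0, fun a b =>
      tendsto_const_nhds, fun _ a _ b _ _ => ?_, ih _⟩⟩
    simp only [Pi.zero_apply, sub_zero, norm_zero, mul_zero]; positivity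

lemma PtReg.down
    (h : PtReg p γ S M (m + 1) L s) : PtReg p γ S M m L s := by
  induction m generalizing L s with
  | zero => exact h.1
  | succ m ih =>
    refine ⟨h.1, h.2.1, fun c hc => ?_⟩
    obtain ⟨s', h1, h2, h3⟩ := h.2.2 c hc
    exact ⟨s', h1, h2, ih h3⟩

lemma AntiReg.hasLim
    (h : AntiReg p γ S M L u) (hc : c ≠ 0) : HasLim c u 0 := fun a b => by
  simpa using h.lim 1 c hc a b

lemma PtReg.anti_lim
    (h : PtReg p γ S M (m + 1) L s) (hc : c ≠ 0) (ε : ℤˣ) (a b : Lat d) :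
    Tendsto (fun t : ℕ => s (a + (t : ℤ) • ((ε : ℤ) • c)) (b - (t : ℤ) • ((ε : ℤ) • c)))
      atTop (𝓝 0) :=
  h.2.1 _ (Lev.unit_smul_ne_zero ε hc) a b

lemma PtReg.ray_neg {γ S M M' : ℝ}
    (h : PtReg p γ S M (m + 1) L s) (hu : AntiReg p γ S M' L' u) (hw : AntiReg p γ S M' L' w)
    (hc : c ≠ 0) (a b : Lat d) :
    Tendsto (ray (-1) c (ofKer s u w) a b) atTop (𝓝 ((0 : LMat d) a b)) :=
  tendsto_ray_neg (fun ε => h.anti_lim hc ε) (hu.lim (-1) c hc) (hw.lim (-1) c hc) a b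

lemma PtReg.isTopl (hM : 0 ≤ M) (m : ℕ)
    (h : PtReg p γ S M m L s) (hu : AntiReg p γ S M L u) (hw : AntiReg p γ S M L w) :
    IsTopl m (ofKer s u w) := by
  induction m generalizing L s u w with
  | zero => trivial
  | succ m ih =>
    have hz := ih (PtReg.zero p γ S M hM m L) (AntiReg.zero p γ S M hM L) (AntiReg.zero p γ S M hM L)
    rw [ofKer_zero] at hz
    have key : ∀ (σ : ℤˣ) (c : Lat d), ∃ A', (∀ a b, Tendsto (ray σ c (ofKer s u w) a b) atTop
        (𝓝 (A' a b))) ∧ IsTopl m A' := by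
      intro σ c
      by_cases hc : c = 0
      · subst hc
        exact ⟨_, tendsto_ray_zero σ _, ih h.down hu hw⟩
      rcases Int.units_eq_one_or σ with rfl | rfl
      · obtain ⟨s', h1, -, h3⟩ := h.2.2 c hc
        exact ⟨_, tendsto_ray_pos h1 (hu.hasLim hc) (hw.hasLim hc),
          ih h3 (AntiReg.zero p γ S M hM _) (AntiReg.zero p γ S M hM _)⟩
      · exact ⟨_, h.ray_neg hu hw hc, hz⟩
    refine ⟨fun σ c a b => ?_, fun σ c => ?_⟩
    · obtain ⟨A', h1, -⟩ := key σ c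
      exact ⟨_, h1 a b⟩
    · obtain ⟨A', h1, h2⟩ := key σ c
      rwa [tlim_eq h1]

lemma decaySup_le
    (h : ∀ a ∈ L, ∀ b ∈ L, absNorm (A a b) ≤ M * Real.exp (-γ * len (a - (σ : ℤ) • b))) :
    decaySup L γ σ A ≤ ENNReal.ofReal M :=
  iSup₂_le fun a ha => iSup₂_le fun b hb => ENNReal.ofReal_le_ofReal <| by
    have h1 := h a ha b hb
    rw [neg_mul, Real.exp_neg, ← div_eq_mul_inv, le_div_iff₀ (Real.exp_pos _)] at h1
    linarith

lemma lipConst_le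
    (h : ∀ c ≠ 0, ∀ a ∈ L, ∀ b ∈ L, LipDom S σ c a b →
      wt c a b * absNorm (A a b - tlim σ c A a b) ≤ M * Real.exp (-γ * len (a - (σ : ℤ) • b))) :
    lipConst L S γ σ A ≤ ENNReal.ofReal M :=
  iSup₂_le fun c hc => iSup₂_le fun a ha => iSup₂_le fun b hb => iSup_le fun hd =>
    ENNReal.ofReal_le_ofReal <| by
    have h1 := h c hc a ha b hb hd
    rw [neg_mul, Real.exp_neg, ← div_eq_mul_inv, le_div_iff₀ (Real.exp_pos _)] at h1
    rw [mul_assoc, mul_comm]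
    exact h1

lemma lipNorm_ofKer_le (hM : 0 ≤ M)
    (h : PtReg True γ S M (m + 1) L s) (hu : AntiReg True γ S M L u) (hw : AntiReg True γ S M L w) :
    lipNorm L S γ (ofKer s u w) ≤ ENNReal.ofReal (4 * M) := by
  have hb := h.1 trivial
  have e4 : ENNReal.ofReal (4 * M) = ENNReal.ofReal (2 * M) + ENNReal.ofReal (2 * M) := by
    rw [← ENNReal.ofReal_add (by linarith) (by linarith)]; congr 1; ring
  rw [lipNorm, decayNorm, part_one_ofKer, part_neg_ofKer, e4]
  refine add_le_add (max_le ?_ ?_) (max_le ?_ ?_)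
  · refine lipConst_le fun c hc a ha b hb' hd => ?_
    obtain ⟨s', h1, h2, -⟩ := h.2.2 c hc
    have h0 : HasLim c (0 : Ker d) 0 := fun a b => tendsto_const_nhds
    rw [tlim_eq (tendsto_ray_pos h1 h0 h0)]
    have hd' : LipDomPos S c a b := by simpa [LipDom] using hd
    have e1 := h2 trivial a ha b hb' hd'
    have e2 := h2 trivial b hb' a ha hd'.symm
    rw [wt_comm, len_sub_comm] at e2
    have hw0 : 0 ≤ wt c a b := (wt_pos c a b).le
    simp only [Units.val_one, one_smul]
    calc wt c a b * absNorm (ofKer s 0 0 a b - ofKer s' 0 0 a b)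
        ≤ wt c a b * (‖s a b - s' a b‖ + ‖s b a - s' b a‖) := by
          gcongr; exact absNorm_ofKer_sub_le s s' a b
      _ ≤ _ := by rw [mul_add]; linarith
  · refine lipConst_le fun c hc a ha b hb' hd => ?_
    have h0 : ∀ (ε : ℤˣ) a b, Tendsto (fun t : ℕ => (0 : Ker d) (a + (t : ℤ) • ((ε : ℤ) • c))
      (b - (t : ℤ) • ((ε : ℤ) • c))) atTop (𝓝 0) := fun _ _ _ => tendsto_const_nhds
    rw [tlim_eq (tendsto_ray_neg h0 (hu.lim (-1) c hc) (hw.lim (-1) c hc))]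
    have hd' : LipDomPos S c a (-b) := by simpa [LipDom] using hd
    have e1 := hu.lip trivial c hc a ha b hb' hd'
    have e2 := hw.lip trivial c hc a ha b hb' hd'
    have hw0 : 0 ≤ wt c a b := (wt_pos c a b).le
    simp only [Units.val_neg, Units.val_one, neg_smul, one_smul, sub_neg_eq_add, Pi.zero_apply,
      sub_zero]
    calc wt c a b * absNorm (ofKer 0 u w a b) ≤ wt c a b * (‖u a b‖ + ‖w a b‖) := by
          gcongr; exact absNorm_ofKer_le u w a b
      _ ≤ _ := by rw [mul_add]; linarith
  · refine decaySup_le fun a ha b hb' => ?_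
    have := absNorm_ofKer_sub_le s 0 a b
    rw [ofKer_zero] at this
    simp only [Pi.zero_apply, sub_zero] at this
    have e1 := hb a ha b hb'
    have e2 := hb b hb' a ha
    rw [len_sub_comm] at e2
    simp only [Units.val_one, one_smul]
    linarith
  · refine decaySup_le fun a ha b hb' => ?_
    have := absNorm_ofKer_le u w a b
    have e1 := hu.bd trivial a ha b hb'
    have e2 := hw.bd trivial a ha b hb'
    simp only [Units.val_neg, Units.val_one, neg_smul, one_smul, sub_neg_eq_add]
    linarith

lemma PtReg.mono_set
    (h : PtReg p γ S M m L s) (hL : L' ⊆ L) : PtReg p γ S M m L' s := by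
  cases m with
  | zero => exact fun hp a ha b hb => h hp a (hL ha) b (hL hb)
  | succ m =>
    refine ⟨fun hp a ha b hb => h.1 hp a (hL ha) b (hL hb), h.2.1, fun c hc => ?_⟩
    obtain ⟨s', h1, h2, h3⟩ := h.2.2 c hc
    exact ⟨s', h1, fun hp a ha b hb => h2 hp a (hL ha) b (hL hb), h3⟩

lemma iterNorm_ofKer_le (hM : 0 ≤ M) (m : ℕ)
    (h : PtReg True γ S M (m + 1) L s) (hu : AntiReg True γ S M L u) (hw : AntiReg True γ S M L w) :
    iterNorm L S γ m (ofKer s u w) ≤ ENNReal.ofReal (4 * M) := by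
  induction m generalizing s u w with
  | zero => exact lipNorm_ofKer_le hM h hu hw
  | succ m ih =>
    have h0 := AntiReg.zero True γ S M hM L
    refine iSup₂_le fun c σ => ?_
    by_cases hc : c = 0
    · subst hc
      rw [tlim_zero_dir]
      exact ih h.down hu hw
    rcases Int.units_eq_one_or σ with rfl | rfl
    · obtain ⟨s', h1, -, h3⟩ := h.2.2 c hc
      rw [tlim_eq (tendsto_ray_pos h1 (hu.hasLim hc) (hw.hasLim hc))]
      exact ih (h3.mono_set (Set.subset_univ _)) h0 h0
    · rw [tlim_eq (h.ray_neg hu hw hc), ← ofKer_zero]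
      exact ih (PtReg.zero _ _ _ _ hM _ _) h0 h0

/-! ### From matrices to kernels -/

lemma lipNorm_le_iterNorm (L : Set (Lat d)) (S γ : ℝ) (m : ℕ) (A : LMat d) :
    lipNorm L S γ A ≤ iterNorm L S γ m A := by
  induction m with
  | zero => exact le_rfl
  | succ m ih =>
    refine ih.trans ?_
    have := le_iSup₂ (f := fun (c : Lat d) (σ : ℤˣ) => iterNorm L S γ m (tlim σ c A)) 0 1
    rwa [tlim_zero_dir] at this

lemma absNorm_le_of_decaySup (hM : 0 ≤ M)
    (h : decaySup L γ σ A ≤ ENNReal.ofReal M) (ha : a ∈ L) (hb : b ∈ L) :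
    absNorm (A a b) ≤ M * Real.exp (-γ * len (a - (σ : ℤ) • b)) := by
  have h1 : ENNReal.ofReal (Real.exp (γ * len (a - (σ : ℤ) • b)) * absNorm (A a b))
      ≤ ENNReal.ofReal M := by
    refine le_trans ?_ h
    refine le_iSup₂_of_le a ha ?_
    refine le_iSup₂_of_le b hb ?_
    exact le_rfl
  rw [ENNReal.ofReal_le_ofReal_iff hM] at h1
  rw [neg_mul, Real.exp_neg, ← div_eq_mul_inv, le_div_iff₀ (Real.exp_pos _)]
  linarith

lemma absNorm_le_of_lipConst (hM : 0 ≤ M)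
    (h : lipConst L S γ σ A ≤ ENNReal.ofReal M) (hc : c ≠ 0) (ha : a ∈ L)
    (hb : b ∈ L) (hd : LipDom S σ c a b) :
    wt c a b * absNorm (A a b - tlim σ c A a b)
      ≤ M * Real.exp (-γ * len (a - (σ : ℤ) • b)) := by
  have h1 : ENNReal.ofReal (Real.exp (γ * len (a - (σ : ℤ) • b)) * wt c a b *
      absNorm (A a b - tlim σ c A a b)) ≤ ENNReal.ofReal M := by
    refine le_trans ?_ h
    refine le_iSup₂_of_le c hc ?_
    refine le_iSup₂_of_le a ha ?_
    refine le_iSup₂_of_le b hb ?_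
    refine le_iSup_of_le hd ?_
    exact le_rfl
  rw [ENNReal.ofReal_le_ofReal_iff hM] at h1
  rw [neg_mul, Real.exp_neg, ← div_eq_mul_inv, le_div_iff₀ (Real.exp_pos _)]
  linarith

lemma norm_psi_le_of_iterNorm (hM : 0 ≤ M)
    (h : iterNorm L S γ m A ≤ ENNReal.ofReal M) (ε : ℤˣ) (ha : a ∈ L) (hb : b ∈ L) :
    ‖psi ε (A a b)‖ ≤ M * Real.exp (-γ * len (a + b)) := by
  have h1 : decaySup L γ (-1) (part (-1) A) ≤ ENNReal.ofReal M :=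
    (le_max_right _ _).trans (le_add_self.trans ((lipNorm_le_iterNorm L S γ m A).trans h))
  have h2 := absNorm_le_of_decaySup hM h1 ha hb
  rw [part_neg_apply] at h2
  have := (norm_psi_le ε (A a b)).trans h2
  simpa using this

lemma tendsto_part_ray {σ τ : ℤˣ}
    (h : ∀ a b, Tendsto (ray σ c A a b) atTop (𝓝 (A' a b))) (a b : Lat d) :
    Tendsto (ray σ c (part τ A) a b) atTop (𝓝 (part τ A' a b)) := by
  have h1 := (continuous_piM.tendsto _).comp (h a b)
  rcases Int.units_eq_one_or τ with rfl | rfl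
  · rw [part_one_apply]
    refine h1.congr fun t => ?_
    simp [ray, part_one_apply]
  · rw [part_neg_apply]
    refine ((h a b).sub h1).congr fun t => ?_
    simp [ray, part_neg_apply]

lemma mem_of_lipDomPos {ρ S : ℝ} (hL : ∀ a, ρ ≤ len a → a ∈ L) (hρ : ρ ≤ S)
    (hS : 1 ≤ S) (hc : c ≠ 0) (h : LipDomPos S c a b) : a ∈ L ∧ b ∈ L := by
  have hc1 := one_le_len hc
  have key : ∀ x : Lat d, 2 * S ^ 2 ≤ len x / len c → x ∈ L := fun x hx => hL x <| by
    rw [le_div_iff₀ (by linarith)] at hx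
    nlinarith [sq_nonneg S]
  exact ⟨key a h.2.1, key b h.2.2⟩

lemma ptReg_phi {ρ γ S M R : ℝ} (hM : 0 ≤ M)
    (hL : ∀ a, ρ ≤ len a → a ∈ L) (hρ : p → ρ ≤ S ∧ 1 ≤ S) (m : ℕ)
    (hL' : L' = L ∨ ∃ c : Lat d, c ≠ 0 ∧ ∀ a b, A (a + c) (b + c) = A a b)
    (hA : IsTopl (m + 1) A) (hn : p → iterNorm L S γ m A ≤ ENNReal.ofReal M)
    (htr : ∀ a ∈ L, ∀ b ∈ L, R < len (a - b) → piM (A a b) = 0) (ε : ℤˣ) :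
    PtReg p γ S M (m + 1) L' fun a b => phi ε (A a b) := by
  have hmem : ∀ (c : Lat d), c ≠ 0 → ∀ a, ∀ᶠ t : ℕ in atTop, a + (t : ℤ) • c ∈ L := fun c hc a =>
    ((Lev.tendsto_len_shift a hc).eventually_ge_atTop ρ).mono fun t ht => hL _ ht
  have bdL : ∀ {A : LMat d} {m : ℕ}, iterNorm L S γ m A ≤ ENNReal.ofReal M → ∀ a ∈ L, ∀ b ∈ L,
      ‖phi ε (A a b)‖ ≤ M * Real.exp (-γ * len (a - b)) := by
    intro A m h a ha b hb
    have h1 : decaySup L γ 1 (part 1 A) ≤ ENNReal.ofReal M :=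
      (le_max_left _ _).trans (le_add_self.trans ((lipNorm_le_iterNorm L S γ m A).trans h))
    have h2 := absNorm_le_of_decaySup hM h1 ha hb
    rw [part_one_apply] at h2
    simpa using (norm_phi_le ε (A a b)).trans h2
  have bd : ∀ {A : LMat d} {m : ℕ} {L' : Set (Lat d)},
      (L' = L ∨ ∃ c : Lat d, c ≠ 0 ∧ ∀ a b, A (a + c) (b + c) = A a b) →
      iterNorm L S γ m A ≤ ENNReal.ofReal M → ∀ a ∈ L', ∀ b ∈ L',
      ‖phi ε (A a b)‖ ≤ M * Real.exp (-γ * len (a - b)) := by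
    intro A m L' hL' h a ha b hb
    rcases hL' with rfl | ⟨c, hc, hinv⟩
    · exact bdL h a ha b hb
    · obtain ⟨t, ht⟩ := ((hmem c hc a).and (hmem c hc b)).exists
      have h1 := bdL h _ ht.1 _ ht.2
      have h2 : ∀ t : ℕ, A (a + (t : ℤ) • c) (b + (t : ℤ) • c) = A a b := fun t => by
        induction t with
        | zero => simp
        | succ t ih =>
          rw [← ih, ← hinv (a + (t : ℤ) • c)]
          simp [add_smul, add_assoc]
      rwa [h2, add_sub_add_right_eq_sub] at h1
  have anti : ∀ {A : LMat d}, (∀ a ∈ L, ∀ b ∈ L, R < len (a - b) → piM (A a b) = 0) →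
      ∀ c : Lat d, c ≠ 0 → ∀ a b,
        Tendsto (fun t : ℕ => phi ε (A (a + (t : ℤ) • c) (b - (t : ℤ) • c))) atTop (𝓝 0) := by
    intro A htr c hc a b
    refine tendsto_const_nhds.congr' ?_
    filter_upwards [hmem c hc a, hmem (-c) (neg_ne_zero.2 hc) b,
      (Lev.tendsto_len_shift (a - b) (c := (2 : ℤ) • c)
        (smul_ne_zero two_ne_zero hc)).eventually_gt_atTop R] with t h1 h2 h3
    rw [smul_neg, ← sub_eq_add_neg] at h2
    have e : a + (t : ℤ) • c - (b - (t : ℤ) • c) = a - b + (t : ℤ) • ((2 : ℤ) • c) := by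
      rw [smul_comm, two_smul]; abel
    rw [← phi_piM, htr _ h1 _ h2 (by rwa [e]), phi_zero]
  have step : ∀ {A : LMat d} {m : ℕ}, IsTopl (m + 1) A → ∀ c : Lat d, c ≠ 0 →
      (∀ a b, Tendsto (ray 1 c A a b) atTop (𝓝 (tlim 1 c A a b))) ∧
      HasLim c (fun a b => phi ε (A a b)) (fun a b => phi ε (tlim 1 c A a b)) := by
    intro A m hA c hc
    have h1 : ∀ a b, Tendsto (ray 1 c A a b) atTop (𝓝 (tlim 1 c A a b)) := fun a b => by
      obtain ⟨l, hl⟩ := hA.1 1 c a b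
      exact tendsto_nhds_limUnder ⟨l, hl⟩
    refine ⟨h1, fun a b => ?_⟩
    refine (((continuous_phi ε).tendsto _).comp (h1 a b)).congr fun t => ?_
    simp [ray]
  have lip : ∀ {A : LMat d} {m : ℕ}, p → IsTopl (m + 1) A → iterNorm L S γ m A ≤ ENNReal.ofReal M →
      ∀ c : Lat d, c ≠ 0 → ∀ a b, LipDomPos S c a b →
        wt c a b * ‖phi ε (A a b) - phi ε (tlim 1 c A a b)‖ ≤ M * Real.exp (-γ * len (a - b)) := by
    intro A m hp hA h c hc a b hd
    obtain ⟨ha, hb⟩ := mem_of_lipDomPos hL (hρ hp).1 (hρ hp).2 hc hd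
    have h1 : lipConst L S γ 1 (part 1 A) ≤ ENNReal.ofReal M :=
      (le_max_left _ _).trans (le_self_add.trans ((lipNorm_le_iterNorm L S γ m A).trans h))
    have h2 := absNorm_le_of_lipConst hM h1 hc ha hb (by simpa [LipDom] using hd)
    rw [tlim_eq (tendsto_part_ray (step hA c hc).1), part_one_apply, part_one_apply] at h2
    have e : piM (A a b) - piM (tlim 1 c A a b) = piM (A a b - tlim 1 c A a b) := by
      refine eq_of_comp (fun ε => ?_) fun ε => ?_ <;> simp [phi_sub, psi_sub, phi_piM, psi_piM]
    rw [e] at h2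
    rw [← phi_sub]
    have hw0 : 0 ≤ wt c a b := (wt_pos c a b).le
    calc wt c a b * ‖phi ε (A a b - tlim 1 c A a b)‖
        ≤ wt c a b * absNorm (piM (A a b - tlim 1 c A a b)) := by gcongr; exact norm_phi_le _ _
      _ ≤ _ := by simpa using h2
  induction m generalizing A L' with
  | zero =>
    refine ⟨fun hp => bd hL' (hn hp), anti htr, fun c hc => ⟨_, (step hA c hc).2,
      fun hp a _ b _ => lip hp hA (hn hp) c hc a b, fun hp a _ b _ => ?_⟩⟩
    refine le_of_tendsto ((step hA c hc).2 a b).norm ?_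
    filter_upwards [hmem c hc a, hmem c hc b] with t h1 h2
    have := bdL (hn hp) _ h1 _ h2
    rwa [add_sub_add_right_eq_sub] at this
  | succ m ih =>
    refine ⟨fun hp => bd hL' (hn hp), anti htr, fun c hc => ⟨_, (step hA c hc).2,
      fun hp a _ b _ => lip hp hA (hn hp) c hc a b, ?_⟩⟩
    have hlim := (step hA c hc).1
    refine ih (Or.inr ⟨c, hc, fun a b => ?_⟩) (hA.2 1 c) (fun hp => ?_) fun a _ b _ hab => ?_
    · refine tendsto_nhds_unique (hlim (a + c) (b + c)) ?_
      refine ((hlim a b).comp (tendsto_add_atTop_nat 1)).congr fun t => ?_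
      simp [ray, add_smul, add_assoc, add_comm c]
    · exact le_trans (le_iSup₂ (f := fun (c : Lat d) (σ : ℤˣ) => iterNorm L S γ m (tlim σ c A)) c 1)
        (hn hp)
    · refine tendsto_nhds_unique ((continuous_piM.tendsto _).comp (hlim a b)) ?_
      refine tendsto_const_nhds.congr' ?_
      filter_upwards [hmem c hc a, hmem c hc b] with t h1 h2
      simp only [Function.comp, ray, Units.val_one, one_mul]
      rw [htr _ h1 _ h2 (by rwa [add_sub_add_right_eq_sub])]

end Norms

/-! ### Differentiability in the sense of Whitney -/

section Whitney

variable {n d : ℕ} {V W : Type*} [NormedAddCommGroup V] [NormedSpace ℝ V] [NormedAddCommGroup W]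
  [NormedSpace ℝ W] {X : Set (Par n)}

lemma WhitneyC1.mono {f : Par n → V} {g : Fin n → Par n → V} (h : WhitneyC1 X f g)
    {X' : Set (Par n)} (hX : X' ⊆ X) : WhitneyC1 X' f g :=
  ⟨fun l => (h.1 l).mono hX, fun x hx => (h.2 x (hX hx)).mono
    (nhdsWithin_mono _ (Set.prod_mono hX hX))⟩

lemma WhitneyC1.clm {f : Par n → V} {g : Fin n → Par n → V} (h : WhitneyC1 X f g) (T : V →L[ℝ] W) :
    WhitneyC1 X (fun ω => T (f ω)) fun l ω => T (g l ω) := by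
  refine ⟨fun l => T.continuous.comp_continuousOn (h.1 l), fun x hx => ?_⟩
  refine ((T.isBigO_comp _ _).trans_isLittleO (h.2 x hx)).congr_left fun p => ?_
  simp

lemma WhitneyC1.add {f f' : Par n → V} {g g' : Fin n → Par n → V} (h : WhitneyC1 X f g)
    (h' : WhitneyC1 X f' g') : WhitneyC1 X (fun ω => f ω + f' ω) fun l ω => g l ω + g' l ω := by
  refine ⟨fun l => (h.1 l).add (h'.1 l), fun x hx => ?_⟩
  refine ((h.2 x hx).add (h'.2 x hx)).congr_left fun p => ?_
  simp only [smul_add, Finset.sum_add_distrib]; abel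

lemma WhitneyC1.neg {f : Par n → V} {g : Fin n → Par n → V} (h : WhitneyC1 X f g) :
    WhitneyC1 X (fun ω => -f ω) fun l ω => -g l ω := by
  simpa using h.clm (-ContinuousLinearMap.id ℝ V)

lemma WhitneyC1.sub {f f' : Par n → V} {g g' : Fin n → Par n → V} (h : WhitneyC1 X f g)
    (h' : WhitneyC1 X f' g') : WhitneyC1 X (fun ω => f ω - f' ω) fun l ω => g l ω - g' l ω := by
  simpa only [sub_eq_add_neg] using h.add h'.neg

lemma WhitneyC1.const_mul {f : Par n → ℂ} {g : Fin n → Par n → ℂ} (h : WhitneyC1 X f g) (z : ℂ) :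
    WhitneyC1 X (fun ω => z * f ω) fun l ω => z * g l ω := by
  simpa using h.clm ((ContinuousLinearMap.mul ℝ ℂ) z)

lemma WhitneyC1.ofReal {f : Par n → ℝ} {g : Fin n → Par n → ℝ} (h : WhitneyC1 X f g) :
    WhitneyC1 X (fun ω => (f ω : ℂ)) fun l ω => (g l ω : ℂ) :=
  h.clm Complex.ofRealCLM

lemma whitneyC1_const (v : V) : WhitneyC1 X (fun _ => v) fun _ _ => 0 := by
  refine ⟨fun l => continuousOn_const, fun x _ => ?_⟩
  simp only [sub_self, smul_zero, Finset.sum_const_zero]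
  exact isLittleO_zero _ _

lemma whitneyC1_inner (v : Par n) : WhitneyC1 X (fun ω => inner ℝ v ω) fun l _ => v l := by
  refine ⟨fun l => continuousOn_const, fun x _ => ?_⟩
  have : ∀ p : Par n × Par n, inner ℝ v p.2 - inner ℝ v p.1 - ∑ l, (p.2 l - p.1 l) • v l = 0 := by
    intro p
    rw [← inner_sub_right, PiLp.inner_apply, sub_eq_zero]
    refine Finset.sum_congr rfl fun l _ => ?_
    simp
  simp only [this]
  exact isLittleO_zero _ _

lemma WhitneyC1.congr {f f' : Par n → V} {g g' : Fin n → Par n → V} (h : WhitneyC1 X f g)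
    (hf : ∀ ω ∈ X, f' ω = f ω) (hg : ∀ ω ∈ X, ∀ l, g' l ω = g l ω) : WhitneyC1 X f' g' := by
  refine ⟨fun l => (h.1 l).congr fun ω hω => hg ω hω l, fun x hx => ?_⟩
  refine (h.2 x hx).congr' ?_ EventuallyEq.rfl
  filter_upwards [self_mem_nhdsWithin] with p hp
  rw [hf _ hp.1, hf _ hp.2]
  simp only [hg _ hp.1]

lemma tendsto_prod_left {x : Par n} (hx : x ∈ X) :
    Tendsto (fun y : Par n => (x, y)) (𝓝[X] x) (𝓝[X ×ˢ X] (x, x)) := by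
  refine tendsto_nhdsWithin_iff.2 ⟨?_, ?_⟩
  · exact ((continuous_const.prodMk continuous_id).tendsto x).mono_left nhdsWithin_le_nhds
  · filter_upwards [self_mem_nhdsWithin] with y hy
    exact ⟨hx, hy⟩

lemma WhitneyC1.continuousOn {f : Par n → V} {g : Fin n → Par n → V} (h : WhitneyC1 X f g) :
    ContinuousOn f X := by
  intro x hx
  have h1 := (h.2 x hx).comp_tendsto (tendsto_prod_left hx)
  have h2 : Tendsto (fun y : Par n => y - x) (𝓝[X] x) (𝓝 0) := by
    have : Tendsto (fun y : Par n => y - x) (𝓝 x) (𝓝 (x - x)) :=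
      (continuous_id.sub continuous_const).tendsto x
    rw [sub_self] at this
    exact this.mono_left nhdsWithin_le_nhds
  have h3 := h1.isBigO.trans_tendsto h2
  have h4 : Tendsto (fun y : Par n => ∑ l, (y l - x l) • g l x) (𝓝[X] x) (𝓝 0) := by
    have : Tendsto (fun y : Par n => ∑ l, (y l - x l) • g l x) (𝓝 x)
        (𝓝 (∑ l, (x l - x l) • g l x)) := by
      refine Continuous.tendsto ?_ x
      fun_prop
    simp only [sub_self, zero_smul, Finset.sum_const_zero] at this
    exact this.mono_left nhdsWithin_le_nhds
  have h5 := (h3.add h4).add_const (f x)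
  simp only [add_zero, zero_add] at h5
  refine h5.congr fun y => ?_
  simp

lemma hs_le_sum (A B : Finset (Lat d)) (X : Ker d) : hs A B X ≤ ∑ a ∈ A, ∑ b ∈ B, ‖X a b‖ := by
  refine Real.sqrt_le_iff.2 ⟨by positivity, ?_⟩
  calc ∑ a ∈ A, ∑ b ∈ B, ‖X a b‖ ^ 2 ≤ ∑ a ∈ A, (∑ b ∈ B, ‖X a b‖) ^ 2 :=
        Finset.sum_le_sum fun a _ => Finset.sum_sq_le_sq_sum_of_nonneg fun b _ => norm_nonneg _
    _ ≤ _ := Finset.sum_sq_le_sq_sum_of_nonneg fun a _ => by positivity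

lemma sylv_coeff_add (A B : Finset (Lat d)) (z M N z' M' N' X : Ker d) :
    sylv A B (z + z') (M + M') (N + N') X = sylv A B z M N X + sylv A B z' M' N' X := by
  funext a b
  simp only [sylv, lprod, rprod, Pi.add_apply, add_mul, mul_add, Finset.sum_add_distrib]
  ring

lemma sylv_coeff_smul (A B : Finset (Lat d)) (z M N X : Ker d) (c : ℝ) :
    sylv A B (c • z) (c • M) (c • N) X = c • sylv A B z M N X := by
  funext a b
  simp only [sylv, lprod, rprod, Pi.smul_apply, smul_add, Finset.smul_sum, smul_mul_assoc,
    mul_smul_comm]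

lemma sylv_rsmul (A B : Finset (Lat d)) (z M N X : Ker d) (c : ℝ) :
    sylv A B z M N (c • X) = c • sylv A B z M N X := by
  funext a b
  simp only [sylv, lprod, rprod, Pi.smul_apply, smul_add, Finset.smul_sum, smul_mul_assoc,
    mul_smul_comm]

lemma sylv_zero (A B : Finset (Lat d)) (z M N : Ker d) : sylv A B z M N 0 = 0 := by
  funext a b; simp [sylv, lprod, rprod]

lemma sylv_coeff_zero (A B : Finset (Lat d)) (X : Ker d) : sylv A B 0 0 0 X = 0 := by
  funext a b; simp [sylv, lprod, rprod]

lemma sylv_sum (A B : Finset (Lat d)) (z M N : Ker d) {ι : Type*} (I : Finset ι) (X : ι → Ker d) :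
    sylv A B z M N (∑ i ∈ I, X i) = ∑ i ∈ I, sylv A B z M N (X i) := by
  classical
  induction I using Finset.induction_on with
  | empty => simp [sylv_zero]
  | insert i I hi ih => rw [Finset.sum_insert hi, Finset.sum_insert hi, sylv_add, ih]

lemma sylv_coeff_sum (A B : Finset (Lat d)) {ι : Type*} (I : Finset ι) (z M N : ι → Ker d)
    (X : Ker d) : sylv A B (∑ i ∈ I, z i) (∑ i ∈ I, M i) (∑ i ∈ I, N i) X
      = ∑ i ∈ I, sylv A B (z i) (M i) (N i) X := by
  classical
  induction I using Finset.induction_on with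
  | empty => simp [sylv_coeff_zero]
  | insert i I hi ih =>
    rw [Finset.sum_insert hi, Finset.sum_insert hi, Finset.sum_insert hi, Finset.sum_insert hi,
      sylv_coeff_add, ih]

/-- The first order Taylor remainder of a family of kernels. -/
def rem (f : Par n → Ker d) (fl : Fin n → Par n → Ker d) (p : Par n × Par n) : Ker d :=
  f p.2 - f p.1 - ∑ l, (p.2 l - p.1 l) • fl l p.1

lemma rem_apply (f : Par n → Ker d) (fl : Fin n → Par n → Ker d) (p : Par n × Par n) (a b : Lat d) :
    rem f fl p a b = f p.2 a b - f p.1 a b - ∑ l, (p.2 l - p.1 l) • fl l p.1 a b := by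
  simp [rem, Finset.sum_apply]

theorem whitneyC1_sol {A B : Finset (Lat d)} {z M N f s : Par n → Ker d}
    {zl Ml Nl fl r : Fin n → Par n → Ker d} {κ : ℝ} (hκ : 0 < κ)
    (hz : ∀ a ∈ A, ∀ b ∈ B, WhitneyC1 X (fun ω => z ω a b) fun l ω => zl l ω a b)
    (hM : ∀ a ∈ A, ∀ b ∈ A, WhitneyC1 X (fun ω => M ω a b) fun l ω => Ml l ω a b)
    (hN : ∀ a ∈ B, ∀ b ∈ B, WhitneyC1 X (fun ω => N ω a b) fun l ω => Nl l ω a b)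
    (hf : ∀ a ∈ A, ∀ b ∈ B, WhitneyC1 X (fun ω => f ω a b) fun l ω => fl l ω a b)
    (hLB : ∀ ω ∈ X, LB A B (z ω) (M ω) (N ω) κ)
    (hs : ∀ ω ∈ X, ∀ a ∈ A, ∀ b ∈ B, sylv A B (z ω) (M ω) (N ω) (s ω) a b = f ω a b)
    (hr : ∀ ω ∈ X, ∀ l, ∀ a ∈ A, ∀ b ∈ B, sylv A B (z ω) (M ω) (N ω) (r l ω) a b
      = fl l ω a b - sylv A B (zl l ω) (Ml l ω) (Nl l ω) (s ω) a b) :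
    ∀ a ∈ A, ∀ b ∈ B, WhitneyC1 X (fun ω => s ω a b) fun l ω => r l ω a b := by
  have hsc : ∀ x ∈ X, ∀ a ∈ A, ∀ b ∈ B, Tendsto (fun ω => s ω a b) (𝓝[X] x) (𝓝 (s x a b)) :=
    fun x hx => tendsto_sol hκ (fun a ha b hb => (hz a ha b hb).continuousOn x hx)
      (fun a ha b hb => (hM a ha b hb).continuousOn x hx)
      (fun a ha b hb => (hN a ha b hb).continuousOn x hx)
      (fun a ha b hb => (hf a ha b hb).continuousOn x hx)
      (by filter_upwards [self_mem_nhdsWithin] with ω hω using hLB ω hω)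
      (by filter_upwards [self_mem_nhdsWithin] with ω hω using hs ω hω) (hs x hx)
  have hrc : ∀ l, ∀ x ∈ X, ∀ a ∈ A, ∀ b ∈ B,
      Tendsto (fun ω => r l ω a b) (𝓝[X] x) (𝓝 (r l x a b)) := fun l x hx =>
    tendsto_sol hκ (fun a ha b hb => (hz a ha b hb).continuousOn x hx)
      (fun a ha b hb => (hM a ha b hb).continuousOn x hx)
      (fun a ha b hb => (hN a ha b hb).continuousOn x hx)
      (f := fun ω => fl l ω - sylv A B (zl l ω) (Ml l ω) (Nl l ω) (s ω))
      (f' := fl l x - sylv A B (zl l x) (Ml l x) (Nl l x) (s x))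
      (fun a ha b hb => ((hf a ha b hb).1 l x hx).sub (tendsto_sylv
        (fun a ha b hb => (hz a ha b hb).1 l x hx) (fun a ha b hb => (hM a ha b hb).1 l x hx)
        (fun a ha b hb => (hN a ha b hb).1 l x hx) (hsc x hx) a ha b hb))
      (by filter_upwards [self_mem_nhdsWithin] with ω hω using hLB ω hω)
      (by filter_upwards [self_mem_nhdsWithin] with ω hω using hr ω hω l) (hr x hx l)
  have key : ∀ p ∈ X ×ˢ X, ∀ a ∈ A, ∀ b ∈ B,
      sylv A B (z p.1) (M p.1) (N p.1) (rem s r p) a b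
        = rem f fl p a b - sylv A B (rem z zl p) (rem M Ml p) (rem N Nl p) (s p.2) a b
          - ∑ l, (p.2 l - p.1 l) • sylv A B (zl l p.1) (Ml l p.1) (Nl l p.1) (s p.2 - s p.1) a b := by
    rintro ⟨u, w⟩ ⟨hu, hw⟩ a ha b hb
    simp only
    have e1 : sylv A B (z w) (M w) (N w) (s w) = sylv A B (z u) (M u) (N u) (s w)
        + ∑ l, (w l - u l) • sylv A B (zl l u) (Ml l u) (Nl l u) (s w)
        + sylv A B (rem z zl (u, w)) (rem M Ml (u, w)) (rem N Nl (u, w)) (s w) := by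
      simp only [← sylv_coeff_smul, ← sylv_coeff_sum, ← sylv_coeff_add, rem]
      congr 1 <;> abel
    have e2 := congrFun (congrFun e1 a) b
    rw [hs w hw a ha b hb] at e2
    simp only [Pi.add_apply, Finset.sum_apply, Pi.smul_apply] at e2
    have e3 : sylv A B (z u) (M u) (N u) (rem s r (u, w)) a b
        = sylv A B (z u) (M u) (N u) (s w) a b - f u a b
          - ∑ l, (w l - u l) • (fl l u a b - sylv A B (zl l u) (Ml l u) (Nl l u) (s u) a b) := by
      rw [rem, sylv_sub, sylv_sub, sylv_sum]
      simp only [Pi.sub_apply, Finset.sum_apply, sylv_rsmul, Pi.smul_apply, hs u hu a ha b hb,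
        hr u hu _ a ha b hb]
    have e4 : ∀ l, sylv A B (zl l u) (Ml l u) (Nl l u) (s w - s u) a b
        = sylv A B (zl l u) (Ml l u) (Nl l u) (s w) a b
          - sylv A B (zl l u) (Ml l u) (Nl l u) (s u) a b := fun l => by
      rw [sylv_sub]; rfl
    rw [e3, rem_apply f]
    simp only [e4, smul_sub, Finset.sum_sub_distrib]
    linear_combination -e2
  intro a ha b hb
  refine ⟨fun l x hx => hrc l x hx a ha b hb, fun x hx => ?_⟩
  set F := 𝓝[X ×ˢ X] (x, x) with hF
  have hsnd : Tendsto (fun p : Par n × Par n => p.2) F (𝓝[X] x) := by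
    refine tendsto_nhdsWithin_iff.2 ⟨(continuous_snd.tendsto (x, x)).mono_left nhdsWithin_le_nhds, ?_⟩
    filter_upwards [self_mem_nhdsWithin] with p hp using hp.2
  have hfst : Tendsto (fun p : Par n × Par n => p.1) F (𝓝[X] x) := by
    refine tendsto_nhdsWithin_iff.2 ⟨(continuous_fst.tendsto (x, x)).mono_left nhdsWithin_le_nhds, ?_⟩
    filter_upwards [self_mem_nhdsWithin] with p hp using hp.1
  have hsO : ∀ a ∈ A, ∀ b ∈ B, (fun p : Par n × Par n => s p.2 a b) =O[F] fun _ => (1 : ℝ) :=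
    fun a ha b hb => ((hsc x hx a ha b hb).comp hsnd).isBigO_one ℝ
  have hrem : ∀ {f : Par n → Ker d} {fl : Fin n → Par n → Ker d} {a b : Lat d},
      WhitneyC1 X (fun ω => f ω a b) (fun l ω => fl l ω a b) →
      (fun p => rem f fl p a b) =o[F] fun p => p.2 - p.1 := fun h => by
    simpa only [rem_apply] using h.2 x hx
  have hmul : ∀ {u v : Par n × Par n → ℂ}, u =o[F] (fun p => p.2 - p.1) →
      v =O[F] (fun _ => (1 : ℝ)) → (fun p => u p * v p) =o[F] fun p => p.2 - p.1 := by
    intro u v hu hv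
    have := hu.norm_right.mul_isBigO hv
    simp only [mul_one] at this
    exact this.of_norm_right
  have hterm : ∀ a ∈ A, ∀ b ∈ B, (fun p => sylv A B (z p.1) (M p.1) (N p.1) (rem s r p) a b)
      =o[F] fun p => p.2 - p.1 := by
    intro a ha b hb
    have t1 := hrem (hf a ha b hb)
    have t2 : (fun p => sylv A B (rem z zl p) (rem M Ml p) (rem N Nl p) (s p.2) a b)
        =o[F] fun p => p.2 - p.1 := by
      unfold sylv lprod rprod
      refine ((hmul (hrem (hz a ha b hb)) (hsO a ha b hb)).add
        (IsLittleO.fun_sum fun e he => hmul (hrem (hM a ha e he)) (hsO e he b hb))).add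
        (IsLittleO.fun_sum fun e he => ?_)
      simpa only [mul_comm] using hmul (hrem (hN e he b hb)) (hsO a ha e he)
    have t3 : (fun p : Par n × Par n => ∑ l, (p.2 l - p.1 l) •
        sylv A B (zl l p.1) (Ml l p.1) (Nl l p.1) (s p.2 - s p.1) a b) =o[F] fun p => p.2 - p.1 := by
      refine IsLittleO.fun_sum fun l _ => ?_
      have h1 : Tendsto (fun p : Par n × Par n =>
          sylv A B (zl l p.1) (Ml l p.1) (Nl l p.1) (s p.2 - s p.1) a b) F (𝓝 0) := by
        have := tendsto_sylv (l := F) (A := A) (B := B) (X := fun p => s p.2 - s p.1)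
          (z := fun p : Par n × Par n => zl l p.1)
          (M := fun p => Ml l p.1) (N := fun p => Nl l p.1)
          (z' := zl l x) (M' := Ml l x) (N' := Nl l x) (X' := 0)
          (fun a ha b hb => Filter.Tendsto.comp ((hz a ha b hb).1 l x hx) hfst)
          (fun a ha b hb => Filter.Tendsto.comp ((hM a ha b hb).1 l x hx) hfst)
          (fun a ha b hb => Filter.Tendsto.comp ((hN a ha b hb).1 l x hx) hfst)
          (fun a ha b hb => by
            have := ((hsc x hx a ha b hb).comp hsnd).sub ((hsc x hx a ha b hb).comp hfst)
            rw [sub_self] at this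
            exact this) a ha b hb
        rwa [sylv_zero] at this
      have h2 : (fun p : Par n × Par n => p.2 l - p.1 l) =O[F] fun p => p.2 - p.1 :=
        IsBigO.of_bound 1 (Eventually.of_forall fun p => by
          rw [one_mul]; exact PiLp.norm_apply_le (p.2 - p.1) l)
      have h3 := h2.norm_right.smul_isLittleO ((isLittleO_one_iff ℝ).2 h1)
      simp only [smul_eq_mul, mul_one] at h3
      exact h3.of_norm_right
    refine ((t1.sub t2).sub t3).congr' ?_ EventuallyEq.rfl
    filter_upwards [self_mem_nhdsWithin] with p hp
    exact (key p hp a ha b hb).symm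
  have hsum : (fun p => ∑ a ∈ A, ∑ b ∈ B, ‖sylv A B (z p.1) (M p.1) (N p.1) (rem s r p) a b‖)
      =o[F] fun p => p.2 - p.1 :=
    IsLittleO.fun_sum fun a ha => IsLittleO.fun_sum fun b hb => (hterm a ha b hb).norm_left
  have hfin : (fun p => rem s r p a b) =o[F] fun p => p.2 - p.1 := by
    refine IsBigO.trans_isLittleO (IsBigO.of_bound κ⁻¹ ?_) hsum
    filter_upwards [self_mem_nhdsWithin] with p hp
    refine (norm_le_hs _ ha hb).trans (((hLB p.1 hp.1).hs_le hκ _).trans ?_)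
    refine mul_le_mul_of_nonneg_left ((hs_le_sum _ _ _).trans (le_abs_self _)) (inv_pos.2 hκ).le
  simpa only [rem_apply] using hfin

end Whitney

/-! ### The scalar operators of the equation -/

section Operators

variable {d n : ℕ} {A : Finset (Lat d)} {K : ℝ} {L : Set (Lat d)} {x : Lat d → ℝ} {M : Ker d}

/-- The diagonal kernel with real entries `x`. -/
def dg (x : Lat d → ℝ) : Ker d := fun a b => if a = b then ((x a : ℝ) : ℂ) else 0

lemma LipDomPos.mono {S S' : ℝ} {c a b : Lat d} (h : LipDomPos S' c a b) (hS : 0 ≤ S)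
    (hSS : S ≤ S') : LipDomPos S c a b := by
  obtain ⟨⟨a', b', t, h0, h1, h2, h3, h4⟩, h5, h6⟩ := h
  have l1 : ∀ x : Lat d, 0 ≤ (len x + len c) * len c := fun x =>
    mul_nonneg (add_nonneg (norm_nonneg _) (norm_nonneg _)) (norm_nonneg _)
  have l2 : 2 * S ^ 2 ≤ 2 * S' ^ 2 := by gcongr
  have l3 : ∀ x : Lat d, S * (len x + len c) * len c ≤ S' * (len x + len c) * len c := fun x => by
    rw [mul_assoc, mul_assoc]
    exact mul_le_mul_of_nonneg_right hSS (l1 x)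
  exact ⟨⟨a', b', t, h0, h1, (l3 a').trans h2, h3, (l3 b').trans h4⟩, l2.trans h5, l2.trans h6⟩

lemma SReg.add {ρ S K K' : ℝ} : ∀ {m : ℕ} {A B : Ker d},
    SReg ρ S K m A → SReg ρ S K' m B → SReg ρ S (K + K') m (A + B)
  | 0, _, _, _, _ => trivial
  | _ + 1, A, B, h, h' => fun c hc => by
    obtain ⟨A', h1, h2, h3⟩ := h c hc
    obtain ⟨B', h1', h2', h3'⟩ := h' c hc
    refine ⟨A' + B', fun a b => (h1 a b).add (h1' a b), fun a b ha hb hd => ?_, h3.add h3'⟩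
    have e : (A + B) a b - (A' + B') a b = (A a b - A' a b) + (B a b - B' a b) := by
      simp only [Pi.add_apply]; ring
    rw [e]
    refine (mul_le_mul_of_nonneg_left (norm_add_le _ _) ?_).trans ?_
    · exact (wt_pos c a b).le
    · rw [mul_add]; exact add_le_add (h2 a b ha hb hd) (h2' a b ha hb hd)

lemma SReg.zero {ρ S K : ℝ} (hK : 0 ≤ K) : ∀ m : ℕ, SReg ρ S K m (0 : Ker d)
  | 0 => trivial
  | m + 1 => fun c _ => ⟨0, fun _ _ => tendsto_const_nhds, fun a b _ _ _ => by simpa using hK,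
      SReg.zero hK m⟩

lemma PtReg.sReg {ρ S M : ℝ} : ∀ {m : ℕ} {L : Set (Lat d)} {s : Ker d},
    (∀ a, ρ ≤ len a → a ∈ L) → PtReg True 0 S M m L s → SReg ρ S M m s
  | 0, _, _, _, _ => trivial
  | _ + 1, L, s, hL, h => fun c hc => by
    obtain ⟨s', h1, h2, h3⟩ := h.2.2 c hc
    refine ⟨s', h1, fun a b ha hb hd => ?_, PtReg.sReg (L := Set.univ) (fun _ _ => trivial) h3⟩
    simpa using h2 trivial a (hL a ha) b (hL b hb) hd

lemma sReg_dg {ρ S C C' : ℝ} (hρ : 0 ≤ C) (hC' : 0 < C')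
    (hL : ∀ a, ρ ≤ len a → a ∈ L)
    (hx : ∀ a ∈ L, |x a| ≤ C * Real.exp (-C' * len a)) (m : ℕ) :
    SReg ρ S (C * (1 / C' + 1)) m (dg x) := by
  have hK : 0 ≤ C * (1 / C' + 1) := by positivity
  rcases m with _ | m
  · trivial
  intro c hc
  refine ⟨0, fun a b => ?_, fun a b ha hb hd => ?_, SReg.zero hK m⟩
  · by_cases hab : a = b
    · subst hab
      have hl := Lev.tendsto_len_shift a hc
      have h0 : Tendsto (fun t : ℕ => C * Real.exp (-C' * len (a + (t : ℤ) • c))) atTop (𝓝 0) := by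
        have : Tendsto (fun t : ℕ => -C' * len (a + (t : ℤ) • c)) atTop atBot :=
          hl.const_mul_atTop_of_neg (by linarith)
        simpa using (Real.tendsto_exp_atBot.comp this).const_mul C
      have h1 : Tendsto (fun t : ℕ => x (a + (t : ℤ) • c)) atTop (𝓝 0) := by
        refine squeeze_zero_norm' ?_ h0
        filter_upwards [hl.eventually_ge_atTop ρ] with t ht
        exact hx _ (hL _ ht)
      have : Tendsto (fun t : ℕ => ((x (a + (t : ℤ) • c) : ℝ) : ℂ)) atTop (𝓝 ((0 : ℝ) : ℂ)) :=
        (Complex.continuous_ofReal.tendsto 0).comp h1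
      simpa [dg] using this
    · simp [dg, hab]
  · by_cases hab : a = b
    · subst hab
      have h1 : 1 ≤ len c := one_le_len hc
      have hw : wt c a a ≤ len a + 1 := by
        have : len a / len c ≤ len a := div_le_self (norm_nonneg _) h1
        simp only [wt, max_self]
        linarith
      have h2 := hx a (hL a ha)
      have h3 : len a * Real.exp (-C' * len a) ≤ 1 / C' := by
        have h := Real.add_one_le_exp (C' * len a)
        rw [neg_mul, Real.exp_neg, ← div_eq_mul_inv, div_le_div_iff₀ (Real.exp_pos _) hC']
        nlinarith
      have h4 : Real.exp (-C' * len a) ≤ 1 := by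
        have : 0 ≤ len a := norm_nonneg _
        rw [Real.exp_le_one_iff]
        nlinarith
      have h5 : ‖dg x a a - (0 : Ker d) a a‖ = |x a| := by simp [dg]
      rw [h5]
      have h6 : 0 ≤ len a := norm_nonneg _
      calc wt c a a * |x a| ≤ (len a + 1) * (C * Real.exp (-C' * len a)) :=
            mul_le_mul hw h2 (abs_nonneg _) (by linarith)
        _ = C * (len a * Real.exp (-C' * len a) + Real.exp (-C' * len a)) := by ring
        _ ≤ _ := mul_le_mul_of_nonneg_left (add_le_add h3 h4) hρ
    · simpa [dg, hab] using hK

lemma opOn_iff_norm : OpOn A M K ↔ 0 ≤ K ∧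
    ∀ ξ : Lat d → ℂ, √(∑ a ∈ A, ‖∑ e ∈ A, M a e * ξ e‖ ^ 2) ≤ K * √(∑ e ∈ A, ‖ξ e‖ ^ 2) := by
  refine and_congr_right fun hK => forall_congr' fun ξ => ?_
  rw [Real.sqrt_le_left (by positivity), mul_pow, Real.sq_sqrt (by positivity)]

lemma sqrt_sum_add_le (A : Finset (Lat d)) (u w : Lat d → ℂ) :
    √(∑ a ∈ A, ‖u a + w a‖ ^ 2) ≤ √(∑ a ∈ A, ‖u a‖ ^ 2) + √(∑ a ∈ A, ‖w a‖ ^ 2) := by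
  have h := norm_add_le (WithLp.toLp 2 fun a : A => u a : EuclideanSpace ℂ A)
    (WithLp.toLp 2 fun a : A => w a)
  simp only [EuclideanSpace.norm_eq, PiLp.add_apply] at h
  rwa [Finset.sum_coe_sort A fun a => ‖u a + w a‖ ^ 2, Finset.sum_coe_sort A fun a => ‖u a‖ ^ 2,
    Finset.sum_coe_sort A fun a => ‖w a‖ ^ 2] at h

lemma OpOn.add {M M' : Ker d} {K K' : ℝ} (h : OpOn A M K) (h' : OpOn A M' K') :
    OpOn A (M + M') (K + K') := by
  rw [opOn_iff_norm] at *
  refine ⟨add_nonneg h.1 h'.1, fun ξ => ?_⟩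
  rw [add_mul]
  refine le_trans (le_of_eq ?_) ((sqrt_sum_add_le A _ _).trans (add_le_add (h.2 ξ) (h'.2 ξ)))
  simp only [Pi.add_apply, add_mul, Finset.sum_add_distrib]

lemma opOn_dg (hK : 0 ≤ K) (h : ∀ a ∈ A, |x a| ≤ K) :
    OpOn A (dg x) K := by
  refine ⟨hK, fun ξ => ?_⟩
  rw [Finset.mul_sum]
  refine Finset.sum_le_sum fun a ha => ?_
  have : ∑ e ∈ A, dg x a e * ξ e = (x a : ℂ) * ξ a := by
    rw [Finset.sum_eq_single_of_mem a ha]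
    · simp [dg]
    · intro b _ hb; simp [dg, hb.symm]
  rw [this, norm_mul, mul_pow, Complex.norm_real, Real.norm_eq_abs]
  gcongr
  exact h a ha

lemma tr_dg (x : Lat d → ℝ) : tr (dg x) = dg x := by
  funext a b
  by_cases h : a = b
  · subst h; rfl
  · simp [tr, dg, h, Ne.symm h]

lemma formLe_of_opOn (h : OpOn A M K) : FormLe A M K := by
  intro ξ
  have h1 := (opOn_iff_norm.1 h).2 ξ
  refine (Complex.abs_re_le_norm _).trans ?_
  have h2 : ‖qf A M ξ‖ ≤ ∑ a ∈ A, ‖ξ a‖ * ‖∑ e ∈ A, M a e * ξ e‖ := by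
    unfold qf
    refine (norm_sum_le _ _).trans (Finset.sum_le_sum fun a _ => ?_)
    rw [← Finset.mul_sum, norm_mul, RCLike.norm_conj]
  have h3 := Real.sum_mul_le_sqrt_mul_sqrt A (fun a => ‖ξ a‖) fun a => ‖∑ e ∈ A, M a e * ξ e‖
  have h4 : √(∑ a ∈ A, ‖ξ a‖ ^ 2) * √(∑ a ∈ A, ‖ξ a‖ ^ 2) = ∑ a ∈ A, ‖ξ a‖ ^ 2 :=
    Real.mul_self_sqrt (by positivity)
  calc ‖qf A M ξ‖ ≤ √(∑ a ∈ A, ‖ξ a‖ ^ 2) * √(∑ a ∈ A, ‖∑ e ∈ A, M a e * ξ e‖ ^ 2) := h2.trans h3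
    _ ≤ √(∑ a ∈ A, ‖ξ a‖ ^ 2) * (K * √(∑ a ∈ A, ‖ξ a‖ ^ 2)) :=
        mul_le_mul_of_nonneg_left h1 (Real.sqrt_nonneg _)
    _ = _ := by rw [mul_left_comm, h4]

lemma piM_mul_phi {X : Gl2} (hX : piM X = X) (ε : ℤˣ) (i : Fin 2) :
    ∑ j, X i j * ![1, ((ε : ℤ) : ℂ) * Complex.I] j
      = phi ε X * ![1, ((ε : ℤ) : ℂ) * Complex.I] i := by
  have h := piM_apply X
  rw [hX] at h
  have hI := Complex.I_mul_I
  have e1 : (((ε : ℤ) : ℂ)) * ((ε : ℤ) : ℂ) = 1 := by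
    rcases Int.units_eq_one_or ε with rfl | rfl <;> simp
  have h11 : X 1 1 = X 0 0 := by
    have h0 := congrFun (congrFun h 0) 0
    have h1 := congrFun (congrFun h 1) 1
    simp at h0 h1
    linear_combination h1 - h0
  have h10 : X 1 0 = - X 0 1 := by
    have h0 := congrFun (congrFun h 0) 1
    have h1 := congrFun (congrFun h 1) 0
    simp at h0 h1
    linear_combination h1 + h0
  fin_cases i
  · simp [Fin.sum_univ_two, phi, h11, h10]; ring
  · simp [Fin.sum_univ_two, phi, h11, h10]
    linear_combination (-(X 0 1)) * Complex.I ^ 2 * e1 - X 0 1 * hI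

lemma opOn_phi {X : LMat d} (hK : 0 ≤ K)
    (hX : ∀ a ∈ L, ∀ b ∈ L, piM (X a b) = X a b) (h : opNorm L X ≤ ENNReal.ofReal K)
    (hA : ∀ a ∈ A, a ∈ L) (ε : ℤˣ) :
    OpOn A (fun a b => phi ε (X a b)) K := by
  refine ⟨hK, fun ξ => ?_⟩
  set T := Matrix.toEuclideanCLM (𝕜 := ℂ) (n := A × Fin 2)
      (Matrix.of fun p q => X (p.1 : Lat d) (q.1 : Lat d) p.2 q.2) with hT
  have hTn : ‖T‖ ≤ K := by
    have : ‖T‖ₑ ≤ ENNReal.ofReal K :=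
      le_trans (le_iSup₂_of_le (f := fun (s : Finset (Lat d)) (_ : (s : Set (Lat d)) ⊆ L) =>
        ‖Matrix.toEuclideanCLM (𝕜 := ℂ) (n := s × Fin 2)
          (Matrix.of fun p q => X (p.1 : Lat d) (q.1 : Lat d) p.2 q.2)‖ₑ) A hA le_rfl) h
    rwa [← ofReal_norm, ENNReal.ofReal_le_ofReal_iff hK] at this
  set vε : Fin 2 → ℂ := ![1, ((ε : ℤ) : ℂ) * Complex.I] with hv
  have hvn : ∀ i, ‖vε i‖ = 1 := by
    intro i
    fin_cases i
    · simp [hv]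
    · rcases Int.units_eq_one_or ε with rfl | rfl <;> simp [hv]
  set y : EuclideanSpace ℂ (A × Fin 2) := WithLp.toLp 2 fun p => ξ p.1 * vε p.2 with hy
  have hyn : ‖y‖ ^ 2 = 2 * ∑ e ∈ A, ‖ξ e‖ ^ 2 := by
    rw [EuclideanSpace.norm_sq_eq, Fintype.sum_prod_type, ← Finset.sum_coe_sort A, Finset.mul_sum]
    refine Finset.sum_congr rfl fun a _ => ?_
    simp only [hy, norm_mul, hvn, Fin.sum_univ_two, mul_one]
    ring
  have hTy : ∀ p : A × Fin 2, T y p = (∑ e ∈ A, phi ε (X p.1 e) * ξ e) * vε p.2 := by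
    rintro ⟨a, i⟩
    have : T y (a, i) = ∑ q : A × Fin 2, X (a : Lat d) (q.1 : Lat d) i q.2 * (ξ q.1 * vε q.2) := by
      rw [hT, hy]
      simp [Matrix.toEuclideanCLM_toLp, Matrix.mulVec, dotProduct]
    rw [this, Fintype.sum_prod_type, Finset.sum_mul, ← Finset.sum_coe_sort A]
    refine Finset.sum_congr rfl fun e _ => ?_
    have h1 := piM_mul_phi (hX a (hA a a.2) e (hA e e.2)) ε i
    calc ∑ j, X (a : Lat d) (e : Lat d) i j * (ξ e * vε j)
        = ξ e * ∑ j, X (a : Lat d) (e : Lat d) i j * vε j := by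
          rw [Finset.mul_sum]; exact Finset.sum_congr rfl fun j _ => by ring
      _ = _ := by rw [h1]; ring
  have hTyn : ‖T y‖ ^ 2 = 2 * ∑ a ∈ A, ‖∑ e ∈ A, phi ε (X a e) * ξ e‖ ^ 2 := by
    rw [EuclideanSpace.norm_sq_eq, Fintype.sum_prod_type, ← Finset.sum_coe_sort A, Finset.mul_sum]
    refine Finset.sum_congr rfl fun a _ => ?_
    simp only [hTy, norm_mul, hvn, Fin.sum_univ_two, mul_one]
    ring
  have hle : ‖T y‖ ≤ K * ‖y‖ := (T.le_opNorm y).trans (by gcongr)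
  have h2 : ‖T y‖ ^ 2 ≤ K ^ 2 * ‖y‖ ^ 2 := by
    rw [← mul_pow]; gcongr
  rw [hTyn, hyn] at h2
  linarith

end Operators

/-! ### Increments along segments -/

section Segments

variable {d n : ℕ}

lemma WhitneyC1.sum {X : Set (Par n)} {V : Type*} [NormedAddCommGroup V] [NormedSpace ℝ V]
    {ι : Type*} (I : Finset ι) {f : ι → Par n → V} {g : ι → Fin n → Par n → V}
    (h : ∀ i ∈ I, WhitneyC1 X (f i) (g i)) :
    WhitneyC1 X (fun ω => ∑ i ∈ I, f i ω) fun l ω => ∑ i ∈ I, g i l ω := by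
  classical
  induction I using Finset.induction_on with
  | empty => simpa using whitneyC1_const (X := X) (0 : V)
  | insert i I hi ih =>
    simp only [Finset.sum_insert hi]
    exact (h i (Finset.mem_insert_self i I)).add
      (ih fun j hj => h j (Finset.mem_insert_of_mem hj))

lemma WhitneyC1.norm_sub_le {B : Set (Par n)} (hB : Convex ℝ B) {f : Par n → ℝ}
    {g : Fin n → Par n → ℝ} (h : WhitneyC1 B f g) {x y : Par n} (hx : x ∈ B) (hy : y ∈ B) {C : ℝ}
    (hC : ∀ z ∈ B, |∑ l, (y l - x l) * g l z| ≤ C) : |f y - f x| ≤ C := by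
  set γ : ℝ → Par n := fun t => x + t • (y - x) with hγ
  have hmem : ∀ t ∈ Set.Icc (0 : ℝ) 1, γ t ∈ B := fun t ht => by
    have := hB.add_smul_sub_mem hx hy ht
    exact this
  have hder : ∀ t ∈ Set.Icc (0 : ℝ) 1, HasDerivWithinAt (fun t => f (γ t))
      (∑ l, (y l - x l) * g l (γ t)) (Set.Icc 0 1) t := by
    intro t ht
    rw [hasDerivWithinAt_iff_isLittleO]
    have h1 := h.2 (γ t) (hmem t ht)
    have hcont : Continuous γ := by rw [hγ]; fun_prop
    have htend : Tendsto (fun u => (γ t, γ u)) (𝓝[Set.Icc 0 1] t) (𝓝[B ×ˢ B] (γ t, γ t)) := by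
      refine (tendsto_prod_left (hmem t ht)).comp ?_
      exact tendsto_nhdsWithin_iff.2 ⟨(hcont.tendsto t).mono_left nhdsWithin_le_nhds,
        eventually_nhdsWithin_of_forall fun u hu => hmem u hu⟩
    have h2 := h1.comp_tendsto htend
    have e1 : ∀ u, γ u - γ t = (u - t) • (y - x) := fun u => by
      simp only [hγ, add_sub_add_left_eq_sub, ← sub_smul]
    have h3 : ((fun p : Par n × Par n => p.2 - p.1) ∘ fun u => (γ t, γ u))
        =O[𝓝[Set.Icc 0 1] t] fun u => u - t := by
      refine IsBigO.of_bound ‖y - x‖ (Eventually.of_forall fun u => ?_)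
      simp only [Function.comp, e1, norm_smul]
      rw [mul_comm]
    refine (h2.trans_isBigO h3).congr_left fun u => ?_
    simp only [Function.comp, smul_eq_mul, Finset.mul_sum]
    congr 1
    refine Finset.sum_congr rfl fun l _ => ?_
    have : γ u l - γ t l = (u - t) * (y l - x l) := by
      have := congrArg (fun z : Par n => z l) (e1 u)
      simpa using this
    rw [this, mul_assoc]
  have := norm_image_sub_le_of_norm_deriv_le_segment' hder (C := C)
    (fun t ht => hC _ (hmem t ⟨ht.1, ht.2.le⟩)) 1 ⟨zero_le_one, le_rfl⟩
  simpa [hγ] using this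

end Segments

/-! ### Blocks -/

section Blocks

variable {d n : ℕ} {L : Set (Lat d)}

/-- The level at which the equation is posed. -/
def baseLev (L : Set (Lat d)) (Δ Δ' D ρ : ℝ) (k0 : Prop) : Lev d := ⟨L, [], Δ, Δ', D, ρ, k0⟩

lemma sameBlock_iff {Δ Δ' D ρ : ℝ} {k0 : Prop} {a b : Lat d} :
    SameBlock L Δ a b ↔ (baseLev L Δ Δ' D ρ k0).Rel a b := by
  constructor
  · intro h
    unfold SameBlock at h
    induction h with
    | rel x y h =>
      exact Relation.ReflTransGen.single ⟨h.1, h.2.1, h.2.2.1, h.2.2.2, by simp [baseLev]⟩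
    | refl x => exact Lev.Rel.refl x
    | symm x y _ ih => exact ih.symm
    | trans x y z _ _ h1 h2 => exact h1.trans h2
  · intro h
    unfold Lev.Rel at h
    induction h with
    | refl => exact Relation.EqvGen.refl _
    | tail _ h2 ih =>
      exact ih.trans _ _ _ (Relation.EqvGen.rel _ _ ⟨h2.1, h2.2.1, h2.2.2.1, h2.2.2.2.1⟩)

/-- The block diameters are bounded by a power of `Δ`. -/
lemma exists_blockDiam_le (d : ℕ) : ∃ (C : ℝ) (e : ℕ), 1 ≤ C ∧ ∀ (L : Set (Lat d)) (Δ : ℝ), 1 ≤ Δ →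
    (∀ a b, SameBlock L Δ a b → len (a - b) ≤ blockDiam L Δ) ∧ blockDiam L Δ ≤ C * Δ ^ e := by
  obtain ⟨C, e, hC, H⟩ := diam_connected_sphere_le d
  refine ⟨C, e, hC, fun L Δ hΔ => ?_⟩
  have key : ∀ a b, SameBlock L Δ a b → len (a - b) ≤ C * Δ ^ e := by
    intro a b hab
    set g := baseLev L Δ 0 0 0 False
    have hr : ∀ x y, SameBlock L Δ x y ↔ g.Rel x y := fun x y => sameBlock_iff
    refine H Δ hΔ {e | g.Rel a e} (fun x hx y hy => ?_) (fun x hx y hy => ?_) a (Lev.Rel.refl a) b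
      ((hr a b).1 hab)
    · exact (Lev.Rel.len_eq hx).symm.trans (Lev.Rel.len_eq hy)
    · have hxy : g.Rel x y := (Lev.Rel.symm hx).trans hy
      unfold Lev.Rel at hxy
      induction hxy with
      | refl => exact Relation.ReflTransGen.refl
      | @tail u w h1 h2 ih =>
        have hu : g.Rel a u := Lev.Rel.trans hx h1
        refine (ih hu).tail ⟨hu.tail h2, ?_⟩
        rw [len_sub_comm]
        exact h2.2.2.2.1
  have hbdd : BddAbove {r : ℝ | ∃ a ∈ L, ∃ b ∈ L, SameBlock L Δ a b ∧ r = len (a - b)} :=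
    ⟨C * Δ ^ e, by rintro r ⟨a, -, b, -, h, rfl⟩; exact key a b h⟩
  have hpos : 0 ≤ blockDiam L Δ := Real.sSup_nonneg (by
    rintro r ⟨a, -, b, -, -, rfl⟩; exact len_nonneg _)
  refine ⟨fun a b hab => ?_, Real.sSup_le (by rintro r ⟨a, -, b, -, h, rfl⟩; exact key a b h)
    (by positivity)⟩
  rcases Lev.Rel.eq_or_mem ((sameBlock_iff (Δ' := 0) (D := 0) (ρ := 0) (k0 := False)).1 hab)
    with rfl | ⟨ha, hb⟩
  · simpa using hpos
  · exact le_csSup hbdd ⟨a, ha, b, hb, hab, rfl⟩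

lemma exists_radius (hL : Lᶜ.Finite) : ∃ ρ : ℝ, 0 ≤ ρ ∧ ∀ a, ρ ≤ len a → a ∈ L := by
  obtain ⟨M, hM⟩ := (hL.image len).bddAbove
  refine ⟨max M 0 + 1, by positivity, fun a ha => ?_⟩
  by_contra h
  have := hM ⟨a, h, rfl⟩
  have := le_max_left M 0
  linarith

lemma two_mul_le_blockDiam (hd : 2 ≤ d) (hL : Lᶜ.Finite) {Δ : ℝ} (hΔ : 1 ≤ Δ) (p : ℕ)
    (hp : 2 * (p : ℝ) ≤ Δ) : 2 * (p : ℝ) ≤ blockDiam L Δ := by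
  obtain ⟨ρ, hρ0, hρ⟩ := exists_radius hL
  obtain ⟨m, hm⟩ := exists_nat_ge ρ
  set i0 : Fin d := ⟨0, by omega⟩
  set i1 : Fin d := ⟨1, by omega⟩
  have h01 : i0 ≠ i1 := by simp [i0, i1]
  let v : ℤ → Lat d := fun q => Pi.single i0 q + Pi.single i1 (m : ℤ)
  have hdot : ∀ q : ℤ, v q ⬝ᵥ v q = q * q + m * m := by
    intro q
    simp [v, h01, h01.symm]
  have hmem : ∀ q, v q ∈ L := fun q => hρ _ (hm.trans (by
    have := abs_coord_le_len (v q) i1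
    simpa [v, h01.symm] using this))
  have hlen : len (v p - v (-p)) = 2 * (p : ℝ) := by
    have e : v p - v (-p) = Pi.single i0 (2 * (p : ℤ)) := by
      simp only [v, add_sub_add_right_eq_sub, ← Pi.single_sub]
      congr 1; ring
    have h2 : len (v p - v (-p)) ^ 2 = (2 * (p : ℝ)) ^ 2 := by
      rw [len_sq, e]
      simp
      ring
    exact (pow_left_inj₀ (len_nonneg _) (by positivity) two_ne_zero).1 h2
  have hsame : SameBlock L Δ (v p) (v (-p)) :=
    Relation.EqvGen.rel _ _ ⟨hmem _, hmem _, len_eq_iff.2 (by rw [hdot, hdot]; ring), hlen ▸ hp⟩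
  obtain ⟨C, e, hC, H⟩ := exists_blockDiam_le d
  exact hlen ▸ (H L Δ hΔ).1 _ _ hsame

lemma two_le_blockDiam (hd : 2 ≤ d) (hL : Lᶜ.Finite) {Δ : ℝ} (hΔ : 2 ≤ Δ) : 2 ≤ blockDiam L Δ := by
  simpa using two_mul_le_blockDiam hd hL (by linarith) 1 (by simpa using hΔ)

lemma le_max_blockDiam (hd : 2 ≤ d) (hL : Lᶜ.Finite) {Δ Δ' : ℝ} (hΔ : 2 ≤ Δ) (hΔ' : 1 ≤ Δ') :
    Δ' ^ 2 / 4 ≤ max (blockDiam L Δ ^ 2) (blockDiam L Δ' ^ 2) := by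
  have h2 := two_le_blockDiam hd hL hΔ
  rcases lt_or_ge Δ' 2 with h | h
  · refine le_trans ?_ (le_max_left _ _)
    nlinarith
  · refine le_trans ?_ (le_max_right _ _)
    have hf := Nat.lt_floor_add_one (Δ' / 2)
    have hf' := Nat.floor_le (show 0 ≤ Δ' / 2 by linarith)
    have h1 : 1 ≤ ⌊Δ' / 2⌋₊ := Nat.one_le_floor_iff _ |>.2 (by linarith)
    have h1' : (1 : ℝ) ≤ ⌊Δ' / 2⌋₊ := by exact_mod_cast h1
    have h3 := two_mul_le_blockDiam hd hL hΔ' ⌊Δ' / 2⌋₊ (by linarith)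
    nlinarith

lemma baseLev_good {Δ Δ' D ρ : ℝ} {k0 : Prop} (hρ : ∀ a, ρ ≤ len a → a ∈ L)
    (hD : ∀ a b, SameBlock L Δ a b → len (a - b) ≤ D) (hD1 : 1 ≤ D) (hΔ' : 1 ≤ Δ') :
    (baseLev L Δ Δ' D ρ k0).Good :=
  ⟨hρ, fun a b h => hD a b (sameBlock_iff.2 h), hD1, hΔ'⟩

end Blocks

/-! ### Linear combinations of Töplitz matrices -/

section Linear

variable {d n : ℕ}

lemma piM_add (X Y : Gl2) : piM (X + Y) = piM X + piM Y :=
  eq_of_comp (fun ε => by simp only [phi_piM, phi_add]) fun ε => by simp [psi_piM, psi_add]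

lemma piM_smul (z : ℂ) (X : Gl2) : piM (z • X) = z • piM X :=
  eq_of_comp (fun ε => by simp only [phi_piM, phi_smul]) fun ε => by simp [psi_piM, psi_smul]

lemma piM_sum {ι : Type*} (s : Finset ι) (X : ι → Gl2) : piM (∑ i ∈ s, X i) = ∑ i ∈ s, piM (X i) :=
  eq_of_comp (fun ε => by simp only [phi_piM, phi_sum]) fun ε => by simp [psi_piM, psi_sum]

lemma piM_zero : piM 0 = 0 :=
  eq_of_comp (fun ε => by simp [phi_piM]) fun ε => by simp [psi_piM, psi_zero]

lemma piM_piM (X : Gl2) : piM (piM X) = piM X :=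
  eq_of_comp (fun ε => by simp [phi_piM]) fun ε => by simp [psi_piM]

lemma piM_transpose (X : Gl2) : piM X.transpose = (piM X).transpose :=
  eq_of_comp (fun ε => by simp [phi_piM, phi_transpose]) fun ε => by simp [psi_piM, psi_transpose]

lemma phi_dirDeriv (ε : ℤˣ) (v : Par n) (DA : Fin n → LMat d) (a b : Lat d) :
    phi ε (dirDeriv v DA a b) = ∑ l, ((v l : ℝ) : ℂ) * phi ε (DA l a b) := by
  simp only [dirDeriv, phi_sum, phi_smul]

lemma psi_dirDeriv (ε : ℤˣ) (v : Par n) (DA : Fin n → LMat d) (a b : Lat d) :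
    psi ε (dirDeriv v DA a b) = ∑ l, ((v l : ℝ) : ℂ) * psi ε (DA l a b) := by
  simp only [dirDeriv, psi_sum, psi_smul]

lemma piM_dirDeriv (v : Par n) (DA : Fin n → LMat d) (a b : Lat d) :
    piM (dirDeriv v DA a b) = ∑ l, ((v l : ℝ) : ℂ) • piM (DA l a b) := by
  simp only [dirDeriv, piM_sum, piM_smul]

lemma tendsto_ray_dirDeriv (σ : ℤˣ) (c : Lat d) (v : Par n) {DA DA' : Fin n → LMat d}
    (h : ∀ l a b, Tendsto (ray σ c (DA l) a b) atTop (𝓝 (DA' l a b))) (a b : Lat d) :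
    Tendsto (ray σ c (dirDeriv v DA) a b) atTop (𝓝 (dirDeriv v DA' a b)) :=
  tendsto_finsetSum _ fun l _ => (h l a b).const_smul ((v l : ℝ) : ℂ)

lemma IsTopl.tendsto {m : ℕ} {A : LMat d} (h : IsTopl (m + 1) A) (σ : ℤˣ) (c a b : Lat d) :
    Tendsto (ray σ c A a b) atTop (𝓝 (tlim σ c A a b)) :=
  tendsto_nhds_limUnder (h.1 σ c a b)

lemma IsTopl.dirDeriv (v : Par n) : ∀ {m : ℕ} {DA : Fin n → LMat d},
    (∀ l, IsTopl m (DA l)) → IsTopl m (ToplitzLipschitz.dirDeriv v DA)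
  | 0, _, _ => trivial
  | _ + 1, DA, h => by
    have h1 := fun σ c => tendsto_ray_dirDeriv σ c v fun l a b => (h l).tendsto σ c a b
    refine ⟨fun σ c a b => ⟨_, h1 σ c a b⟩, fun σ c => ?_⟩
    rw [tlim_eq (h1 σ c)]
    exact IsTopl.dirDeriv v fun l => (h l).2 σ c

lemma dirDeriv_single (l : Fin n) (DA : Fin n → LMat d) :
    dirDeriv (EuclideanSpace.single l (1 : ℝ)) DA = DA l := by
  funext a b
  simp [dirDeriv]

lemma IsNormalForm.dirDeriv {L : Set (Lat d)} {Δ : ℝ} {DA : Fin n → LMat d}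
    (h : ∀ l, IsNormalForm L Δ (DA l)) (v : Par n) :
    IsNormalForm L Δ (ToplitzLipschitz.dirDeriv v DA) := by
  refine ⟨fun a ha b hb i j => ?_, fun a ha b hb => ?_, fun a ha b hb => ?_,
    fun a ha b hb hab => ?_⟩
  · simp [ToplitzLipschitz.dirDeriv, Matrix.sum_apply, (h _).1 a ha b hb]
  · simp only [ToplitzLipschitz.dirDeriv, Matrix.transpose_sum, Matrix.transpose_smul]
    exact Finset.sum_congr rfl fun l _ => by rw [(h l).2.1 a ha b hb]
  · rw [piM_dirDeriv]
    exact Finset.sum_congr rfl fun l _ => by rw [(h l).2.2.1 a ha b hb]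
  · exact Finset.sum_eq_zero fun l _ => by rw [(h l).2.2.2 a ha b hb hab, smul_zero]

end Linear

/-! ### The operators `Q` and their derivatives -/

section Setting

variable {d n : ℕ} {ω v : Par n} {A : Finset (Lat d)} {a b : Lat d} {K Δ' D ρ : ℝ} {k0 : Prop} {k : Lat n}

/-- The assumptions on the frequencies and on `H`. -/
structure Setting (L : Set (Lat d)) (Λ Δ C₁ C₂ C₃ C₄ C₅ C₆ : ℝ) (U B : Set (Par n))
    (Ω : Par n → Lat d → ℝ) (DΩ : Par n → Lat d → Par n) (H : Par n → LMat d)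
    (DH : Fin n → Par n → LMat d) : Prop where
  hd : 2 ≤ d
  hC₁ : 1 ≤ C₁
  hC₃ : 0 < C₃
  hC₄ : 0 < C₄
  hC₅ : 0 < C₅
  hΛ : 0 ≤ Λ
  hU : U ⊆ Metric.closedBall 0 C₁
  hUB : U ⊆ B
  hB : Convex ℝ B
  omega : ∀ a ∈ L, WhitneyC1 B (fun ω => Ω ω a) (fun l ω => DΩ ω a l)
  decay : FreqDecay L U C₂ C₃ Ω DΩ
  trans : FreqTransversal L B C₄ DΩ
  nonres : FreqNonresonant L U C₅ Ω
  c1 : MatC1 L B H DH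
  topl : ∀ ω ∈ B, IsToplitz (H ω) ∧ ∀ l, IsToplitz (DH l ω)
  nf : ∀ ω ∈ B, IsNormalForm L Δ (H ω) ∧ ∀ l, IsNormalForm L Δ (DH l ω)
  opD : ∀ ω ∈ B, ∀ v : Par n, ‖v‖ ≤ 1 →
    opNorm L (dirDeriv v fun l => DH l ω) ≤ ENNReal.ofReal (C₄ / 4)
  op : ∀ ω ∈ U, opNorm L (H ω) ≤ ENNReal.ofReal (C₅ / 4)
  norm : tlNormOn L Λ 0 U H DH ≤ ENNReal.ofReal C₆

/-- The operator of the scalar equations. -/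
def qKer (Ω : Lat d → ℝ) (H : LMat d) : Ker d :=
  (fun a b => phi 1 (H a b)) + dg fun a => Ω a - len a ^ 2

/-- The derivative of the operator of the scalar equations. -/
def pKer (DΩ : Lat d → Par n) (DH : Fin n → LMat d) (v : Par n) : Ker d :=
  (fun a b => phi 1 (dirDeriv v DH a b)) + dg fun a => inner ℝ (DΩ a) v

lemma conj_phi {X : Gl2} (h : ∀ i j, (X i j).im = 0) (ε : ℤˣ) :
    starRingEnd ℂ (phi ε X) = phi (-ε) X := by
  have h' : ∀ i j, starRingEnd ℂ (X i j) = X i j := fun i j => Complex.conj_eq_iff_im.2 (h i j)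
  simp [phi, h', Complex.conj_ofNat]

lemma conj_phi_normalForm {L : Set (Lat d)} {Δ : ℝ} {X : LMat d} (h : IsNormalForm L Δ X)
    (ha : a ∈ L) (hb : b ∈ L) (ε : ℤˣ) :
    starRingEnd ℂ (phi ε (X a b)) = phi ε (X b a) := by
  rw [conj_phi (h.1 a ha b hb), ← phi_transpose, ← h.2.1 b hb a ha]

lemma pKer_sum (DΩ : Lat d → Par n) (DH : Fin n → LMat d) (v : Par n) :
    pKer DΩ DH v = ∑ l, ((v l : ℝ) : ℂ) • pKer DΩ DH (EuclideanSpace.single l 1) := by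
  funext a b
  simp only [pKer, Finset.sum_apply, Pi.smul_apply, Pi.add_apply, dirDeriv_single, smul_eq_mul,
    mul_add, Finset.sum_add_distrib, phi_dirDeriv]
  congr 1
  by_cases hab : a = b
  · subst hab
    simp [dg, PiLp.inner_apply]
  · simp [dg, hab]

lemma OpOn.tr_of_herm {M : Ker d} (h : OpOn A M K)
    (hM : HermOn A M) : OpOn A (tr M) K := by
  refine ⟨h.1, fun ξ => ?_⟩
  have h1 := h.2 fun a => starRingEnd ℂ (ξ a)
  simp only [RCLike.norm_conj] at h1
  refine le_trans (le_of_eq (Finset.sum_congr rfl fun a ha => ?_)) h1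
  rw [← RCLike.norm_conj, map_sum]
  congr 2
  refine Finset.sum_congr rfl fun e he => ?_
  rw [map_mul]
  congr 1
  exact hM e he a ha

lemma opNorm_smul_le {L : Set (Lat d)} {n : ℕ} (DH : Fin n → LMat d) (hK : 0 ≤ K)
    (hX : ∀ v, ∀ a ∈ L, ∀ b ∈ L, piM (dirDeriv v DH a b) = dirDeriv v DH a b)
    (h : ∀ v : Par n, ‖v‖ ≤ 1 → opNorm L (dirDeriv v DH) ≤ ENNReal.ofReal K) (v : Par n)
    (hA : ∀ a ∈ A, a ∈ L) :
    OpOn A (fun a b => phi 1 (dirDeriv v DH a b)) (K * ‖v‖) := by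
  rcases eq_or_ne v 0 with rfl | hv
  · refine ⟨by simp, fun ξ => ?_⟩
    simp [phi_dirDeriv]
  · have hv0 : ‖v‖ ≠ 0 := norm_ne_zero_iff.2 hv
    have h1 := opOn_phi hK (hX (‖v‖⁻¹ • v)) (h (‖v‖⁻¹ • v) (by rw [norm_smul]; simp [hv0])) hA 1
    refine ⟨by positivity, fun ξ => ?_⟩
    have h2 := h1.2 ξ
    have e : ∀ a, ∑ e ∈ A, phi 1 (dirDeriv v DH a e) * ξ e
        = (‖v‖ : ℂ) * ∑ e ∈ A, phi 1 (dirDeriv (‖v‖⁻¹ • v) DH a e) * ξ e := by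
      intro a
      rw [Finset.mul_sum]
      refine Finset.sum_congr rfl fun e _ => ?_
      simp only [phi_dirDeriv]
      rw [← mul_assoc, Finset.mul_sum]
      congr 1
      refine Finset.sum_congr rfl fun l _ => ?_
      have : (‖v‖ : ℂ) ≠ 0 := by exact_mod_cast hv0
      simp only [PiLp.smul_apply, smul_eq_mul, Complex.ofReal_mul, Complex.ofReal_inv]
      field_simp
    simp only [e, norm_mul, mul_pow, Complex.norm_real, norm_norm]
    rw [← Finset.mul_sum]
    nlinarith [sq_nonneg ‖v‖]

variable {L : Set (Lat d)} {Λ Δ C₁ C₂ C₃ C₄ C₅ C₆ : ℝ} {U B : Set (Par n)}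
  {Ω : Par n → Lat d → ℝ} {DΩ : Par n → Lat d → Par n} {H : Par n → LMat d}
  {DH : Fin n → Par n → LMat d}

namespace Setting

lemma decay' (h : Setting L Λ Δ C₁ C₂ C₃ C₄ C₅ C₆ U B Ω DΩ H DH) (hω : ω ∈ U)
    (ha : a ∈ L) : |Ω ω a - len a ^ 2| ≤ |C₂| * Real.exp (-C₃ * len a) ∧
      ‖DΩ ω a‖ ≤ |C₂| * Real.exp (-C₃ * len a) := by
  have h1 := h.decay ω hω a ha
  have h2 : C₂ * Real.exp (-C₃ * len a) ≤ |C₂| * Real.exp (-C₃ * len a) :=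
    mul_le_mul_of_nonneg_right (le_abs_self _) (Real.exp_pos _).le
  exact ⟨h1.1.trans h2, h1.2.trans h2⟩

lemma decay_le (h : Setting L Λ Δ C₁ C₂ C₃ C₄ C₅ C₆ U B Ω DΩ H DH) (hω : ω ∈ U)
    (ha : a ∈ L) : |Ω ω a - len a ^ 2| ≤ |C₂| ∧ ‖DΩ ω a‖ ≤ |C₂| := by
  have h1 := h.decay' hω ha
  have h2 : |C₂| * Real.exp (-C₃ * len a) ≤ |C₂| := by
    refine mul_le_of_le_one_right (abs_nonneg _) (Real.exp_le_one_iff.2 ?_)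
    have := len_nonneg a
    have := h.hC₃
    nlinarith
  exact ⟨h1.1.trans h2, h1.2.trans h2⟩

lemma nfD (h : Setting L Λ Δ C₁ C₂ C₃ C₄ C₅ C₆ U B Ω DΩ H DH) (hω : ω ∈ B) (v : Par n) :
    IsNormalForm L Δ (dirDeriv v fun l => DH l ω) :=
  IsNormalForm.dirDeriv (h.nf ω hω).2 v

lemma herm (h : Setting L Λ Δ C₁ C₂ C₃ C₄ C₅ C₆ U B Ω DΩ H DH) (hω : ω ∈ U)
    (ha : a ∈ L) (hb : b ∈ L) :
    starRingEnd ℂ (qKer (Ω ω) (H ω) a b) = qKer (Ω ω) (H ω) b a := by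
  simp only [qKer, Pi.add_apply, map_add, conj_phi_normalForm (h.nf ω (h.hUB hω)).1 ha hb]
  congr 1
  by_cases hab : a = b
  · subst hab; simp [dg, -Complex.ofReal_sub]
  · simp [dg, hab, Ne.symm hab]

lemma hermD (h : Setting L Λ Δ C₁ C₂ C₃ C₄ C₅ C₆ U B Ω DΩ H DH) (hω : ω ∈ B)
    (v : Par n) (ha : a ∈ L) (hb : b ∈ L) :
    starRingEnd ℂ (pKer (DΩ ω) (fun l => DH l ω) v a b) = pKer (DΩ ω) (fun l => DH l ω) v b a := by
  simp only [pKer, Pi.add_apply, map_add, conj_phi_normalForm (h.nfD hω v) ha hb]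
  congr 1
  by_cases hab : a = b
  · subst hab; simp [dg]
  · simp [dg, hab, Ne.symm hab]

lemma opOn (h : Setting L Λ Δ C₁ C₂ C₃ C₄ C₅ C₆ U B Ω DΩ H DH) (hω : ω ∈ U)
    (hA : ∀ a ∈ A, a ∈ L) :
    OpOn A (qKer (Ω ω) (H ω)) (C₅ / 4 + |C₂|) :=
  (opOn_phi (by have := h.hC₅; positivity) (h.nf ω (h.hUB hω)).1.2.2.1 (h.op ω hω) hA 1).add
    (opOn_dg (abs_nonneg _) fun a ha => (h.decay_le hω (hA a ha)).1)

lemma opOnD (h : Setting L Λ Δ C₁ C₂ C₃ C₄ C₅ C₆ U B Ω DΩ H DH) (hω : ω ∈ U)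
    (hv : ‖v‖ ≤ 1) (hA : ∀ a ∈ A, a ∈ L) :
    OpOn A (pKer (DΩ ω) (fun l => DH l ω) v) (C₄ / 4 + |C₂|) := by
  have h4 := h.hC₄
  refine ((opNorm_smul_le _ (by positivity) (fun v => (h.nfD (h.hUB hω) v).2.2.1)
    (h.opD ω (h.hUB hω)) v hA).mono (?_ : _ ≤ C₄ / 4)).add (opOn_dg (abs_nonneg _) fun a ha => ?_)
  · exact mul_le_of_le_one_right (by positivity) hv
  · refine (abs_real_inner_le_norm _ _).trans ?_
    exact (mul_le_of_le_one_right (norm_nonneg _) hv).trans (h.decay_le hω (hA a ha)).2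

lemma opBlk (h : Setting L Λ Δ C₁ C₂ C₃ C₄ C₅ C₆ U B Ω DΩ H DH) (hω : ω ∈ U)
    (hg : (baseLev L Δ Δ' D ρ k0).Good) :
    (baseLev L Δ Δ' D ρ k0).OpBlk (qKer (Ω ω) (H ω)) (C₅ / 4 + |C₂|) := fun a ha => by
  have hA : ∀ x ∈ (baseLev L Δ Δ' D ρ k0).blk a, x ∈ L := fun x hx => Lev.mem_of_blk hg ha hx
  exact ⟨h.opOn hω hA, (h.opOn hω hA).tr_of_herm fun a ha b hb => h.herm hω (hA a ha) (hA b hb)⟩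

lemma opBlkD (h : Setting L Λ Δ C₁ C₂ C₃ C₄ C₅ C₆ U B Ω DΩ H DH) (hω : ω ∈ U)
    (hv : ‖v‖ ≤ 1) (hg : (baseLev L Δ Δ' D ρ k0).Good) :
    (baseLev L Δ Δ' D ρ k0).OpBlk (pKer (DΩ ω) (fun l => DH l ω) v) (C₄ / 4 + |C₂|) := fun a ha => by
  have hA : ∀ x ∈ (baseLev L Δ Δ' D ρ k0).blk a, x ∈ L := fun x hx => Lev.mem_of_blk hg ha hx
  exact ⟨h.opOnD hω hv hA, (h.opOnD hω hv hA).tr_of_herm fun a ha b hb =>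
    h.hermD (h.hUB hω) v (hA a ha) (hA b hb)⟩

lemma abs_inner_DΩ_le (h : Setting L Λ Δ C₁ C₂ C₃ C₄ C₅ C₆ U B Ω DΩ H DH) (hω : ω ∈ B)
    (hk : k ≠ 0) (ha : a ∈ L) :
    |inner ℝ (DΩ ω a) ((len k)⁻¹ • toE k)| ≤ (len k - C₄) / 2 := by
  have hk0 : len k ≠ 0 := fun h0 => hk (len_eq_zero.1 h0)
  have hkk : inner ℝ (toE k) ((len k)⁻¹ • toE k) = len k := by
    rw [inner_smul_right, real_inner_self_eq_norm_sq]
    change (len k)⁻¹ * len k ^ 2 = len k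
    field_simp
  have h1 := (h.trans ω hω k hk a ha a ha).2.1
  have h2 := (h.trans ω hω (-k) (neg_ne_zero.2 hk) a ha a ha).2.1
  rw [inner_add_left, inner_add_left, hkk] at h1
  rw [len_neg, toE_neg, inner_add_left, inner_add_left, smul_neg, inner_neg_right, inner_neg_right,
    inner_neg_left, hkk] at h2
  rw [abs_le]
  constructor <;> linarith

lemma norm_DΩ_le (h : Setting L Λ Δ C₁ C₂ C₃ C₄ C₅ C₆ U B Ω DΩ H DH) (hω : ω ∈ B)
    (ha : a ∈ L) : ‖DΩ ω a‖ ≤ n := by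
  have hc : ∀ l, |DΩ ω a l| ≤ 1 := by
    intro l
    have hk : (Pi.single l 1 : Lat n) ≠ 0 := fun h0 => by
      have := congrFun h0 l; simp at this
    have hl : len (Pi.single l 1 : Lat n) = 1 := by
      have : len (Pi.single l 1 : Lat n) ^ 2 = 1 ^ 2 := by rw [len_sq]; simp
      exact (pow_left_inj₀ (len_nonneg _) zero_le_one two_ne_zero).1 this
    have hs : toE (Pi.single l 1 : Lat n) = EuclideanSpace.single l (1 : ℝ) := by
      ext i
      by_cases hi : i = l
      · subst hi; simp
      · simp [hi]
    have h1 := h.abs_inner_DΩ_le hω hk ha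
    rw [hl, hs] at h1
    rw [inv_one, one_smul, EuclideanSpace.inner_single_right] at h1
    simp only [one_mul, conj_trivial] at h1
    have := h.hC₄
    linarith
  have h1 : ‖DΩ ω a‖ ≤ ∑ l, |DΩ ω a l| := by
    rw [EuclideanSpace.norm_eq]
    refine Real.sqrt_le_iff.2 ⟨by positivity, ?_⟩
    simp only [← Real.norm_eq_abs]
    exact Finset.sum_sq_le_sq_sum_of_nonneg fun i _ => norm_nonneg _
  refine h1.trans ((Finset.sum_le_sum fun l _ => hc l).trans ?_)
  simp

lemma whitney_qKer (h : Setting L Λ Δ C₁ C₂ C₃ C₄ C₅ C₆ U B Ω DΩ H DH)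
    (ha : a ∈ L) (hb : b ∈ L) : WhitneyC1 B (fun ω => qKer (Ω ω) (H ω) a b)
      fun l ω => pKer (DΩ ω) (fun l => DH l ω) (EuclideanSpace.single l 1) a b := by
  have hH := h.c1 a ha b hb
  refine WhitneyC1.add ?_ ?_
  · refine ((((hH 0 0).add (hH 1 1)).const_mul (1 / 2)).add
      (((hH 0 1).sub (hH 1 0)).const_mul (Complex.I / 2))).congr (fun ω _ => ?_) fun ω _ l => ?_
    · simp [phi]; ring
    · simp only [dirDeriv_single, phi, Units.val_one, Int.cast_one]; ring
  · by_cases hab : a = b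
    · subst hab
      have h2 := ((h.omega a ha).sub (whitneyC1_const (len a ^ 2))).ofReal
      exact h2.congr (fun ω _ => by simp [dg]) fun ω _ l => by
        simp [dg, EuclideanSpace.inner_single_right]
    · exact (whitneyC1_const (0 : ℂ)).congr (fun ω _ => by simp [dg, hab])
        fun ω _ l => by simp [dg, hab]

/-- Increments of the operator in the direction of `k`. -/
lemma formLe_sub (h : Setting L Λ Δ C₁ C₂ C₃ C₄ C₅ C₆ U B Ω DΩ H DH) (hk : k ≠ 0)
    {x y : Par n} (hx : x ∈ U) (hy : y ∈ U) {s : ℝ} {w : Par n} (hs : 0 ≤ s)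
    (hxy : y - x = s • ((len k)⁻¹ • toE k) + w) (hA : ∀ a ∈ A, a ∈ L) :
    FormLe A (qKer (Ω y) (H y) - qKer (Ω x) (H x))
      ((2 * len k - C₄) / 4 * s + (C₄ / 4 + n) * ‖w‖) := by
  intro ξ
  have hC₄ := h.hC₄
  have hk0 : len k ≠ 0 := fun h0 => hk (len_eq_zero.1 h0)
  have hvn : ‖(len k)⁻¹ • toE k‖ = 1 := by
    rw [norm_smul, norm_inv, Real.norm_of_nonneg (len_nonneg k)]
    exact inv_mul_cancel₀ hk0
  have hP : ∀ z ∈ B, FormLe A (pKer (DΩ z) (fun l => DH l z) (y - x))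
      ((2 * len k - C₄) / 4 * s + (C₄ / 4 + n) * ‖w‖) := by
    intro z hz
    have h1 : ‖y - x‖ ≤ s + ‖w‖ := by
      rw [hxy]
      refine (norm_add_le _ _).trans ?_
      rw [norm_smul, hvn, Real.norm_of_nonneg hs, mul_one]
    have h2 : ∀ a ∈ A, |inner ℝ (DΩ z a) (y - x)| ≤ (len k - C₄) / 2 * s + n * ‖w‖ := by
      intro a ha
      rw [hxy, inner_add_right, inner_smul_right]
      refine (abs_add_le _ _).trans (add_le_add ?_ ?_)
      · rw [abs_mul, abs_of_nonneg hs, mul_comm]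
        exact mul_le_mul_of_nonneg_right (h.abs_inner_DΩ_le hz hk (hA a ha)) hs
      · refine (abs_real_inner_le_norm _ _).trans ?_
        exact mul_le_mul_of_nonneg_right (h.norm_DΩ_le hz (hA a ha)) (norm_nonneg _)
    have h3 : 0 ≤ (len k - C₄) / 2 * s + n * ‖w‖ ∨ A = ∅ := by
      rcases A.eq_empty_or_nonempty with h0 | ⟨a, ha⟩
      · exact Or.inr h0
      · exact Or.inl ((abs_nonneg _).trans (h2 a ha))
    rcases h3 with h3 | rfl
    · have := formLe_of_opOn ((opNorm_smul_le _ (by positivity) (fun v => (h.nfD hz v).2.2.1)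
        (h.opD z hz) (y - x) hA).add (opOn_dg h3 h2))
      intro ξ
      refine (this ξ).trans (mul_le_mul_of_nonneg_right ?_ (by positivity))
      have h4 : C₄ / 4 * ‖y - x‖ ≤ C₄ / 4 * (s + ‖w‖) := by gcongr
      linarith
    · intro ξ; simp [qf]
  have hW : WhitneyC1 B (fun ω => (qf A (qKer (Ω ω) (H ω)) ξ).re)
      fun l ω => (qf A (pKer (DΩ ω) (fun l => DH l ω) (EuclideanSpace.single l 1)) ξ).re := by
    have h1 : WhitneyC1 B (fun ω => qf A (qKer (Ω ω) (H ω)) ξ)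
        fun l ω => qf A (pKer (DΩ ω) (fun l => DH l ω) (EuclideanSpace.single l 1)) ξ := by
      refine WhitneyC1.sum A fun a ha => WhitneyC1.sum A fun b hb => ?_
      have := (h.whitney_qKer (hA a ha) (hA b hb)).const_mul (starRingEnd ℂ (ξ a) * ξ b)
      exact this.congr (fun ω _ => by ring) fun ω _ l => by ring
    exact h1.clm Complex.reCLM
  have hfin := hW.norm_sub_le h.hB (h.hUB hx) (h.hUB hy)
    (C := ((2 * len k - C₄) / 4 * s + (C₄ / 4 + n) * ‖w‖) * ∑ a ∈ A, ‖ξ a‖ ^ 2) fun z hz => by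
      refine le_trans (le_of_eq ?_) (hP z hz ξ)
      congr 1
      have e : qf A (pKer (DΩ z) (fun l => DH l z) (y - x)) ξ = ∑ l, ((y l - x l : ℝ) : ℂ) *
          qf A (pKer (DΩ z) (fun l => DH l z) (EuclideanSpace.single l 1)) ξ := by
        rw [pKer_sum]
        simp only [qf, Finset.mul_sum, Finset.sum_apply, Pi.smul_apply, smul_eq_mul, Finset.sum_mul]
        rw [Finset.sum_comm (s := Finset.univ)]
        refine Finset.sum_congr rfl fun a _ => ?_
        rw [Finset.sum_comm (s := Finset.univ)]
        refine Finset.sum_congr rfl fun b _ => Finset.sum_congr rfl fun l _ => ?_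
        rw [PiLp.sub_apply]
        ring
      rw [e, Complex.re_sum]
      refine Finset.sum_congr rfl fun l _ => ?_
      rw [Complex.re_ofReal_mul]
  refine le_trans (le_of_eq ?_) hfin
  have e : qf A (qKer (Ω y) (H y) - qKer (Ω x) (H x)) ξ
      = qf A (qKer (Ω y) (H y)) ξ - qf A (qKer (Ω x) (H x)) ξ := by
    simp only [qf, Pi.sub_apply, sub_mul, mul_sub, Finset.sum_sub_distrib]
  rw [e, Complex.sub_re]

end Setting

end Setting

/-! ### Regularity and resonances of the operators -/

section Resonances

variable {d n : ℕ} {ω : Par n} {k : Lat n} {κ S S' γ : ℝ} {X : Set (Par n)} {A : Par n → LMat d}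
  {DA : Fin n → Par n → LMat d} {M : ℝ≥0∞} {Y : ℕ}

lemma lipConst_anti {L : Set (Lat d)} (hS : 0 ≤ S) (hSS : S ≤ S') (σ : ℤˣ)
    (A : LMat d) : lipConst L S' γ σ A ≤ lipConst L S γ σ A :=
  iSup_mono fun _ => iSup_mono fun _ => iSup_mono fun _ => iSup_mono fun _ => iSup_mono fun _ =>
    iSup_mono fun _ => iSup_le fun h =>
      le_iSup_of_le (show LipDom S σ _ _ _ from LipDomPos.mono h hS hSS) le_rfl

lemma iterNorm_anti {L : Set (Lat d)} (hS : 0 ≤ S) (hSS : S ≤ S') :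
    ∀ (m : ℕ) (A : LMat d), iterNorm L S' γ m A ≤ iterNorm L S γ m A
  | 0, _ => add_le_add (max_le_max (lipConst_anti hS hSS _ _) (lipConst_anti hS hSS _ _)) le_rfl
  | m + 1, _ => iSup_mono fun _ => iSup_mono fun _ => iterNorm_anti hS hSS m _

lemma iterNorm_le_of_tlNormOn {L : Set (Lat d)}
    (h : tlNormOn L S γ X A DA ≤ M)
    (hω : ω ∈ X) : iterNorm L S γ (d - 2) (A ω) ≤ M ∧
      ∀ v : Par n, ‖v‖ ≤ 1 → iterNorm L S γ (d - 2) (dirDeriv v fun l => DA l ω) ≤ M := by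
  have h1 := (le_iSup₂ (f := fun (ω : Par n) (_ : ω ∈ X) => max (tlNorm L S γ (A ω))
    (⨆ (v : Par n) (_ : ‖v‖ ≤ 1), tlNorm L S γ (dirDeriv v fun l => DA l ω))) ω hω).trans h
  rw [max_le_iff, iSup₂_le_iff] at h1
  exact h1

lemma tlNormOn_le {L : Set (Lat d)}
   
    (h : ∀ ω ∈ X, iterNorm L S γ (d - 2) (A ω) ≤ M ∧
      ∀ v : Par n, ‖v‖ ≤ 1 → iterNorm L S γ (d - 2) (dirDeriv v fun l => DA l ω) ≤ M) :
    tlNormOn L S γ X A DA ≤ M :=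
  iSup₂_le fun ω hω => max_le (h ω hω).1 (iSup₂_le fun v hv => (h ω hω).2 v hv)

lemma sylv_dg (A B : Finset (Lat d)) (z M N X : Ker d) (x y : Lat d → ℝ) {a b : Lat d}
    (ha : a ∈ A) (hb : b ∈ B) : sylv A B z (M + dg x) (N + dg y) X a b
      = sylv A B (fun a b => z a b + x a + y b) M N X a b := by
  have e1 : ∑ e ∈ A, dg x a e * X e b = (x a : ℂ) * X a b := by
    rw [Finset.sum_eq_single_of_mem a ha fun e _ he => by simp [dg, he.symm]]
    simp [dg]
  have e2 : ∑ e ∈ B, X a e * dg y e b = (y b : ℂ) * X a b := by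
    rw [Finset.sum_eq_single_of_mem b hb fun e _ he => by simp [dg, he]]
    simp [dg, mul_comm]
  simp only [sylv, lprod, rprod, Pi.add_apply, add_mul, mul_add, Finset.sum_add_distrib, e1, e2]
  ring

lemma LB_dg {A B : Finset (Lat d)} {z M N : Ker d} {x y : Lat d → ℝ} :
    LB A B z (M + dg x) (N + dg y) κ ↔ LB A B (fun a b => z a b + x a + y b) M N κ :=
  forall_congr' fun X => by
    rw [hs_congr fun a ha b hb => sylv_dg A B z M N X x y ha hb]

lemma neg_dg (x : Lat d → ℝ) : -dg x = dg fun a => -x a := by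
  funext a b
  by_cases h : a = b <;> simp [dg, h]

lemma LB.conj {A B : Finset (Lat d)} {z M N : Ker d} (h : LB A B z M N κ) :
    LB A B (fun a b => starRingEnd ℂ (z a b)) (fun a b => starRingEnd ℂ (M a b))
      (fun a b => starRingEnd ℂ (N a b)) κ := by
  intro X
  have h1 := h fun a b => starRingEnd ℂ (X a b)
  have e : ∀ Y : Ker d, hs A B (fun a b => starRingEnd ℂ (Y a b)) = hs A B Y := fun Y => by
    simp [hs]
  rw [e] at h1
  refine h1.trans_eq ?_
  rw [← e]
  congr 1
  funext a b
  simp [sylv, lprod, rprod, map_sum]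

variable {L : Set (Lat d)} {Λ Δ C₁ C₂ C₃ C₄ C₅ C₆ : ℝ} {U B : Set (Par n)}
  {Ω : Par n → Lat d → ℝ} {DΩ : Par n → Lat d → Par n} {H : Par n → LMat d}
  {DH : Fin n → Par n → LMat d}

namespace Setting

lemma sReg (h : Setting L Λ Δ C₁ C₂ C₃ C₄ C₅ C₆ U B Ω DΩ H DH) (hω : ω ∈ U)
    {D ρ S : ℝ} (hL : ∀ a, ρ ≤ len a → a ∈ L) (hD : ∀ a b, SameBlock L Δ a b → len (a - b) ≤ D)
    (hS : Λ ≤ S) (hρ : ρ ≤ S) (hS1 : 1 ≤ S) :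
    SReg ρ S (|C₆| + |C₂| * (1 / C₃ + 1)) (d - 1) (qKer (Ω ω) (H ω)) ∧
    ∀ v : Par n, ‖v‖ ≤ 1 → SReg ρ S (|C₆| + |C₂| * (1 / C₃ + 1)) (d - 1)
      (pKer (DΩ ω) (fun l => DH l ω) v) := by
  have hd : d - 1 = d - 2 + 1 := by have := h.hd; omega
  have hnorm := iterNorm_le_of_tlNormOn
    (h.norm.trans (ENNReal.ofReal_le_ofReal (le_abs_self C₆))) hω
  have key : ∀ X : LMat d, IsToplitz X → IsNormalForm L Δ X →
      iterNorm L Λ 0 (d - 2) X ≤ ENNReal.ofReal |C₆| →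
      SReg ρ S |C₆| (d - 1) fun a b => phi 1 (X a b) := by
    intro X h1 h2 h3
    rw [IsToplitz, hd] at h1
    rw [hd]
    refine PtReg.sReg hL (ptReg_phi (p := True) (abs_nonneg _) hL (fun _ => ⟨hρ, hS1⟩) (d - 2)
      (Or.inl rfl) h1 (fun _ => (iterNorm_anti h.hΛ hS _ _).trans h3) (R := D) ?_ 1)
    intro a ha b hb hab
    rw [h2.2.2.2 a ha b hb fun hs => absurd (hD a b hs) (not_le.2 hab), piM_zero]
  have hdg : ∀ x : Lat d → ℝ, (∀ a ∈ L, |x a| ≤ |C₂| * Real.exp (-C₃ * len a)) →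
      SReg ρ S (|C₂| * (1 / C₃ + 1)) (d - 1) (dg x) := fun x hx =>
    sReg_dg (abs_nonneg _) h.hC₃ hL hx (d - 1)
  refine ⟨(key _ (h.topl ω (h.hUB hω)).1 (h.nf ω (h.hUB hω)).1 hnorm.1).add
    (hdg _ fun a ha => (h.decay' hω ha).1), fun v hv => ?_⟩
  refine (key _ (IsTopl.dirDeriv v (h.topl ω (h.hUB hω)).2) (h.nfD (h.hUB hω) v)
    (hnorm.2 v hv)).add (hdg _ fun a ha => ?_)
  refine (abs_real_inner_le_norm _ _).trans ?_
  exact (mul_le_of_le_one_right (norm_nonneg _) hv).trans (h.decay' hω ha).2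

lemma LB_nonres (h : Setting L Λ Δ C₁ C₂ C₃ C₄ C₅ C₆ U B Ω DΩ H DH) (hω : ω ∈ U)
    {A A' : Finset (Lat d)} (hA : ∀ a ∈ A, a ∈ L) (hA' : ∀ a ∈ A', a ∈ L) :
    LB A A' (energyP 0) (qKer (Ω ω) (H ω)) (tr (qKer (Ω ω) (H ω))) (C₅ / 2) ∧
    ((∀ a ∈ A, ∀ b ∈ A', len a ≠ len b) →
      LB A A' (energy 0) (qKer (Ω ω) (H ω)) (-qKer (Ω ω) (H ω)) (C₅ / 2)) := by
  have h5 := h.hC₅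
  have hop : ∀ {A : Finset (Lat d)}, (∀ a ∈ A, a ∈ L) →
      OpOn A (fun a b => phi 1 (H ω a b)) (C₅ / 4) := fun hA =>
    opOn_phi (by positivity) (h.nf ω (h.hUB hω)).1.2.2.1 (h.op ω hω) hA 1
  have hherm : ∀ {A : Finset (Lat d)}, (∀ a ∈ A, a ∈ L) →
      HermOn A (fun a b => phi 1 (H ω a b)) := fun hA a ha b hb =>
    conj_phi_normalForm (h.nf ω (h.hUB hω)).1 (hA a ha) (hA b hb) 1
  constructor
  · have e : tr (qKer (Ω ω) (H ω)) = tr (fun a b => phi 1 (H ω a b))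
        + dg fun a => Ω ω a - len a ^ 2 := by
      rw [← tr_dg]; rfl
    rw [e, qKer, LB_dg]
    refine (LB_of_diag (μ := C₅) h5.le (fun a ha b hb => ?_) (hop hA) (hop hA')).mono (by linarith)
    refine ((h.nonres ω hω a (hA a ha) b (hA' b hb)).2.1).trans_eq ?_
    rw [← Real.norm_eq_abs, ← Complex.norm_real]
    congr 1
    simp only [energyP, len_sq]
    push_cast
    ring
  · intro hne
    rw [qKer, neg_add, neg_dg, LB_dg]
    refine (LB_of_diag (μ := C₅) h5.le (fun a ha b hb => ?_) (hop hA)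
      (((hop hA').tr_of_herm (hherm hA')).neg)).mono (by linarith)
    refine ((h.nonres ω hω a (hA a ha) b (hA' b hb)).2.2 (hne a ha b hb)).trans_eq ?_
    rw [← Real.norm_eq_abs, ← Complex.norm_real]
    congr 1
    simp only [energy, len_sq]
    push_cast
    ring

variable {Δ' D ρ : ℝ}

lemma inner_mono (hk : k ≠ 0) {x y : Par n} {s : ℝ} {w : Par n} {K : ℝ} (hK : len k ≤ K)
    (hxy : y - x = s • ((len k)⁻¹ • toE k) + w) :
    len k * s - K * ‖w‖ ≤ inner ℝ (toE k) y - inner ℝ (toE k) x := by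
  have hk0 : len k ≠ 0 := fun h0 => hk (len_eq_zero.1 h0)
  rw [← inner_sub_right, hxy, inner_add_right, inner_smul_right, inner_smul_right,
    real_inner_self_eq_norm_sq]
  have h1 : s * ((len k)⁻¹ * ‖toE k‖ ^ 2) = len k * s := by
    change s * ((len k)⁻¹ * len k ^ 2) = len k * s
    field_simp
  have h2 := (abs_le.1 (abs_real_inner_le_norm (toE k) w)).1
  have h3 : ‖toE k‖ * ‖w‖ ≤ K * ‖w‖ := mul_le_mul_of_nonneg_right hK (norm_nonneg _)
  linarith

lemma C₄_le (h : Setting L Λ Δ C₁ C₂ C₃ C₄ C₅ C₆ U B Ω DΩ H DH) (hk : k ≠ 0)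
    (hω : ω ∈ U) {a : Lat d} (ha : a ∈ L) : C₄ ≤ len k := by
  have := (abs_nonneg _).trans (h.abs_inner_DΩ_le (h.hUB hω) hk ha)
  linarith

lemma volume_not_LBall_le (h : Setting L Λ Δ C₁ C₂ C₃ C₄ C₅ C₆ U B Ω DΩ H DH) {e E : ℕ}
    (he : ∀ {Y : ℕ}, d + 8 ≤ Y → Lev.NearRay d e Y)
    (hE : VolBd d e (d - 1) E n)
    (hg : (baseLev L Δ Δ' D ρ False).Good) {S T : ℝ}
    (hS : (baseLev L Δ Δ' D ρ False).Radius S) (hΛS : Λ ≤ S) (hS1 : 1 ≤ S)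
    (hDm : (baseLev L Δ Δ' D ρ False).Dom S (|C₆| + |C₂| * (1 / C₃ + 1)) T Y)
    (hY : 1 ≤ C₄ / 2 * Y) (hT : Δ' * C₁ + 2 * (C₅ / 4 + |C₂|) + 1 ≤ T) (hk : k ≠ 0)
    (hkΔ : len k ≤ Δ') {x : ℝ} (hx : 0 < x) (hx1 : x ≤ 1 / 2) :
    volume {ω ∈ U | ¬ (baseLev L Δ Δ' D ρ False).LBall (inner ℝ (toE k) ω) (qKer (Ω ω) (H ω))
      (x ^ ((d + 1) ^ d))} ≤ (Y : ℝ≥0∞) ^ E *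
      (ballVol n C₁ * ENNReal.ofReal x) := by
  have hd := h.hd
  have h3 := h.hC₃
  have h5 := h.hC₅
  have h1 := h.hC₁
  have h4 := h.hC₄
  rcases U.eq_empty_or_nonempty with rfl | ⟨ω₀, hω₀⟩
  · simp
  have hLne : L.Nonempty := by
    have hinf : ∃ a : Lat d, ρ ≤ len a := by
      obtain ⟨m, hm⟩ := exists_nat_ge ρ
      refine ⟨fun _ => (m : ℤ), hm.trans ?_⟩
      have := abs_coord_le_len (fun _ => (m : ℤ) : Lat d) ⟨0, by omega⟩
      simpa using this
    exact ⟨_, hg.hL _ hinf.choose_spec⟩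
  obtain ⟨a₀, ha₀⟩ := hLne
  have hkC := h.C₄_le hk hω₀ ha₀
  have hk0 : len k ≠ 0 := fun h0 => hk (len_eq_zero.1 h0)
  have hv : ‖(len k)⁻¹ • toE k‖ = 1 := by
    rw [norm_smul, norm_inv, Real.norm_of_nonneg (len_nonneg k)]
    exact inv_mul_cancel₀ hk0
  have hfam : Fam (baseLev L Δ Δ' D ρ False) U ((len k)⁻¹ • toE k) S
      (|C₆| + |C₂| * (1 / C₃ + 1)) (C₅ / 4 + |C₂|) ((2 * len k - C₄) / 4) (C₄ / 4 + n + len k)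
      (d - 1) fun ω => qKer (Ω ω) (H ω) :=
    { herm := fun ω hω a ha b hb => h.herm hω ha hb
      op := fun ω hω => h.opBlk hω hg
      reg := fun ω hω => (h.sReg hω hg.hL (fun a b hab => hg.hdiam a b (sameBlock_iff.1 hab)) hΛS
        hS.rho hS1).1
      mono := fun x hx y hy s w hs hxy A hA ξ => by
        refine (h.formLe_sub hk hx hy hs hxy hA ξ).trans ?_
        refine mul_le_mul_of_nonneg_right ?_ (by positivity)
        have := mul_nonneg (len_nonneg k) (norm_nonneg w)
        linarith
      inv := fun ω _ c hc => by simp [baseLev] at hc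
      univ := fun hc => absurd rfl hc }
  have hfreq : Freq U ((len k)⁻¹ • toE k) C₁ (C₅ / 4 + |C₂|) ((2 * len k - C₄) / 4) (len k)
      (C₄ / 4 + n + len k) T Y fun ω => inner ℝ (toE k) ω :=
    { hC := h.hC₁
      hU := h.hU
      hv := hv
      hα := by linarith
      hβ := by
        refine hY.trans_eq ?_
        ring
      mono := fun x _ y _ s w _ hxy => inner_mono hk (by
        have : (0 : ℝ) ≤ n := Nat.cast_nonneg n
        linarith) hxy
      le := fun ω hω => by
        have h1 := abs_real_inner_le_norm (toE k) ω
        have h2 : ‖ω‖ ≤ C₁ := by simpa using h.hU hω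
        have h3 : ‖toE k‖ * ‖ω‖ ≤ Δ' * C₁ :=
          mul_le_mul hkΔ h2 (norm_nonneg _) ((len_nonneg k).trans hkΔ)
        linarith }
  have hdd : d - 1 + 1 = d := by omega
  have := hE hg hS hDm (he hDm.hY) (by positivity) (by positivity) (by
      have : 0 ≤ Δ' * C₁ := mul_nonneg ((len_nonneg k).trans hkΔ) (by linarith)
      have := abs_nonneg C₂
      linarith)
    (by simp [baseLev]) (by simp [baseLev]; omega) (by simp [baseLev]) hfam hfreq hx hx1
  rwa [hdd] at this

lemma volume_not_LBallP_le (h : Setting L Λ Δ C₁ C₂ C₃ C₄ C₅ C₆ U B Ω DΩ H DH)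
    (hg : (baseLev L Δ Δ' D ρ False).Good) {S K T : ℝ}
    (hDm : (baseLev L Δ Δ' D ρ False).Dom S K T Y)
    (hY : 8 ≤ C₄ * Y) (hT : Δ' * C₁ + 2 * (C₅ / 4 + |C₂|) + 1 ≤ T) (hTY : 5 * T ≤ Y)
    (hk : k ≠ 0) (hkΔ : len k ≤ Δ') (hκ : 0 < κ) (hκT : κ ≤ T) :
    volume {ω ∈ U | ¬ (baseLev L Δ Δ' D ρ False).LBallP (inner ℝ (toE k) ω) (qKer (Ω ω) (H ω)) κ} ≤
      (Y : ℝ≥0∞) ^ (2 * d + 4) *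
      (ballVol n C₁ * ENNReal.ofReal κ) := by
  set g := baseLev L Δ Δ' D ρ False with hgdef
  have h5 := h.hC₅
  have h1 := h.hC₁
  have h4 := h.hC₄
  have hT1 : 1 ≤ T := by
    have : 0 ≤ Δ' * C₁ := mul_nonneg ((len_nonneg k).trans hkΔ) (by linarith)
    have := abs_nonneg C₂
    linarith
  have hY1 : (1 : ℝ) ≤ Y := by linarith
  have hk0 : len k ≠ 0 := fun h0 => hk (len_eq_zero.1 h0)
  have hv : ‖(len k)⁻¹ • toE k‖ = 1 := by
    rw [norm_smul, norm_inv, Real.norm_of_nonneg (len_nonneg k)]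
    exact inv_mul_cancel₀ hk0
  set V := ballVol n C₁
  set I := box d (2 * T)
  have hI : (I.card : ℝ) ≤ (Y : ℝ) ^ d := by
    refine (card_box (by linarith)).trans ?_
    gcongr
    linarith
  have hsub : {ω ∈ U | ¬ g.LBallP (inner ℝ (toE k) ω) (qKer (Ω ω) (H ω)) κ} ⊆
      ⋃ a ∈ I, ⋃ b ∈ I, {ω ∈ U | (a ∈ L ∧ b ∈ L) ∧ ¬ LB (g.blk a) (g.blk b)
        (energyP (inner ℝ (toE k) ω)) (qKer (Ω ω) (H ω)) (tr (qKer (Ω ω) (H ω))) κ} := by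
    rintro ω ⟨hω, hn⟩
    unfold Lev.LBallP at hn
    push Not at hn
    obtain ⟨a, ha, b, hb, hab⟩ := hn
    have hθ : |inner ℝ (toE k) ω| + 2 * (C₅ / 4 + |C₂|) ≤ T := by
      have h1 := abs_real_inner_le_norm (toE k) ω
      have h2 : ‖ω‖ ≤ C₁ := by simpa using h.hU hω
      have h3 : ‖toE k‖ * ‖ω‖ ≤ Δ' * C₁ :=
        mul_le_mul hkΔ h2 (norm_nonneg _) ((len_nonneg k).trans hkΔ)
      linarith
    have hlt : len a ^ 2 + len b ^ 2 < 2 * T := by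
      by_contra hge
      push Not at hge
      refine hab ((Lev.LBP_of_large hg (h.opBlk hω hg) ha hb ?_).mono ?_) <;> linarith
    have hmem : ∀ x : Lat d, len x ^ 2 ≤ 2 * T → x ∈ I := fun x hx => mem_box (by
      nlinarith [sq_nonneg (len x - 1), len_nonneg x])
    simp only [Set.mem_iUnion]
    exact ⟨a, hmem a (by nlinarith [sq_nonneg (len b)]), b,
      hmem b (by nlinarith [sq_nonneg (len a)]), hω, ⟨ha, hb⟩, hab⟩
  have hpair : ∀ a b, volume {ω ∈ U | (a ∈ L ∧ b ∈ L) ∧ ¬ LB (g.blk a) (g.blk b)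
      (energyP (inner ℝ (toE k) ω)) (qKer (Ω ω) (H ω)) (tr (qKer (Ω ω) (H ω))) κ} ≤
      (Y : ℝ≥0∞) ^ 4 * (V * ENNReal.ofReal κ) := by
    intro a b
    by_cases hab : a ∈ L ∧ b ∈ L
    swap
    · simp [hab]
    simp only [hab, true_and]
    have hA : ∀ x ∈ g.blk a, x ∈ L := fun x hx => Lev.mem_of_blk hg hab.1 hx
    have hB : ∀ x ∈ g.blk b, x ∈ L := fun x hx => Lev.mem_of_blk hg hab.2 hx
    have hmain := volume_not_LB_le (U := U) (C₁ := C₁) (τ := κ) (α := (2 * len k - C₄) / 4)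
      (β := len k) (K := C₄ / 4 + n + len k) h1 h.hU hv hκ (by linarith) (g.blk a) (g.blk b)
      (fun ω a b => inner ℝ (toE k) ω + ((a ⬝ᵥ a + b ⬝ᵥ b : ℤ) : ℝ)) (fun ω => qKer (Ω ω) (H ω))
      (fun ω => tr (qKer (Ω ω) (H ω))) (fun ω hω x hx y hy => h.herm hω (hA x hx) (hA y hy))
      (fun ω hω x hx y hy => h.herm hω (hB y hy) (hB x hx))
      (fun x hx y hy s w hs hxy => by
        have hF : ∀ A : Finset (Lat d), (∀ a ∈ A, a ∈ L) →
            FormLe A (qKer (Ω y) (H y) - qKer (Ω x) (H x))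
              ((2 * len k - C₄) / 4 * s + (C₄ / 4 + n + len k) * ‖w‖) := fun A hA ξ => by
          refine (h.formLe_sub hk hx hy hs hxy hA ξ).trans ?_
          refine mul_le_mul_of_nonneg_right ?_ (by positivity)
          have := mul_nonneg (len_nonneg k) (norm_nonneg w)
          linarith
        refine ⟨fun a b => ?_, hF _ hA, hF _ hB⟩
        have := inner_mono (K := C₄ / 4 + n + len k) hk (by
          have : (0 : ℝ) ≤ n := Nat.cast_nonneg n
          linarith) hxy
        linarith)
    have hez : ∀ ω : Par n, (fun a b => ((inner ℝ (toE k) ω + ((a ⬝ᵥ a + b ⬝ᵥ b : ℤ) : ℝ) : ℝ) : ℂ))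
        = (energyP (inner ℝ (toE k) ω) : Ker d) := fun ω => by
      funext a b
      simp only [energyP]
      push_cast
      rfl
    simp only [hez] at hmain
    refine hmain.trans ?_
    have hc1 := (hg.card_blk a).trans hDm.h4
    have hc2 := (hg.card_blk b).trans hDm.h4
    have hcard : (((g.blk a).card * (g.blk b).card + 1 : ℕ) : ℝ≥0∞) ≤ (Y : ℝ≥0∞) ^ 3 := by
      have e1 : (g.blk a).card ≤ Y := by exact_mod_cast hc1
      have e2 : (g.blk b).card ≤ Y := by exact_mod_cast hc2
      have e3 : 2 ≤ Y := by have := hDm.hY; omega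
      have : (g.blk a).card * (g.blk b).card + 1 ≤ Y ^ 3 := by
        have := Nat.mul_le_mul e1 e2
        nlinarith
      exact_mod_cast this
    have hτ : ENNReal.ofReal (4 * κ / (len k - 2 * ((2 * len k - C₄) / 4)))
        ≤ (Y : ℝ≥0∞) * ENNReal.ofReal κ := by
      rw [← ENNReal.ofReal_natCast, ← ENNReal.ofReal_mul (by positivity)]
      refine ENNReal.ofReal_le_ofReal ?_
      rw [div_le_iff₀ (by linarith)]
      nlinarith
    calc _ ≤ (Y : ℝ≥0∞) ^ 3 * (V * ((Y : ℝ≥0∞) * ENNReal.ofReal κ)) := by gcongr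
      _ = _ := by ring
  have hIe : (I.card : ℝ≥0∞) ≤ (Y : ℝ≥0∞) ^ d := by exact_mod_cast hI
  refine (measure_mono hsub).trans ((measure_biUnion_finset_le _ _).trans ?_)
  refine (Finset.sum_le_sum fun a _ => (measure_biUnion_finset_le _ _).trans
    (Finset.sum_le_sum fun b _ => hpair a b)).trans ?_
  simp only [Finset.sum_const, nsmul_eq_mul]
  calc (I.card : ℝ≥0∞) * ((I.card : ℝ≥0∞) * ((Y : ℝ≥0∞) ^ 4 * (V * ENNReal.ofReal κ)))
      ≤ (Y : ℝ≥0∞) ^ d * ((Y : ℝ≥0∞) ^ d * ((Y : ℝ≥0∞) ^ 4 * (V * ENNReal.ofReal κ))) := by gcongr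
    _ = _ := by ring

end Setting

end Resonances

/-! ### The set of good parameters -/

section GoodSet

variable {d n : ℕ}

/-- The conditions on the small divisors. -/
def NonRes (L : Set (Lat d)) (Δ Δ' D ρ κ : ℝ) (Q : Ker d) (ω : Par n) : Prop :=
  ∀ k : Lat n, len k ≤ Δ' →
    (baseLev L Δ Δ' D ρ (k = 0)).LBall (inner ℝ (toE k) ω) Q κ ∧
    (baseLev L Δ Δ' D ρ (k = 0)).LBallP (inner ℝ (toE k) ω) Q κ

lemma dom_of_large {L : Set (Lat d)} {Δ Δ' D ρ : ℝ} {k0 : Prop} {Λ K T W : ℝ} (hW : 10000 ≤ W)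
    (hΔ0 : 0 ≤ Δ') (hΔ' : Δ' ≤ W) (hD0 : 0 ≤ D) (hD : D ≤ W) (hρ0 : 0 ≤ ρ) (hρ : ρ ≤ W)
    (hΛ0 : 0 ≤ Λ) (hΛ : Λ ≤ W) (hK : K ≤ W) (hT : T ≤ W) (hd : (d : ℝ) + 8 ≤ W)
    (h3 : (3 : ℝ) ^ d ≤ W) :
    (baseLev L Δ Δ' D ρ k0).Radius (32 * (Δ' + 2 * D + 1) ^ 2 + ρ + Λ + 1) ∧
    (baseLev L Δ Δ' D ρ k0).Dom (32 * (Δ' + 2 * D + 1) ^ 2 + ρ + Λ + 1) K T ⌈W ^ (d + 8)⌉₊ := by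
  have hW1 : 1 ≤ W := by linarith
  have hsq : 0 ≤ (Δ' + 2 * D + 1) ^ 2 := sq_nonneg _
  set S := 32 * (Δ' + 2 * D + 1) ^ 2 + ρ + Λ + 1 with hSdef
  have h4W : (Δ' + 2 * D + 1) ^ 2 ≤ (4 * W) ^ 2 := by gcongr; linarith
  have hS0 : 0 ≤ S := by positivity
  have hS : S ≤ W ^ 3 - 1 := by
    have : W ^ 3 ≥ 10000 * W ^ 2 := by nlinarith [sq_nonneg W]
    nlinarith
  have hceil : W ^ (d + 8) ≤ ⌈W ^ (d + 8)⌉₊ := Nat.le_ceil _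
  have hpow : ∀ m ≤ d + 8, W ^ m ≤ (⌈W ^ (d + 8)⌉₊ : ℝ) := fun m hm =>
    (pow_le_pow_right₀ hW1 hm).trans hceil
  refine ⟨⟨?_, ?_⟩, ?_, ?_, ?_, ?_, ?_, ?_⟩
  · change 32 * (Δ' + 2 * D + 1) ^ 2 ≤ S
    linarith
  · change ρ ≤ S
    linarith
  · have := hd.trans ((pow_one W).symm.le.trans (hpow 1 (by omega)))
    exact_mod_cast this
  · change (S + 1) * (Δ' + 3 * D + 1) ≤ _
    refine le_trans ?_ (hpow 5 (by omega))
    have h1 : (S + 1) * (Δ' + 3 * D + 1) ≤ W ^ 3 * (5 * W) := by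
      gcongr <;> linarith
    have h2 : W ^ 3 * (5 * W) ≤ W ^ 3 * (W * W) := by gcongr; linarith
    calc _ ≤ _ := h1.trans h2
      _ = W ^ 5 := by ring
  · change 2 * S ^ 2 + Δ' + 3 * D + 1 ≤ _
    refine le_trans ?_ (hpow 7 (by omega))
    have h1 : S ^ 2 ≤ (W ^ 3) ^ 2 := by gcongr; linarith
    have h2 : 1 * W ≤ W ^ 5 * W := by gcongr; exact one_le_pow₀ hW1
    have h3 : W ^ 7 = W ^ 6 * W := by ring
    have h4 : W ^ 6 * 10000 ≤ W ^ 6 * W := by gcongr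
    have h5 : (W ^ 3) ^ 2 = W ^ 6 := by ring
    have h6 : W ^ 5 * W = W ^ 6 := by ring
    rw [h5] at h1
    rw [h6] at h2
    linarith
  · change (Δ' + 2 * D + 1) ^ 2 + T + 1 ≤ _
    refine le_trans ?_ (hpow 3 (by omega))
    have : W ^ 3 ≥ 10000 * W ^ 2 := by nlinarith [sq_nonneg W]
    nlinarith
  · change (3 * D) ^ d ≤ _
    refine le_trans ?_ (hpow (d + 1) (by omega))
    rw [mul_pow, pow_succ, mul_comm]
    gcongr
  · exact hK.trans ((pow_one W).symm.le.trans (hpow 1 (by omega)))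

lemma exists_scale (d : ℕ) {L : Set (Lat d)} {ρ C₁ C₄ C₅ C₂ K C : ℝ} (f : ℕ) (hρ0 : 0 ≤ ρ)
    (hC₁ : 1 ≤ C₁) (hC₄ : 0 < C₄) (hC₅ : 0 < C₅) (hK : 0 ≤ K) (hC : 1 ≤ C) :
    ∃ c₀ : ℝ, 1 ≤ c₀ ∧ ∀ (Λ Δ Δ' D : ℝ), 0 ≤ Λ → 1 ≤ Δ → 1 ≤ Δ' → 1 ≤ D → D ≤ C * Δ ^ f →
      ∃ (S T : ℝ) (Y : ℕ), (∀ k0, (baseLev L Δ Δ' D ρ k0).Radius S) ∧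
        (∀ k0, (baseLev L Δ Δ' D ρ k0).Dom S K T Y) ∧ Λ ≤ S ∧ 1 ≤ S ∧ 8 ≤ C₄ * Y ∧ 5 * T ≤ Y ∧
        2 * Δ' + 1 ≤ Y ∧ Δ' * C₁ + 2 * (C₅ / 4 + |C₂|) + 1 ≤ T ∧ C₅ ≤ T ∧
        (Y : ℝ) ≤ (c₀ * max Λ (max Δ Δ') ^ (f + 1)) ^ (d + 9) := by
  have hC₂ := abs_nonneg C₂
  obtain ⟨c₁, hc₁⟩ : ∃ c₁, c₁ = C₁ + 2 * (C₅ / 4 + |C₂|) + 1 + C₅ := ⟨_, rfl⟩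
  have h3d : (0 : ℝ) < 3 ^ d := by positivity
  have h8 : 0 ≤ 8 / C₄ := by positivity
  have hdn : (0 : ℝ) ≤ d := Nat.cast_nonneg d
  have hc₁0 : 0 ≤ c₁ := by linarith
  obtain ⟨c₀, hc₀⟩ : ∃ c₀, c₀ = 10000 + ((d : ℝ) + 8) + 3 ^ d + C + ρ + K + c₁ + 8 / C₄ := ⟨_, rfl⟩
  have hc₀1 : 1 ≤ c₀ := by linarith
  refine ⟨c₀, hc₀1, fun Λ Δ Δ' D hΛ hΔ hΔ' hD hDC => ?_⟩
  obtain ⟨Z, hZ⟩ : ∃ Z, Z = max Λ (max Δ Δ') := ⟨_, rfl⟩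
  have hZΛ : Λ ≤ Z := hZ ▸ le_max_left _ _
  have hZΔ : Δ ≤ Z := hZ ▸ (le_max_left _ _).trans (le_max_right _ _)
  have hZΔ' : Δ' ≤ Z := hZ ▸ (le_max_right _ _).trans (le_max_right _ _)
  have hZ1 : 1 ≤ Z := hΔ.trans hZΔ
  rw [← hZ]
  obtain ⟨W, hW⟩ : ∃ W, W = c₀ * Z ^ (f + 1) := ⟨_, rfl⟩
  rw [← hW]
  have hZp : Z ≤ Z ^ (f + 1) := le_self_pow₀ hZ1 (by omega)
  have hZf : Z ^ f ≤ Z ^ (f + 1) := pow_le_pow_right₀ hZ1 (by omega)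
  have hZp1 : 1 ≤ Z ^ (f + 1) := one_le_pow₀ hZ1
  have hc₀0 : 0 ≤ c₀ := zero_le_one.trans hc₀1
  have hcW : ∀ c, c ≤ c₀ → c ≤ W := fun c hc =>
    hW ▸ hc.trans (le_mul_of_one_le_right hc₀0 hZp1)
  have hW1 : 10000 ≤ W := hcW _ (by linarith)
  have hDW : D ≤ W := hW ▸ hDC.trans (mul_le_mul (by linarith)
    ((pow_le_pow_left₀ (by linarith) hZΔ f).trans hZf) (by positivity) hc₀0)
  have hZW : Z ≤ W := hW ▸ hZp.trans (le_mul_of_one_le_left (by positivity) hc₀1)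
  obtain ⟨T, hT⟩ : ∃ T, T = Δ' * C₁ + 2 * (C₅ / 4 + |C₂|) + 1 + C₅ := ⟨_, rfl⟩
  have hTW : T ≤ W := by
    have h1 : T ≤ c₁ * Δ' := by
      have : 0 ≤ (2 * (C₅ / 4 + |C₂|) + 1 + C₅) * (Δ' - 1) :=
        mul_nonneg (by linarith) (by linarith)
      rw [hT, hc₁]
      linarith
    exact hW ▸ h1.trans (mul_le_mul (by linarith) (hZΔ'.trans hZp) (by linarith) hc₀0)
  have hdom : ∀ k0, (baseLev L Δ Δ' D ρ k0).Radius (32 * (Δ' + 2 * D + 1) ^ 2 + ρ + Λ + 1) ∧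
      (baseLev L Δ Δ' D ρ k0).Dom (32 * (Δ' + 2 * D + 1) ^ 2 + ρ + Λ + 1) K T ⌈W ^ (d + 8)⌉₊ :=
    fun k0 => dom_of_large hW1 (by linarith) (hZΔ'.trans hZW) (by linarith) hDW hρ0
      (hcW _ (by linarith)) hΛ (hZΛ.trans hZW) (hcW _ (by linarith)) hTW (hcW _ (by linarith))
      (hcW _ (by linarith))
  have hsq : 0 ≤ 32 * (Δ' + 2 * D + 1) ^ 2 := by positivity
  have hW1' : 1 ≤ W := by linarith
  have hYW : W ^ 2 ≤ (⌈W ^ (d + 8)⌉₊ : ℝ) :=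
    (pow_le_pow_right₀ hW1' (by omega)).trans (Nat.le_ceil _)
  have h5W : 5 * W ≤ (⌈W ^ (d + 8)⌉₊ : ℝ) := by nlinarith
  have hYle : (⌈W ^ (d + 8)⌉₊ : ℝ) ≤ W ^ (d + 9) := by
    have h1 : (⌈W ^ (d + 8)⌉₊ : ℝ) ≤ W ^ (d + 8) + 1 := (Nat.ceil_lt_add_one (by positivity)).le
    have h2 : 1 ≤ W ^ (d + 8) := one_le_pow₀ hW1'
    have h3 : W ^ (d + 9) = W ^ (d + 8) * W := pow_succ _ _
    have h4 : W ^ (d + 8) * 2 ≤ W ^ (d + 8) * W := by gcongr; linarith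
    linarith
  have hΔC : 0 ≤ Δ' * C₁ := by positivity
  refine ⟨_, T, _, fun k0 => (hdom k0).1, fun k0 => (hdom k0).2, by linarith, by linarith, ?_,
    by linarith, by linarith, by linarith, by linarith, hYle⟩
  have : 8 / C₄ ≤ (⌈W ^ (d + 8)⌉₊ : ℝ) := (hcW _ (by linarith)).trans (by linarith)
  rwa [div_le_iff₀' hC₄] at this

set_option maxHeartbeats 1000000 in
/-- There is a large set of parameters at which all operators of the equation are invertible with a
good bound. -/
theorem exists_good_set (d : ℕ) (hd : 2 ≤ d) (n : ℕ) : ∃ exponent : ℕ,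
    ∀ (L : Set (Lat d)) (ρ C₁ C₂ C₃ C₄ C₅ C₆ : ℝ) (_ : 0 ≤ ρ) (_ : ∀ a, ρ ≤ len a → a ∈ L)
      (_ : Lᶜ.Finite) (_ : 1 ≤ C₁) (_ : 0 < C₃) (_ : 0 < C₄) (_ : 0 < C₅),
    ∃ cte : ℝ, 0 < cte ∧ ∀ (Λ Δ Δ' κ : ℝ) (_ : 2 ≤ Δ) (_ : 1 ≤ Δ') (_ : 0 < κ)
      (_ : κ < C₅ / 2) (U B : Set (Par n)) (Ω : Par n → Lat d → ℝ) (DΩ : Par n → Lat d → Par n)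
      (H : Par n → LMat d) (DH : Fin n → Par n → LMat d)
      (_ : Setting L Λ Δ C₁ C₂ C₃ C₄ C₅ C₆ U B Ω DΩ H DH),
    ∃ U' : Set (Par n), U' ⊆ U ∧ volume (U \ U') ≤
        ENNReal.ofReal (cte * max Λ (max Δ Δ') ^ exponent
          * κ ^ ((1 / ((d : ℝ) + 1)) ^ d : ℝ)) ∧
      ∀ ω ∈ U', NonRes L Δ Δ' (blockDiam L Δ) ρ κ (qKer (Ω ω) (H ω)) ω := by
  obtain ⟨e, he⟩ := exists_near_ray d
  obtain ⟨E, hE⟩ := exists_volBd d e (d - 1)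
  obtain ⟨C, f, hC, hdiam⟩ := exists_blockDiam_le d
  obtain ⟨M, hM⟩ : ∃ M, M = n + E + 2 * d + 5 := ⟨_, rfl⟩
  refine ⟨(f + 1) * (d + 9) * M, fun L ρ C₁ C₂ C₃ C₄ C₅ C₆ hρ0 hρ hL hC₁ hC₃ hC₄ hC₅ => ?_⟩
  obtain ⟨V, hV⟩ : ∃ V, V = ballVol n C₁ := ⟨_, rfl⟩
  have hVfin : V ≠ ∞ := hV ▸ measure_closedBall_lt_top.ne
  obtain ⟨c₀, hc₀1, hscale⟩ := exists_scale d (L := L) (C₂ := C₂)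
    (K := |C₆| + |C₂| * (1 / C₃ + 1)) f hρ0 hC₁ hC₄ hC₅ (by positivity) hC
  have hc₀0 : 0 < c₀ := by linarith
  refine ⟨c₀ ^ ((d + 9) * M) * (2 * (V.toReal + 1)), by positivity, ?_⟩
  intro Λ Δ Δ' κ hΔ hΔ' hκ hκ5 U B Ω DΩ H DH h
  have hD2 : 2 ≤ blockDiam L Δ := two_le_blockDiam hd hL hΔ
  have hDm := hdiam L Δ (by linarith)
  generalize blockDiam L Δ = D at hD2 hDm ⊢
  obtain ⟨S, T, Y, hrad, hdom, hΛS, hS1, hY8, hTY, hYΔ, hT, hTC, hYle⟩ :=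
    hscale Λ Δ Δ' D h.hΛ (by linarith) hΔ' (by linarith) hDm.2
  have hZ1 : 1 ≤ max Λ (max Δ Δ') := hΔ'.trans ((le_max_right _ _).trans (le_max_right _ _))
  generalize max Λ (max Δ Δ') = Z at hYle hZ1 ⊢
  obtain ⟨x, hxdef⟩ : ∃ x, x = κ ^ ((1 / ((d : ℝ) + 1)) ^ d : ℝ) := ⟨_, rfl⟩
  rw [← hxdef]
  have hx : 0 < x := hxdef ▸ Real.rpow_pos_of_pos hκ _
  have hxκ : x ^ ((d + 1) ^ d) = κ := by
    rw [hxdef, ← Real.rpow_natCast, ← Real.rpow_mul hκ.le]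
    have : (1 / ((d : ℝ) + 1)) ^ d * (((d + 1) ^ d : ℕ) : ℝ) = 1 := by
      push_cast
      rw [← mul_pow, one_div_mul_cancel (by positivity), one_pow]
    rw [this, Real.rpow_one]
  have hg : ∀ k0, (baseLev L Δ Δ' D ρ k0).Good := fun k0 =>
    baseLev_good hρ hDm.1 (by linarith) hΔ'
  have hYM : (Y : ℝ) ^ M ≤ c₀ ^ ((d + 9) * M) * Z ^ ((f + 1) * (d + 9) * M) := by
    calc (Y : ℝ) ^ M ≤ ((c₀ * Z ^ (f + 1)) ^ (d + 9)) ^ M := by gcongr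
      _ = _ := by rw [mul_pow, mul_pow, ← pow_mul, ← pow_mul, ← pow_mul, mul_assoc]
  have hZ0 : 1 ≤ c₀ ^ ((d + 9) * M) * Z ^ ((f + 1) * (d + 9) * M) :=
    one_le_mul_of_one_le_of_one_le (one_le_pow₀ hc₀1) (one_le_pow₀ hZ1)
  have hκT : κ ≤ T := by linarith
  have hYC : 1 ≤ C₄ / 2 * Y := by linarith
  have hVU : volume U ≤ V := hV ▸ measure_mono (h.hU.trans
    (Metric.closedBall_subset_closedBall (by linarith)))
  by_cases hx1 : x ≤ 1 / 2
  swap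
  · refine ⟨∅, Set.empty_subset _, ?_, fun ω hω => absurd hω (Set.notMem_empty ω)⟩
    rw [Set.sdiff_empty]
    refine hVU.trans ?_
    refine (ENNReal.ofReal_toReal hVfin).symm.le.trans (ENNReal.ofReal_le_ofReal ?_)
    have hV0 : 0 ≤ V.toReal := ENNReal.toReal_nonneg
    have h2 : V.toReal ≤ (2 * (V.toReal + 1)) * x := by nlinarith
    calc V.toReal ≤ 1 * ((2 * (V.toReal + 1)) * x) := by rw [one_mul]; exact h2
      _ ≤ (c₀ ^ ((d + 9) * M) * Z ^ ((f + 1) * (d + 9) * M)) * ((2 * (V.toReal + 1)) * x) := by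
          gcongr
      _ = _ := by ring
  · set gF := baseLev L Δ Δ' D ρ False with hgF
    have hκx : κ ≤ x := by
      rw [← hxκ]
      exact pow_le_of_le_one hx.le (by linarith) (by positivity)
    set good : Set (Par n) := {ω ∈ U | ∀ k : Lat n, len k ≤ Δ' → k ≠ 0 →
      gF.LBall (inner ℝ (toE k) ω) (qKer (Ω ω) (H ω)) κ ∧
      gF.LBallP (inner ℝ (toE k) ω) (qKer (Ω ω) (H ω)) κ} with hgood
    refine ⟨good, fun ω hω => hω.1, ?_, ?_⟩
    · set bad : Lat n → Set (Par n) := fun k => {ω ∈ U | (len k ≤ Δ' ∧ k ≠ 0) ∧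
          ¬ gF.LBall (inner ℝ (toE k) ω) (qKer (Ω ω) (H ω)) κ} ∪ {ω ∈ U | (len k ≤ Δ' ∧ k ≠ 0) ∧
          ¬ gF.LBallP (inner ℝ (toE k) ω) (qKer (Ω ω) (H ω)) κ} with hbad
      have hsub : U \ good ⊆ ⋃ k ∈ box n Δ', bad k := by
        rintro ω ⟨hω, hn⟩
        obtain ⟨k, hk⟩ := not_forall.1 fun hall => hn ⟨hω, hall⟩
        push Not at hk
        obtain ⟨hk1, hk2, hk3⟩ := hk
        simp only [Set.mem_iUnion]
        refine ⟨k, mem_box hk1, ?_⟩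
        by_cases hb : gF.LBall (inner ℝ (toE k) ω) (qKer (Ω ω) (H ω)) κ
        · exact Or.inr ⟨hω, ⟨hk1, hk2⟩, hk3 hb⟩
        · exact Or.inl ⟨hω, ⟨hk1, hk2⟩, hb⟩
      have hterm : ∀ k : Lat n, volume (bad k) ≤
          (Y : ℝ≥0∞) ^ E * (V * ENNReal.ofReal x) +
            (Y : ℝ≥0∞) ^ (2 * d + 4) * (V * ENNReal.ofReal x) := by
        intro k
        by_cases hk : len k ≤ Δ' ∧ k ≠ 0
        swap
        · rw [show bad k = ∅ by ext; simp only [hbad, hk]; simp, measure_empty]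
          exact zero_le
        simp only [hbad, hk, ne_eq, not_false_eq_true, and_self, true_and]
        refine (measure_union_le _ _).trans (add_le_add ?_ ?_)
        · have := h.volume_not_LBall_le (fun hY => he _ hY) (hE n) (hg False) (hrad False) hΛS hS1
            (hdom False) hYC hT hk.2 hk.1 hx hx1
          rwa [hxκ, ← hV] at this
        · refine (h.volume_not_LBallP_le (hg False) (hdom False) hY8 hT hTY hk.2 hk.1
            hκ hκT).trans ?_
          rw [← hV]
          gcongr
      have hcard : ((box n Δ').card : ℝ≥0∞) ≤ (Y : ℝ≥0∞) ^ n := by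
        have : ((box n Δ').card : ℝ) ≤ (Y : ℝ) ^ n := by
          refine (card_box (by linarith)).trans ?_
          gcongr
        exact_mod_cast this
      have hY1 : (1 : ℝ≥0∞) ≤ Y := by
        have : (1 : ℝ) ≤ Y := by linarith
        exact_mod_cast this
      have hY2 : (2 : ℝ≥0∞) ≤ Y := by
        have : (2 : ℝ) ≤ Y := by linarith
        exact_mod_cast this
      refine (measure_mono hsub).trans ((measure_biUnion_finset_le _ _).trans
        ((Finset.sum_le_sum fun k _ => hterm k).trans ?_))
      rw [Finset.sum_const, nsmul_eq_mul, ← add_mul]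
      calc ((box n Δ').card : ℝ≥0∞) * (((Y : ℝ≥0∞) ^ E + (Y : ℝ≥0∞) ^ (2 * d + 4)) *
            (V * ENNReal.ofReal x))
          ≤ (Y : ℝ≥0∞) ^ n * (((Y : ℝ≥0∞) ^ (E + 2 * d + 4) + (Y : ℝ≥0∞) ^ (E + 2 * d + 4)) *
            (V * ENNReal.ofReal x)) := by
            gcongr <;> first | exact hY1 | omega
        _ = (Y : ℝ≥0∞) ^ n * ((2 * (Y : ℝ≥0∞) ^ (E + 2 * d + 4)) * (V * ENNReal.ofReal x)) := by
            ring
        _ ≤ (Y : ℝ≥0∞) ^ n * ((Y * (Y : ℝ≥0∞) ^ (E + 2 * d + 4)) * (V * ENNReal.ofReal x)) := by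
            gcongr
        _ = (Y : ℝ≥0∞) ^ M * V * ENNReal.ofReal x := by rw [hM]; ring
        _ = ENNReal.ofReal ((Y : ℝ) ^ M * V.toReal * x) := by
            rw [ENNReal.ofReal_mul (by positivity), ENNReal.ofReal_mul (by positivity),
              ENNReal.ofReal_toReal hVfin, ENNReal.ofReal_pow (by positivity),
              ENNReal.ofReal_natCast]
        _ ≤ _ := by
            refine ENNReal.ofReal_le_ofReal ?_
            have hV0 : 0 ≤ V.toReal := ENNReal.toReal_nonneg
            calc (Y : ℝ) ^ M * V.toReal * x
                ≤ (c₀ ^ ((d + 9) * M) * Z ^ ((f + 1) * (d + 9) * M)) * (2 * (V.toReal + 1)) * x := by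
                  gcongr
                  linarith
              _ = _ := by ring
    · intro ω hω k hk
      by_cases hk0 : k = 0
      · subst hk0
        have hz : inner ℝ (toE (0 : Lat n)) ω = 0 := by rw [toE_zero, inner_zero_left]
        rw [hz]
        set g := baseLev L Δ Δ' D ρ ((0 : Lat n) = 0)
        have hmem : ∀ a ∈ L, ∀ x ∈ g.blk a, x ∈ L := fun a ha x hx => Lev.mem_of_blk (hg _) ha hx
        refine ⟨fun a b hab => ?_, fun a ha b hb => ?_⟩
        · refine ((h.LB_nonres hω.1 (hmem a hab.1) (hmem b hab.2.1)).2 fun x hx y hy => ?_).mono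
            hκ5.le
          rw [← ((hg _).mem_blk.1 hx).len_eq, ← ((hg _).mem_blk.1 hy).len_eq]
          exact hab.2.2.2.1 rfl
        · exact (h.LB_nonres hω.1 (hmem a ha) (hmem b hb)).1.mono hκ5.le
      · rw [eq_false hk0]
        exact hω.2 k hk hk0

end GoodSet

/-! ### Solutions and their derivatives -/

section Solutions

variable {d n : ℕ}

lemma const_bounds {q k A B K m : ℝ} (hq : 0 < q) (hk : 1 ≤ k) (hkq : 1 ≤ k * q) (hA : 0 ≤ A)
    (hB : 1 ≤ B) (hK : 0 ≤ K) (hm : 1 ≤ m) :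
    q * (A + 2 * (2 * B * K) * (q * A)) ≤ 32 * (k * q) ^ 3 * (1 + K) * (B * m) * A ∧
    16 * (A + m * (q * A)) ≤ 32 * (k * q) ^ 3 * (1 + K) * (B * m) * A ∧
    q * (A + m * (q * A)) ≤ 32 * (k * q) ^ 3 * (1 + K) * (B * m) * A ∧
    q * ((A + m * (q * (A + 2 * (2 * B * K) * (q * A))) + 2 * (2 * B * K) * (q * A))
      + 2 * (2 * B * K) * (q * (A + m * (q * A))))
      ≤ 32 * (k * q) ^ 3 * (1 + K) * (B * m) * A := by
  have hqk : q ≤ k * q := le_mul_of_one_le_left hq.le hk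
  have hT : ∀ i ≤ 3, q ^ i ≤ (k * q) ^ 3 := fun i hi =>
    (pow_le_pow_left₀ hq.le hqk i).trans (pow_le_pow_right₀ hkq hi)
  have hBm1 : 1 ≤ B * m := one_le_mul_of_one_le_of_one_le hB hm
  have hB' : B ≤ B * m := le_mul_of_one_le_right (by linarith) hm
  have hm' : m ≤ B * m := le_mul_of_one_le_left (by linarith) hB
  have h0 := hT 0 (by norm_num)
  have h1 := hT 1 (by norm_num)
  have h2 := hT 2 (by norm_num)
  have h3 := hT 3 (by norm_num)
  rw [pow_zero] at h0
  rw [pow_one] at h1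
  generalize (k * q) ^ 3 = T at *
  have hT0 : 0 ≤ T := by linarith
  have key : ∀ x y : ℝ, 0 ≤ x → x ≤ B * m → y ≤ T → x * y * A ≤ T * (B * m) * A :=
    fun x y hx0 hx hy => by
      have : x * y ≤ (B * m) * T := (mul_le_mul_of_nonneg_left hy hx0).trans
        (mul_le_mul_of_nonneg_right hx hT0)
      calc x * y * A ≤ (B * m) * T * A := mul_le_mul_of_nonneg_right this hA
        _ = _ := by ring
  have keyK : ∀ x y : ℝ, 0 ≤ x → x ≤ B * m → y ≤ T → x * y * A * K ≤ T * (B * m) * A * K :=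
    fun x y hx0 hx hy => mul_le_mul_of_nonneg_right (key x y hx0 hx hy) hK
  have a1 := key 1 q zero_le_one hBm1 h1
  have a2 := key m (q ^ 2) (by linarith) hm' h2
  have a3 := keyK (B * m) (q ^ 3) (by positivity) le_rfl h3
  have a4 := keyK B (q ^ 2) (by linarith) hB' h2
  have a5 := key 1 1 zero_le_one hBm1 h0
  have a6 := key m q (by linarith) hm' h1
  have a7 : 0 ≤ T * (B * m) * A := by positivity
  have a8 : 0 ≤ T * (B * m) * A * K := by positivity
  refine ⟨?_, ?_, ?_, ?_⟩ <;> linarith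

/-- The common bound for solutions and their derivatives. -/
def solBound (k K Kop D Δ' κ γ M : ℝ) (d : ℕ) : ℝ :=
  32 * (k * κ⁻¹) ^ 3 * (1 + K) * ((3 * D) ^ d * (Δ' * (1 + 2 * Kop))) *
    ((3 * D) ^ d * (Real.exp (2 * γ * D) * M))

variable {g : Lev d} {p : Prop} {k θ η κ γ S₀ K Kop M : ℝ} {Q P : Ker d}

lemma solBound_nonneg (hk : 1 ≤ k) (hκ : 0 < κ) (hg : g.Good) (hK : 0 ≤ K) (hKop : 0 ≤ Kop)
    (hM : 0 ≤ M) : 0 ≤ solBound k K Kop g.D g.Δ' κ γ M d := by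
  have := hg.hD
  have := hg.hΔ'
  unfold solBound
  positivity

lemma le_delta (hg : g.Good) (hKop : 0 ≤ Kop) (hη : |η| ≤ g.Δ') :
    |η| ≤ g.Δ' * (1 + 2 * Kop) - 2 * Kop ∧ 1 ≤ g.Δ' * (1 + 2 * Kop) := by
  have := hg.hΔ'
  have : 0 ≤ (g.Δ' - 1) * (2 * Kop) := mul_nonneg (by linarith) (by linarith)
  constructor <;> linarith

lemma IsSol_reg_pair (hg : g.Good) (hS : g.Radius S₀) (hκ : 0 < κ) (hk : 1 ≤ k) (hkκ : κ ≤ k)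
    (hγ : 0 ≤ γ) (hK : 0 ≤ K) (hKop : 0 ≤ Kop) (hM : 0 ≤ M) (hθ : |θ| + 2 * Kop ≤ S₀ + g.D + 2)
    (hη : |η| ≤ g.Δ') (hLB : g.LBall θ Q κ) (hop : g.OpBlk Q Kop) (hopP : g.OpBlk P Kop) {m : ℕ}
    (hQ : SReg g.ρ S₀ K m Q) (hP : SReg g.ρ S₀ K m P) {f fv s sv : Ker d}
    (hf : PtReg p γ S₀ M m g.L f) (hfv : PtReg p γ S₀ M m g.L fv) (h : g.IsSol θ Q f s)
    (hv : g.IsSol θ Q (g.dRhs η P fv s) sv) :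
    PtReg p γ (S₀ + g.D + 2) (solBound k K Kop g.D g.Δ' κ γ M d) m g.L s ∧
    PtReg p γ (S₀ + g.D + 2) (solBound k K Kop g.D g.Δ' κ γ M d) m g.L sv := by
  have hD := hg.hD
  have hS0 : 0 ≤ S₀ := le_trans (by positivity) hS.big
  have hkq : 1 ≤ k * κ⁻¹ := by
    rw [← div_eq_mul_inv, le_div_iff₀ hκ]; linarith
  have hB : 1 ≤ (3 * g.D) ^ d := one_le_pow₀ (by linarith)
  have hA : 0 ≤ (3 * g.D) ^ d * (Real.exp (2 * γ * g.D) * M) := by positivity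
  obtain ⟨c1, c2, c3, c4⟩ := const_bounds (inv_pos.2 hκ) hk hkq hA hB hK (le_delta hg hKop hη).2
  have hb := Lev.blkReg_of_entries hγ hM m hg hS0 rfl hf
  have hbv := Lev.blkReg_of_entries hγ hM m hg hS0 rfl hfv
  have hm0 : 0 ≤ g.Δ' * (1 + 2 * Kop) * (κ⁻¹ * ((3 * g.D) ^ d * (Real.exp (2 * γ * g.D) * M))) := by
    have := (le_delta hg hKop hη).2
    positivity
  have hs := Lev.IsSol.reg (M := solBound k K Kop g.D g.Δ' κ γ M d) hκ hK hA m c1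
    (le_trans (by linarith) c2) ((mul_le_mul_of_nonneg_left (by linarith)
      (inv_pos.2 hκ).le).trans c3) hg hS rfl rfl hθ hLB hop hQ hb h
  have hd := Lev.BlkReg.dRhs hK (le_delta hg hKop hη).1 m hg hS rfl rfl hopP hP hbv hs.1
  rw [sub_add_cancel] at hd
  exact ⟨hs.2, (Lev.IsSol.reg (M := solBound k K Kop g.D g.Δ' κ γ M d) hκ hK (by linarith) m c4 c2 c3
    hg hS rfl rfl hθ hLB hop hQ hd hv).2⟩

lemma IsSolP_reg_pair (hg : g.Good) (hS : g.Radius S₀) (hκ : 0 < κ) (hk : 1 ≤ k) (hkκ : κ ≤ k)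
    (hγ : 0 ≤ γ) (hK : 0 ≤ K) (hKop : 0 ≤ Kop) (hM : 0 ≤ M) (hθ : |θ| + 2 * Kop ≤ S₀ + g.D + 2)
    (hη : |η| ≤ g.Δ') (hLB : g.LBallP θ Q κ) (hop : g.OpBlk Q Kop) (hopP : g.OpBlk P Kop)
    {f fv s sv : Ker d} (hr : g.RayBdd f) (hrv : g.RayBdd fv)
    (hf : p → ∀ a ∈ g.L, ∀ b ∈ g.L, ‖f a b‖ ≤ M * Real.exp (-γ * len (a + b)))
    (hfv : p → ∀ a ∈ g.L, ∀ b ∈ g.L, ‖fv a b‖ ≤ M * Real.exp (-γ * len (a + b)))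
    (h : g.IsSolP θ Q f s) (hv : g.IsSolP θ Q (g.dRhsP η P fv s) sv) :
    AntiReg p γ (S₀ + g.D + 2) (solBound k K Kop g.D g.Δ' κ γ M d) g.L s ∧
    AntiReg p γ (S₀ + g.D + 2) (solBound k K Kop g.D g.Δ' κ γ M d) g.L sv := by
  have hD := hg.hD
  have hS0 : 0 ≤ S₀ := le_trans (by positivity) hS.big
  have hkq : 1 ≤ k * κ⁻¹ := by
    rw [← div_eq_mul_inv, le_div_iff₀ hκ]; linarith
  have hB : 1 ≤ (3 * g.D) ^ d := one_le_pow₀ (by linarith)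
  have hA : 0 ≤ (3 * g.D) ^ d * (Real.exp (2 * γ * g.D) * M) := by positivity
  obtain ⟨-, c2, c3, -⟩ := const_bounds (inv_pos.2 hκ) hk hkq hA hB hK (le_delta hg hKop hη).2
  have hm0 : 0 ≤ g.Δ' * (1 + 2 * Kop) * (κ⁻¹ * ((3 * g.D) ^ d * (Real.exp (2 * γ * g.D) * M))) := by
    have := (le_delta hg hKop hη).2
    positivity
  have hb := fun hp => Lev.bdP_of_entries hg hγ hM (hf hp)
  have hbv := fun hp => Lev.bdP_of_entries hg hγ hM (hfv hp)
  have hd := fun hp => (hbv hp).dRhs hg hopP (le_delta hg hKop hη).1 ((hb hp).sol hg hκ hLB h)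
  rw [sub_add_cancel] at hd
  refine ⟨h.antiReg hg hκ hLB hop hr ((mul_le_mul_of_nonneg_left (by linarith)
      (inv_pos.2 hκ).le).trans c3) (le_trans (by linarith) c2) (by linarith) hθ hb,
    hv.antiReg hg hκ hLB hop (hr.dRhsP hg hop hopP h hrv) c3 (le_trans (by linarith) c2)
      (by linarith) hθ hd⟩

lemma Lev.IsSol.lincomb {ι : Type*} (I : Finset ι) (c : ι → ℂ) {f s : ι → Ker d}
    (h : ∀ i, g.IsSol θ Q (f i) (s i)) :
    g.IsSol θ Q (∑ i ∈ I, c i • f i) (∑ i ∈ I, c i • s i) := by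
  refine ⟨fun a b hab => ?_, fun a b hab => ?_⟩
  · rw [sylv_sum]
    simp only [sylv_smul, Finset.sum_apply, Pi.smul_apply, (h _).eq a b hab]
  · simp [Finset.sum_apply, (h _).zero a b hab]

lemma Lev.IsSolP.lincomb {ι : Type*} (I : Finset ι) (c : ι → ℂ) {f s : ι → Ker d}
    (h : ∀ i, g.IsSolP θ Q (f i) (s i)) :
    g.IsSolP θ Q (∑ i ∈ I, c i • f i) (∑ i ∈ I, c i • s i) := by
  refine ⟨fun a ha b hb => ?_, fun a b hab => ?_⟩
  · rw [sylv_sum]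
    simp only [sylv_smul, Finset.sum_apply, Pi.smul_apply, (h _).eq a ha b hb]
  · simp [Finset.sum_apply, (h _).zero a b hab]

lemma dRhs_lincomb (v : Par n) (η : Fin n → ℝ) (P f : Fin n → Ker d) (s : Ker d) :
    ∑ l, ((v l : ℝ) : ℂ) • g.dRhs (η l) (P l) (f l) s
      = g.dRhs (∑ l, v l * η l) (∑ l, ((v l : ℝ) : ℂ) • P l) (∑ l, ((v l : ℝ) : ℂ) • f l) s := by
  have e : g.comm (∑ l, ((v l : ℝ) : ℂ) • P l) s = ∑ l, ((v l : ℝ) : ℂ) • g.comm (P l) s := by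
    funext a b
    simp only [Lev.comm, lprod, rprod, Finset.sum_apply, Pi.smul_apply, smul_eq_mul, mul_sub,
      Finset.sum_sub_distrib, Finset.sum_mul, Finset.mul_sum]
    rw [Finset.sum_comm, Finset.sum_comm (s := g.blk b)]
    simp only [mul_assoc, mul_left_comm (s _ _)]
  unfold Lev.dRhs
  rw [e]
  push_cast
  simp only [smul_sub, Finset.sum_sub_distrib, Finset.sum_smul, smul_smul]

lemma dRhsP_lincomb (v : Par n) (η : Fin n → ℝ) (P f : Fin n → Ker d) (s : Ker d) :
    ∑ l, ((v l : ℝ) : ℂ) • g.dRhsP (η l) (P l) (f l) s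
      = g.dRhsP (∑ l, v l * η l) (∑ l, ((v l : ℝ) : ℂ) • P l) (∑ l, ((v l : ℝ) : ℂ) • f l) s := by
  have e : g.acomm (∑ l, ((v l : ℝ) : ℂ) • P l) s = ∑ l, ((v l : ℝ) : ℂ) • g.acomm (P l) s := by
    funext a b
    simp only [Lev.acomm, lprod, rprod, tr, Finset.sum_apply, Pi.smul_apply, smul_eq_mul, mul_add,
      Finset.sum_add_distrib, Finset.sum_mul, Finset.mul_sum]
    rw [Finset.sum_comm, Finset.sum_comm (s := g.blk b)]
    simp only [mul_assoc, mul_left_comm (s _ _)]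
  unfold Lev.dRhsP
  rw [e]
  push_cast
  simp only [smul_sub, Finset.sum_sub_distrib, Finset.sum_smul, smul_smul]

lemma dirDeriv_ofKer (v : Par n) (s u w : Fin n → Ker d) :
    dirDeriv v (fun l => ofKer (s l) (u l) (w l)) = ofKer (∑ l, ((v l : ℝ) : ℂ) • s l)
      (∑ l, ((v l : ℝ) : ℂ) • u l) (∑ l, ((v l : ℝ) : ℂ) • w l) := by
  funext a b
  refine eq_of_comp (fun ε => ?_) fun ε => ?_
  · rw [phi_dirDeriv]
    rcases Int.units_eq_one_or ε with rfl | rfl <;>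
      simp [ofKer, phi_ofComp, Finset.sum_apply]
  · rw [psi_dirDeriv]
    rcases Int.units_eq_one_or ε with rfl | rfl <;>
      simp [ofKer, psi_ofComp, Finset.sum_apply]

end Solutions

/-! ### The homological equation in components -/

section Equation

variable {d n : ℕ} {L : Set (Lat d)}

/-- The diagonal kernel with entries `|a|²`. -/
def lsq : Ker d := dg fun a => len a ^ 2

lemma lmul_eq_sum {A B : LMat d} {a b : Lat d} (T : Finset (Lat d)) (hT : ∀ e ∈ T, e ∈ L)
    (h : ∀ e ∈ L, e ∉ T → A a e * B e b = 0) : lmul L A B a b = ∑ e ∈ T, A a e * B e b := by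
  classical
  unfold lmul
  rw [tsum_eq_sum (s := T.subtype (· ∈ L)) fun e he => h e e.2 fun h' =>
    he (Finset.mem_subtype.2 h'), Finset.sum_subtype_of_mem (fun e => A a e * B e b) hT]

lemma sylv_energy_dg {A B : Finset (Lat d)} (θ : ℝ) (Q s : Ker d) {a b : Lat d} (ha : a ∈ A)
    (hb : b ∈ B) : sylv A B (energy θ) Q (-Q) s a b = θ * s a b
      + ∑ e ∈ A, (Q + lsq : Ker d) a e * s e b
      - ∑ e ∈ B, s a e * (Q + lsq : Ker d) e b := by
  have h := sylv_dg A B (fun _ _ => (θ : ℂ)) Q (-Q) s (fun a => len a ^ 2) (fun a => -len a ^ 2) ha hb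
  have e : -Q + dg (fun a : Lat d => -len a ^ 2) = -(Q + lsq) := by
    rw [neg_add, lsq, neg_dg]
  rw [e, show dg (fun a : Lat d => len a ^ 2) = lsq from rfl] at h
  simp only [sylv, lprod, rprod, Pi.neg_apply, mul_neg, Finset.sum_neg_distrib,
    ← sub_eq_add_neg] at h ⊢
  rw [h, energy, len_sq, len_sq]
  push_cast
  ring

lemma sylv_energyP_dg {A B : Finset (Lat d)} (θ : ℝ) (Q N s : Ker d) {a b : Lat d} (ha : a ∈ A)
    (hb : b ∈ B) : sylv A B (energyP θ) Q N s a b = θ * s a b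
      + ∑ e ∈ A, (Q + lsq : Ker d) a e * s e b
      + ∑ e ∈ B, s a e * (N + lsq : Ker d) e b := by
  have h := sylv_dg A B (fun _ _ => (θ : ℂ)) Q N s (fun a => len a ^ 2) (fun a => len a ^ 2) ha hb
  rw [show dg (fun a : Lat d => len a ^ 2) = lsq from rfl] at h
  simp only [sylv, lprod, rprod] at h ⊢
  rw [h, energyP, len_sq, len_sq]
  push_cast
  ring

lemma homologicalEq_of {Δ Δ' D ρ : ℝ} {k0 : Prop} (hg : (baseLev L Δ Δ' D ρ k0).Good)
    {Ω : Lat d → ℝ} {H : LMat d} (hH : IsNormalForm L Δ H) {ω : Par n} {k : Lat n} {s u w : Ker d}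
    {F H' : LMat d} (hF : IsSymm L F) (hH' : IsSymm L H') (hpsi : ∀ ε a b, psi ε (H' a b) = 0)
    (hs : ∀ a ∈ L, ∀ b ∈ L, sylv ((baseLev L Δ Δ' D ρ k0).blk a) ((baseLev L Δ Δ' D ρ k0).blk b)
      (energy (inner ℝ (toE k) ω)) (qKer Ω H) (-qKer Ω H) s a b
        = -Complex.I * (phi 1 (F a b) - phi 1 (H' a b)))
    (hu : (baseLev L Δ Δ' D ρ k0).IsSolP (inner ℝ (toE k) ω) (qKer Ω H)
      (fun a b => -Complex.I * psi 1 (F a b)) u)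
    (hw : (baseLev L Δ Δ' D ρ k0).IsSolP (-inner ℝ (toE k) ω) (tr (qKer Ω H))
      (fun a b => Complex.I * psi (-1) (F a b)) w) :
    HomologicalEq L ω k Ω H (ofKer s u w) F H' := by
  intro a ha b hb
  set g := baseLev L Δ Δ' D ρ k0
  have hu' := hu.eq a ha b hb
  have hw' := hw.eq a ha b hb
  have hs1 := hs a ha b hb
  have hs2 := hs b hb a ha
  have hFs := hF a ha b hb
  have hHs := hH' a ha b hb
  have haa := hg.self_mem_blk a
  have hbb := hg.self_mem_blk b
  rw [sylv_energyP_dg _ _ _ _ haa hbb] at hu' hw'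
  rw [sylv_energy_dg _ _ _ haa hbb] at hs1
  rw [sylv_energy_dg _ _ _ hbb haa] at hs2
  have hA : ∀ x ∈ g.blk a, x ∈ L := fun x hx => Lev.mem_of_blk hg ha hx
  have hB : ∀ x ∈ g.blk b, x ∈ L := fun x hx => Lev.mem_of_blk hg hb hx
  set K := diagMat Ω + H with hK
  set q := qKer Ω H + lsq with hq
  have htrq : tr (qKer Ω H) + lsq = tr q := by
    rw [lsq, ← tr_dg]; rfl
  rw [htrq] at hu' hw'
  have hq1 : ∀ x y, phi 1 (K x y) = q x y := by
    intro x y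
    simp only [hK, hq, qKer, lsq, Pi.add_apply, phi_add, diagMat, dg]
    by_cases hxy : x = y
    · simp [hxy, phi]; ring
    · simp [hxy, phi_zero]
  have hq2 : ∀ x ∈ L, ∀ y ∈ L, phi (-1) (K x y) = q y x := by
    intro x hx y hy
    rw [← hq1, ← phi_transpose]
    congr 1
    simp only [hK, Pi.add_apply, Matrix.transpose_add, ← hH.2.1 y hy x hx, diagMat]
    by_cases hxy : x = y
    · simp [hxy]
    · simp [hxy, Ne.symm hxy]
  have hpi : ∀ x ∈ L, ∀ y ∈ L, piM (K x y) = K x y := by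
    intro x hx y hy
    rw [hK, Pi.add_apply, Pi.add_apply, piM_add, hH.2.2.1 x hx y hy, diagMat]
    congr 1
    by_cases hxy : x = y
    · simp only [hxy, if_true, piM_smul]
      congr 1
      exact eq_of_comp (fun ε => by simp [phi_piM]) fun ε => by simp [psi_piM]; simp [psi]
    · simp [hxy, piM_zero]
  have hK0 : ∀ x ∈ L, ∀ y ∈ L, ¬ g.Rel x y → K x y = 0 := by
    intro x hx y hy hxy
    rw [hK, Pi.add_apply, Pi.add_apply, hH.2.2.2 x hx y hy fun h => hxy (sameBlock_iff.1 h), diagMat,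
      if_neg (by rintro rfl; exact hxy (Lev.Rel.refl x)), zero_add]
  rw [lmul_eq_sum (g.blk a) hA fun e he hn => by
      rw [hK0 a ha e he fun h => hn (hg.mem_blk.2 h), zero_mul],
    lmul_eq_sum (g.blk b) hB fun e he hn => by
      rw [jmul, hK0 e he b hb fun h => hn (hg.mem_blk.2 h.symm), mul_zero, mul_zero]]
  have hI := Complex.I_mul_I
  refine eq_of_comp (fun ε => ?_) fun ε => ?_
  · have e1 : phi ε (∑ e ∈ g.blk a, K a e * jmul (ofKer s u w) e b) = ((ε : ℤ) : ℂ) * Complex.I *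
        ∑ e ∈ g.blk a, phi ε (K a e) * phi ε (ofKer s u w e b) := by
      rw [phi_sum, Finset.mul_sum]
      exact Finset.sum_congr rfl fun e he => phi_mul_J_mul ε (hpi a ha e (hA e he)) _
    have e2 : phi ε (∑ e ∈ g.blk b, ofKer s u w a e * jmul K e b) = ((ε : ℤ) : ℂ) * Complex.I *
        ∑ e ∈ g.blk b, phi ε (ofKer s u w a e) * phi ε (K e b) := by
      rw [phi_sum, Finset.mul_sum]
      exact Finset.sum_congr rfl fun e he => phi_mul_J_mul' ε (hpi e (hB e he) b hb) _
    rw [phi_sub, phi_sub, phi_add, phi_smul, e1, e2]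
    rcases Int.units_eq_one_or ε with rfl | rfl
    · simp only [ofKer, phi_ofComp, hq1, Units.val_one, Int.cast_one, one_mul]
      linear_combination Complex.I * hs1 + (-phi 1 (F a b) + phi 1 (H' a b)) * hI
    · have e3 : ∑ e ∈ g.blk a, phi (-1) (K a e) * s b e = ∑ e ∈ g.blk a, s b e * q e a :=
        Finset.sum_congr rfl fun e he => by rw [hq2 a ha e (hA e he), mul_comm]
      have e4 : ∑ e ∈ g.blk b, s e a * phi (-1) (K e b) = ∑ e ∈ g.blk b, q b e * s e a :=
        Finset.sum_congr rfl fun e he => by rw [hq2 e (hB e he) b hb, mul_comm]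
      simp only [ofKer, phi_ofComp, e3, e4]
      rw [hFs, hHs, phi_transpose, phi_transpose, neg_neg]
      push_cast
      linear_combination Complex.I * hs2 + (-phi 1 (F b a) + phi 1 (H' b a)) * hI
  · have e1 : psi ε (∑ e ∈ g.blk a, K a e * jmul (ofKer s u w) e b) = ((ε : ℤ) : ℂ) * Complex.I *
        ∑ e ∈ g.blk a, phi ε (K a e) * psi ε (ofKer s u w e b) := by
      rw [psi_sum, Finset.mul_sum]
      exact Finset.sum_congr rfl fun e he => psi_mul_J_mul ε (hpi a ha e (hA e he)) _
    have e2 : psi ε (∑ e ∈ g.blk b, ofKer s u w a e * jmul K e b) = -(((ε : ℤ) : ℂ) * Complex.I *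
        ∑ e ∈ g.blk b, psi ε (ofKer s u w a e) * phi (-ε) (K e b)) := by
      rw [psi_sum, Finset.mul_sum, ← Finset.sum_neg_distrib]
      exact Finset.sum_congr rfl fun e he => psi_mul_J_mul' ε (hpi e (hB e he) b hb) _
    rw [psi_sub, psi_sub, psi_add, psi_smul, e1, e2, hpsi]
    rcases Int.units_eq_one_or ε with rfl | rfl
    · have e4 : ∑ e ∈ g.blk b, u a e * phi (-1) (K e b) = ∑ e ∈ g.blk b, u a e * tr q e b :=
        Finset.sum_congr rfl fun e he => by rw [hq2 e (hB e he) b hb, tr]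
      simp only [ofKer, psi_ofComp, hq1, e4, Units.val_one, Int.cast_one, one_mul]
      linear_combination Complex.I * hu' - psi 1 (F a b) * hI
    · have e3 : ∑ e ∈ g.blk a, phi (-1) (K a e) * w e b = ∑ e ∈ g.blk a, tr q a e * w e b :=
        Finset.sum_congr rfl fun e he => by rw [hq2 a ha e (hA e he), tr]
      have e5 : ∑ e ∈ g.blk b, w a e * (tr (tr (qKer Ω H)) + lsq : Ker d) e b
          = ∑ e ∈ g.blk b, w a e * q e b := rfl
      rw [e5] at hw'
      simp only [ofKer, psi_ofComp, neg_neg, hq1, e3]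
      push_cast at hw' ⊢
      linear_combination -Complex.I * hw' - psi (-1) (F a b) * hI

end Equation

/-! ### Existence of the solution -/

section Existence

variable {d n : ℕ} {g : Lev d} {X : Set (Par n)} {κ : ℝ} {Q : Par n → Ker d}
  {Ql : Fin n → Par n → Ker d} {θ : Par n → ℝ} {f : Par n → Ker d} {fl : Fin n → Par n → Ker d}

lemma sylv_const_eq (A B : Finset (Lat d)) (η : ℝ) (P N s : Ker d) (a b : Lat d) :
    sylv A B (fun _ _ => (η : ℂ)) P N s a b = η * s a b + lprod A P s a b + rprod B s N a b := rfl

lemma exists_solFamily (hg : g.Good) (hκ : 0 < κ) {η : Fin n → ℝ}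
    (hθ : WhitneyC1 X θ fun l _ => η l)
    (hQ : ∀ a ∈ g.L, ∀ b ∈ g.L, WhitneyC1 X (fun ω => Q ω a b) fun l ω => Ql l ω a b)
    (hf : ∀ a ∈ g.L, ∀ b ∈ g.L, WhitneyC1 X (fun ω => f ω a b) fun l ω => fl l ω a b)
    (hLB : ∀ ω ∈ X, g.LBall (θ ω) (Q ω) κ) :
    ∃ (s : Par n → Ker d) (r : Fin n → Par n → Ker d), (∀ ω ∈ X, g.IsSol (θ ω) (Q ω) (f ω) (s ω)) ∧
      (∀ ω ∈ X, ∀ l, g.IsSol (θ ω) (Q ω) (g.dRhs (η l) (Ql l ω) (fl l ω) (s ω)) (r l ω)) ∧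
      ∀ a ∈ g.L, ∀ b ∈ g.L, WhitneyC1 X (fun ω => s ω a b) fun l ω => r l ω a b := by
  choose! s hs using fun ω hω => Lev.exists_isSol hg hκ (hLB ω hω) (f ω)
  choose! r hr using fun (l : Fin n) ω hω =>
    Lev.exists_isSol hg hκ (hLB ω hω) (g.dRhs (η l) (Ql l ω) (fl l ω) (s ω))
  refine ⟨s, r, hs, fun ω hω l => hr l ω hω, fun a ha b hb => ?_⟩
  by_cases hab : g.Act a b
  · have hA : ∀ x ∈ g.blk a, x ∈ g.L := fun x hx => Lev.mem_of_blk hg ha hx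
    have hB : ∀ x ∈ g.blk b, x ∈ g.L := fun x hx => Lev.mem_of_blk hg hb hx
    refine whitneyC1_sol (z := fun ω => energy (θ ω)) (zl := fun l _ _ _ => (η l : ℂ))
      (M := Q) (Ml := Ql) (N := fun ω => -Q ω) (Nl := fun l ω => -Ql l ω) hκ
      (fun x _ y _ => ?_) (fun x hx y hy => hQ x (hA x hx) y (hA y hy))
      (fun x hx y hy => (hQ x (hB x hx) y (hB y hy)).neg)
      (fun x hx y hy => hf x (hA x hx) y (hB y hy)) (fun ω hω => hLB ω hω a b hab)
      (fun ω hω => (hs ω hω).eq_on hg hab) (fun ω hω l x hx y hy => ?_)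
      a (hg.self_mem_blk a) b (hg.self_mem_blk b)
    · exact (hθ.ofReal.add (whitneyC1_const (((x ⬝ᵥ x - y ⬝ᵥ y : ℤ) : ℂ)))).congr
        (fun _ _ => rfl) fun _ _ _ => (add_zero _).symm
    · rw [(hr l ω hω).eq_on hg hab x hx y hy, sylv_const_eq]
      simp only [Lev.dRhs, Lev.comm, Pi.sub_apply, Pi.smul_apply, smul_eq_mul,
        Lev.blk_of_mem hg hx, Lev.blk_of_mem hg hy]
      have : rprod (g.blk b) (s ω) (-Ql l ω) x y = -rprod (g.blk b) (s ω) (Ql l ω) x y := by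
        simp [rprod]
      rw [this]
      ring
  · exact (whitneyC1_const (0 : ℂ)).congr (fun ω hω => (hs ω hω).zero a b hab)
      fun ω hω l => (hr l ω hω).zero a b hab

lemma exists_solFamilyP (hg : g.Good) (hκ : 0 < κ) {η : Fin n → ℝ}
    (hθ : WhitneyC1 X θ fun l _ => η l)
    (hQ : ∀ a ∈ g.L, ∀ b ∈ g.L, WhitneyC1 X (fun ω => Q ω a b) fun l ω => Ql l ω a b)
    (hf : ∀ a ∈ g.L, ∀ b ∈ g.L, WhitneyC1 X (fun ω => f ω a b) fun l ω => fl l ω a b)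
    (hLB : ∀ ω ∈ X, g.LBallP (θ ω) (Q ω) κ) :
    ∃ (s : Par n → Ker d) (r : Fin n → Par n → Ker d), (∀ ω ∈ X, g.IsSolP (θ ω) (Q ω) (f ω) (s ω)) ∧
      (∀ ω ∈ X, ∀ l, g.IsSolP (θ ω) (Q ω) (g.dRhsP (η l) (Ql l ω) (fl l ω) (s ω)) (r l ω)) ∧
      ∀ a ∈ g.L, ∀ b ∈ g.L, WhitneyC1 X (fun ω => s ω a b) fun l ω => r l ω a b := by
  choose! s hs using fun ω hω => Lev.exists_isSolP hg hκ (hLB ω hω) (f ω)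
  choose! r hr using fun (l : Fin n) ω hω =>
    Lev.exists_isSolP hg hκ (hLB ω hω) (g.dRhsP (η l) (Ql l ω) (fl l ω) (s ω))
  refine ⟨s, r, hs, fun ω hω l => hr l ω hω, fun a ha b hb => ?_⟩
  have hA : ∀ x ∈ g.blk a, x ∈ g.L := fun x hx => Lev.mem_of_blk hg ha hx
  have hB : ∀ x ∈ g.blk b, x ∈ g.L := fun x hx => Lev.mem_of_blk hg hb hx
  refine whitneyC1_sol (z := fun ω => energyP (θ ω)) (zl := fun l _ _ _ => (η l : ℂ))
    (M := Q) (Ml := Ql) (N := fun ω => tr (Q ω)) (Nl := fun l ω => tr (Ql l ω)) hκ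
    (fun x _ y _ => ?_) (fun x hx y hy => hQ x (hA x hx) y (hA y hy))
    (fun x hx y hy => hQ y (hB y hy) x (hB x hx))
    (fun x hx y hy => hf x (hA x hx) y (hB y hy)) (fun ω hω => hLB ω hω a ha b hb)
    (fun ω hω => (hs ω hω).eq_on hg ha hb) (fun ω hω l x hx y hy => ?_)
    a (hg.self_mem_blk a) b (hg.self_mem_blk b)
  · exact (hθ.ofReal.add (whitneyC1_const (((x ⬝ᵥ x + y ⬝ᵥ y : ℤ) : ℂ)))).congr
      (fun _ _ => rfl) fun _ _ _ => (add_zero _).symm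
  · rw [(hr l ω hω).eq_on hg ha hb x hx y hy, sylv_const_eq]
    simp only [Lev.dRhsP, Lev.acomm, Pi.sub_apply, Pi.smul_apply, smul_eq_mul,
      Lev.blk_of_mem hg hx, Lev.blk_of_mem hg hy]
    ring

lemma matC1_ofKer {L : Set (Lat d)} {s u w : Par n → Ker d} {r ru rw : Fin n → Par n → Ker d}
    (hs : ∀ a ∈ L, ∀ b ∈ L, WhitneyC1 X (fun ω => s ω a b) fun l ω => r l ω a b)
    (hu : ∀ a ∈ L, ∀ b ∈ L, WhitneyC1 X (fun ω => u ω a b) fun l ω => ru l ω a b)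
    (hw : ∀ a ∈ L, ∀ b ∈ L, WhitneyC1 X (fun ω => w ω a b) fun l ω => rw l ω a b) :
    MatC1 L X (fun ω => ofKer (s ω) (u ω) (w ω)) fun l ω => ofKer (r l ω) (ru l ω) (rw l ω) := by
  intro a ha b hb i j
  have key : ∀ c₁ c₂ c₃ c₄ : ℂ, WhitneyC1 X
      (fun ω => c₁ * s ω a b + c₂ * s ω b a + (c₃ * u ω a b + c₄ * w ω a b))
      fun l ω => c₁ * r l ω a b + c₂ * r l ω b a + (c₃ * ru l ω a b + c₄ * rw l ω a b) :=
    fun c₁ c₂ c₃ c₄ => (((hs a ha b hb).const_mul c₁).add ((hs b hb a ha).const_mul c₂)).add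
      (((hu a ha b hb).const_mul c₃).add ((hw a ha b hb).const_mul c₄))
  have hI := Complex.I
  fin_cases i <;> fin_cases j
  · refine (key (1 / 2) (1 / 2) (-Complex.I / 2) (Complex.I / 2)).congr (fun _ _ => ?_)
      fun _ _ _ => ?_ <;> simp [ofKer, ofComp] <;> ring
  · refine (key (-Complex.I / 2) (Complex.I / 2) (1 / 2) (1 / 2)).congr (fun _ _ => ?_)
      fun _ _ _ => ?_ <;> simp [ofKer, ofComp] <;> ring
  · refine (key (Complex.I / 2) (-Complex.I / 2) (1 / 2) (1 / 2)).congr (fun _ _ => ?_)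
      fun _ _ _ => ?_ <;> simp [ofKer, ofComp] <;> ring
  · refine (key (1 / 2) (1 / 2) (Complex.I / 2) (-Complex.I / 2)).congr (fun _ _ => ?_)
      fun _ _ _ => ?_ <;> simp [ofKer, ofComp] <;> ring

end Existence

/-! ### The resonant part -/

section Resonant

variable {d n : ℕ} {L : Set (Lat d)} {Δ' : ℝ}
variable {F : LMat d} {c : Lat d} {m : ℕ} {g : Lev d} {S γ : ℝ}

/-- The part of `π F` on pairs with `|a| = |b|` and `a - b` orthogonal to `C`. -/
def cut (C : List (Lat d)) (F : LMat d) : LMat d := fun a b =>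
  open Classical in if len a = len b ∧ ∀ c ∈ C, (a - b) ⬝ᵥ c = 0 then piM (F a b) else 0

lemma eventually_mem (hL : Lᶜ.Finite) (a : Lat d) (hc : c ≠ 0) :
    ∀ᶠ t : ℕ in atTop, a + (t : ℤ) • c ∈ L := by
  obtain ⟨ρ, -, hρ⟩ := exists_radius hL
  exact ((Lev.tendsto_len_shift a hc).eventually_ge_atTop ρ).mono fun t ht => hρ _ ht

lemma IsTruncated.tlim (hL : Lᶜ.Finite) (hF : IsTopl (m + 1) F)
    (h : IsTruncated L Δ' F) (hc : c ≠ 0) :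
    IsTruncated L Δ' (ToplitzLipschitz.tlim 1 c F) := by
  intro a _ b _ hab
  have h1 := (continuous_piM.tendsto _).comp (hF.tendsto 1 c a b)
  refine tendsto_nhds_unique h1 (tendsto_const_nhds.congr' ?_)
  filter_upwards [eventually_mem hL a hc, eventually_mem hL b hc] with t ha hb
  simp only [Function.comp, ray, Units.val_one, one_mul]
  exact (h _ ha _ hb (by rwa [add_sub_add_right_eq_sub])).symm

lemma tendsto_ray_cut (hF : IsTopl (m + 1) F)
    (hc : c ≠ 0) (C : List (Lat d)) (a b : Lat d) :
    Tendsto (ray 1 c (cut C F) a b) atTop (𝓝 (cut (c :: C) (tlim 1 c F) a b)) := by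
  have h1 := (continuous_piM.tendsto _).comp (hF.tendsto 1 c a b)
  have hsub : ∀ t : ℕ, a + (t : ℤ) • c - (b + (t : ℤ) • c) = a - b := fun t =>
    add_sub_add_right_eq_sub _ _ _
  by_cases horth : (a - b) ⬝ᵥ c = 0
  · have hiff : ∀ t : ℕ, (len (a + (t : ℤ) • c) = len (b + (t : ℤ) • c) ↔ len a = len b) := fun t =>
      Lev.len_shift_iff (by rw [dotProduct_smul, horth, smul_zero])
    by_cases hcond : len a = len b ∧ ∀ e ∈ C, (a - b) ⬝ᵥ e = 0
    · have e1 : cut (c :: C) (tlim 1 c F) a b = piM (tlim 1 c F a b) :=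
        if_pos ⟨hcond.1, fun e he => by
          rcases List.mem_cons.1 he with rfl | he
          exacts [horth, hcond.2 e he]⟩
      rw [e1]
      refine h1.congr fun t => ?_
      simp only [Function.comp, ray, cut, Units.val_one, one_mul, hiff, hsub, if_pos hcond]
    · have e1 : cut (c :: C) (tlim 1 c F) a b = 0 :=
        if_neg fun h => hcond ⟨h.1, fun e he => h.2 e (List.mem_cons_of_mem c he)⟩
      rw [e1]
      refine tendsto_const_nhds.congr fun t => ?_
      simp only [ray, cut, Units.val_one, one_mul, hiff, hsub, if_neg hcond]
  · have e1 : cut (c :: C) (tlim 1 c F) a b = 0 :=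
      if_neg fun h => horth (h.2 c List.mem_cons_self)
    rw [e1]
    refine tendsto_const_nhds.congr' ?_
    filter_upwards [eventually_gt_atTop (a ⬝ᵥ a - b ⬝ᵥ b).natAbs] with t ht
    refine (if_neg fun h => ?_).symm
    have h2 := len_eq_iff.1 h.1
    have h3 := Lev.sq_sub_shift a b ((t : ℤ) • c)
    simp only [Units.val_one, one_mul] at h2
    rw [h2, sub_self, dotProduct_smul, smul_eq_mul] at h3
    have h4 : 1 ≤ |(a - b) ⬝ᵥ c| := Int.one_le_abs horth
    have h5 : |a ⬝ᵥ a - b ⬝ᵥ b| = 2 * t * |(a - b) ⬝ᵥ c| := by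
      have : a ⬝ᵥ a - b ⬝ᵥ b = -(2 * t * ((a - b) ⬝ᵥ c)) := by linarith
      rw [this, abs_neg, abs_mul, abs_of_nonneg (by positivity)]
    have h6 : ((a ⬝ᵥ a - b ⬝ᵥ b).natAbs : ℤ) = |a ⬝ᵥ a - b ⬝ᵥ b| := Int.natCast_natAbs _
    have h7 : ((a ⬝ᵥ a - b ⬝ᵥ b).natAbs : ℤ) < t := by exact_mod_cast ht
    nlinarith

lemma tendsto_ray_neg_cut (hL : Lᶜ.Finite) (h : IsTruncated L Δ' F)
    (hc : c ≠ 0) (C : List (Lat d)) (a b : Lat d) :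
    Tendsto (ray (-1) c (cut C F) a b) atTop (𝓝 ((0 : LMat d) a b)) := by
  refine tendsto_const_nhds.congr' ?_
  have h2 : ((2 : ℤ) • c) ≠ 0 := smul_ne_zero two_ne_zero hc
  filter_upwards [eventually_mem hL a hc, eventually_mem hL b (neg_ne_zero.2 hc),
    (Lev.tendsto_len_shift (a - b) h2).eventually_gt_atTop Δ'] with t ha hb ht
  have e1 : b + (((-1 : ℤˣ) : ℤ) * (t : ℤ)) • c = b + (t : ℤ) • -c := by simp
  have e2 : a + (t : ℤ) • c - (b + (t : ℤ) • -c) = a - b + (t : ℤ) • ((2 : ℤ) • c) := by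
    rw [smul_neg, two_smul, smul_add]; abel
  simp only [ray, cut, e1, h _ ha _ hb (by rwa [e2]), ite_self]
  rfl

lemma isTopl_zero (m : ℕ) : IsTopl m (0 : LMat d) := by
  rw [← ofKer_zero]
  exact PtReg.isTopl (p := True) (γ := 0) (S := 0) (L := Set.univ) le_rfl m
    (PtReg.zero _ _ _ _ le_rfl _ _) (AntiReg.zero _ _ _ _ le_rfl _) (AntiReg.zero _ _ _ _ le_rfl _)

lemma iterNorm_zero (L : Set (Lat d)) (S γ : ℝ) (m : ℕ) : iterNorm L S γ m 0 = 0 := by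
  rw [← ofKer_zero]
  refine le_antisymm ((iterNorm_ofKer_le le_rfl m (PtReg.zero _ _ _ _ le_rfl _ _)
    (AntiReg.zero _ _ _ _ le_rfl _) (AntiReg.zero _ _ _ _ le_rfl _)).trans ?_) bot_le
  simp

lemma IsTopl.cut (hL : Lᶜ.Finite) : ∀ {m : ℕ} {F : LMat d} (C : List (Lat d)),
    IsTopl m F → IsTruncated L Δ' F → IsTopl m (ToplitzLipschitz.cut C F)
  | 0, _, _, _, _ => trivial
  | m + 1, F, C, hF, hT => by
    have key : ∀ (σ : ℤˣ) (c : Lat d), ∃ A', (∀ a b, Tendsto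
        (ray σ c (ToplitzLipschitz.cut C F) a b) atTop (𝓝 (A' a b))) ∧ IsTopl m A' := by
      intro σ c
      by_cases hc : c = 0
      · subst hc
        have h0 := hF.2 1 0
        rw [tlim_zero_dir] at h0
        exact ⟨_, tendsto_ray_zero σ _, IsTopl.cut hL C h0 hT⟩
      rcases Int.units_eq_one_or σ with rfl | rfl
      · exact ⟨_, tendsto_ray_cut hF hc C, IsTopl.cut hL _ (hF.2 1 c) (hT.tlim hL hF hc)⟩
      · exact ⟨0, tendsto_ray_neg_cut hL hT hc C, isTopl_zero m⟩
    refine ⟨fun σ c a b => ?_, fun σ c => ?_⟩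
    · obtain ⟨A', h, -⟩ := key σ c
      exact ⟨_, h a b⟩
    · obtain ⟨A', h, h'⟩ := key σ c
      rwa [tlim_eq h]

lemma part_one_cut (C : List (Lat d)) (F : LMat d) : part 1 (cut C F) = cut C F := by
  funext a b
  rw [part_one_apply, cut]
  split_ifs
  exacts [piM_piM _, piM_zero]

lemma part_neg_cut (C : List (Lat d)) (F : LMat d) : part (-1) (cut C F) = 0 := by
  have h := part_one_cut C F
  funext a b
  have h' := congrFun (congrFun h a) b
  rw [part_one_apply] at h'
  rw [part_neg_apply, h', sub_self]
  rfl

lemma absNorm_zero : absNorm 0 = 0 := by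
  have h := absNorm_piM_le 0
  rw [piM_zero, phi_zero, phi_zero, norm_zero, add_zero] at h
  exact le_antisymm h (absNorm_nonneg _)

lemma lipNorm_cut_le (hg : g.Good) (hL : Lᶜ.Finite) (hS : g.Radius S)
    (C : List (Lat d)) (hF : IsTopl (m + 1) F) (hT : IsTruncated L g.Δ' F) :
    lipNorm L S γ (cut C F) ≤ lipNorm L S γ F := by
  unfold lipNorm decayNorm
  have hz : ∀ σ, decaySup L γ σ (0 : LMat d) = 0 ∧ lipConst L S γ σ (0 : LMat d) = 0 := fun σ => by
    have ht : ∀ c, tlim σ c (0 : LMat d) = 0 := fun c => tlim_eq fun a b => tendsto_const_nhds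
    simp [decaySup, lipConst, ht, absNorm_zero]
  have hm : ∀ x : ℝ≥0∞, max x 0 = x := fun x => max_eq_left bot_le
  rw [part_one_cut, part_neg_cut, (hz _).1, (hz _).2, hm, hm]
  refine add_le_add (le_max_of_le_left ?_) (le_max_of_le_left ?_)
  · refine iSup_mono fun c => iSup_mono fun hc => iSup₂_mono fun a ha => iSup₂_mono fun b hb =>
      iSup_mono fun hdom => ENNReal.ofReal_le_ofReal (mul_le_mul_of_nonneg_left ?_ ?_)
    swap
    · exact mul_nonneg (Real.exp_pos _).le ((wt_pos c a b).le)
    rw [tlim_eq (tendsto_ray_cut hF hc C), tlim_eq (tendsto_part_ray (τ := 1)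
      fun a b => hF.tendsto 1 c a b), part_one_apply, part_one_apply, cut, cut]
    by_cases hcond : len a = len b ∧ ∀ e ∈ C, (a - b) ⬝ᵥ e = 0
    swap
    · rw [if_neg hcond, if_neg fun h => hcond ⟨h.1, fun e he => h.2 e (List.mem_cons_of_mem c he)⟩,
        sub_self, absNorm_zero]
      exact absNorm_nonneg _
    by_cases hab : g.Δ' < len (a - b)
    · rw [hT a ha b hb hab, hT.tlim hL hF hc a ha b hb hab]
      simp
    have horth : (a - b) ⬝ᵥ c = 0 := by
      by_contra hne
      have hdom' : LipDomPos S c a b := by simpa [LipDom] using hdom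
      have h1 := (Lev.energy_large hg hdom' hc hS.big (by linarith [hg.hD]) hne).1
      rw [len_eq_iff.1 hcond.1, sub_self, Int.cast_zero, abs_zero] at h1
      linarith [one_le_wt c a b]
    rw [if_pos hcond, if_pos ⟨hcond.1, fun e he => by
          rcases List.mem_cons.1 he with rfl | he
          exacts [horth, hcond.2 e he]⟩]
  · refine iSup₂_mono fun a _ => iSup₂_mono fun b _ => ENNReal.ofReal_le_ofReal
      (mul_le_mul_of_nonneg_left ?_ (Real.exp_pos _).le)
    rw [part_one_apply, cut]
    split_ifs
    · exact le_rfl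
    · rw [absNorm_zero]; exact absNorm_nonneg _

lemma iterNorm_cut_le (hg : g.Good) (hL : Lᶜ.Finite) (hS : g.Radius S) :
    ∀ {m : ℕ} {F : LMat d} (C : List (Lat d)), IsTopl (m + 1) F → IsTruncated L g.Δ' F →
      iterNorm L S γ m (cut C F) ≤ iterNorm L S γ m F
  | 0, _, C, hF, hT => lipNorm_cut_le hg hL hS C hF hT
  | m + 1, F, C, hF, hT => by
    refine iSup_mono fun c => iSup_mono fun σ => ?_
    by_cases hc : c = 0
    · subst hc
      have h0 := hF.2 1 0
      rw [tlim_zero_dir] at h0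
      rw [tlim_zero_dir, tlim_zero_dir]
      exact iterNorm_cut_le hg hL hS C h0 hT
    rcases Int.units_eq_one_or σ with rfl | rfl
    · rw [tlim_eq (tendsto_ray_cut hF hc C)]
      exact iterNorm_cut_le hg hL hS _ (hF.2 1 c) (hT.tlim hL hF hc)
    · rw [tlim_eq (tendsto_ray_neg_cut hL hT hc C), iterNorm_zero]
      exact bot_le

lemma dirDeriv_cut (v : Par n) (C : List (Lat d)) (DF : Fin n → LMat d) :
    dirDeriv v (fun l => cut C (DF l)) = cut C (dirDeriv v DF) := by
  funext a b
  by_cases h : len a = len b ∧ ∀ c ∈ C, (a - b) ⬝ᵥ c = 0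
  · simp only [cut, dirDeriv, if_pos h, piM_sum, piM_smul]
  · simp only [cut, dirDeriv, if_neg h, smul_zero, Finset.sum_const_zero]

lemma IsSymm.cut (hF : IsSymm L F) (C : List (Lat d)) :
    IsSymm L (ToplitzLipschitz.cut C F) := by
  intro a ha b hb
  have e : (len a = len b ∧ ∀ c ∈ C, (a - b) ⬝ᵥ c = 0) ↔
      (len b = len a ∧ ∀ c ∈ C, (b - a) ⬝ᵥ c = 0) := by
    refine and_congr eq_comm (forall₂_congr fun c _ => ?_)
    rw [← neg_sub, neg_dotProduct, neg_eq_zero]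
  simp only [ToplitzLipschitz.cut, e]
  split_ifs
  · rw [hF a ha b hb, piM_transpose]
  · simp

lemma IsTruncated.isBlockDiag_cut (hF : IsTruncated L Δ' F) (C : List (Lat d)) :
    IsBlockDiag L Δ' (cut C F) := by
  intro a ha b hb hab
  rw [cut]
  split_ifs with h
  · refine hF a ha b hb (not_le.1 fun hle => hab (Relation.EqvGen.rel _ _ ⟨ha, hb, h.1, hle⟩))
  · rfl

lemma isNormalForm_cut (hF : IsTruncated L Δ' F) (hs : IsSymm L F) (hr : IsReal L F)
    (C : List (Lat d)) : IsNormalForm L Δ' (cut C F) := by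
  refine ⟨fun a ha b hb i j => ?_, hs.cut C, fun a _ b _ => ?_, hF.isBlockDiag_cut C⟩
  · rw [cut]
    split_ifs
    · rw [piM_apply]
      have h := hr a ha b hb
      fin_cases i <;> fin_cases j <;> simp [h]
    · simp
  · exact (part_one_apply _ a b).symm.trans (by rw [part_one_cut])

lemma matC1_cut {X : Set (Par n)} {F : Par n → LMat d} {DF : Fin n → Par n → LMat d}
    (h : MatC1 L X F DF) (C : List (Lat d)) :
    MatC1 L X (fun ω => cut C (F ω)) fun l ω => cut C (DF l ω) := by
  intro a ha b hb i j
  by_cases hc : len a = len b ∧ ∀ c ∈ C, (a - b) ⬝ᵥ c = 0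
  swap
  · exact (whitneyC1_const (0 : ℂ)).congr (fun _ _ => by simp only [cut, if_neg hc]; rfl)
      fun _ _ _ => by simp only [cut, if_neg hc]; rfl
  have hF := h a ha b hb
  simp only [cut, if_pos hc, piM_apply]
  have h1 := ((hF 0 0).add (hF 1 1)).const_mul (1 / 2)
  have h2 := ((hF 0 1).sub (hF 1 0)).const_mul (1 / 2)
  have h3 := ((hF 0 1).sub (hF 1 0)).const_mul (-1 / 2)
  fin_cases i <;> fin_cases j
  exacts [h1.congr (fun _ _ => by simp; ring) fun _ _ _ => by simp; ring,
    h2.congr (fun _ _ => by simp; ring) fun _ _ _ => by simp; ring,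
    h3.congr (fun _ _ => by simp; ring) fun _ _ _ => by simp; ring,
    h1.congr (fun _ _ => by simp; ring) fun _ _ _ => by simp; ring]

end Resonant

/-! ### The forcing terms and the solution at a parameter -/

section Forcing

variable {d n : ℕ} {L : Set (Lat d)} {Q s u w : Ker d}

/-- The forcing term of the equation for `π S`. -/
def forceS (A : LMat d) : Ker d := fun a b => -Complex.I * phi 1 (A a b)

/-- The forcing terms of the equations for the two components of `(1 - π) S`. -/
def forceP (ε : ℤˣ) (A : LMat d) : Ker d := fun a b => (-(ε : ℤ) : ℂ) * Complex.I * psi ε (A a b)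

lemma forceS_dirDeriv (v : Par n) (DA : Fin n → LMat d) :
    ∑ l, ((v l : ℝ) : ℂ) • forceS (DA l) = forceS (dirDeriv v DA) := by
  funext a b
  simp only [forceS, phi_dirDeriv, Finset.sum_apply, Pi.smul_apply, smul_eq_mul, Finset.mul_sum,
    mul_left_comm]

lemma forceP_dirDeriv (ε : ℤˣ) (v : Par n) (DA : Fin n → LMat d) :
    ∑ l, ((v l : ℝ) : ℂ) • forceP ε (DA l) = forceP ε (dirDeriv v DA) := by
  funext a b
  simp only [forceP, psi_dirDeriv, Finset.sum_apply, Pi.smul_apply, smul_eq_mul, Finset.mul_sum]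
  exact Finset.sum_congr rfl fun l _ => mul_left_comm _ _ _

lemma MatC1.whitney_force {X : Set (Par n)} {F : Par n → LMat d}
    {DF : Fin n → Par n → LMat d} (h : MatC1 L X F DF) {a b : Lat d} (ha : a ∈ L) (hb : b ∈ L) :
    WhitneyC1 X (fun ω => forceS (F ω) a b) (fun l ω => forceS (DF l ω) a b) ∧
    ∀ ε, WhitneyC1 X (fun ω => forceP ε (F ω) a b) fun l ω => forceP ε (DF l ω) a b := by
  have hF := h a ha b hb
  refine ⟨?_, fun ε => ?_⟩
  · refine ((((hF 0 0).add (hF 1 1)).const_mul (-Complex.I / 2)).add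
      (((hF 0 1).sub (hF 1 0)).const_mul (1 / 2))).congr (fun _ _ => ?_) fun _ _ _ => ?_ <;>
    · simp only [forceS, phi, Units.val_one, Int.cast_one]
      ring_nf
      simp only [Complex.I_sq]
      ring
  · refine ((((hF 0 1).add (hF 1 0)).const_mul ((-(ε : ℤ) : ℂ) * Complex.I / 2)).add
      (((hF 0 0).sub (hF 1 1)).const_mul ((-(ε : ℤ) : ℂ) * Complex.I * (ε : ℤ) * Complex.I / 2))).congr
      (fun _ _ => ?_) fun _ _ _ => ?_ <;> simp only [forceP, psi] <;> ring

lemma PtReg.unit_mul {p : Prop} {γ S M : ℝ} {z : ℂ} (hz : ‖z‖ = 1) {m : ℕ}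
    (h : PtReg p γ S M m L s) : PtReg p γ S M m L fun a b => z * s a b := by
  induction m generalizing L s with
  | zero => simpa only [PtReg, norm_mul, hz, one_mul] using h
  | succ m ih =>
    refine ⟨by simpa only [norm_mul, hz, one_mul] using h.1, fun c hc a b => ?_, fun c hc => ?_⟩
    · simpa using (h.2.1 c hc a b).const_mul z
    · obtain ⟨s', h1, h2, h3⟩ := h.2.2 c hc
      refine ⟨fun a b => z * s' a b, fun a b => (h1 a b).const_mul z, ?_, ih h3⟩
      simpa only [← mul_sub, norm_mul, hz, one_mul] using h2

lemma norm_neg_unit_mul_I (ε : ℤˣ) : ‖(-(ε : ℤ) : ℂ) * Complex.I‖ = 1 := by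
  rw [norm_mul, norm_neg, norm_eps, Complex.norm_I, one_mul]

variable {g : Lev d} {p : Prop} {γ S M : ℝ} {m : ℕ} {A : LMat d}

lemma rayBdd_forceP (hg : g.Good) (hA : IsTopl (m + 1) A) (ε : ℤˣ) : g.RayBdd (forceP ε A) :=
  Lev.rayBdd_of_lim hg fun σ c _ a b => ⟨_, ((((continuous_psi ε).tendsto _).comp
    (hA.tendsto σ c a b)).const_mul _)⟩

lemma ptReg_forceS (hg : g.Good) (hS : g.Radius S) (hM : 0 ≤ M) (hA : IsTopl (m + 1) A)
    (hn : p → iterNorm g.L S γ m A ≤ ENNReal.ofReal M) (hT : IsTruncated g.L g.Δ' A) :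
    PtReg p γ S M (m + 1) g.L (forceS A) :=
  (ptReg_phi hM hg.hL (fun _ => ⟨hS.rho, le_trans (by nlinarith [hg.hD, hg.hΔ']) hS.big⟩) m
    (Or.inl rfl) hA hn hT 1).unit_mul (by rw [norm_neg, Complex.norm_I])

lemma norm_forceP_le (hM : 0 ≤ M) (hn : p → iterNorm g.L S γ m A ≤ ENNReal.ofReal M) (ε : ℤˣ)
    (hp : p) : ∀ a ∈ g.L, ∀ b ∈ g.L, ‖forceP ε A a b‖ ≤ M * Real.exp (-γ * len (a + b)) :=
  fun a ha b hb => by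
    rw [forceP, norm_mul, norm_neg_unit_mul_I, one_mul]
    exact norm_psi_le_of_iterNorm hM (hn hp) ε ha hb

/-- `s, u, w` solve the equations for the components of `S`, and `r, ru, rw` the differentiated
equations. -/
structure SolAt (g : Lev d) (θ : ℝ) (η : Fin n → ℝ) (Q : Ker d) (Ql : Fin n → Ker d) (F : LMat d)
    (DF : Fin n → LMat d) (s u w : Ker d) (r ru rw : Fin n → Ker d) : Prop where
  solS : g.IsSol θ Q (forceS F) s
  solU : g.IsSolP θ Q (forceP 1 F) u
  solW : g.IsSolP (-θ) (tr Q) (forceP (-1) F) w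
  derS : ∀ l, g.IsSol θ Q (g.dRhs (η l) (Ql l) (forceS (DF l)) s) (r l)
  derU : ∀ l, g.IsSolP θ Q (g.dRhsP (η l) (Ql l) (forceP 1 (DF l)) u) (ru l)
  derW : ∀ l, g.IsSolP (-θ) (tr Q) (g.dRhsP (-η l) (tr (Ql l)) (forceP (-1) (DF l)) w) (rw l)

/-- The regularity of the components of `S`. -/
def KerReg (p : Prop) (γ S M : ℝ) (m : ℕ) (L : Set (Lat d)) (s u w : Ker d) : Prop :=
  PtReg p γ S M m L s ∧ AntiReg p γ S M L u ∧ AntiReg p γ S M L w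

lemma Lev.OpBlk.transpose {K : ℝ} (h : g.OpBlk Q K) : g.OpBlk (tr Q) K := fun a ha =>
  ⟨(h a ha).2, (h a ha).1⟩

lemma SolAt.kerReg {θ κ k K Kop : ℝ} {η : Fin n → ℝ} {Ql : Fin n → Ker d} {F : LMat d}
    {DF : Fin n → LMat d} {r ru rw : Fin n → Ker d}
    (h : SolAt g θ η Q Ql F DF s u w r ru rw) (hg : g.Good) (hS : g.Radius S) (hκ : 0 < κ)
    (hk : 1 ≤ k) (hkκ : κ ≤ k) (hγ : 0 ≤ γ) (hK : 0 ≤ K) (hKop : 0 ≤ Kop) (hM : 0 ≤ M)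
    (hθ : |θ| + 2 * Kop ≤ S + g.D + 2) (hLB : g.LBall θ Q κ) (hLBP : g.LBallP θ Q κ)
    (hLBN : g.LBallP (-θ) (tr Q) κ) {v : Par n} (hη : |∑ l, v l * η l| ≤ g.Δ')
    (hop : g.OpBlk Q Kop) (hopP : g.OpBlk (∑ l, ((v l : ℝ) : ℂ) • Ql l) Kop)
    (hQ : SReg g.ρ S K (m + 1) Q) (hP : SReg g.ρ S K (m + 1) (∑ l, ((v l : ℝ) : ℂ) • Ql l))
    (hF : IsTopl (m + 1) F) (hDF : ∀ l, IsTopl (m + 1) (DF l))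
    (hT : IsTruncated g.L g.Δ' F) (hDT : ∀ l, IsTruncated g.L g.Δ' (DF l))
    (hn : p → iterNorm g.L S γ m F ≤ ENNReal.ofReal M)
    (hDn : p → iterNorm g.L S γ m (dirDeriv v DF) ≤ ENNReal.ofReal M) :
    KerReg p γ (S + g.D + 2) (solBound k K Kop g.D g.Δ' κ γ M d) (m + 1) g.L s u w ∧
    KerReg p γ (S + g.D + 2) (solBound k K Kop g.D g.Δ' κ γ M d) (m + 1) g.L
      (∑ l, ((v l : ℝ) : ℂ) • r l) (∑ l, ((v l : ℝ) : ℂ) • ru l) (∑ l, ((v l : ℝ) : ℂ) • rw l) := by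
  have hv := IsTopl.dirDeriv v hDF
  have hTv : IsTruncated g.L g.Δ' (dirDeriv v DF) := fun a ha b hb hab => by
    rw [piM_dirDeriv]
    exact Finset.sum_eq_zero fun l _ => by rw [hDT l a ha b hb hab, smul_zero]
  have e1 := Lev.IsSol.lincomb Finset.univ (fun l => ((v l : ℝ) : ℂ)) h.derS
  have e2 := Lev.IsSolP.lincomb Finset.univ (fun l => ((v l : ℝ) : ℂ)) h.derU
  have e3 := Lev.IsSolP.lincomb Finset.univ (fun l => ((v l : ℝ) : ℂ)) h.derW
  rw [dRhs_lincomb, forceS_dirDeriv] at e1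
  rw [dRhsP_lincomb, forceP_dirDeriv] at e2 e3
  have htr : ∑ l, ((v l : ℝ) : ℂ) • tr (Ql l) = tr (∑ l, ((v l : ℝ) : ℂ) • Ql l) := by
    funext a b
    simp only [tr, Finset.sum_apply, Pi.smul_apply]
  have hη' : |∑ l, v l * -η l| ≤ g.Δ' := by
    simpa only [mul_neg, Finset.sum_neg_distrib, abs_neg] using hη
  rw [htr] at e3
  have r1 := IsSol_reg_pair hg hS hκ hk hkκ hγ hK hKop hM hθ hη hLB hop hopP hQ hP
    (ptReg_forceS hg hS hM hF hn hT) (ptReg_forceS hg hS hM hv hDn hTv) h.solS e1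
  have r2 := IsSolP_reg_pair hg hS hκ hk hkκ hγ hK hKop hM hθ hη hLBP hop hopP
    (rayBdd_forceP hg hF 1) (rayBdd_forceP hg hv 1) (norm_forceP_le hM hn 1)
    (norm_forceP_le hM hDn 1) h.solU e2
  have r3 := IsSolP_reg_pair hg hS hκ hk hkκ hγ hK hKop hM (by rwa [abs_neg]) hη' hLBN hop.transpose
    hopP.transpose (rayBdd_forceP hg hF (-1)) (rayBdd_forceP hg hv (-1)) (norm_forceP_le hM hn (-1))
    (norm_forceP_le hM hDn (-1)) h.solW e3
  exact ⟨⟨r1.1, r2.1, r3.1⟩, r1.2, r2.2, r3.2⟩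

lemma isSymm_ofKer (hu : ∀ a b, u a b = u b a)
    (hw : ∀ a b, w a b = w b a) : IsSymm L (ofKer s u w) := by
  intro a _ b _
  refine eq_of_comp (fun ε => ?_) fun ε => ?_
  · rw [phi_transpose]
    rcases Int.units_eq_one_or ε with rfl | rfl <;> simp [ofKer, phi_ofComp]
  · rw [psi_transpose]
    rcases Int.units_eq_one_or ε with rfl | rfl <;> simp [ofKer, psi_ofComp, hu a b, hw a b]

lemma IsSymm.forceP (hA : IsSymm L A) (ε : ℤˣ) :
    ∀ a ∈ L, ∀ b ∈ L, forceP ε A a b = forceP ε A b a := fun a ha b hb => by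
  rw [ToplitzLipschitz.forceP, ToplitzLipschitz.forceP, hA a ha b hb, psi_transpose]

end Forcing

/-! ### The resonant part of `F` -/

section ResPart

variable {d n : ℕ} {L : Set (Lat d)}
variable {F : LMat d} {m : ℕ}

/-- The resonant part of `F`, which vanishes unless `k = 0`. -/
def resPart (k : Lat n) (F : LMat d) : LMat d :=
  open Classical in if k = 0 then cut [] F else 0

lemma resPart_psi (k : Lat n) (F : LMat d) (ε : ℤˣ) (a b : Lat d) : psi ε (resPart k F a b) = 0 := by
  unfold resPart
  split_ifs
  · unfold cut
    split_ifs
    exacts [psi_piM _ _, psi_zero _]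
  · exact psi_zero _

lemma IsSymm.resPart (hF : IsSymm L F) (k : Lat n) :
    IsSymm L (ToplitzLipschitz.resPart k F) := by
  unfold ToplitzLipschitz.resPart
  split_ifs
  · exact hF.cut []
  · exact fun a _ b _ => Matrix.transpose_zero.symm

lemma IsTopl.resPart {Δ' : ℝ} (hL : Lᶜ.Finite) (hF : IsTopl m F)
    (hT : IsTruncated L Δ' F) (k : Lat n) : IsTopl m (ToplitzLipschitz.resPart k F) := by
  unfold ToplitzLipschitz.resPart
  split_ifs
  · exact hF.cut hL [] hT
  · exact isTopl_zero m

lemma iterNorm_resPart_le {g : Lev d} (hg : g.Good) (hL : Lᶜ.Finite) {S γ : ℝ} (hS : g.Radius S)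
    (hF : IsTopl (m + 1) F) (hT : IsTruncated L g.Δ' F) (k : Lat n) :
    iterNorm L S γ m (resPart k F) ≤ iterNorm L S γ m F := by
  unfold resPart
  split_ifs
  · exact iterNorm_cut_le hg hL hS [] hF hT
  · rw [iterNorm_zero]; exact bot_le

lemma dirDeriv_resPart (k : Lat n) (v : Par n) (DF : Fin n → LMat d) :
    dirDeriv v (fun l => resPart k (DF l)) = resPart k (dirDeriv v DF) := by
  unfold resPart
  split_ifs
  · exact dirDeriv_cut v [] DF
  · funext a b
    simp [dirDeriv]

lemma MatC1.resPart {X : Set (Par n)} {F : Par n → LMat d} {DF : Fin n → Par n → LMat d}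
    (h : MatC1 L X F DF) (k : Lat n) : MatC1 L X (fun ω => ToplitzLipschitz.resPart k (F ω))
      fun l ω => ToplitzLipschitz.resPart k (DF l ω) := by
  unfold ToplitzLipschitz.resPart
  split_ifs
  · exact matC1_cut h []
  · exact fun a _ b _ i j => whitneyC1_const (0 : ℂ)

lemma Lev.IsSol.eq_resPart {Δ Δ' D ρ θ : ℝ} {k : Lat n}
    (hg : (baseLev L Δ Δ' D ρ (k = 0)).Good) {Q s : Ker d} (hT : IsTruncated L Δ' F)
    (h : (baseLev L Δ Δ' D ρ (k = 0)).IsSol θ Q (forceS F) s) {a b : Lat d} (ha : a ∈ L) (hb : b ∈ L) :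
    sylv ((baseLev L Δ Δ' D ρ (k = 0)).blk a) ((baseLev L Δ Δ' D ρ (k = 0)).blk b)
      (energy θ) Q (-Q) s a b = -Complex.I * (phi 1 (F a b) - phi 1 (resPart k F a b)) := by
  by_cases hab : (baseLev L Δ Δ' D ρ (k = 0)).Act a b
  · rw [h.eq a b hab, forceS]
    have : resPart k F a b = 0 := by
      unfold resPart
      split_ifs with hk
      · exact if_neg fun h => hab.2.2.2.1 hk h.1
      · rfl
    rw [this, phi_zero, sub_zero]
  · rw [sylv_congr (hg.self_mem_blk a) (hg.self_mem_blk b) (fun _ _ _ _ => rfl) (fun _ _ _ _ => rfl)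
      (fun _ _ _ _ => rfl) (fun x hx y hy => show s x y = (0 : Ker d) x y from h.zero x y fun hxy =>
        hab (hxy.congr (hg.mem_blk.1 hx).symm (hg.mem_blk.1 hy).symm)), sylv_zero]
    have h0 : phi 1 (F a b) = phi 1 (resPart k F a b) := by
      by_cases hk : k = 0 ∧ len a = len b
      · rw [resPart, if_pos hk.1, cut, if_pos ⟨hk.2, by simp⟩, phi_piM]
      · have hd : Δ' < len (a - b) := by
          by_contra hle
          exact hab ⟨ha, hb, fun c hc => absurd hc List.not_mem_nil, fun h1 h2 => hk ⟨h1, h2⟩,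
            a, b, .refl a, .refl b, not_lt.1 hle⟩
        have hz := hT a ha b hb hd
        have : resPart k F a b = 0 := by
          unfold resPart cut
          split_ifs <;> simp [hz]
        rw [this, ← phi_piM, hz]
    rw [h0, sub_self, mul_zero]
    rfl

end ResPart

/-! ### Assembling the solution -/

section Assembly

variable {d n : ℕ} {L : Set (Lat d)} {Λ Δ Δ' D ρ κ C₁ C₂ C₃ C₄ C₅ C₆ : ℝ} {U B U' : Set (Par n)}
  {Ω : Par n → Lat d → ℝ} {DΩ : Par n → Lat d → Par n} {H : Par n → LMat d}
  {DH : Fin n → Par n → LMat d}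

lemma Setting.lballP_neg (h : Setting L Λ Δ C₁ C₂ C₃ C₄ C₅ C₆ U B Ω DΩ H DH) {ω : Par n}
    (hω : ω ∈ U) {k : Lat n} (hg : (baseLev L Δ Δ' D ρ (k = 0)).Good)
    (hLB : (baseLev L Δ Δ' D ρ (-k = 0)).LBallP (inner ℝ (toE (-k)) ω) (qKer (Ω ω) (H ω)) κ) :
    (baseLev L Δ Δ' D ρ (k = 0)).LBallP (-inner ℝ (toE k) ω) (tr (qKer (Ω ω) (H ω))) κ := by
  rw [neg_eq_zero, toE_neg, inner_neg_left] at hLB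
  intro a ha b hb
  refine (hLB a ha b hb).conj.congr (fun x _ y _ => ?_) (fun x hx y hy => ?_) fun x hx y hy => ?_
  · simp [energyP]
  · exact h.herm hω (Lev.mem_of_blk hg ha hx) (Lev.mem_of_blk hg ha hy)
  · exact h.herm hω (Lev.mem_of_blk hg hb hy) (Lev.mem_of_blk hg hb hx)

lemma Setting.exists_solAt (h : Setting L Λ Δ C₁ C₂ C₃ C₄ C₅ C₆ U B Ω DΩ H DH) (hU : U' ⊆ U)
    (hκ : 0 < κ) (hN : ∀ ω ∈ U', NonRes L Δ Δ' D ρ κ (qKer (Ω ω) (H ω)) ω) {k : Lat n}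
    (hk : len k ≤ Δ') (hg : (baseLev L Δ Δ' D ρ (k = 0)).Good) {F : Par n → LMat d}
    {DF : Fin n → Par n → LMat d} (hF : MatC1 L U' F DF) :
    ∃ (s u w : Par n → Ker d) (r ru rw : Fin n → Par n → Ker d),
      (∀ ω ∈ U', SolAt (baseLev L Δ Δ' D ρ (k = 0)) (inner ℝ (toE k) ω) (fun l => toE k l)
        (qKer (Ω ω) (H ω)) (fun l => pKer (DΩ ω) (fun l => DH l ω) (EuclideanSpace.single l 1))
        (F ω) (fun l => DF l ω) (s ω) (u ω) (w ω) (fun l => r l ω) (fun l => ru l ω)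
        fun l => rw l ω) ∧
      MatC1 L U' (fun ω => ofKer (s ω) (u ω) (w ω)) fun l ω => ofKer (r l ω) (ru l ω) (rw l ω) := by
  have hθ : WhitneyC1 U' (fun ω => inner ℝ (toE k) ω) fun l _ => toE k l := whitneyC1_inner _
  have hQ : ∀ a ∈ L, ∀ b ∈ L, WhitneyC1 U' (fun ω => qKer (Ω ω) (H ω) a b) fun l ω =>
      pKer (DΩ ω) (fun l => DH l ω) (EuclideanSpace.single l 1) a b := fun a ha b hb =>
    (h.whitney_qKer ha hb).mono (hU.trans h.hUB)
  obtain ⟨s, r, h1, h2, h3⟩ := exists_solFamily hg hκ hθ hQ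
    (fun a ha b hb => (hF.whitney_force ha hb).1) fun ω hω => (hN ω hω k hk).1
  obtain ⟨u, ru, h4, h5, h6⟩ := exists_solFamilyP hg hκ hθ hQ
    (fun a ha b hb => (hF.whitney_force ha hb).2 1) fun ω hω => (hN ω hω k hk).2
  obtain ⟨w, rw, h7, h8, h9⟩ := exists_solFamilyP hg hκ hθ.neg (Q := fun ω => tr (qKer (Ω ω) (H ω)))
    (Ql := fun l ω => tr (pKer (DΩ ω) (fun l => DH l ω) (EuclideanSpace.single l 1)))
    (fun a ha b hb => hQ b hb a ha)
    (fun a ha b hb => (hF.whitney_force ha hb).2 (-1)) fun ω hω =>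
      h.lballP_neg (hU hω) hg (hN ω hω (-k) (by rwa [len_neg])).2
  exact ⟨s, u, w, r, ru, rw, fun ω hω => ⟨h1 ω hω, h4 ω hω, h7 ω hω, h2 ω hω, h5 ω hω, h8 ω hω⟩,
    matC1_ofKer h3 h6 h9⟩

lemma Setting.kerReg (h : Setting L Λ Δ C₁ C₂ C₃ C₄ C₅ C₆ U B Ω DΩ H DH) {p : Prop} {γ S M : ℝ}
    {ω : Par n} (hω : ω ∈ U) (hκ : 0 < κ) (hκ₅ : κ < C₅ / 2) {k : Lat n}
    (hN : NonRes L Δ Δ' D ρ κ (qKer (Ω ω) (H ω)) ω)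
    (hk : len k ≤ Δ') (hg : (baseLev L Δ Δ' D ρ (k = 0)).Good)
    (hρ : ∀ a : Lat d, ρ ≤ len a → a ∈ L) (hD : ∀ a b, SameBlock L Δ a b → len (a - b) ≤ D)
    (hS : (baseLev L Δ Δ' D ρ (k = 0)).Radius S) (hΛ : Λ ≤ S)
    (hθ : Δ' * C₁ + 2 * (C₅ + C₄ + |C₂|) ≤ S) (hγ : 0 ≤ γ) (hM : 0 ≤ M)
    {F : LMat d} {DF : Fin n → LMat d} {s u w : Ker d} {r ru rw : Fin n → Ker d}
    (hs : SolAt (baseLev L Δ Δ' D ρ (k = 0)) (inner ℝ (toE k) ω) (fun l => toE k l)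
        (qKer (Ω ω) (H ω)) (fun l => pKer (DΩ ω) (fun l => DH l ω) (EuclideanSpace.single l 1))
        F DF s u w r ru rw)
    (hF : IsToplitz F ∧ ∀ l, IsToplitz (DF l)) (hT : IsTruncated L Δ' F ∧ ∀ l, IsTruncated L Δ' (DF l))
    (hn : p → iterNorm L S γ (d - 2) F ≤ ENNReal.ofReal M ∧
      ∀ v : Par n, ‖v‖ ≤ 1 → iterNorm L S γ (d - 2) (dirDeriv v DF) ≤ ENNReal.ofReal M)
    {v : Par n} (hv : ‖v‖ ≤ 1) :
    KerReg p γ (S + D + 2) (solBound (1 + C₅) (|C₆| + |C₂| * (1 / C₃ + 1)) (C₅ + C₄ + |C₂|) D Δ' κ γ M d)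
      (d - 2 + 1) L s u w ∧
    KerReg p γ (S + D + 2) (solBound (1 + C₅) (|C₆| + |C₂| * (1 / C₃ + 1)) (C₅ + C₄ + |C₂|) D Δ' κ γ M d)
      (d - 2 + 1) L (∑ l, ((v l : ℝ) : ℂ) • r l) (∑ l, ((v l : ℝ) : ℂ) • ru l)
      (∑ l, ((v l : ℝ) : ℂ) • rw l) := by
  have hd : d - 1 = d - 2 + 1 := by have := h.hd; omega
  have h₅ := h.hC₅
  have h₄ := h.hC₄
  have h₃ := h.hC₃
  have hD1 : 1 ≤ D := hg.hD
  have hΔ1 : 1 ≤ Δ' := hg.hΔ'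
  have hS1 : 1 ≤ S := le_trans (show (1 : ℝ) ≤ 32 * (Δ' + 2 * D + 1) ^ 2 by nlinarith) hS.big
  have hC₂ := abs_nonneg C₂
  have hsr := h.sReg hω hρ hD hΛ hS.rho hS1
  have hωn : ‖ω‖ ≤ C₁ := by simpa using h.hU hω
  have hin : |inner ℝ (toE k) ω| ≤ Δ' * C₁ :=
    (abs_real_inner_le_norm _ _).trans (mul_le_mul hk hωn (norm_nonneg _) (by linarith))
  have hη : |∑ l, v l * toE k l| ≤ Δ' := by
    have e : ∑ l, v l * toE k l = inner ℝ (toE k) v := by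
      rw [PiLp.inner_apply]; rfl
    rw [e]
    exact (abs_real_inner_le_norm _ _).trans ((mul_le_of_le_one_right (norm_nonneg _) hv).trans hk)
  have hop : ∀ {Q : Ker d} {x y : ℝ}, (baseLev L Δ Δ' D ρ (k = 0)).OpBlk Q x → x ≤ y →
      (baseLev L Δ Δ' D ρ (k = 0)).OpBlk Q y := fun hQ hxy a ha =>
    ⟨(hQ a ha).1.mono hxy, (hQ a ha).2.mono hxy⟩
  rw [hd] at hsr
  refine hs.kerReg hg hS hκ (by linarith) (by linarith) hγ (by positivity) (by positivity) hM
    (by show _ ≤ S + D + 2; linarith) (hN k hk).1 (hN k hk).2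
    (h.lballP_neg hω hg (hN (-k) (by rwa [len_neg])).2) hη
    (hop (h.opBlk hω hg) (by linarith)) ?_ hsr.1 ?_ (hd ▸ hF.1) (fun l => hd ▸ hF.2 l) hT.1 hT.2
    (fun hp => (hn hp).1) fun hp => (hn hp).2 v hv
  · rw [← pKer_sum]
    exact hop (h.opBlkD hω hv hg) (by linarith)
  · rw [← pKer_sum]
    exact hsr.2 v hv

lemma solBound_eq (k K Kop D Δ' κ γ M : ℝ) (d : ℕ) : 4 * solBound k K Kop D Δ' κ γ M d
    = 128 * k ^ 3 * (1 + K) * 9 ^ d * (1 + 2 * Kop) * (1 / κ ^ 3) * Δ' * D ^ (2 * d)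
      * Real.exp (2 * γ * D) * M := by
  have e : (9 : ℝ) ^ d = 3 ^ d * 3 ^ d := by rw [← mul_pow]; norm_num
  rw [solBound, e, mul_pow, mul_pow, inv_pow, one_div, two_mul d, pow_add]
  ring

lemma radius_of_le {k0 : Prop} {Λ Λ' D D' cte C K : ℝ} (hD : 2 ≤ D) (hΔ' : 1 ≤ Δ')
    (h4 : Δ' ^ 2 / 4 ≤ max (D ^ 2) (D' ^ 2)) (hρ : 0 ≤ ρ) (hC : 0 ≤ C) (hK : 0 ≤ K)
    (hcte : 800 + ρ + 4 * C + K ≤ cte) (h : cte * max Λ (max (D ^ 2) (D' ^ 2)) ≤ Λ') :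
    (baseLev L Δ Δ' D ρ k0).Radius Λ' ∧ Λ ≤ Λ' ∧ Δ' * C + K ≤ Λ' := by
  set m := max Λ (max (D ^ 2) (D' ^ 2))
  have h1 : Λ ≤ m := le_max_left _ _
  have h2 : D ^ 2 ≤ m := (le_max_left _ _).trans (le_max_right _ _)
  have h3 : Δ' ^ 2 / 4 ≤ m := h4.trans (le_max_right _ _)
  have hm : 4 ≤ m := by nlinarith
  have h5 := (mul_le_mul_of_nonneg_right hcte (by linarith : 0 ≤ m)).trans h
  have h6 : ρ ≤ ρ * m := le_mul_of_one_le_right hρ (by linarith)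
  have h7 : K ≤ K * m := le_mul_of_one_le_right hK (by linarith)
  have h8 : Δ' ≤ 4 * m := by nlinarith
  have h9 : Δ' * C ≤ 4 * m * C := mul_le_mul_of_nonneg_right h8 hC
  have h10 : 0 ≤ C * m := by positivity
  refine ⟨⟨?_, ?_⟩, ?_, ?_⟩
  · show 32 * (Δ' + 2 * D + 1) ^ 2 ≤ Λ'
    nlinarith [sq_nonneg (Δ' - 2 * D), sq_nonneg (Δ' - 1), sq_nonneg (2 * D - 1)]
  · show ρ ≤ Λ'
    nlinarith
  all_goals nlinarith

end Assembly

end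
end ToplitzLipschitz

theorem proposition6p7 (d : ℕ) (hd : 2 ≤ d) (n : ℕ) :
    ∃ exponent : ℕ,
    ∀ (L : Set (Lat d)) (_ : Lᶜ.Finite) (C₁ C₂ C₃ C₄ C₅ C₆ : ℝ)
      (_ : 1 ≤ C₁) (_ : 0 < C₃) (_ : 0 < C₄) (_ : 0 < C₅),
    ∃ cte : ℝ, 0 < cte ∧
    ∀ (Λ Δ Δ' κ : ℝ) (_ : 0 ≤ Λ) (_ : 2 ≤ Δ) (_ : 1 ≤ Δ') (_ : 0 < κ) (_ : κ < C₅ / 2)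
      -- the parameter set, and a convex set to which the data extend
      (U B : Set (Par n)) (_ : U ⊆ Metric.closedBall 0 C₁) (_ : U ⊆ B) (_ : Convex ℝ B)
      -- the frequencies and their gradients
      (Ω : Par n → Lat d → ℝ) (DΩ : Par n → Lat d → Par n)
      (_ : ∀ a ∈ L, WhitneyC1 B (fun ω => Ω ω a) (fun l ω => DΩ ω a l))
      (_ : FreqDecay L U C₂ C₃ Ω DΩ)
      (_ : FreqTransversal L B C₄ DΩ)
      (_ : FreqNonresonant L U C₅ Ω)
      -- the matrix `H` and its partial derivatives
      (H : Par n → LMat d) (DH : Fin n → Par n → LMat d)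
      (_ : MatC1 L B H DH)
      (_ : ∀ ω ∈ B, IsToplitz (H ω) ∧ ∀ l, IsToplitz (DH l ω))
      (_ : ∀ ω ∈ B, IsNormalForm L Δ (H ω) ∧ ∀ l, IsNormalForm L Δ (DH l ω))
      (_ : ∀ ω ∈ B, ∀ v : Par n, ‖v‖ ≤ 1 →
        opNorm L (dirDeriv v fun l => DH l ω) ≤ ENNReal.ofReal (C₄ / 4))
      (_ : ∀ ω ∈ U, opNorm L (H ω) ≤ ENNReal.ofReal (C₅ / 4))
      (_ : tlNormOn L Λ 0 U H DH ≤ ENNReal.ofReal C₆),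
    ∃ U' : Set (Par n), U' ⊆ U ∧
      MeasureTheory.volume (U \ U') ≤
        ENNReal.ofReal (cte * max Λ (max Δ Δ') ^ exponent
          * κ ^ ((1 / ((d : ℝ) + 1)) ^ d : ℝ)) ∧
      ∀ (k : Lat n) (_ : len k ≤ Δ')
        (F : Par n → LMat d) (DF : Fin n → Par n → LMat d)
        (_ : MatC1 L U' F DF)
        (_ : ∀ ω ∈ U', IsToplitz (F ω) ∧ ∀ l, IsToplitz (DF l ω))
        (_ : ∀ ω ∈ U', IsSymm L (F ω) ∧ ∀ l, IsSymm L (DF l ω))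
        (_ : ∀ ω ∈ U', IsTruncated L Δ' (F ω) ∧ ∀ l, IsTruncated L Δ' (DF l ω)),
      ∃ (S : Par n → LMat d) (DS : Fin n → Par n → LMat d)
        (H' : Par n → LMat d) (DH' : Fin n → Par n → LMat d),
        MatC1 L U' S DS ∧ MatC1 L U' H' DH' ∧
        (∀ ω ∈ U', IsToplitz (S ω) ∧ ∀ l, IsToplitz (DS l ω)) ∧
        (∀ ω ∈ U', IsToplitz (H' ω) ∧ ∀ l, IsToplitz (DH' l ω)) ∧
        (∀ ω ∈ U', IsSymm L (S ω) ∧ IsSymm L (H' ω)) ∧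
        (∀ ω ∈ U', HomologicalEq L ω k (Ω ω) (H ω) (S ω) (F ω) (H' ω)) ∧
        (k ≠ 0 → ∀ ω ∈ U', ∀ a ∈ L, ∀ b ∈ L, H' ω a b = 0 ∧ ∀ l, DH' l ω a b = 0) ∧
        (k = 0 → ∀ ω ∈ U', IsBlockDiag L Δ' (H' ω) ∧ ∀ l, IsBlockDiag L Δ' (DH' l ω)) ∧
        (k = 0 → (∀ ω ∈ U', IsReal L (F ω) ∧ ∀ l, IsReal L (DF l ω)) →
          ∀ ω ∈ U', IsNormalForm L Δ' (H' ω) ∧ ∀ l, IsNormalForm L Δ' (DH' l ω)) ∧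
        ∀ Λ' : ℝ, cte * max Λ (max (blockDiam L Δ ^ 2) (blockDiam L Δ' ^ 2)) ≤ Λ' →
          (∀ γ : ℝ, 0 ≤ γ →
            tlNormOn L (Λ' + blockDiam L Δ + 2) γ U' S DS ≤
              ENNReal.ofReal (cte * (1 / κ ^ 3) * Δ' * blockDiam L Δ ^ (2 * d)
                * Real.exp (2 * γ * blockDiam L Δ)) * tlNormOn L Λ' γ U' F DF) ∧
          tlNormOn L (Λ' + blockDiam L Δ + 2) 0 U' H' DH' ≤ tlNormOn L Λ' 0 U' F DF := by
  obtain ⟨e, he⟩ := exists_good_set d hd n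
  refine ⟨e, fun L hL C₁ C₂ C₃ C₄ C₅ C₆ hC₁ hC₃ hC₄ hC₅ => ?_⟩
  obtain ⟨ρ, hρ0, hρ⟩ := exists_radius hL
  obtain ⟨c, hc, hgood⟩ := he L ρ C₁ C₂ C₃ C₄ C₅ C₆ hρ0 hρ hL hC₁ hC₃ hC₄ hC₅
  obtain ⟨C₀, e₀, -, hdiam⟩ := exists_blockDiam_le d
  have hC₂ := abs_nonneg C₂
  set K : ℝ := |C₆| + |C₂| * (1 / C₃ + 1)
  have hK : 0 ≤ K := by positivity
  set Kop : ℝ := C₅ + C₄ + |C₂|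
  have hKop : 0 ≤ Kop := by positivity
  set cs : ℝ := 128 * (1 + C₅) ^ 3 * (1 + K) * 9 ^ d * (1 + 2 * Kop)
  have hcs : 0 ≤ cs := by positivity
  set cte : ℝ := 800 + ρ + 4 * C₁ + 2 * Kop + c + cs
  have hcte : 0 < cte := by positivity
  refine ⟨cte, hcte, fun Λ Δ Δ' κ hΛ hΔ hΔ' hκ hκ₅ U B hU hUB hB Ω DΩ hΩ hdec htr hnr H DH hH hHt hHn
    hHD hHo hHl => ?_⟩
  have hs : Setting L Λ Δ C₁ C₂ C₃ C₄ C₅ C₆ U B Ω DΩ H DH :=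
    ⟨hd, hC₁, hC₃, hC₄, hC₅, hΛ, hU, hUB, hB, hΩ, hdec, htr, hnr, hH, hHt, hHn, hHD, hHo, hHl⟩
  obtain ⟨U', hU', hvol, hN⟩ := hgood Λ Δ Δ' κ hΔ hΔ' hκ hκ₅ U B Ω DΩ H DH hs
  refine ⟨U', hU', hvol.trans (ENNReal.ofReal_le_ofReal ?_), fun k hk F DF hF hFt hFs hFT => ?_⟩
  · have : 0 ≤ max Λ (max Δ Δ') := hΛ.trans (le_max_left _ _)
    gcongr
    linarith
  have hD := (hdiam L Δ (by linarith)).1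
  have hD2 := two_le_blockDiam hd hL hΔ
  have h4 := le_max_blockDiam hd hL hΔ hΔ'
  have hD0 : 0 < blockDiam L Δ := by linarith
  set D := blockDiam L Δ
  have hg : (baseLev L Δ Δ' D ρ (k = 0)).Good := baseLev_good hρ hD (by linarith) hΔ'
  obtain ⟨s, u, w, r, ru, rw, hsol, hC1⟩ := hs.exists_solAt hU' hκ hN hk hg hF
  have hm : d - 1 = d - 2 + 1 := by omega
  have hrad : ∀ {Λ' : ℝ}, cte * max Λ (max (D ^ 2) (blockDiam L Δ' ^ 2)) ≤ Λ' →
      (baseLev L Δ Δ' D ρ (k = 0)).Radius Λ' ∧ Λ ≤ Λ' ∧ Δ' * C₁ + 2 * Kop ≤ Λ' := fun h =>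
    radius_of_le hD2 hΔ' h4 hρ0 (by linarith) (by linarith) (by linarith) h
  have hreg : ∀ {p : Prop} {γ S M : ℝ}, cte * max Λ (max (D ^ 2) (blockDiam L Δ' ^ 2)) ≤ S → 0 ≤ γ →
      0 ≤ M → (p → tlNormOn L S γ U' F DF ≤ ENNReal.ofReal M) → ∀ ω ∈ U', ∀ v : Par n, ‖v‖ ≤ 1 →
      KerReg p γ (S + D + 2) (solBound (1 + C₅) K Kop D Δ' κ γ M d) (d - 2 + 1) L
        (s ω) (u ω) (w ω) ∧
      KerReg p γ (S + D + 2) (solBound (1 + C₅) K Kop D Δ' κ γ M d) (d - 2 + 1) L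
        (∑ l, ((v l : ℝ) : ℂ) • r l ω) (∑ l, ((v l : ℝ) : ℂ) • ru l ω)
        (∑ l, ((v l : ℝ) : ℂ) • rw l ω) := fun h hγ hM hn ω hω v hv =>
    hs.kerReg (hU' hω) hκ hκ₅ (hN ω hω) hk hg hρ hD (hrad h).1 (hrad h).2.1 (hrad h).2.2 hγ hM
      (hsol ω hω) (hFt ω hω) (hFT ω hω) (fun hp => iterNorm_le_of_tlNormOn (hn hp) hω) hv
  have hsb : ∀ {γ M : ℝ}, 0 ≤ M → 0 ≤ solBound (1 + C₅) K Kop D Δ' κ γ M d := fun hM =>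
    solBound_nonneg (by linarith) hκ hg hK hKop hM
  refine ⟨fun ω => ofKer (s ω) (u ω) (w ω), fun l ω => ofKer (r l ω) (ru l ω) (rw l ω),
    fun ω => resPart k (F ω), fun l ω => resPart k (DF l ω), hC1, hF.resPart k, fun ω hω => ?_,
    fun ω hω => ⟨(hFt ω hω).1.resPart hL (hFT ω hω).1 k, fun l =>
      ((hFt ω hω).2 l).resPart hL ((hFT ω hω).2 l) k⟩, fun ω hω => ⟨isSymm_ofKer ?_ ?_,
      (hFs ω hω).1.resPart k⟩, fun ω hω => ?_, fun hk0 ω _ a _ b _ => ⟨by simp [resPart, hk0], fun l =>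
      by simp [resPart, hk0]⟩, fun hk0 ω hω => ?_, fun hk0 hr ω hω => ?_, fun Λ' hΛ' => ⟨fun γ hγ => ?_, ?_⟩⟩
  · have h0 := hreg (p := False) le_rfl le_rfl le_rfl False.elim ω hω
    unfold IsToplitz
    rw [hm]
    refine ⟨?_, fun l => ?_⟩
    · obtain ⟨h1, h2, h3⟩ := (h0 0 (by simp)).1
      exact h1.isTopl (hsb le_rfl) _ h2 h3
    · obtain ⟨h1, h2, h3⟩ := (h0 (EuclideanSpace.single l 1) (by simp)).2
      show IsTopl _ (ofKer (r l ω) (ru l ω) (rw l ω))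
      rw [← dirDeriv_single l fun l => ofKer (r l ω) (ru l ω) (rw l ω), dirDeriv_ofKer]
      exact h1.isTopl (hsb le_rfl) _ h2 h3
  · exact (hsol ω hω).solU.symm hg hκ (hN ω hω k hk).2 ((hFs ω hω).1.forceP 1)
  · exact (hsol ω hω).solW.symm hg hκ (hs.lballP_neg (hU' hω) hg
      (hN ω hω (-k) (by rwa [len_neg])).2) ((hFs ω hω).1.forceP (-1))
  · refine homologicalEq_of hg (hHn ω (hUB (hU' hω))).1 (hFs ω hω).1 ((hFs ω hω).1.resPart k)
      (fun ε a b => resPart_psi k _ ε a b)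
      (fun a ha b hb => (hsol ω hω).solS.eq_resPart hg (hFT ω hω).1 ha hb) ?_ ?_
    · have h := (hsol ω hω).solU
      rwa [show forceP 1 (F ω) = fun a b => -Complex.I * psi 1 (F ω a b) by
        funext a b; simp [forceP]] at h
    · have h := (hsol ω hω).solW
      rwa [show forceP (-1) (F ω) = fun a b => Complex.I * psi (-1) (F ω a b) by
        funext a b; simp [forceP]] at h
  · simp only [resPart, if_pos hk0]
    exact ⟨(hFT ω hω).1.isBlockDiag_cut [], fun l => ((hFT ω hω).2 l).isBlockDiag_cut []⟩
  · simp only [resPart, if_pos hk0]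
    exact ⟨isNormalForm_cut (hFT ω hω).1 (hFs ω hω).1 (hr ω hω).1 [], fun l =>
      isNormalForm_cut ((hFT ω hω).2 l) ((hFs ω hω).2 l) ((hr ω hω).2 l) []⟩
  · set M := tlNormOn L Λ' γ U' F DF with hMdef
    have hpos : 0 < cte * (1 / κ ^ 3) * Δ' * D ^ (2 * d) * Real.exp (2 * γ * D) := by positivity
    by_cases hM : M = ⊤
    · rw [hM, ENNReal.mul_top (ENNReal.ofReal_pos.2 hpos).ne']
      exact le_top
    have hr := hreg (p := True) hΛ' hγ ENNReal.toReal_nonneg fun _ =>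
      (ENNReal.ofReal_toReal hM).ge
    have hle : ENNReal.ofReal (4 * solBound (1 + C₅) K Kop D Δ' κ γ M.toReal d) ≤
        ENNReal.ofReal (cte * (1 / κ ^ 3) * Δ' * D ^ (2 * d) * Real.exp (2 * γ * D)) * M := by
      conv_rhs => rw [← ENNReal.ofReal_toReal hM]
      rw [← ENNReal.ofReal_mul hpos.le, solBound_eq]
      refine ENNReal.ofReal_le_ofReal ?_
      have : cs ≤ cte := by linarith
      gcongr
    refine (tlNormOn_le fun ω hω => ?_).trans hle
    have hb : 0 ≤ solBound (1 + C₅) K Kop D Δ' κ γ M.toReal d := hsb ENNReal.toReal_nonneg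
    refine ⟨?_, fun v hv => ?_⟩
    · obtain ⟨h1, h2, h3⟩ := (hr ω hω 0 (by simp)).1
      exact iterNorm_ofKer_le hb _ h1 h2 h3
    · obtain ⟨h1, h2, h3⟩ := (hr ω hω v hv).2
      rw [dirDeriv_ofKer]
      exact iterNorm_ofKer_le hb _ h1 h2 h3
  · have hS := (hrad hΛ').1
    have hΛ'0 : 0 ≤ Λ' := hρ0.trans hS.rho
    refine tlNormOn_le fun ω hω => ?_
    have hn := iterNorm_le_of_tlNormOn (le_refl (tlNormOn L Λ' 0 U' F DF)) hω
    have hFt' := hFt ω hω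
    unfold IsToplitz at hFt'
    rw [hm] at hFt'
    refine ⟨(iterNorm_anti hΛ'0 (by linarith) _ _).trans
      ((iterNorm_resPart_le hg hL hS hFt'.1 (hFT ω hω).1 k).trans hn.1), fun v hv => ?_⟩
    rw [dirDeriv_resPart]
    refine (iterNorm_anti hΛ'0 (by linarith) _ _).trans
      ((iterNorm_resPart_le hg hL hS (IsTopl.dirDeriv v hFt'.2) (fun a ha b hb hab => ?_) k).trans
        (hn.2 v hv))
    rw [piM_dirDeriv]
    exact Finset.sum_eq_zero fun l _ => by rw [(hFT ω hω).2 l a ha b hb hab, smul_zero]
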